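/- **Setting.** A *rational arc* is a map $\gamma=(x,y):[a,b]\to\mathbb R^2$, $a<b$, whose coordinates are real rational functions without poles on $[a,b]$, such that $\gamma$ is a simple arc or a simple loop (only $\gamma(a)=\gamma(b)$ is allowed as a coincidence) and $\gamma'\neq0$ on $(a,b)$. A *regular rational polypol* is a bounded path-connected semialgebraic set $P\subset\mathbb R^2$ with $P\subset\overline{\operatorname{int}P}$ whose boundary is a finite union of rational arcs $\gamma_1,\dots,\gamma_n$, $\gamma_j=(x_j,y_j):[a_j,b_j]\to\mathbb R^2$, distinct arcs meeting only at common endpoints. Put $Q_{u,v}(x,y)=1-ux-vy$, let $U_P\subset\mathbb C^2$ be the set of all $(u,v)$ such that $Q_{u,v}$ has no zero on $\overline P$, and for $(u,v)\in U_P$ let $$F_P(u,v)=2\int_P\frac{dx\,dy}{(1-ux-vy)^3}.$$ **Theorem.** Let $P$ be a regular rational polypol with boundary arcs $\gamma_1,\dots,\gamma_n$. Then $U_P$ is an open set that contains the origin, the integral converges absolutely for $(u,v)\in U_P$, $F_P$ is holomorphic on $U_P$, and the following hold. 1. (Boundary integrals.) Along each $\gamma_j$, $P$ lies either on the left only, or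 on the right only, or on both sides; let $m_j=1,-1,0$ accordingly. For all $(u,v)\in U_P$, $$F_P(u,v)=\frac1u\sum_{j}m_j\int_{a_j}^{b_j}\frac{y_j'(\tau)\,d\tau}{(1-ux_j(\tau)-vy_j(\tau))^2}\quad(u\ne0),\qquad F_P(u,v)=-\frac1v\sum_{j}m_j\int_{a_j}^{b_j}\frac{x_j'(\tau)\,d\tau}{(1-ux_j(\tau)-vy_j(\tau))^2}\quad(v\ne0).$$ 2. (Elementary and holonomic.) At every point of $U_P$ the germ of $F_P$ is holonomic: the module it generates over the Weyl algebra $\mathbb C\langle u,v,\partial_u,\partial_v\rangle$ has Bernstein dimension at most $2$. There is a nonzero polynomial $D\in\mathbb C[u,v]$ such that the germ of $F_P$ at any point of $U_P\setminus\{D=0\}$ can be continued analytically along every path in $\mathbb C^2\setminus\{D=0\}$ that starts there, and every germ so obtained is holonomic and of the form $\alpha_0+\sum_k\alpha_k\log\beta_k$, a finite sum with germs $\alpha_0,\alpha_k,\beta_k$ of analytic functions that are algebraic over $\mathbb C(u,v)$, and with analytic branches of the logarithms (arctangents being complex logarithms). 3. (Polygons.) If every $\gamma_j$ lies on a line, then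 each integral in 1, and $F_P$ itself, coincides on $U_P$ with a rational function in $\mathbb R(u,v)$ without poles in $U_P$. If moreover $P$ is convex and contains the origin in its interior, then the polar polygon $P^\circ=\{w\in\mathbb R^2: 1-\langle p,w\rangle\ge0\text{ for all vertices }p\text{ of }\overline P\}$ has a unique canonical form, and this form is $F_P\,du\wedge dv$. Here a canonical form of a convex polygon is a rational two-form on the projective plane whose only poles are simple poles along the lines carrying the edges and whose residue along each counterclockwise edge from $p$ to $q$, parametrized by $p+s(q-p)$, is $\frac{ds}{s}+\frac{ds}{1-s}$; the residue of $\omega'\wedge d\ell/\ell$ along $\ell=0$ is $\omega'$. 4. (Curved arcs.) The unit disk $\mathbb D=\{x^2+y^2\le1\}$ and the half-disk $\mathbb D_+=\{x^2+y^2\le1,\ y\ge0\}$ are regular rational polypols. For real $u,v$ with $u^2+v^2<1$, $$F_{\mathbb D}(u,v)=\frac{2\pi}{(1-u^2-v^2)^{3/2}},\qquad F_{\mathbb D_+}(u,v)=\frac{\pi+2\arctan\frac{v}{\sqrt{1-u^2-v^2}}}{(1-u^2-v^2)^{3/2}}+\frac{2v}{(1-u^2)(1-u^2-v^2)},$$ and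 neither $F_{\mathbb D}$ nor $F_{\mathbb D_+}$ coincides near the origin with a rational function in $\mathbb R(u,v)$. -/

import Mathlib

open Set Filter Topology MeasureTheory

noncomputable section

namespace Polypol

/-! ### Rational arcs and polypols -/

/-- A compact real rational arc `t ↦ (X t / W t, Y t / W t)`, `t ∈ [a, b]`, without poles on
`[a, b]`.  It is a simple arc or a simple loop (the two endpoints may coincide, nothing else), and
it is smooth between its endpoints: an arc with cusps is to be subdivided at them. -/
structure RationalArc where
  X : Polynomial ℝ
  Y : Polynomial ℝ
  W : Polynomial ℝ
  a : ℝ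
  b : ℝ
  a_lt_b : a < b
  W_ne_zero : ∀ t ∈ Icc a b, W.eval t ≠ 0
  injOn_Ico : InjOn (fun t => (X.eval t / W.eval t, Y.eval t / W.eval t)) (Ico a b)
  injOn_Ioc : InjOn (fun t => (X.eval t / W.eval t, Y.eval t / W.eval t)) (Ioc a b)
  regular : ∀ t ∈ Ioo a b,
    ¬ (deriv (fun s => X.eval s / W.eval s) t = 0 ∧ deriv (fun s => Y.eval s / W.eval s) t = 0)

namespace RationalArc

/-- First coordinate of the arc. -/
def x (γ : RationalArc) (t : ℝ) : ℝ := γ.X.eval t / γ.W.eval t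

/-- Second coordinate of the arc. -/
def y (γ : RationalArc) (t : ℝ) : ℝ := γ.Y.eval t / γ.W.eval t

/-- The point of the arc with parameter `t`. -/
def point (γ : RationalArc) (t : ℝ) : ℝ × ℝ := (γ.x t, γ.y t)

/-- The set of points of the arc, endpoints included. -/
def image (γ : RationalArc) : Set (ℝ × ℝ) := γ.point '' Icc γ.a γ.b

/-- The arc without its endpoints. -/
def openImage (γ : RationalArc) : Set (ℝ × ℝ) := γ.point '' Ioo γ.a γ.b

/-- The normal vector pointing to the left of the direction of travel. -/
def leftNormal (γ : RationalArc) (t : ℝ) : ℝ × ℝ := (-deriv γ.y t, deriv γ.x t)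

end RationalArc

/-- Semialgebraic subsets of the plane: finite unions of sets cut out by finitely many polynomial
equations and strict polynomial inequalities. -/
def IsSemialgebraic (S : Set (ℝ × ℝ)) : Prop :=
  ∃ (m : ℕ) (E I : Fin m → Finset (MvPolynomial (Fin 2) ℝ)),
    S = ⋃ i, {p : ℝ × ℝ | (∀ f ∈ E i, MvPolynomial.eval ![p.1, p.2] f = 0) ∧
      ∀ g ∈ I i, 0 < MvPolynomial.eval ![p.1, p.2] g}

/-- `P` is a regular rational plane polypol, and `γ` is a decomposition of its boundary into
rational arcs: `P` is a bounded path-connected semialgebraic two-dimensional domain (open, closed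
or in between), its boundary is the union of the arcs, and distinct arcs meet only at common
endpoints, the vertices. -/
structure IsRegularPolypol {n : ℕ} (P : Set (ℝ × ℝ)) (γ : Fin n → RationalArc) : Prop where
  bounded : Bornology.IsBounded P
  pathConnected : IsPathConnected P
  semialgebraic : IsSemialgebraic P
  domain : P ⊆ closure (interior P)
  frontier_eq : frontier P = ⋃ j, (γ j).image
  meet_at_vertices : ∀ i j, i ≠ j → Disjoint (γ i).openImage (γ j).image

/-- The multiplicity of the arc `γ` in the oriented boundary of `P`.  It is `1` if `P` lies on the
left of the arc and not on its right, `-1` in the opposite case (so that the reversed arc is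
positively oriented), and `0` if `P` lies on both sides (a slit). -/
def IsBoundaryMultiplicity (P : Set (ℝ × ℝ)) (γ : RationalArc) (m : ℤ) : Prop :=
  ∃ l r : ℤ, m = l - r ∧ ∀ t ∈ Ioo γ.a γ.b, ∀ᶠ s : ℝ in 𝓝[>] 0,
    P.indicator (fun _ => (1 : ℤ)) (γ.point t + s • γ.leftNormal t) = l ∧
    P.indicator (fun _ => (1 : ℤ)) (γ.point t - s • γ.leftNormal t) = r

/-! ### The transform -/

/-- `Q_{u,v}(x,y) = 1 - u x - v y`, for `w = (u, v)` complex and `p = (x, y)` real. -/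
def Q (w : ℂ × ℂ) (p : ℝ × ℝ) : ℂ := 1 - w.1 * (p.1 : ℂ) - w.2 * (p.2 : ℂ)

/-- The parameters `(u, v)` for which `Q_{u,v}` has no zero on the closure of `P`. -/
def params (P : Set (ℝ × ℝ)) : Set (ℂ × ℂ) := {w | ∀ p ∈ closure P, Q w p ≠ 0}

/-- `F_P(u,v) = 2 ∫_P dx dy / (1 - u x - v y)^3`. -/
def fantappie (P : Set (ℝ × ℝ)) (w : ℂ × ℂ) : ℂ := 2 * ∫ p in P, 1 / Q w p ^ 3

/-- `∫_γ dx / Q_{u,v}^2`. -/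
def arcIntegralDx (γ : RationalArc) (w : ℂ × ℂ) : ℂ :=
  ∫ t in γ.a..γ.b, ((deriv γ.x t : ℝ) : ℂ) / Q w (γ.point t) ^ 2

/-- `∫_γ dy / Q_{u,v}^2`. -/
def arcIntegralDy (γ : RationalArc) (w : ℂ × ℂ) : ℂ :=
  ∫ t in γ.a..γ.b, ((deriv γ.y t : ℝ) : ℂ) / Q w (γ.point t) ^ 2

/-! ### Multivalued elementary and holonomic functions -/

/-- `g` is, near `z`, an analytic branch of an algebraic function of `(u, v)`. -/
def IsAlgebraicAt (g : ℂ × ℂ → ℂ) (z : ℂ × ℂ) : Prop :=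
  AnalyticAt ℂ g z ∧ ∃ p : Polynomial (MvPolynomial (Fin 2) ℂ), p ≠ 0 ∧
    ∀ᶠ w in 𝓝 z, (p.map (MvPolynomial.eval ![w.1, w.2])).eval (g w) = 0

/-- Near `z`, `f` is an algebraic function plus a linear combination, with algebraic functions as
coefficients, of branches of logarithms of algebraic functions.  Rational functions are algebraic,
and arctangent terms are included by `arctan w = (log (1 + i w) - log (1 - i w)) / (2 i)`. -/
def IsElementaryAt (f : ℂ × ℂ → ℂ) (z : ℂ × ℂ) : Prop :=
  ∃ (n : ℕ) (α₀ : ℂ × ℂ → ℂ) (α β L : Fin n → ℂ × ℂ → ℂ),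
    IsAlgebraicAt α₀ z ∧
    (∀ k, IsAlgebraicAt (α k) z ∧ IsAlgebraicAt (β k) z ∧ AnalyticAt ℂ (L k) z ∧
      ∀ᶠ w in 𝓝 z, Complex.exp (L k w) = β k w) ∧
    ∀ᶠ w in 𝓝 z, f w = α₀ w + ∑ k, α k w * L k w

/-- `∂f/∂u`. -/
def partialU (f : ℂ × ℂ → ℂ) : ℂ × ℂ → ℂ := fun w => deriv (fun u => f (u, w.2)) w.1

/-- `∂f/∂v`. -/
def partialV (f : ℂ × ℂ → ℂ) : ℂ × ℂ → ℂ := fun w => deriv (fun v => f (w.1, v)) w.2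

/-- The `k`-th piece of the Bernstein filtration of the cyclic module over the Weyl algebra in two
variables generated by the germ of `f` at `z`: the span of the germs `u^a v^b ∂_u^c ∂_v^d f` with
`a + b + c + d ≤ k`. -/
def bernsteinFiltration (f : ℂ × ℂ → ℂ) (z : ℂ × ℂ) (k : ℕ) :
    Submodule ℂ (Germ (𝓝 z) ℂ) :=
  Submodule.span ℂ {g | ∃ a b c d : ℕ, a + b + c + d ≤ k ∧
    g = ((fun w : ℂ × ℂ => w.1 ^ a * w.2 ^ b * (partialU^[c] (partialV^[d] f)) w :
      ℂ × ℂ → ℂ) : Germ (𝓝 z) ℂ)}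

/-- The analytic germ of `f` at `z` is holonomic: the module that it generates over the Weyl algebra
has Bernstein dimension at most `2`, the number of variables. -/
def IsHolonomicAt (f : ℂ × ℂ → ℂ) (z : ℂ × ℂ) : Prop :=
  AnalyticAt ℂ f z ∧
    ∃ C : ℕ, ∀ k : ℕ, Module.finrank ℂ (bernsteinFiltration f z k) ≤ C * (k + 1) ^ 2

/-- `f t`, `t ∈ [0, 1]`, is an analytic continuation along the path `η` of the germ of `F` at the
starting point of `η`. -/
def IsContinuationAlong (F : ℂ × ℂ → ℂ) (η : C(unitInterval, ℂ × ℂ))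
    (f : unitInterval → ℂ × ℂ → ℂ) : Prop :=
  f 0 =ᶠ[𝓝 (η 0)] F ∧ (∀ t, AnalyticAt ℂ (f t) (η t)) ∧
    ∀ t, ∀ᶠ s in 𝓝 t, f s =ᶠ[𝓝 (η s)] f t

/-! ### Rational functions and canonical forms of polygons -/

/-- The field `ℝ(u, v)`. -/
abbrev RationalFunctions : Type := FractionRing (MvPolynomial (Fin 2) ℝ)

/-- The rational function `R` is regular at `w` and has the value `c` there. -/
def HasValueAt (R : RationalFunctions) (w : ℂ × ℂ) (c : ℂ) : Prop :=
  ∃ N D : MvPolynomial (Fin 2) ℝ, MvPolynomial.aeval ![w.1, w.2] D ≠ 0 ∧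
    R = algebraMap (MvPolynomial (Fin 2) ℝ) RationalFunctions N /
      algebraMap (MvPolynomial (Fin 2) ℝ) RationalFunctions D ∧
    c = MvPolynomial.aeval ![w.1, w.2] N / MvPolynomial.aeval ![w.1, w.2] D

/-- The determinant of two plane vectors. -/
def cross (d e : ℝ × ℝ) : ℝ := d.1 * e.2 - d.2 * e.1

/-- The edges of a convex polygon `G`, oriented counterclockwise: ordered pairs of distinct vertices
such that `G` lies on the left of the line through them. -/
def edges (G : Set (ℝ × ℝ)) : Set ((ℝ × ℝ) × (ℝ × ℝ)) :=
  {e | e.1 ∈ G.extremePoints ℝ ∧ e.2 ∈ G.extremePoints ℝ ∧ e.1 ≠ e.2 ∧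
    ∀ p ∈ G, 0 ≤ cross (e.2 - e.1) (p - e.1)}

/-- The affine function `p ↦ cross (e.2 - e.1) (p - e.1)`, which vanishes on the edge `e` and is
positive inside, as a polynomial. -/
def edgeForm (e : (ℝ × ℝ) × (ℝ × ℝ)) : MvPolynomial (Fin 2) ℝ :=
  MvPolynomial.C (e.2.1 - e.1.1) * (MvPolynomial.X 1 - MvPolynomial.C e.1.2) -
    MvPolynomial.C (e.2.2 - e.1.2) * (MvPolynomial.X 0 - MvPolynomial.C e.1.1)

open Classical in
/-- The rational two-form `Ω du ∧ dv` on the projective plane is a canonical form of the convex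
polygon `G` with its counterclockwise orientation.
* Its poles in the affine plane are at most simple poles along the lines that carry the edges,
  `Ω = A / ∏ ℓ_e`, where `ℓ_e = edgeForm e`.
* It has no pole along the line at infinity: as `du ∧ dv` has a pole of order `3` there, this says
  that the degree `deg A - #edges` of `Ω` is at most `-3`.
* Its residue along each edge is the canonical one-form `ds/s + ds/(1 - s)` of that edge, which has
  residues `1` and `-1` at the endpoints and no other poles.  Here `e.1 + s (e.2 - e.1)`
  parametrizes the edge `e`; writing `Ω du ∧ dv = ω' ∧ dℓ_e/ℓ_e`, the pull-back of `ω'` to the edge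
  is `A / ∏_{e' ≠ e} ℓ_{e'} ds`, because `(du ∧ dv) (e.2 - e.1, n) = dℓ_e n` for all vectors `n`. -/
def IsCanonicalForm (G : Set (ℝ × ℝ)) (Ω : RationalFunctions) : Prop :=
  ∃ (E : Finset ((ℝ × ℝ) × (ℝ × ℝ))) (A : MvPolynomial (Fin 2) ℝ),
    (E : Set ((ℝ × ℝ) × (ℝ × ℝ))) = edges G ∧
    Ω = algebraMap (MvPolynomial (Fin 2) ℝ) RationalFunctions A /
      algebraMap (MvPolynomial (Fin 2) ℝ) RationalFunctions (∏ e ∈ E, edgeForm e) ∧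
    A.totalDegree + 3 ≤ E.card ∧
    ∀ e ∈ E, ∀ s ∈ Ioo (0 : ℝ) 1,
      MvPolynomial.eval ![(e.1 + s • (e.2 - e.1)).1, (e.1 + s • (e.2 - e.1)).2] A /
        MvPolynomial.eval ![(e.1 + s • (e.2 - e.1)).1, (e.1 + s • (e.2 - e.1)).2]
          (∏ e' ∈ E.erase e, edgeForm e') = 1 / s + 1 / (1 - s)

/-- The polar `P° = {u | 1 - ⟨v, u⟩ ≥ 0 for all vertices v of P}` of a convex polygon `P`. -/
def polar (P : Set (ℝ × ℝ)) : Set (ℝ × ℝ) :=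
  {w | ∀ v ∈ (closure P).extremePoints ℝ, 0 ≤ 1 - (v.1 * w.1 + v.2 * w.2)}

/-! ### The two curved examples -/

/-- The closed unit disk. -/
def disk : Set (ℝ × ℝ) := {p | p.1 ^ 2 + p.2 ^ 2 ≤ 1}

/-- The closed upper half of the unit disk. -/
def halfDisk : Set (ℝ × ℝ) := {p | p.1 ^ 2 + p.2 ^ 2 ≤ 1 ∧ 0 ≤ p.2}

end Polypol

end

open Set Filter Topology MeasureTheory
noncomputable section
namespace Polypol

/-! The theorem rests on Green's formula, on the way the parameters enter integrals of rational
functions of one variable, and, for polygons, on polar duality.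

Boundary integrals. Near an interior parameter an arc stays close to its tangent, so every narrower
sector on one side misses the boundary and the indicator function of P is constant there; by
connectedness the one-sided values are constant along the arc (`exists_sideValue_const`). A generic
horizontal line meets the boundary transversally in finitely many points. The fundamental theorem of
calculus with jumps (`integral_indicator_eq_sum_jumps`) evaluates the slice, and the area formula
(`area_formula`) turns the integral over all heights into integrals along the arcs. This gives
`green_fst`, and `green_snd` by reflection. Applied to 1/Q^2 they give the two formulas that divide
by u or by v. Applied to the field (x, y)/Q^2, whose divergence is 2/Q^3, they give a formula with
the Euler form x dy - y dx and no division (`fantappie_eq_sum`). Holonomicity, continuation, the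
rationality of F and the explicit examples all start from the latter.

Holonomicity. For x = X/W, y = Y/W in lowest terms, an arc contributes the integral of N/q^2 dt with
q = W - uX - vY and N = XY' - YX'. All operators of order at most k in the Bernstein filtration lead
to integrals over the common denominator q^(k+2), with numerators in u, v, t of degree O(k). There
are about k^3 such numerators. The derivatives of (t-a)(t-b)p/q^(k+1) integrate to zero, and the map
from p to the numerator of this derivative is injective and raises degrees by a bounded amount.
Hence only O(k^2) dimensions survive (`finrank_map_germInt_le`), which is the Bernstein bound.

Continuation. Off the curve `disc` = 0 the polynomial q has full degree and simple roots, none of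
them a or b. Partial fractions express the integral through algebraic functions of the roots τ and
the logarithms of (b-τ)/(a-τ). Two local choices of roots and logarithms differ by a permutation and
by constants, so a branch extends to a neighbourhood that does not depend on the branch
(`exists_extension`), and a subdivision of the path finishes the continuation
(`exists_continuation`). The dimensions of the Bernstein filtration are constant along a
continuation by the identity theorem, so holonomicity persists.

Polygons. On a line the integrands have explicit rational primitives, and for a convex polygon F is
the sum of det(p, q)/(Q_p Q_q) over the edges pq. The edge of the polar dual to a vertex v lies on
Q_v = 0; only the two summands that involve v contribute there, and they give ds/s + ds/(1-s)
(`residue_eq`). That there is no pole at infinity is a drop of degree by telescoping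
(`X_mul_adjoint`). For uniqueness, the difference of two numerators has degree below the number of
edges and vanishes on every edge line, hence is zero (`eq_zero_of_vanish`).

Disk and half-disk. The half-circle integral has an explicit primitive, and the disk is the union of
two mirror images of the half-disk. On the u-axis both transforms are constant multiples of
(1-u^2)^(-3/2), whose square has odd order at u = 1, so neither is rational. -/

/-! ### Calculus of rational arcs -/

namespace RationalArc

/-- The velocity vector of the arc. -/
def vel (γ : RationalArc) (t : ℝ) : ℝ × ℝ := (deriv γ.x t, deriv γ.y t)

lemma hasDerivAt_x (γ : RationalArc) {t : ℝ} (ht : t ∈ Icc γ.a γ.b) :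
    HasDerivAt γ.x (deriv γ.x t) t :=
  (γ.X.differentiableAt.div γ.W.differentiableAt (γ.W_ne_zero t ht)).hasDerivAt

lemma hasDerivAt_y (γ : RationalArc) {t : ℝ} (ht : t ∈ Icc γ.a γ.b) :
    HasDerivAt γ.y (deriv γ.y t) t :=
  (γ.Y.differentiableAt.div γ.W.differentiableAt (γ.W_ne_zero t ht)).hasDerivAt

lemma deriv_x (γ : RationalArc) {t : ℝ} (ht : t ∈ Icc γ.a γ.b) :
    deriv γ.x t = (γ.X.derivative.eval t * γ.W.eval t - γ.X.eval t * γ.W.derivative.eval t) /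
      γ.W.eval t ^ 2 :=
  ((γ.X.hasDerivAt t).div (γ.W.hasDerivAt t) (γ.W_ne_zero t ht)).deriv

lemma deriv_y (γ : RationalArc) {t : ℝ} (ht : t ∈ Icc γ.a γ.b) :
    deriv γ.y t = (γ.Y.derivative.eval t * γ.W.eval t - γ.Y.eval t * γ.W.derivative.eval t) /
      γ.W.eval t ^ 2 :=
  ((γ.Y.hasDerivAt t).div (γ.W.hasDerivAt t) (γ.W_ne_zero t ht)).deriv

lemma hasDerivAt_point (γ : RationalArc) {t : ℝ} (ht : t ∈ Icc γ.a γ.b) :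
    HasDerivAt γ.point (γ.vel t) t :=
  (γ.hasDerivAt_x ht).prodMk (γ.hasDerivAt_y ht)

lemma continuousOn_x (γ : RationalArc) : ContinuousOn γ.x (Icc γ.a γ.b) :=
  fun _ ht => (γ.hasDerivAt_x ht).continuousAt.continuousWithinAt

lemma continuousOn_y (γ : RationalArc) : ContinuousOn γ.y (Icc γ.a γ.b) :=
  fun _ ht => (γ.hasDerivAt_y ht).continuousAt.continuousWithinAt

lemma continuousOn_point (γ : RationalArc) : ContinuousOn γ.point (Icc γ.a γ.b) :=
  γ.continuousOn_x.prodMk γ.continuousOn_y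

lemma continuousOn_deriv_x (γ : RationalArc) : ContinuousOn (deriv γ.x) (Icc γ.a γ.b) := by
  refine ContinuousOn.congr ?_ (fun t ht => γ.deriv_x ht)
  refine ContinuousOn.div (by fun_prop) (by fun_prop) fun t ht => pow_ne_zero _ (γ.W_ne_zero t ht)

lemma continuousOn_deriv_y (γ : RationalArc) : ContinuousOn (deriv γ.y) (Icc γ.a γ.b) := by
  refine ContinuousOn.congr ?_ (fun t ht => γ.deriv_y ht)
  refine ContinuousOn.div (by fun_prop) (by fun_prop) fun t ht => pow_ne_zero _ (γ.W_ne_zero t ht)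

lemma vel_ne_zero (γ : RationalArc) {t : ℝ} (ht : t ∈ Ioo γ.a γ.b) : γ.vel t ≠ 0 := by
  intro h
  rw [Prod.ext_iff] at h
  exact γ.regular t ht h

lemma isCompact_image (γ : RationalArc) : IsCompact γ.image :=
  isCompact_Icc.image_of_continuousOn γ.continuousOn_point

lemma point_injective (γ : RationalArc) {s t : ℝ} (ht : t ∈ Ioo γ.a γ.b) (hs : s ∈ Icc γ.a γ.b)
    (h : γ.point s = γ.point t) : s = t := by
  rcases eq_or_lt_of_le hs.2 with hb | hb
  · exact γ.injOn_Ioc ⟨hb ▸ γ.a_lt_b, hs.2⟩ ⟨ht.1, ht.2.le⟩ h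
  · exact γ.injOn_Ico ⟨hs.1, hb⟩ ⟨ht.1.le, ht.2⟩ h

end RationalArc

/-! ### Sides of a boundary arc -/

/-- The bounded measurable set `P` is bounded by the arcs `γ i`, which meet only at their
endpoints. -/
structure ArcBoundary {ι : Type*} (P : Set (ℝ × ℝ)) (γ : ι → RationalArc) : Prop where
  bounded : Bornology.IsBounded P
  measurable : MeasurableSet P
  frontier_eq : frontier P = ⋃ j, (γ j).image
  meet_at_vertices : ∀ i j, i ≠ j → Disjoint (γ i).openImage (γ j).image

lemma cross_add_right (d e f : ℝ × ℝ) : cross d (e + f) = cross d e + cross d f := by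
  simp [cross]; ring

lemma cross_smul_right (d e : ℝ × ℝ) (c : ℝ) : cross d (c • e) = c * cross d e := by
  simp [cross]; ring

lemma cross_self (d : ℝ × ℝ) : cross d d = 0 := by
  simp [cross]; ring

lemma hasDerivAt_cross {c : ℝ → ℝ × ℝ} {c' : ℝ × ℝ} {t : ℝ} (d : ℝ × ℝ) (h : HasDerivAt c c' t) :
    HasDerivAt (fun s => cross d (c s)) (cross d c') t := by
  have h1 : HasDerivAt (fun s => (c s).1) c'.1 t := by
    exact (hasFDerivAt_fst (𝕜 := ℝ) (p := c t)).comp_hasDerivAt t h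
  have h2 : HasDerivAt (fun s => (c s).2) c'.2 t := by
    exact (hasFDerivAt_snd (𝕜 := ℝ) (p := c t)).comp_hasDerivAt t h
  exact (h2.const_mul _).sub (h1.const_mul _)

/-- A differentiable curve with nonzero velocity leaves a point tangentially. -/
lemma eventually_abs_cross_le {c : ℝ → ℝ × ℝ} {c' : ℝ × ℝ} {t₀ : ℝ} (h : HasDerivAt c c' t₀)
    (hc : c' ≠ 0) {κ : ℝ} (hκ : 0 < κ) :
    ∀ᶠ t in 𝓝 t₀, |cross c' (c t - c t₀)| ≤ κ * ‖c t - c t₀‖ := by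
  have h1 : HasDerivAt (fun t => cross c' (c t - c t₀)) 0 t₀ := by
    simpa [cross_self] using hasDerivAt_cross c' (h.sub_const (c t₀))
  have h2 : (fun t => cross c' (c t - c t₀)) =o[𝓝 t₀] fun t => t - t₀ := by
    have := hasDerivAt_iff_isLittleO.1 h1
    simpa [cross] using this
  -- Here the nonvanishing of the velocity enters: the displacement of the curve controls the
  -- displacement of the parameter.
  have h3 : (fun t => t - t₀) =O[𝓝 t₀] fun t => c t - c t₀ := by
    have := (HasDerivAtFilter.isTheta_sub h hc).symm.isBigO
    have h4 : Tendsto (fun t : ℝ => (t, t₀)) (𝓝 t₀) (𝓝 t₀ ×ˢ pure t₀) :=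
      tendsto_id.prodMk tendsto_const_pure
    simpa [Function.comp_def] using this.comp_tendsto h4
  exact (h2.trans_isBigO h3).def hκ

/-- Off its frontier, P is its interior and the complement of P is the exterior; these two disjoint
open sets cannot both meet a connected set that they cover. -/
lemma indicator_eq_of_isPreconnected {P S : Set (ℝ × ℝ)} (hS : IsPreconnected S)
    (h : Disjoint S (frontier P)) {p q : ℝ × ℝ} (hp : p ∈ S) (hq : q ∈ S) :
    P.indicator (fun _ => (1 : ℤ)) p = P.indicator (fun _ => (1 : ℤ)) q := by
  have key : ∀ a ∈ S, ∀ b ∈ S, a ∈ P → b ∈ P := by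
    intro a ha b hb haP
    by_contra hbP
    have hin : ∀ x ∈ S, x ∈ P → x ∈ interior P := fun x hx hxP => by
      by_contra hxi
      exact h.le_bot ⟨hx, subset_closure hxP, hxi⟩
    have hout : ∀ x ∈ S, x ∉ P → x ∈ (closure P)ᶜ := fun x hx hxP hxc =>
      h.le_bot ⟨hx, hxc, fun hxi => hxP (interior_subset hxi)⟩
    obtain ⟨x, _, hx, hx'⟩ := hS _ _ isOpen_interior isClosed_closure.isOpen_compl
      (fun x hx => (em (x ∈ P)).imp (hin x hx) (hout x hx)) ⟨a, ha, hin a ha haP⟩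
      ⟨b, hb, hout b hb hbP⟩
    exact hx' (subset_closure (interior_subset hx))
  by_cases h1 : p ∈ P
  · simp [h1, key p hp q hq h1]
  · have h2 : q ∉ P := fun h2 => h1 (key q hq p hp h2)
    simp [h1, h2]

namespace ArcBoundary

variable {ι : Type*} [Finite ι] {P : Set (ℝ × ℝ)} {γ : ι → RationalArc}

/-- Near an interior point of an arc, the boundary consists of nearby points of that arc. -/
lemma eventually_frontier (hP : ArcBoundary P γ) (j : ι) {t₀ : ℝ} (ht₀ : t₀ ∈ Ioo (γ j).a (γ j).b)
    {s : Set ℝ} (hs : s ∈ 𝓝 t₀) :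
    ∀ᶠ p in 𝓝 ((γ j).point t₀), p ∈ frontier P → p ∈ (γ j).point '' (s ∩ Icc (γ j).a (γ j).b) := by
  classical
  -- All of the boundary except the part of the arc `j` near `t₀`: a closed set, which misses the
  -- point because interior parameters are never repeated.
  set C : Set (ℝ × ℝ) := (⋃ i ∈ {i | i ≠ j}, (γ i).image) ∪
    (γ j).point '' (Icc (γ j).a (γ j).b \ interior s) with hC
  have hCc : IsClosed C := by
    refine IsClosed.union ?_ ?_
    · exact (Set.toFinite _).isClosed_biUnion fun i _ => (γ i).isCompact_image.isClosed
    · refine IsCompact.isClosed (IsCompact.image_of_continuousOn ?_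
        ((γ j).continuousOn_point.mono sdiff_subset))
      exact isCompact_Icc.diff isOpen_interior
  have hmem : (γ j).point t₀ ∉ C := by
    rintro (h | ⟨t, ht, h⟩)
    · simp only [mem_iUnion] at h
      obtain ⟨i, hi, h⟩ := h
      exact (hP.meet_at_vertices j i (Ne.symm hi)).le_bot ⟨mem_image_of_mem _ ht₀, h⟩
    · have := (γ j).point_injective ht₀ ht.1 h
      exact ht.2 (this ▸ mem_interior_iff_mem_nhds.2 hs)
  filter_upwards [hCc.isOpen_compl.mem_nhds hmem] with p hp hpf
  rw [hP.frontier_eq, mem_iUnion] at hpf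
  obtain ⟨i, hi⟩ := hpf
  by_cases hij : i = j
  · subst hij
    obtain ⟨t, ht, rfl⟩ := hi
    refine ⟨t, ⟨?_, ht⟩, rfl⟩
    by_contra hts
    exact hp (Or.inr ⟨t, ⟨ht, fun h => hts (interior_subset h)⟩, rfl⟩)
  · exact absurd (Or.inl (mem_biUnion (s := {i | i ≠ j}) hij hi)) hp

end ArcBoundary

/-- Along every ray that leaves the arc at the parameter `t` to the side given by the sign `ε`, the
indicator function of `P` is eventually equal to `l`. -/
def SideValue (P : Set (ℝ × ℝ)) (γ : RationalArc) (ε t : ℝ) (l : ℤ) : Prop :=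
  ∀ d, 0 < ε * cross (γ.vel t) d →
    ∀ᶠ s : ℝ in 𝓝[>] 0, P.indicator (fun _ => (1 : ℤ)) (γ.point t + s • d) = l

lemma cross_vel_leftNormal (γ : RationalArc) (t : ℝ) :
    cross (γ.vel t) (γ.leftNormal t) = deriv γ.x t ^ 2 + deriv γ.y t ^ 2 := by
  simp [cross, RationalArc.vel, RationalArc.leftNormal]; ring

lemma cross_vel_leftNormal_pos (γ : RationalArc) {t : ℝ} (ht : t ∈ Ioo γ.a γ.b) :
    0 < cross (γ.vel t) (γ.leftNormal t) := by
  rw [cross_vel_leftNormal]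
  rcases not_and_or.1 (γ.regular t ht) with h | h
  · have : deriv γ.x t ≠ 0 := h
    positivity
  · have : deriv γ.y t ≠ 0 := h
    positivity

/-- The norm is convex and `cross e` is linear. Such truncated sectors serve as connected regions on
one side of a tangent line. -/
lemma convex_sector (e : ℝ × ℝ) (κ ε r : ℝ) (hκ : 0 ≤ κ) :
    Convex ℝ {x : ℝ × ℝ | κ * ‖x‖ < ε * cross e x ∧ ‖x‖ < r} := by
  intro x hx y hy a b ha hb hab
  have h1 : ‖a • x + b • y‖ ≤ a * ‖x‖ + b * ‖y‖ := by
    refine (norm_add_le _ _).trans ?_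
    rw [norm_smul, norm_smul, Real.norm_of_nonneg ha, Real.norm_of_nonneg hb]
  have ha' : a < 1 ∨ 0 < a := by
    rcases lt_or_ge a 1 with h | h
    · exact Or.inl h
    · exact Or.inr (by linarith)
  have key : ∀ p q r s : ℝ, p < r → q < s → a * p + b * q < a * r + b * s := by
    intro p q r s h1 h2
    rcases ha.eq_or_lt with h | h
    · have : b = 1 := by linarith
      subst this; subst h; simpa using h2
    · have := mul_lt_mul_of_pos_left h1 h
      have := mul_le_mul_of_nonneg_left h2.le hb
      linarith
  constructor
  · have h2 := key _ _ _ _ hx.1 hy.1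
    rw [cross_add_right, cross_smul_right, cross_smul_right]
    have h3 := mul_le_mul_of_nonneg_left h1 hκ
    linarith
  · have h2 := key _ _ _ _ hx.2 hy.2
    have : a * r + b * r = r := by rw [← add_mul, hab, one_mul]
    linarith

namespace ArcBoundary

variable {ι : Type*} [Finite ι] {P : Set (ℝ × ℝ)} {γ : ι → RationalArc}

/-- Short multiples of two vectors on the same side of the tangent lie in one convex sector. The arc
leaves its point tangentially and therefore avoids the sector, and the rest of the boundary is far
away, so the sector misses the frontier. -/
lemma exists_indicator_eq (hP : ArcBoundary P γ) (j : ι) {t : ℝ} (ht : t ∈ Ioo (γ j).a (γ j).b)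
    (ε : ℝ) (hε : |ε| = 1) {d e : ℝ × ℝ} (hd : 0 < ε * cross ((γ j).vel t) d)
    (he : 0 < ε * cross ((γ j).vel t) e) :
    ∃ r > 0, ∀ s ∈ Ioo (0 : ℝ) r, ∀ s' ∈ Ioo (0 : ℝ) r,
      P.indicator (fun _ => (1 : ℤ)) ((γ j).point t + s • d) =
        P.indicator (fun _ => (1 : ℤ)) ((γ j).point t + s' • e) := by
  have hex : ∀ f : ℝ × ℝ, 0 < ε * cross ((γ j).vel t) f →
      ∃ κ > 0, κ * ‖f‖ < ε * cross ((γ j).vel t) f := by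
    intro f hf
    refine ⟨(ε * cross ((γ j).vel t) f) / (‖f‖ + 1), by positivity, ?_⟩
    rw [div_mul_eq_mul_div, div_lt_iff₀ (by positivity)]
    nlinarith [norm_nonneg f]
  obtain ⟨κ₁, hκ₁, h1⟩ := hex d hd
  obtain ⟨κ₂, hκ₂, h2⟩ := hex e he
  -- A sector with this opening contains both directions.
  set κ := min κ₁ κ₂ with hκdef
  have hκ : 0 < κ := lt_min hκ₁ hκ₂
  have h1' : κ * ‖d‖ < ε * cross ((γ j).vel t) d :=
    (mul_le_mul_of_nonneg_right (min_le_left _ _) (norm_nonneg _)).trans_lt h1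
  have h2' : κ * ‖e‖ < ε * cross ((γ j).vel t) e :=
    (mul_le_mul_of_nonneg_right (min_le_right _ _) (norm_nonneg _)).trans_lt h2
  have hev := eventually_abs_cross_le ((γ j).hasDerivAt_point (Ioo_subset_Icc_self ht))
    ((γ j).vel_ne_zero ht) hκ
  have hfr := hP.eventually_frontier j ht hev
  obtain ⟨ρ, hρ, hball⟩ := Metric.eventually_nhds_iff.1 hfr
  set S : Set (ℝ × ℝ) := (fun x => (γ j).point t + x) ''
    {x : ℝ × ℝ | κ * ‖x‖ < ε * cross ((γ j).vel t) x ∧ ‖x‖ < ρ} with hS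
  have hSc : IsPreconnected S :=
    (convex_sector _ κ ε ρ hκ.le).isPreconnected.image _ (by fun_prop)
  have hSd : Disjoint S (frontier P) := by
    rw [Set.disjoint_left]
    rintro _ ⟨x, ⟨hx1, hx2⟩, rfl⟩ hxf
    obtain ⟨t', ⟨ht', _⟩, h⟩ := hball (by simpa [dist_eq_norm] using hx2) hxf
    have hx : (γ j).point t' - (γ j).point t = x := by rw [h]; simp
    simp only [mem_ofPred_eq, hx] at ht'
    have : ε * cross ((γ j).vel t) x ≤ |cross ((γ j).vel t) x| := by
      refine (le_abs_self _).trans ?_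
      rw [abs_mul, hε, one_mul]
    linarith
  have hmem : ∀ f : ℝ × ℝ, κ * ‖f‖ < ε * cross ((γ j).vel t) f → ∀ s, 0 < s → s < ρ / (‖f‖ + 1) →
      (γ j).point t + s • f ∈ S := by
    intro f hf s hs hs'
    refine ⟨s • f, ⟨?_, ?_⟩, rfl⟩
    · rw [norm_smul, Real.norm_of_nonneg hs.le, cross_smul_right]
      nlinarith
    · rw [norm_smul, Real.norm_of_nonneg hs.le]
      rw [lt_div_iff₀ (by positivity)] at hs'
      nlinarith
  refine ⟨min (ρ / (‖d‖ + 1)) (ρ / (‖e‖ + 1)), lt_min (by positivity) (by positivity), ?_⟩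
  intro s hs s' hs'
  exact indicator_eq_of_isPreconnected hSc hSd
    (hmem d h1' s hs.1 (hs.2.trans_le (min_le_left _ _)))
    (hmem e h2' s' hs'.1 (hs'.2.trans_le (min_le_right _ _)))

lemma exists_sideValue (hP : ArcBoundary P γ) (j : ι) {t : ℝ} (ht : t ∈ Ioo (γ j).a (γ j).b)
    (ε : ℝ) (hε : |ε| = 1) : ∃ l, SideValue P (γ j) ε t l := by
  have hε2 : ε * ε = 1 := by rw [← abs_mul_abs_self, hε, one_mul]
  have hn : 0 < ε * cross ((γ j).vel t) (ε • (γ j).leftNormal t) := by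
    rw [cross_smul_right, ← mul_assoc, hε2, one_mul]
    exact cross_vel_leftNormal_pos _ ht
  obtain ⟨r, hr, h⟩ := hP.exists_indicator_eq j ht ε hε hn hn
  -- The value is read off at one short step along the normal; every other direction on this side is
  -- compared with the normal.
  refine ⟨P.indicator (fun _ => (1 : ℤ)) ((γ j).point t + (r / 2) • (ε • (γ j).leftNormal t)), ?_⟩
  intro d hd
  obtain ⟨r', hr', h'⟩ := hP.exists_indicator_eq j ht ε hε hd hn
  filter_upwards [Ioo_mem_nhdsGT hr'] with s hs
  have hm : 0 < min r r' := lt_min hr hr'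
  rw [h' s hs (min r r' / 2) ⟨by positivity, by linarith [min_le_right r r']⟩]
  exact h _ ⟨by positivity, by linarith [min_le_left r r']⟩ _ ⟨by positivity, by linarith⟩

lemma _root_.Polypol.SideValue.unique {P : Set (ℝ × ℝ)} {γ : RationalArc} {ε t : ℝ} {l l' : ℤ}
    (ht : t ∈ Ioo γ.a γ.b) (hε : |ε| = 1)
    (h : SideValue P γ ε t l) (h' : SideValue P γ ε t l') : l = l' := by
  have hε2 : ε * ε = 1 := by rw [← abs_mul_abs_self, hε, one_mul]
  have hn : 0 < ε * cross (γ.vel t) (ε • γ.leftNormal t) := by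
    rw [cross_smul_right, ← mul_assoc, hε2, one_mul]
    exact cross_vel_leftNormal_pos _ ht
  obtain ⟨s, hs, hs'⟩ := ((h _ hn).and (h' _ hn)).exists
  exact hs.symm.trans hs'

/-- The arc, pushed along the fixed normal at `t₀` by small positive amounts, sweeps out a connected
set. It misses the frontier because the coordinate `cross n` is injective along the arc and
unaffected by the push: a pushed point on the boundary would be the point of the arc with the same
parameter. -/
lemma eventually_sideValue (hP : ArcBoundary P γ) (j : ι) {t₀ : ℝ}
    (ht₀ : t₀ ∈ Ioo (γ j).a (γ j).b) (ε : ℝ) (hε : |ε| = 1) {l : ℤ}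
    (hl : SideValue P (γ j) ε t₀ l) : ∀ᶠ t in 𝓝 t₀, SideValue P (γ j) ε t l := by
  have hε2 : ε * ε = 1 := by rw [← abs_mul_abs_self, hε, one_mul]
  have hε0 : ε ≠ 0 := by rintro rfl; simp at hε
  set n := (γ j).leftNormal t₀ with hn
  have hnpos := cross_vel_leftNormal_pos _ ht₀
  -- near `t₀` the arc is transversal to `n`
  have hIoo : Ioo (γ j).a (γ j).b ∈ 𝓝 t₀ := isOpen_Ioo.mem_nhds ht₀
  have hcont : ContinuousAt (fun t => cross ((γ j).vel t) n) t₀ := by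
    have hx := ((γ j).continuousOn_deriv_x).continuousAt (Icc_mem_nhds ht₀.1 ht₀.2)
    have hy := ((γ j).continuousOn_deriv_y).continuousAt (Icc_mem_nhds ht₀.1 ht₀.2)
    exact (hx.mul continuousAt_const).sub (hy.mul continuousAt_const)
  have hpos : ∀ᶠ t in 𝓝 t₀, 0 < cross ((γ j).vel t) n := hcont.eventually (lt_mem_nhds hnpos)
  obtain ⟨δ, hδ, hδball⟩ := Metric.eventually_nhds_iff.1 (hpos.and hIoo)
  have hin : ∀ t ∈ Ioo (t₀ - δ) (t₀ + δ), 0 < cross ((γ j).vel t) n ∧ t ∈ Ioo (γ j).a (γ j).b := by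
    intro t ht
    exact hδball (by rw [Real.dist_eq, abs_lt]; constructor <;> linarith [ht.1, ht.2])
  -- The derivative of this coordinate is minus the determinant of the velocity and `n`, which is
  -- positive by transversality.
  have hinj : InjOn (fun t => cross n ((γ j).point t)) (Ioo (t₀ - δ) (t₀ + δ)) := by
    refine StrictAntiOn.injOn (strictAntiOn_of_deriv_neg (convex_Ioo _ _) ?_ ?_)
    · intro t ht
      exact (hasDerivAt_cross n ((γ j).hasDerivAt_point
        (Ioo_subset_Icc_self (hin t ht).2))).continuousAt.continuousWithinAt
    · intro t ht
      rw [interior_Ioo] at ht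
      rw [(hasDerivAt_cross n ((γ j).hasDerivAt_point (Ioo_subset_Icc_self (hin t ht).2))).deriv]
      have := (hin t ht).1
      simp only [cross] at this ⊢
      linarith
  have hfr := hP.eventually_frontier j ht₀ (Ioo_mem_nhds (show t₀ - δ < t₀ by linarith)
    (show t₀ < t₀ + δ by linarith))
  -- a box around `t₀` that is mapped into the neighbourhood of `hfr`
  have hΦ : ContinuousAt (fun q : ℝ × ℝ => (γ j).point q.1 + q.2 • (ε • n)) (t₀, 0) := by
    have h1 : ContinuousAt (γ j).point t₀ :=
      ((γ j).hasDerivAt_point (Ioo_subset_Icc_self ht₀)).continuousAt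
    refine ContinuousAt.add (ContinuousAt.comp' (f := Prod.fst) (g := (γ j).point) h1
      continuousAt_fst) ?_
    fun_prop
  have hev : ∀ᶠ q : ℝ × ℝ in 𝓝 (t₀, 0), (γ j).point q.1 + q.2 • (ε • n) ∈ frontier P →
      (γ j).point q.1 + q.2 • (ε • n) ∈ (γ j).point '' (Ioo (t₀ - δ) (t₀ + δ) ∩ Icc (γ j).a (γ j).b) := by
    refine hΦ.eventually (p := fun p => p ∈ frontier P →
      p ∈ (γ j).point '' (Ioo (t₀ - δ) (t₀ + δ) ∩ Icc (γ j).a (γ j).b)) ?_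
    simpa using hfr
  obtain ⟨ρ, hρ, hball⟩ := Metric.eventually_nhds_iff.1 hev
  set ρ' := min ρ δ with hρ'
  have hρ'0 : 0 < ρ' := lt_min hρ hδ
  set S : Set (ℝ × ℝ) := (fun q : ℝ × ℝ => (γ j).point q.1 + q.2 • (ε • n)) ''
    (Ioo (t₀ - ρ') (t₀ + ρ') ×ˢ Ioo 0 ρ') with hS
  have hsub : ∀ t ∈ Ioo (t₀ - ρ') (t₀ + ρ'), t ∈ Ioo (t₀ - δ) (t₀ + δ) := fun t ht =>
    ⟨by linarith [ht.1, min_le_right ρ δ], by linarith [ht.2, min_le_right ρ δ]⟩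
  have hSc : IsPreconnected S := by
    refine (isPreconnected_Ioo.prod isPreconnected_Ioo).image _ ?_
    intro q hq
    have h1 : ContinuousAt (γ j).point q.1 :=
      ((γ j).hasDerivAt_point (Ioo_subset_Icc_self (hin _ (hsub _ hq.1)).2)).continuousAt
    refine ContinuousAt.continuousWithinAt (ContinuousAt.add (ContinuousAt.comp' (f := Prod.fst)
      (g := (γ j).point) h1 continuousAt_fst) ?_)
    fun_prop
  have hSd : Disjoint S (frontier P) := by
    rw [Set.disjoint_left]
    rintro _ ⟨⟨t, s⟩, ⟨ht, hs⟩, rfl⟩ hxf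
    have hdist : dist (t, s) (t₀, (0 : ℝ)) < ρ := by
      rw [Prod.dist_eq, max_lt_iff, Real.dist_eq, Real.dist_eq, abs_lt, abs_lt]
      have := min_le_left ρ δ
      refine ⟨⟨?_, ?_⟩, ?_, ?_⟩ <;> linarith [ht.1, ht.2, hs.1, hs.2]
    obtain ⟨t', ⟨ht', _⟩, h⟩ := hball hdist hxf
    have hcr : cross n ((γ j).point t') = cross n ((γ j).point t) := by
      rw [h, cross_add_right, cross_smul_right, cross_smul_right, cross_self]; simp
    have htt := hinj ht' (hsub t ht) hcr
    subst htt
    have h0 : s • (ε • n) = 0 := by simpa using h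
    rw [smul_eq_zero, smul_eq_zero] at h0
    have hn0 : n ≠ 0 := by
      intro h0
      rw [← hn, h0] at hnpos
      simp [cross] at hnpos
    exact h0.elim hs.1.ne' fun h => h.elim hε0 hn0
  have hdir : ∀ t ∈ Ioo (t₀ - ρ') (t₀ + ρ'), 0 < ε * cross ((γ j).vel t) (ε • n) := by
    intro t ht
    rw [cross_smul_right, ← mul_assoc, hε2, one_mul]
    exact (hin t (hsub t ht)).1
  have hmemS : ∀ t ∈ Ioo (t₀ - ρ') (t₀ + ρ'), ∀ᶠ s : ℝ in 𝓝[>] 0, (γ j).point t + s • (ε • n) ∈ S := by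
    intro t ht
    filter_upwards [Ioo_mem_nhdsGT hρ'0] with s hs
    exact ⟨(t, s), ⟨ht, hs⟩, rfl⟩
  have ht₀' : t₀ ∈ Ioo (t₀ - ρ') (t₀ + ρ') := ⟨by linarith, by linarith⟩
  filter_upwards [Ioo_mem_nhds ht₀'.1 ht₀'.2] with t ht
  obtain ⟨l', hl'⟩ := hP.exists_sideValue j (hin t (hsub t ht)).2 ε hε
  obtain ⟨s, hs1, hs2⟩ := ((hl' _ (hdir t ht)).and (hmemS t ht)).exists
  obtain ⟨s', hs1', hs2'⟩ := ((hl _ (hdir t₀ ht₀')).and (hmemS t₀ ht₀')).exists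
  have : l' = l := by
    rw [← hs1, ← hs1']
    exact indicator_eq_of_isPreconnected hSc hSd hs2 hs2'
  exact this ▸ hl'

/-- One-sided values exist, are unique and are locally constant, so they are constant on the
connected parameter interval. -/
lemma exists_sideValue_const (hP : ArcBoundary P γ) (j : ι) (ε : ℝ) (hε : |ε| = 1) :
    ∃ l, ∀ t ∈ Ioo (γ j).a (γ j).b, SideValue P (γ j) ε t l := by
  have hmid : ((γ j).a + (γ j).b) / 2 ∈ Ioo (γ j).a (γ j).b := by
    have := (γ j).a_lt_b
    constructor <;> linarith
  obtain ⟨l, hl⟩ := hP.exists_sideValue j hmid ε hε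
  refine ⟨l, ?_⟩
  have hpre : IsPreconnected (Ioo (γ j).a (γ j).b) := isPreconnected_Ioo
  by_contra! hcon
  obtain ⟨t₁, ht₁, hl₁⟩ := hcon
  have hu : IsOpen {t | t ∈ Ioo (γ j).a (γ j).b ∧ SideValue P (γ j) ε t l} := by
    rw [isOpen_iff_mem_nhds]
    rintro t ⟨ht, h⟩
    exact inter_mem (isOpen_Ioo.mem_nhds ht) (hP.eventually_sideValue j ht ε hε h)
  have hv : IsOpen {t | t ∈ Ioo (γ j).a (γ j).b ∧ ¬ SideValue P (γ j) ε t l} := by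
    rw [isOpen_iff_mem_nhds]
    rintro t ⟨ht, h⟩
    obtain ⟨l', hl'⟩ := hP.exists_sideValue j ht ε hε
    filter_upwards [isOpen_Ioo.mem_nhds ht, hP.eventually_sideValue j ht ε hε hl'] with s hs hs'
    refine ⟨hs, fun h' => h ?_⟩
    exact (hs'.unique hs hε h') ▸ hl'
  obtain ⟨t, _, ⟨_, h1⟩, _, h2⟩ := hpre _ _ hu hv
    (fun t ht => (em (SideValue P (γ j) ε t l)).imp (⟨ht, ·⟩) (⟨ht, ·⟩))
    ⟨_, hmid, hmid, hl⟩ ⟨_, ht₁, ht₁, hl₁⟩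
  exact h2 h1

end ArcBoundary

lemma isBoundaryMultiplicity_of_sideValue {P : Set (ℝ × ℝ)} {γ : RationalArc} {l r : ℤ}
    (hl : ∀ t ∈ Ioo γ.a γ.b, SideValue P γ 1 t l) (hr : ∀ t ∈ Ioo γ.a γ.b, SideValue P γ (-1) t r) :
    IsBoundaryMultiplicity P γ (l - r) := by
  refine ⟨l, r, rfl, fun t ht => ?_⟩
  have hn := cross_vel_leftNormal_pos γ ht
  have h1 := hl t ht (γ.leftNormal t) (by linarith)
  have h2 := hr t ht (-γ.leftNormal t) (by
    have : cross (γ.vel t) (-γ.leftNormal t) = - cross (γ.vel t) (γ.leftNormal t) := by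
      simp [cross]; ring
    rw [this]; linarith)
  filter_upwards [h1, h2] with s h1 h2
  refine ⟨h1, ?_⟩
  rw [sub_eq_add_neg, ← smul_neg]
  exact h2

/-! ### Green's theorem -/

/-- The fundamental theorem of calculus on a set of reals that is a finite union of intervals up to
finitely many points `s k`; `lam k` and `rho k` are the values of its indicator function to the left
and to the right of `s k`. -/
lemma integral_indicator_eq_sum_jumps {κ : Type*} (A : Set ℝ) (K : Finset κ) (s : κ → ℝ)
    (hs : InjOn s K) (f g : ℝ → ℂ) (lam rho : κ → ℤ) (hbd : Bornology.IsBounded A)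
    (hloc : ∀ x, (∀ k ∈ K, s k ≠ x) → ∀ᶠ y in 𝓝 x, (y ∈ A ↔ x ∈ A))
    (hl : ∀ k ∈ K, ∀ᶠ x in 𝓝[<] (s k), A.indicator (fun _ => (1 : ℤ)) x = lam k)
    (hr : ∀ k ∈ K, ∀ᶠ x in 𝓝[>] (s k), A.indicator (fun _ => (1 : ℤ)) x = rho k)
    (hf : ∀ k ∈ K, ContinuousAt f (s k))
    (hg : ∀ x ∈ A, (∀ k ∈ K, s k ≠ x) → HasDerivAt f (g x) x)
    (hInt : Integrable (A.indicator g)) :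
    ∫ x, A.indicator g x = ∑ k ∈ K, ((lam k - rho k : ℤ) : ℂ) * f (s k) := by
  classical
  set ind : ℝ → ℤ := A.indicator (fun _ => (1 : ℤ)) with hind
  -- The value of the indicator function immediately to the left. At the jumps this does not depend
  -- on whether they belong to `A`.
  set c : ℝ → ℤ := {x | ∀ᶠ y in 𝓝[<] x, y ∈ A}.indicator (fun _ => (1 : ℤ)) with hc
  set J : κ → ℂ := fun k => ((lam k - rho k : ℤ) : ℂ) * f (s k) with hJ
  set σ : ℝ → ℂ := fun x => ∑ k ∈ K, if s k < x then J k else 0 with hσ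
  -- A continuous primitive of the truncated integrand. To the right of `s k` the first term loses
  -- `lam k - rho k` times `f (s k)`, and `σ`, which counts the jumps strictly to the left, gains
  -- exactly this.
  set H : ℝ → ℂ := fun x => (c x : ℂ) * f x + σ x with hH
  have hindA : ∀ x, ind x = 1 ↔ x ∈ A := fun x => by
    by_cases h : x ∈ A <;> simp [hind, h]
  have hcx : ∀ x (v : ℤ), (∀ᶠ y in 𝓝[<] x, ind y = v) → c x = v := by
    intro x v h
    by_cases hx : ∀ᶠ y in 𝓝[<] x, y ∈ A
    · obtain ⟨y, hy, hy'⟩ := (h.and hx).exists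
      have : c x = 1 := by exact indicator_of_mem (s := {x | ∀ᶠ y in 𝓝[<] x, y ∈ A}) hx _
      rw [this, ← hy, (hindA y).2 hy']
    · have h0 : c x = 0 :=
        indicator_of_notMem (s := {x | ∀ᶠ y in 𝓝[<] x, y ∈ A}) hx _
      rw [h0]
      by_contra hv
      refine hx (h.mono fun y hy => ?_)
      by_contra hyA
      rw [← hy] at hv
      simp [hind, hyA] at hv
  have hc_off : ∀ x, (∀ k ∈ K, s k ≠ x) → c x = ind x := by
    intro x hx
    refine hcx x _ (((hloc x hx).filter_mono nhdsWithin_le_nhds).mono fun y hy => ?_)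
    by_cases h : x ∈ A <;> simp [hind, h, hy]
  have hne : ∀ x, ∀ᶠ y in 𝓝[≠] x, ∀ k ∈ K, s k ≠ y := by
    intro x
    rw [eventually_all_finset]
    intro k _
    by_cases h : s k = x
    · filter_upwards [self_mem_nhdsWithin] with y hy h'
      exact hy (by rw [← h', h]; rfl)
    · filter_upwards [nhdsWithin_le_nhds (isOpen_ne.mem_nhds (Ne.symm h))] with y hy
      exact Ne.symm hy
  have hσ_off : ∀ x, (∀ k ∈ K, s k ≠ x) → ∀ᶠ y in 𝓝 x, σ y = σ x := by
    intro x hx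
    have : ∀ᶠ y in 𝓝 x, ∀ k ∈ K, (s k < y ↔ s k < x) := by
      rw [eventually_all_finset]
      intro k hk
      rcases lt_or_gt_of_ne (hx k hk) with h | h
      · filter_upwards [lt_mem_nhds h] with y hy
        simp [hy, h]
      · filter_upwards [gt_mem_nhds h] with y hy
        simp [hy.not_gt, h.not_gt]
    filter_upwards [this] with y hy
    exact Finset.sum_congr rfl fun k hk => by simp [hy k hk]
  have hH_off : ∀ x, (∀ k ∈ K, s k ≠ x) →
      ∀ᶠ y in 𝓝 x, H y = (ind x : ℂ) * f y + σ x := by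
    intro x hx
    have h1 : ∀ᶠ y in 𝓝 x, ∀ k ∈ K, s k ≠ y := by
      rw [eventually_all_finset]
      intro k hk
      filter_upwards [isOpen_ne.mem_nhds (Ne.symm (hx k hk))] with y hy
      exact Ne.symm hy
    filter_upwards [hloc x hx, h1, hσ_off x hx] with y hy hy1 hy2
    simp only [hH, hy2, hc_off y hy1]
    by_cases h : x ∈ A <;> simp [hind, h, hy]
  have hH_deriv : ∀ x, (∀ k ∈ K, s k ≠ x) → HasDerivAt H (A.indicator g x) x := by
    intro x hx
    by_cases h : x ∈ A
    · have : HasDerivAt (fun y => (ind x : ℂ) * f y + σ x) (A.indicator g x) x := by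
        have := ((hg x h hx).const_mul (ind x : ℂ)).add_const (σ x)
        simpa [hind, h] using this
      exact this.congr_of_eventuallyEq (hH_off x hx)
    · have : HasDerivAt (fun _ : ℝ => σ x) (A.indicator g x) x := by
        simpa [h] using hasDerivAt_const x (σ x)
      refine this.congr_of_eventuallyEq ((hH_off x hx).mono fun y hy => ?_)
      simpa [hind, h] using hy
  have hH_jump : ∀ k ∈ K, ContinuousAt H (s k) := by
    intro k hk
    have hσl : ∀ᶠ y in 𝓝 (s k), ∀ i ∈ K, i ≠ k → (s i < y ↔ s i < s k) := by
      rw [eventually_all_finset]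
      intro i hi
      by_cases hik : i = k
      · simp [hik]
      have hne : s i ≠ s k := fun h => hik (hs hi hk h)
      rcases lt_or_gt_of_ne hne with h | h
      · filter_upwards [lt_mem_nhds h] with y hy
        simp [hy, h]
      · filter_upwards [gt_mem_nhds h] with y hy
        simp [hy.not_gt, h.not_gt]
    have hval : H (s k) = (lam k : ℂ) * f (s k) + σ (s k) := by
      simp only [hH, hcx (s k) _ (hl k hk)]
    refine continuousAt_iff_continuous_left'_right'.2 ⟨?_, ?_⟩
    · have ht : Tendsto (fun y => (lam k : ℂ) * f y + σ (s k)) (𝓝[<] (s k)) (𝓝 (H (s k))) := by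
        rw [hval]
        exact (((hf k hk).mono_left nhdsWithin_le_nhds).const_mul _).add_const _
      refine ht.congr' ?_
      have hne' := (hne (s k)).filter_mono (nhdsWithin_mono (s k) (fun y (hy : y < s k) => hy.ne))
      filter_upwards [hl k hk, hne', hσl.filter_mono nhdsWithin_le_nhds, self_mem_nhdsWithin]
        with y h1 h2 h3 h4
      simp only [hH, hc_off y h2, h1, add_right_inj]
      refine Finset.sum_congr rfl fun i hi => ?_
      by_cases hik : i = k
      · subst hik
        simp [(show y < s i from h4).not_gt]
      · simp [h3 i hi hik]
    · have ht : Tendsto (fun y => (rho k : ℂ) * f y + (σ (s k) + J k)) (𝓝[>] (s k))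
          (𝓝 (H (s k))) := by
        have : H (s k) = (rho k : ℂ) * f (s k) + (σ (s k) + J k) := by
          rw [hval, hJ]
          push_cast
          ring
        rw [this]
        exact (((hf k hk).mono_left nhdsWithin_le_nhds).const_mul _).add_const _
      refine ht.congr' ?_
      have hne' := (hne (s k)).filter_mono (nhdsWithin_mono (s k) (fun y (hy : s k < y) => hy.ne'))
      filter_upwards [hr k hk, hne', hσl.filter_mono nhdsWithin_le_nhds, self_mem_nhdsWithin]
        with y h1 h2 h3 h4
      simp only [hH, hc_off y h2, h1, add_right_inj]
      rw [hσ]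
      simp only
      rw [← Finset.add_sum_erase K _ hk, ← Finset.add_sum_erase K _ hk]
      simp only [lt_irrefl, if_false, zero_add, (show s k < y from h4), if_true]
      rw [add_comm]
      congr 1
      refine Finset.sum_congr rfl fun i hi => ?_
      rw [Finset.mem_erase] at hi
      simp [h3 i hi.2 hi.1]
  obtain ⟨R, hR⟩ := (hbd.union (K.finite_toSet.image s).isBounded).subset_ball 0
  have hRA : ∀ x ∈ A, -R < x ∧ x < R := fun x hx => by
    have := hR (Or.inl hx)
    rwa [mem_ball_zero_iff, Real.norm_eq_abs, abs_lt] at this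
  have hRK : ∀ k ∈ K, -R < s k ∧ s k < R := fun k hk => by
    have := hR (Or.inr (mem_image_of_mem s hk))
    rwa [mem_ball_zero_iff, Real.norm_eq_abs, abs_lt] at this
  -- The ball may be empty; then there are neither points of `A` nor jumps.
  rcases le_or_gt R (-R) with hneg | hRR
  · have hA : A = ∅ := by
      ext x
      simp only [mem_empty_iff_false, iff_false]
      intro hx
      linarith [hRA x hx]
    have hK : K = ∅ := by
      ext k
      simp only [Finset.notMem_empty, iff_false]
      intro hk
      linarith [hRK k hk]
    simp [hA, hK]
  have hftc := integral_eq_of_hasDerivAt_off_countable (a := -R) (b := R) H (A.indicator g)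
    (s := s '' K) (K.finite_toSet.image s).countable ?_ ?_ hInt.intervalIntegrable
  · have h1 : ∫ x, A.indicator g x = ∫ x in (-R)..R, A.indicator g x := by
      rw [intervalIntegral.integral_of_le hRR.le, setIntegral_eq_integral_of_forall_compl_eq_zero]
      intro x hx
      refine indicator_of_notMem (fun hxA => hx ?_) _
      exact ⟨(hRA x hxA).1, (hRA x hxA).2.le⟩
    rw [h1, hftc]
    have e1 : H R = σ R := by
      have hR1 : ∀ k ∈ K, s k ≠ R := fun k hk => (hRK k hk).2.ne
      have : R ∉ A := fun h => lt_irrefl _ (hRA R h).2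
      simp [hH, hc_off R hR1, hind, this]
    have e2 : H (-R) = σ (-R) := by
      have hR1 : ∀ k ∈ K, s k ≠ -R := fun k hk => (hRK k hk).1.ne'
      have : -R ∉ A := fun h => lt_irrefl _ (hRA _ h).1
      simp [hH, hc_off _ hR1, hind, this]
    have e3 : σ R = ∑ k ∈ K, J k := Finset.sum_congr rfl fun k hk => by simp [(hRK k hk).2]
    have e4 : σ (-R) = 0 := Finset.sum_eq_zero fun k hk => by simp [(hRK k hk).1.le]
    rw [e1, e2, e3, e4, sub_zero]
  · intro x _
    by_cases hx : ∃ k ∈ K, s k = x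
    · obtain ⟨k, hk, rfl⟩ := hx
      exact (hH_jump k hk).continuousWithinAt
    · push Not at hx
      exact (hH_deriv x hx).continuousAt.continuousWithinAt
  · intro x hx
    exact hH_deriv x fun k hk h => hx.2 ⟨k, hk, h⟩

/-! ### The area formula in one variable -/

/-- The sum over a fibre of `y` that occurs in the area formula. -/
def fibreSum (y y' : ℝ → ℝ) (h : ℝ → ℂ) (c d η : ℝ) : ℂ :=
  ∑ᶠ t ∈ {t | t ∈ Ioo c d ∧ y t = η}, ((SignType.sign (y' t) : ℝ) : ℂ) * h t

/-- The area formula for a function with finitely many critical points. -/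
lemma area_formula {y y' : ℝ → ℝ} {h : ℝ → ℂ} (Z : Finset ℝ) : ∀ {c d : ℝ}, c ≤ d →
    (∀ t ∈ Icc c d, HasDerivAt y (y' t) t) → ContinuousOn y' (Icc c d) →
    ContinuousOn h (Icc c d) → (∀ t ∈ Ioo c d, y' t = 0 → t ∈ Z) →
    (∀ η, {t | t ∈ Ioo c d ∧ y t = η}.Finite) ∧ Integrable (fibreSum y y' h c d) ∧
      ∫ η, fibreSum y y' h c d η = ∫ t in c..d, (y' t : ℂ) * h t := by
  classical
  induction Z using Finset.induction_on with
  | empty =>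
    intro c d hcd hy hy' hh hZ
    -- Without critical points the function is injective by Rolle's theorem, and the claim is the
    -- change of variables formula.
    have hinj : InjOn y (Ioo c d) := by
      have key : ∀ s ∈ Ioo c d, ∀ t ∈ Ioo c d, s < t → y s ≠ y t := by
        intro s hs t ht hst heq
        have hsub : Icc s t ⊆ Icc c d := Icc_subset_Icc hs.1.le ht.2.le
        obtain ⟨r, hr, hr0⟩ := exists_hasDerivAt_eq_zero hst
          (fun x hx => (hy x (hsub hx)).continuousAt.continuousWithinAt) heq
          (fun x hx => hy x (hsub (Ioo_subset_Icc_self hx)))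
        exact absurd (hZ r ⟨hs.1.trans hr.1, hr.2.trans ht.2⟩ hr0) (Finset.notMem_empty _)
      intro s hs t ht heq
      rcases lt_trichotomy s t with h | h | h
      · exact absurd heq (key s hs t ht h)
      · exact h
      · exact absurd heq.symm (key t ht s hs h)
    have hfib : ∀ t ∈ Ioo c d, {r | r ∈ Ioo c d ∧ y r = y t} = {t} := by
      intro t ht
      ext r
      exact ⟨fun hr => hinj hr.1 ht hr.2, fun hr => by rw [mem_singleton_iff] at hr; subst hr; exact ⟨ht, rfl⟩⟩
    have hfib' : ∀ η, η ∉ y '' Ioo c d → {r | r ∈ Ioo c d ∧ y r = η} = ∅ := by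
      intro η hη
      ext r
      simp only [mem_empty_iff_false, iff_false]
      exact fun hr => hη ⟨r, hr.1, hr.2⟩
    have hval : ∀ t ∈ Ioo c d, fibreSum y y' h c d (y t) =
        ((SignType.sign (y' t) : ℝ) : ℂ) * h t := by
      intro t ht
      rw [fibreSum, hfib t ht, finsum_mem_singleton]
    have hval' : ∀ η, η ∉ y '' Ioo c d → fibreSum y y' h c d η = 0 := by
      intro η hη
      rw [fibreSum, hfib' η hη, finsum_mem_empty]
    have hder : ∀ t ∈ Ioo c d, HasDerivWithinAt y (y' t) (Ioo c d) t :=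
      fun t ht => (hy t (Ioo_subset_Icc_self ht)).hasDerivWithinAt
    have heq : EqOn (fun t => |y' t| • fibreSum y y' h c d (y t)) (fun t => (y' t : ℂ) * h t)
        (Ioo c d) := by
      intro t ht
      simp only [hval t ht, Complex.real_smul]
      rw [← mul_assoc, ← Complex.ofReal_mul, abs_mul_sign]
    have hI : IntegrableOn (fun t => (y' t : ℂ) * h t) (Ioo c d) := by
      have : ContinuousOn (fun t => (y' t : ℂ) * h t) (Icc c d) :=
        (Complex.continuous_ofReal.comp_continuousOn hy').mul hh
      exact (this.integrableOn_Icc).mono_set Ioo_subset_Icc_self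
    have hmeas : MeasurableSet (y '' Ioo c d) :=
      measurable_image_of_fderivWithin measurableSet_Ioo
        (fun t ht => (hder t ht).hasFDerivWithinAt) hinj
    refine ⟨fun η => ?_, ?_, ?_⟩
    · by_cases hη : η ∈ y '' Ioo c d
      · obtain ⟨t, ht, rfl⟩ := hη
        rw [hfib t ht]; exact finite_singleton t
      · rw [hfib' η hη]; exact finite_empty
    · have h1 : IntegrableOn (fibreSum y y' h c d) (y '' Ioo c d) := by
        rw [integrableOn_image_iff_integrableOn_abs_deriv_smul measurableSet_Ioo hder hinj]
        exact (integrableOn_congr_fun heq measurableSet_Ioo).2 hI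
      rw [← integrable_indicator_iff hmeas] at h1
      refine h1.congr (Eventually.of_forall fun η => ?_)
      by_cases hη : η ∈ y '' Ioo c d
      · simp [indicator_of_mem hη]
      · simp [indicator_of_notMem hη, hval' η hη]
    · rw [← setIntegral_eq_integral_of_forall_compl_eq_zero (s := y '' Ioo c d) hval',
        integral_image_eq_integral_abs_deriv_smul measurableSet_Ioo hder hinj,
        setIntegral_congr_fun measurableSet_Ioo heq, intervalIntegral.integral_of_le hcd,
        integral_Ioc_eq_integral_Ioo]
  | insert e Z he ih =>
    intro c d hcd hy hy' hh hZ
    by_cases hein : e ∈ Ioo c d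
    · have hs1 : Icc c e ⊆ Icc c d := Icc_subset_Icc le_rfl hein.2.le
      have hs2 : Icc e d ⊆ Icc c d := Icc_subset_Icc hein.1.le le_rfl
      obtain ⟨f1, i1, v1⟩ := ih hein.1.le (fun t ht => hy t (hs1 ht)) (hy'.mono hs1) (hh.mono hs1)
        (fun t ht h0 => (Finset.mem_insert.1 (hZ t ⟨ht.1, ht.2.trans hein.2⟩ h0)).resolve_left
          ht.2.ne)
      obtain ⟨f2, i2, v2⟩ := ih hein.2.le (fun t ht => hy t (hs2 ht)) (hy'.mono hs2) (hh.mono hs2)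
        (fun t ht h0 => (Finset.mem_insert.1 (hZ t ⟨hein.1.trans ht.1, ht.2⟩ h0)).resolve_left
          ht.1.ne')
      -- Cutting the interval at `e` changes only the fibre over `y e`, a single value, which the
      -- integral does not see.
      have hsplit : ∀ η, η ≠ y e → {t | t ∈ Ioo c d ∧ y t = η} =
          {t | t ∈ Ioo c e ∧ y t = η} ∪ {t | t ∈ Ioo e d ∧ y t = η} := by
        intro η hη
        ext t
        constructor
        · rintro ⟨ht, rfl⟩
          rcases lt_trichotomy t e with h | h | h
          · exact Or.inl ⟨⟨ht.1, h⟩, rfl⟩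
          · exact absurd (by rw [h]) hη
          · exact Or.inr ⟨⟨h, ht.2⟩, rfl⟩
        · rintro (⟨ht, rfl⟩ | ⟨ht, rfl⟩)
          · exact ⟨⟨ht.1, ht.2.trans hein.2⟩, rfl⟩
          · exact ⟨⟨hein.1.trans ht.1, ht.2⟩, rfl⟩
      have hae : fibreSum y y' h c e + fibreSum y y' h e d =ᵐ[volume] fibreSum y y' h c d := by
        have : ∀ᵐ η : ℝ, η ≠ y e := by
          simp [ae_iff]
        filter_upwards [this] with η hη
        rw [Pi.add_apply, fibreSum, fibreSum, fibreSum, hsplit η hη,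
          finsum_mem_union _ (f1 η) (f2 η)]
        rw [Set.disjoint_left]
        rintro t ⟨ht, _⟩ ⟨ht', _⟩
        exact lt_asymm ht.2 ht'.1
      have hcontI : ContinuousOn (fun t => (y' t : ℂ) * h t) (Icc c d) :=
        (Complex.continuous_ofReal.comp_continuousOn hy').mul hh
      refine ⟨fun η => ?_, (i1.add i2).congr hae, ?_⟩
      · refine (((f1 η).union (f2 η)).union (finite_singleton e)).subset ?_
        rintro t ⟨ht, rfl⟩
        rcases lt_trichotomy t e with h | h | h
        · exact Or.inl (Or.inl ⟨⟨ht.1, h⟩, rfl⟩)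
        · exact Or.inr h
        · exact Or.inl (Or.inr ⟨⟨h, ht.2⟩, rfl⟩)
      · rw [← integral_congr_ae hae]
        simp only [Pi.add_apply]
        rw [integral_add i1 i2, v1, v2]
        refine intervalIntegral.integral_add_adjacent_intervals ?_ ?_
        · exact (hcontI.mono hs1).intervalIntegrable_of_Icc hein.1.le
        · exact (hcontI.mono hs2).intervalIntegrable_of_Icc hein.2.le
    · exact ih hcd hy hy' hh fun t ht h0 =>
        (Finset.mem_insert.1 (hZ t ht h0)).resolve_left fun h => hein (h ▸ ht)

namespace RationalArc

/-- The second coordinate of an arc is constant, or it has finitely many critical points. -/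
lemma finite_critical_or_const (γ : RationalArc) :
    (∃ Z : Finset ℝ, ∀ t ∈ Icc γ.a γ.b, deriv γ.y t = 0 → t ∈ Z) ∨
      (∀ t ∈ Icc γ.a γ.b, deriv γ.y t = 0) := by
  classical
  set N := γ.Y.derivative * γ.W - γ.Y * γ.W.derivative with hN
  have hval : ∀ t ∈ Icc γ.a γ.b, deriv γ.y t = N.eval t / γ.W.eval t ^ 2 := fun t ht => by
    rw [γ.deriv_y ht, hN]; simp
  by_cases h : N = 0
  · right
    intro t ht
    rw [hval t ht, h]; simp
  · left
    refine ⟨N.roots.toFinset, fun t ht h0 => ?_⟩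
    rw [hval t ht, div_eq_zero_iff] at h0
    rw [Multiset.mem_toFinset, Polynomial.mem_roots h]
    exact h0.resolve_right (pow_ne_zero _ (γ.W_ne_zero t ht))

lemma y_eq_of_deriv_eq_zero (γ : RationalArc) (h : ∀ t ∈ Icc γ.a γ.b, deriv γ.y t = 0) {t : ℝ}
    (ht : t ∈ Icc γ.a γ.b) : γ.y t = γ.y γ.a := by
  refine (convex_Icc γ.a γ.b).is_const_of_fderivWithin_eq_zero (𝕜 := ℝ) (f := γ.y)
    (fun s hs => (γ.hasDerivAt_y hs).differentiableAt.differentiableWithinAt) ?_ ht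
    (left_mem_Icc.2 γ.a_lt_b.le)
  intro s hs
  have h1 := (γ.hasDerivAt_y hs).hasFDerivAt.hasFDerivWithinAt (s := Icc γ.a γ.b)
  rw [h1.fderivWithin ((uniqueDiffOn_Icc γ.a_lt_b) s hs), h s hs]
  ext; simp

/-- The values of the second coordinate at the endpoints and the critical points. -/
def criticalValues (γ : RationalArc) : Set ℝ :=
  γ.y '' {t | t ∈ Icc γ.a γ.b ∧ (t = γ.a ∨ t = γ.b ∨ deriv γ.y t = 0)}

/-- A horizontal arc has only critical parameters but a single value; otherwise the critical
parameters are roots of a nonzero polynomial. -/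
lemma finite_criticalValues (γ : RationalArc) : γ.criticalValues.Finite := by
  rcases γ.finite_critical_or_const with ⟨Z, hZ⟩ | h
  · refine Finite.image _ ((Z.finite_toSet.union (toFinite {γ.a, γ.b})).subset ?_)
    rintro t ⟨ht, rfl | rfl | h⟩
    · simp
    · simp
    · exact Or.inl (hZ t ht h)
  · refine (finite_singleton (γ.y γ.a)).subset ?_
    rintro _ ⟨t, ⟨ht, _⟩, rfl⟩
    exact γ.y_eq_of_deriv_eq_zero h ht

/-- The area formula for the second coordinate of an arc. -/
lemma area_formula_y (γ : RationalArc) {h : ℝ → ℂ} (hh : ContinuousOn h (Icc γ.a γ.b)) :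
    (∀ η, η ∉ γ.criticalValues → {t | t ∈ Ioo γ.a γ.b ∧ γ.y t = η}.Finite) ∧
      Integrable (fibreSum γ.y (deriv γ.y) h γ.a γ.b) ∧
      ∫ η, fibreSum γ.y (deriv γ.y) h γ.a γ.b η =
        ∫ t in γ.a..γ.b, ((deriv γ.y t : ℝ) : ℂ) * h t := by
  rcases γ.finite_critical_or_const with ⟨Z, hZ⟩ | h0
  · obtain ⟨h1, h2, h3⟩ := area_formula Z γ.a_lt_b.le (fun t ht => γ.hasDerivAt_y ht)
      γ.continuousOn_deriv_y hh (fun t ht => hZ t (Ioo_subset_Icc_self ht))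
    exact ⟨fun η _ => h1 η, h2, h3⟩
  -- On a horizontal arc the sign of the derivative is zero, so the fibre sums vanish even where a
  -- fibre is infinite.
  · have hzero : fibreSum γ.y (deriv γ.y) h γ.a γ.b = 0 := by
      ext η
      refine finsum_mem_eq_zero_of_forall_eq_zero fun t ht => ?_
      simp [h0 t (Ioo_subset_Icc_self ht.1)]
    refine ⟨fun η hη => ?_, ?_, ?_⟩
    · refine Set.Finite.subset finite_empty ?_
      rintro t ⟨ht, rfl⟩
      exact hη ⟨t, ⟨Ioo_subset_Icc_self ht, Or.inr (Or.inr (h0 t (Ioo_subset_Icc_self ht)))⟩, rfl⟩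
    · rw [hzero]; exact integrable_zero _ _ _
    · rw [hzero, intervalIntegral.integral_congr (g := fun _ => (0 : ℂ))]
      · simp
      · intro t ht
        rw [uIcc_of_le γ.a_lt_b.le] at ht
        simp [h0 t ht]

end RationalArc

namespace ArcBoundary

variable {ι : Type*} {P : Set (ℝ × ℝ)} {γ : ι → RationalArc}

lemma isCompact_closure (hP : ArcBoundary P γ) : IsCompact (closure P) :=
  hP.bounded.isCompact_closure

lemma point_mem_closure (hP : ArcBoundary P γ) (j : ι) {t : ℝ} (ht : t ∈ Icc (γ j).a (γ j).b) :
    (γ j).point t ∈ closure P := by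
  refine frontier_subset_closure ?_
  rw [hP.frontier_eq]
  exact mem_iUnion.2 ⟨j, mem_image_of_mem _ ht⟩

/-- The integral over a generic horizontal slice. -/
lemma integral_slice [Fintype ι] (hP : ArcBoundary P γ) {l r : ι → ℤ}
    (hl : ∀ j, ∀ t ∈ Ioo (γ j).a (γ j).b, SideValue P (γ j) 1 t (l j))
    (hr : ∀ j, ∀ t ∈ Ioo (γ j).a (γ j).b, SideValue P (γ j) (-1) t (r j))
    {f g : ℝ × ℝ → ℂ}
    (hfg : ∀ p ∈ closure P, HasDerivAt (fun x => f (x, p.2)) (g p) p.1)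
    {η : ℝ} (hη : ∀ j, η ∉ (γ j).criticalValues)
    (hfin : ∀ j, {t | t ∈ Ioo (γ j).a (γ j).b ∧ (γ j).y t = η}.Finite)
    (hInt : Integrable fun x => P.indicator g (x, η)) :
    ∫ x, P.indicator g (x, η) = ∑ j, ((l j - r j : ℤ) : ℂ) *
      fibreSum (γ j).y (deriv (γ j).y) (fun t => f ((γ j).point t)) (γ j).a (γ j).b η := by
  classical
  set A : Set ℝ := {x | (x, η) ∈ P} with hA
  -- The crossings of the line at height `η` with the boundary, as pairs of an arc and a parameter.
  -- A generic height avoids endpoints and horizontal tangents.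
  set K : Finset (Σ _ : ι, ℝ) := Finset.univ.sigma fun j => (hfin j).toFinset with hK
  have hKmem : ∀ k : Σ _ : ι, ℝ, k ∈ K ↔ k.2 ∈ Ioo (γ k.1).a (γ k.1).b ∧ (γ k.1).y k.2 = η := by
    intro k
    simp [hK]
  have hpt : ∀ k ∈ K, ((γ k.1).x k.2, η) = (γ k.1).point k.2 := fun k hk => by
    rw [RationalArc.point, ((hKmem k).1 hk).2]
  have hmemf : ∀ x, (∀ k ∈ K, (γ k.1).x k.2 ≠ x) → (x, η) ∉ frontier P := by
    intro x hx hxf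
    rw [hP.frontier_eq, mem_iUnion] at hxf
    obtain ⟨j, t, ht, h⟩ := hxf
    have hx' : (γ j).x t = x := congrArg Prod.fst h
    have hy' : (γ j).y t = η := congrArg Prod.snd h
    have hta : t ≠ (γ j).a := fun h' => hη j ⟨t, ⟨ht, Or.inl h'⟩, hy'⟩
    have htb : t ≠ (γ j).b := fun h' => hη j ⟨t, ⟨ht, Or.inr (Or.inl h')⟩, hy'⟩
    exact hx ⟨j, t⟩ ((hKmem _).2 ⟨⟨lt_of_le_of_ne ht.1 (Ne.symm hta), lt_of_le_of_ne ht.2 htb⟩,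
      hy'⟩) hx'
  have hder : ∀ k ∈ K, deriv (γ k.1).y k.2 ≠ 0 := fun k hk h =>
    hη k.1 ⟨k.2, ⟨Ioo_subset_Icc_self ((hKmem k).1 hk).1, Or.inr (Or.inr h)⟩, ((hKmem k).1 hk).2⟩
  have hind : ∀ x, A.indicator (fun _ => (1 : ℤ)) x = P.indicator (fun _ => (1 : ℤ)) (x, η) :=
    fun x => rfl
  have hleft : ∀ (x₀ : ℝ) (v : ℤ), (∀ᶠ s : ℝ in 𝓝[>] 0,
      P.indicator (fun _ => (1 : ℤ)) ((x₀, η) + s • ((-1 : ℝ), (0 : ℝ))) = v) →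
      ∀ᶠ x in 𝓝[<] x₀, A.indicator (fun _ => (1 : ℤ)) x = v := by
    intro x₀ v h
    have ht : Tendsto (fun x => x₀ - x) (𝓝[<] x₀) (𝓝[>] 0) := by
      refine tendsto_nhdsWithin_of_tendsto_nhds_of_eventually_within _ ?_ ?_
      · have : Tendsto (fun x => x₀ - x) (𝓝 x₀) (𝓝 (x₀ - x₀)) :=
          Continuous.tendsto (by fun_prop) x₀
        rw [sub_self] at this
        exact this.mono_left nhdsWithin_le_nhds
      · filter_upwards [self_mem_nhdsWithin] with x hx
        exact sub_pos.2 (mem_ofPred.1 hx)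
    filter_upwards [ht.eventually h] with x hx
    rw [hind, ← hx]
    simp
  have hright : ∀ (x₀ : ℝ) (v : ℤ), (∀ᶠ s : ℝ in 𝓝[>] 0,
      P.indicator (fun _ => (1 : ℤ)) ((x₀, η) + s • ((1 : ℝ), (0 : ℝ))) = v) →
      ∀ᶠ x in 𝓝[>] x₀, A.indicator (fun _ => (1 : ℤ)) x = v := by
    intro x₀ v h
    have ht : Tendsto (fun x => x - x₀) (𝓝[>] x₀) (𝓝[>] 0) := by
      refine tendsto_nhdsWithin_of_tendsto_nhds_of_eventually_within _ ?_ ?_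
      · have : Tendsto (fun x => x - x₀) (𝓝 x₀) (𝓝 (x₀ - x₀)) :=
          Continuous.tendsto (by fun_prop) x₀
        rw [sub_self] at this
        exact this.mono_left nhdsWithin_le_nhds
      · filter_upwards [self_mem_nhdsWithin] with x hx
        exact sub_pos.2 (mem_ofPred.1 hx)
    filter_upwards [ht.eventually h] with x hx
    rw [hind, ← hx]
    simp
  have hcr1 : ∀ k : Σ _ : ι, ℝ, cross ((γ k.1).vel k.2) (-1, 0) = deriv (γ k.1).y k.2 := fun k => by
    simp [cross, RationalArc.vel]
  have hcr2 : ∀ k : Σ _ : ι, ℝ, cross ((γ k.1).vel k.2) (1, 0) = -deriv (γ k.1).y k.2 := fun k => by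
    simp [cross, RationalArc.vel]
  -- In the direction of increasing x, an arc with `y' > 0` is crossed from its left to its right,
  -- and an arc with `y' < 0` from its right to its left. The sign of `y'` in the fibre sum restores
  -- the common factor `l - r`.
  have hmain := integral_indicator_eq_sum_jumps A K (fun k => (γ k.1).x k.2) ?_
    (fun x => f (x, η)) (fun x => g (x, η))
    (fun k => if 0 < deriv (γ k.1).y k.2 then l k.1 else r k.1)
    (fun k => if 0 < deriv (γ k.1).y k.2 then r k.1 else l k.1) ?_ ?_ ?_ ?_ ?_ ?_ ?_
  · have e1 : ∀ x, A.indicator (fun x => g (x, η)) x = P.indicator g (x, η) := fun x => rfl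
    simp only [e1] at hmain
    rw [hmain, hK, Finset.sum_sigma]
    refine Finset.sum_congr rfl fun j _ => ?_
    rw [fibreSum, finsum_mem_eq_finite_toFinset_sum _ (hfin j), Finset.mul_sum]
    refine Finset.sum_congr rfl fun t ht => ?_
    have htK : (⟨j, t⟩ : Σ _ : ι, ℝ) ∈ K := by simpa [hK] using ht
    have h1 := hpt _ htK
    simp only at h1
    simp only [h1]
    rcases lt_or_gt_of_ne (hder _ htK) with h | h
    · simp only at h
      simp only [h.not_gt, if_false, sign_neg h, SignType.coe_neg, SignType.coe_one]
      push_cast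
      ring
    · simp only at h
      simp only [h, if_true, sign_pos h, SignType.coe_one]
      push_cast
      ring
  · intro k hk k' hk' h
    have hk1 := (hKmem k).1 hk
    have hk1' := (hKmem k').1 hk'
    have hpp : (γ k.1).point k.2 = (γ k'.1).point k'.2 := by
      rw [← hpt k hk, ← hpt k' hk']
      exact congrArg (·, η) h
    obtain ⟨j, t⟩ := k
    obtain ⟨j', t'⟩ := k'
    by_cases hjj : j = j'
    · subst hjj
      have := (γ j).point_injective hk1'.1 (Ioo_subset_Icc_self hk1.1) hpp
      simp only at this
      rw [this]
    · refine absurd ?_ (Set.disjoint_left.1 (hP.meet_at_vertices j j' hjj)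
        (mem_image_of_mem _ hk1.1))
      rw [hpp]
      exact mem_image_of_mem _ (Ioo_subset_Icc_self hk1'.1)
  · obtain ⟨R, hR⟩ := hP.bounded.subset_closedBall 0
    refine (Metric.isBounded_closedBall (x := (0 : ℝ)) (r := R)).subset fun x hx => ?_
    have := hR hx
    rw [mem_closedBall_zero_iff] at this ⊢
    exact (norm_fst_le (x, η)).trans this
  · intro x hx
    have hxf := hmemf x hx
    have hc : ContinuousAt (fun y : ℝ => (y, η)) x := by fun_prop
    by_cases hxP : (x, η) ∈ P
    · have : (x, η) ∈ interior P := by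
        by_contra h
        exact hxf ⟨subset_closure hxP, h⟩
      filter_upwards [hc.eventually (mem_interior_iff_mem_nhds.1 this)] with y hy
      exact ⟨fun _ => hxP, fun _ => hy⟩
    · have : (x, η) ∈ (closure P)ᶜ := fun h => hxf ⟨h, fun h' => hxP (interior_subset h')⟩
      filter_upwards [hc.eventually (isClosed_closure.isOpen_compl.mem_nhds this)] with y hy
      exact ⟨fun h => absurd (subset_closure (show (y, η) ∈ P from h)) hy, fun h => absurd h hxP⟩
  · intro k hk
    refine hleft _ _ ?_
    rw [hpt k hk]
    rcases lt_or_gt_of_ne (hder k hk) with h | h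
    · simp only [h.not_gt, if_false]
      exact hr k.1 k.2 ((hKmem k).1 hk).1 _ (by rw [hcr1]; linarith)
    · simp only [h, if_true]
      exact hl k.1 k.2 ((hKmem k).1 hk).1 _ (by rw [hcr1]; linarith)
  · intro k hk
    refine hright _ _ ?_
    rw [hpt k hk]
    rcases lt_or_gt_of_ne (hder k hk) with h | h
    · simp only [h.not_gt, if_false]
      exact hl k.1 k.2 ((hKmem k).1 hk).1 _ (by rw [hcr2]; linarith)
    · simp only [h, if_true]
      exact hr k.1 k.2 ((hKmem k).1 hk).1 _ (by rw [hcr2]; linarith)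
  · intro k hk
    have := hfg _ (hP.point_mem_closure k.1 (Ioo_subset_Icc_self ((hKmem k).1 hk).1))
    rw [← hpt k hk] at this
    exact this.continuousAt
  · intro x hx _
    exact hfg (x, η) (subset_closure hx)
  · exact hInt

/-- Green's theorem, horizontal part. -/
theorem green_fst [Fintype ι] (hP : ArcBoundary P γ) {l r : ι → ℤ}
    (hl : ∀ j, ∀ t ∈ Ioo (γ j).a (γ j).b, SideValue P (γ j) 1 t (l j))
    (hr : ∀ j, ∀ t ∈ Ioo (γ j).a (γ j).b, SideValue P (γ j) (-1) t (r j))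
    {f g : ℝ × ℝ → ℂ} (hf : ContinuousOn f (closure P)) (hg : ContinuousOn g (closure P))
    (hfg : ∀ p ∈ closure P, HasDerivAt (fun x => f (x, p.2)) (g p) p.1) :
    ∫ p in P, g p = ∑ j, ((l j - r j : ℤ) : ℂ) *
      ∫ t in (γ j).a..(γ j).b, ((deriv (γ j).y t : ℝ) : ℂ) * f ((γ j).point t) := by
  have hgi : Integrable (P.indicator g) := by
    rw [integrable_indicator_iff hP.measurable]
    exact (hg.integrableOn_compact hP.isCompact_closure).mono_set subset_closure
  have hcont : ∀ j, ContinuousOn (fun t => f ((γ j).point t)) (Icc (γ j).a (γ j).b) := fun j =>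
    hf.comp (γ j).continuousOn_point fun t ht => hP.point_mem_closure j ht
  have harea := fun j => (γ j).area_formula_y (hcont j)
  rw [← integral_indicator hP.measurable]
  rw [Measure.volume_eq_prod] at hgi ⊢
  rw [integral_prod_symm _ hgi]
  have hcrit : ∀ᵐ η : ℝ, ∀ j, η ∉ (γ j).criticalValues := by
    rw [ae_all_iff]
    intro j
    exact (γ j).finite_criticalValues.countable.ae_notMem _
  have hae : ∀ᵐ η : ℝ, ∫ x, P.indicator g (x, η) = ∑ j, ((l j - r j : ℤ) : ℂ) *
      fibreSum (γ j).y (deriv (γ j).y) (fun t => f ((γ j).point t)) (γ j).a (γ j).b η := by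
    filter_upwards [hcrit, hgi.prod_left_ae] with η h1 h2
    exact hP.integral_slice hl hr hfg h1 (fun j => (harea j).1 η (h1 j)) h2
  rw [integral_congr_ae hae, integral_finsetSum]
  · refine Finset.sum_congr rfl fun j _ => ?_
    rw [integral_const_mul, (harea j).2.2]
  · intro j _
    exact (harea j).2.1.const_mul _

end ArcBoundary

/-! ### Exchanging the coordinates -/

/-- The mirror image of an arc under the exchange of the coordinates. -/
def RationalArc.swap (γ : RationalArc) : RationalArc where
  X := γ.Y
  Y := γ.X
  W := γ.W
  a := γ.a
  b := γ.b
  a_lt_b := γ.a_lt_b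
  W_ne_zero := γ.W_ne_zero
  injOn_Ico := fun _ hs _ ht h => γ.injOn_Ico hs ht (Prod.swap_injective h)
  injOn_Ioc := fun _ hs _ ht h => γ.injOn_Ioc hs ht (Prod.swap_injective h)
  regular := fun t ht h => γ.regular t ht h.symm

lemma RationalArc.swap_point (γ : RationalArc) (t : ℝ) : γ.swap.point t = (γ.point t).swap := rfl

lemma RationalArc.swap_image (γ : RationalArc) : γ.swap.image = Prod.swap ⁻¹' γ.image := by
  ext p
  constructor
  · rintro ⟨t, ht, rfl⟩
    exact ⟨t, ht, rfl⟩
  · rintro ⟨t, ht, h⟩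
    exact ⟨t, ht, by rw [γ.swap_point, h, Prod.swap_swap]⟩

lemma RationalArc.swap_openImage (γ : RationalArc) :
    γ.swap.openImage = Prod.swap ⁻¹' γ.openImage := by
  ext p
  constructor
  · rintro ⟨t, ht, rfl⟩
    exact ⟨t, ht, rfl⟩
  · rintro ⟨t, ht, h⟩
    exact ⟨t, ht, by rw [γ.swap_point, h, Prod.swap_swap]⟩

/-- A reflection reverses the orientation, so the determinant changes sign and the two sides of the
arc are exchanged. -/
lemma SideValue.swap {P : Set (ℝ × ℝ)} {γ : RationalArc} {ε t : ℝ} {l : ℤ}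
    (h : SideValue P γ ε t l) : SideValue (Prod.swap ⁻¹' P) γ.swap (-ε) t l := by
  intro d hd
  have hcr : cross (γ.swap.vel t) d = - cross (γ.vel t) d.swap := by
    change deriv γ.y t * d.2 - deriv γ.x t * d.1 = -(deriv γ.x t * d.1 - deriv γ.y t * d.2)
    ring
  exact h d.swap (by rw [hcr] at hd; linarith)

namespace ArcBoundary

variable {ι : Type*} {P : Set (ℝ × ℝ)} {γ : ι → RationalArc}

lemma swap (hP : ArcBoundary P γ) : ArcBoundary (Prod.swap ⁻¹' P) (fun j => (γ j).swap) where
  bounded := by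
    obtain ⟨R, hR⟩ := hP.bounded.subset_closedBall 0
    refine (Metric.isBounded_closedBall (x := (0 : ℝ × ℝ)) (r := R)).subset fun x hx => ?_
    have := hR hx
    rw [mem_closedBall_zero_iff] at this ⊢
    rw [Prod.norm_def] at this ⊢
    rwa [max_comm]
  measurable := measurable_swap hP.measurable
  frontier_eq := by
    have := (Homeomorph.prodComm ℝ ℝ).preimage_frontier P
    simp only [Homeomorph.coe_prodComm] at this
    rw [← this, hP.frontier_eq, preimage_iUnion]
    simp [RationalArc.swap_image]
  meet_at_vertices := by
    intro i j hij
    rw [RationalArc.swap_image, RationalArc.swap_openImage]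
    exact (hP.meet_at_vertices i j hij).preimage _

/-- Green's theorem, vertical part. -/
theorem green_snd [Fintype ι] (hP : ArcBoundary P γ) {l r : ι → ℤ}
    (hl : ∀ j, ∀ t ∈ Ioo (γ j).a (γ j).b, SideValue P (γ j) 1 t (l j))
    (hr : ∀ j, ∀ t ∈ Ioo (γ j).a (γ j).b, SideValue P (γ j) (-1) t (r j))
    {f g : ℝ × ℝ → ℂ} (hf : ContinuousOn f (closure P)) (hg : ContinuousOn g (closure P))
    (hfg : ∀ p ∈ closure P, HasDerivAt (fun y => f (p.1, y)) (g p) p.2) :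
    ∫ p in P, g p = -∑ j, ((l j - r j : ℤ) : ℂ) *
      ∫ t in (γ j).a..(γ j).b, ((deriv (γ j).x t : ℝ) : ℂ) * f ((γ j).point t) := by
  have hcl : closure (Prod.swap ⁻¹' P) = Prod.swap ⁻¹' closure P := by
    have := (Homeomorph.prodComm ℝ ℝ).preimage_closure P
    simpa only [Homeomorph.coe_prodComm] using this.symm
  have hmaps : MapsTo Prod.swap (closure (Prod.swap ⁻¹' P)) (closure P) := by
    rw [hcl]; exact mapsTo_preimage _ _
  -- The roles of `l` and `r` are interchanged by the reflection; this is the source of the minus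
  -- sign.
  have h := hP.swap.green_fst (l := r) (r := l) (f := fun p => f p.swap) (g := fun p => g p.swap)
    (fun j t ht => by simpa using (hr j t ht).swap) (fun j t ht => (hl j t ht).swap)
    (hf.comp continuous_swap.continuousOn hmaps) (hg.comp continuous_swap.continuousOn hmaps)
    (fun p hp => hfg p.swap (hmaps hp))
  have h2 : ∫ p in Prod.swap ⁻¹' P, g p.swap = ∫ p in P, g p := by
    have hmp : MeasurePreserving (Prod.swap : ℝ × ℝ → ℝ × ℝ) volume volume := by
      rw [Measure.volume_eq_prod]; exact Measure.measurePreserving_swap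
    exact hmp.setIntegral_preimage_emb (MeasurableEquiv.prodComm.measurableEmbedding) g P
  rw [← h2, h, ← Finset.sum_neg_distrib]
  refine Finset.sum_congr rfl fun j _ => ?_
  have : ((l j - r j : ℤ) : ℂ) = -((r j - l j : ℤ) : ℂ) := by push_cast; ring
  rw [this, neg_mul, neg_neg]
  rfl

end ArcBoundary

/-! ### The transform as a sum of boundary integrals -/

lemma IsSemialgebraic.measurableSet {S : Set (ℝ × ℝ)} (h : IsSemialgebraic S) :
    MeasurableSet S := by
  obtain ⟨m, E, I, rfl⟩ := h
  have hev : ∀ f : MvPolynomial (Fin 2) ℝ,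
      Continuous fun p : ℝ × ℝ => MvPolynomial.eval ![p.1, p.2] f := fun f => by
    refine (MvPolynomial.continuous_eval f).comp (continuous_pi fun i => ?_)
    fin_cases i
    · exact continuous_fst
    · exact continuous_snd
  refine MeasurableSet.iUnion fun i => MeasurableSet.inter ?_ ?_
  · have : {p : ℝ × ℝ | ∀ f ∈ E i, MvPolynomial.eval ![p.1, p.2] f = 0} =
        ⋂ f ∈ E i, {p : ℝ × ℝ | MvPolynomial.eval ![p.1, p.2] f = 0} := by
      ext; simp
    change MeasurableSet {p : ℝ × ℝ | ∀ f ∈ E i, MvPolynomial.eval ![p.1, p.2] f = 0}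
    rw [this]
    exact Finset.measurableSet_biInter _ fun f _ =>
      (isClosed_eq (hev f) continuous_const).measurableSet
  · have : {p : ℝ × ℝ | ∀ f ∈ I i, 0 < MvPolynomial.eval ![p.1, p.2] f} =
        ⋂ f ∈ I i, {p : ℝ × ℝ | 0 < MvPolynomial.eval ![p.1, p.2] f} := by
      ext; simp
    change MeasurableSet {p : ℝ × ℝ | ∀ f ∈ I i, 0 < MvPolynomial.eval ![p.1, p.2] f}
    rw [this]
    exact Finset.measurableSet_biInter _ fun f _ =>
      (isOpen_lt continuous_const (hev f)).measurableSet

lemma IsRegularPolypol.arcBoundary {n : ℕ} {P : Set (ℝ × ℝ)} {γ : Fin n → RationalArc}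
    (h : IsRegularPolypol P γ) : ArcBoundary P γ where
  bounded := h.bounded
  measurable := h.semialgebraic.measurableSet
  frontier_eq := h.frontier_eq
  meet_at_vertices := h.meet_at_vertices

lemma continuous_Q (w : ℂ × ℂ) : Continuous (Q w) := by
  unfold Q; fun_prop

lemma zero_mem_params (P : Set (ℝ × ℝ)) : ((0, 0) : ℂ × ℂ) ∈ params P := by
  intro p _; simp [Q]

lemma isOpen_params {P : Set (ℝ × ℝ)} (hP : Bornology.IsBounded P) : IsOpen (params P) := by
  have hK := hP.isCompact_closure
  rw [isOpen_iff_mem_nhds]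
  intro w hw
  have hc : Continuous fun z : (ℂ × ℂ) × (ℝ × ℝ) => Q z.1 z.2 := by unfold Q; fun_prop
  have := hK.eventually_forall_of_forall_eventually (x₀ := w)
    (P := fun w p => Q w p ≠ 0) fun p hp => hc.continuousAt.eventually_ne (hw p hp)
  exact this

lemma continuousOn_inv_Q {P : Set (ℝ × ℝ)} {w : ℂ × ℂ} (hw : w ∈ params P) (k : ℕ) :
    ContinuousOn (fun p => 1 / Q w p ^ k) (closure P) :=
  continuousOn_const.div ((continuous_Q w).continuousOn.pow k) fun p hp => pow_ne_zero _ (hw p hp)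

lemma integrableOn_inv_Q {P : Set (ℝ × ℝ)} (hP : Bornology.IsBounded P) {w : ℂ × ℂ}
    (hw : w ∈ params P) : IntegrableOn (fun p => 1 / Q w p ^ 3) P :=
  ((continuousOn_inv_Q hw 3).integrableOn_compact hP.isCompact_closure).mono_set subset_closure

lemma hasDerivAt_Q_fst (w : ℂ × ℂ) (p : ℝ × ℝ) :
    HasDerivAt (fun x : ℝ => Q w (x, p.2)) (-w.1) p.1 := by
  have h : HasDerivAt (fun x : ℝ => (x : ℂ)) 1 p.1 := Complex.ofRealCLM.hasDerivAt
  have := ((h.const_mul w.1).const_sub 1).sub_const (w.2 * (p.2 : ℂ))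
  simpa [Q] using this

lemma hasDerivAt_Q_snd (w : ℂ × ℂ) (p : ℝ × ℝ) :
    HasDerivAt (fun y : ℝ => Q w (p.1, y)) (-w.2) p.2 := by
  have h : HasDerivAt (fun x : ℝ => (x : ℂ)) 1 p.2 := Complex.ofRealCLM.hasDerivAt
  have := (h.const_mul w.2).const_sub (1 - w.1 * (p.1 : ℂ))
  simpa [Q] using this

lemma hasDerivAt_div_sq {q : ℝ → ℂ} {q' : ℂ} {f : ℝ → ℂ} {f' : ℂ} {t : ℝ} (hf : HasDerivAt f f' t)
    (h : HasDerivAt q q' t) (hq : q t ≠ 0) :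
    HasDerivAt (fun x => f x / q x ^ 2) (f' / q t ^ 2 - 2 * f t * q' / q t ^ 3) t := by
  have h2 := hf.div (h.pow 2) (pow_ne_zero 2 hq)
  refine h2.congr_deriv ?_
  simp only [Pi.pow_apply]
  field_simp
  push_cast
  ring

namespace ArcBoundary

variable {ι : Type*} [Fintype ι] {P : Set (ℝ × ℝ)} {γ : ι → RationalArc} {l r : ι → ℤ}

/-- The boundary integrals with `dy`. -/
lemma fst_mul_fantappie (hP : ArcBoundary P γ)
    (hl : ∀ j, ∀ t ∈ Ioo (γ j).a (γ j).b, SideValue P (γ j) 1 t (l j))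
    (hr : ∀ j, ∀ t ∈ Ioo (γ j).a (γ j).b, SideValue P (γ j) (-1) t (r j))
    {w : ℂ × ℂ} (hw : w ∈ params P) :
    w.1 * fantappie P w = ∑ j, ((l j - r j : ℤ) : ℂ) * arcIntegralDy (γ j) w := by
  have h := hP.green_fst hl hr (f := fun p => 1 / Q w p ^ 2) (g := fun p => 2 * w.1 * (1 / Q w p ^ 3))
    (continuousOn_inv_Q hw 2) (continuousOn_const.mul (continuousOn_inv_Q hw 3)) fun p hp => by
      refine (hasDerivAt_div_sq (hasDerivAt_const p.1 (1 : ℂ)) (hasDerivAt_Q_fst w p)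
        (hw p hp)).congr_deriv ?_
      simp only [Prod.mk.eta]
      ring
  rw [integral_const_mul] at h
  rw [fantappie, ← mul_assoc, mul_comm w.1 2, h]
  refine Finset.sum_congr rfl fun j _ => ?_
  simp only [arcIntegralDy, mul_one_div]

/-- The boundary integrals with `dx`. -/
lemma snd_mul_fantappie (hP : ArcBoundary P γ)
    (hl : ∀ j, ∀ t ∈ Ioo (γ j).a (γ j).b, SideValue P (γ j) 1 t (l j))
    (hr : ∀ j, ∀ t ∈ Ioo (γ j).a (γ j).b, SideValue P (γ j) (-1) t (r j))
    {w : ℂ × ℂ} (hw : w ∈ params P) :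
    w.2 * fantappie P w = -∑ j, ((l j - r j : ℤ) : ℂ) * arcIntegralDx (γ j) w := by
  have h := hP.green_snd hl hr (f := fun p => 1 / Q w p ^ 2) (g := fun p => 2 * w.2 * (1 / Q w p ^ 3))
    (continuousOn_inv_Q hw 2) (continuousOn_const.mul (continuousOn_inv_Q hw 3)) fun p hp => by
      refine (hasDerivAt_div_sq (hasDerivAt_const p.2 (1 : ℂ)) (hasDerivAt_Q_snd w p)
        (hw p hp)).congr_deriv ?_
      simp only [Prod.mk.eta]
      ring
  rw [integral_const_mul] at h
  rw [fantappie, ← mul_assoc, mul_comm w.2 2, h]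
  simp only [arcIntegralDx, mul_one_div]

/-- The boundary integrals with the Euler form `x dy - y dx`, which need no division. -/
lemma fantappie_eq_sum (hP : ArcBoundary P γ)
    (hl : ∀ j, ∀ t ∈ Ioo (γ j).a (γ j).b, SideValue P (γ j) 1 t (l j))
    (hr : ∀ j, ∀ t ∈ Ioo (γ j).a (γ j).b, SideValue P (γ j) (-1) t (r j))
    {w : ℂ × ℂ} (hw : w ∈ params P) :
    fantappie P w = ∑ j, ((l j - r j : ℤ) : ℂ) * ∫ t in (γ j).a..(γ j).b,
      (((γ j).x t * deriv (γ j).y t - (γ j).y t * deriv (γ j).x t : ℝ) : ℂ) /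
        Q w ((γ j).point t) ^ 2 := by
  have hofr : ∀ t : ℝ, HasDerivAt (fun x : ℝ => (x : ℂ)) 1 t := fun t => Complex.ofRealCLM.hasDerivAt
  have hc1 : ContinuousOn (fun p : ℝ × ℝ => (p.1 : ℂ)) (closure P) := by fun_prop
  have hc2 : ContinuousOn (fun p : ℝ × ℝ => (p.2 : ℂ)) (closure P) := by fun_prop
  have hn : ∀ k : ℕ, ∀ p ∈ closure P, Q w p ^ k ≠ 0 := fun k p hp => pow_ne_zero k (hw p hp)
  have hQ := fun k : ℕ => ((continuous_Q w).continuousOn (s := closure P)).pow k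
  -- The two terms of the divergence of (x, y)/Q^2. Since ux + vy = 1 - Q, their sum is 2/Q^2 + 2(1
  -- - Q)/Q^3 = 2/Q^3.
  set g₁ : ℝ × ℝ → ℂ := fun p => 1 / Q w p ^ 2 - 2 * p.1 * (-w.1) / Q w p ^ 3 with hg₁
  set g₂ : ℝ × ℝ → ℂ := fun p => 1 / Q w p ^ 2 - 2 * p.2 * (-w.2) / Q w p ^ 3 with hg₂
  have cg₁ : ContinuousOn g₁ (closure P) :=
    (continuousOn_const.div (hQ 2) (hn 2)).sub
      (((continuousOn_const.mul hc1).mul continuousOn_const).div (hQ 3) (hn 3))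
  have cg₂ : ContinuousOn g₂ (closure P) :=
    (continuousOn_const.div (hQ 2) (hn 2)).sub
      (((continuousOn_const.mul hc2).mul continuousOn_const).div (hQ 3) (hn 3))
  have h1 := hP.green_fst hl hr (f := fun p => (p.1 : ℂ) / Q w p ^ 2) (g := g₁)
    (hc1.div (hQ 2) (hn 2)) cg₁ fun p hp =>
      hasDerivAt_div_sq (hofr p.1) (hasDerivAt_Q_fst w p) (hw p hp)
  have h2 := hP.green_snd hl hr (f := fun p => (p.2 : ℂ) / Q w p ^ 2) (g := g₂)
    (hc2.div (hQ 2) (hn 2)) cg₂ fun p hp =>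
      hasDerivAt_div_sq (hofr p.2) (hasDerivAt_Q_snd w p) (hw p hp)
  have hi : ∀ g : ℝ × ℝ → ℂ, ContinuousOn g (closure P) → IntegrableOn g P := fun g hg =>
    (hg.integrableOn_compact hP.isCompact_closure).mono_set subset_closure
  have hsum : fantappie P w = ∫ p in P, (g₁ p + g₂ p) := by
    rw [fantappie, ← integral_const_mul]
    refine setIntegral_congr_fun hP.measurable fun p hp => ?_
    have hq := hw p (subset_closure hp)
    have hQp : Q w p = 1 - w.1 * p.1 - w.2 * p.2 := rfl
    simp only [hg₁, hg₂]
    field_simp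
    rw [hQp]
    ring
  rw [hsum, integral_add (hi _ cg₁) (hi _ cg₂), h1, h2, ← sub_eq_add_neg, ← Finset.sum_sub_distrib]
  refine Finset.sum_congr rfl fun j _ => ?_
  have hmaps : MapsTo (γ j).point (Icc (γ j).a (γ j).b) (closure P) := fun t ht =>
    hP.point_mem_closure j ht
  have hd1 : ContinuousOn (fun t => ((deriv (γ j).y t : ℝ) : ℂ) *
      (((γ j).point t).1 / Q w ((γ j).point t) ^ 2)) (Icc (γ j).a (γ j).b) :=
    (Complex.continuous_ofReal.comp_continuousOn (γ j).continuousOn_deriv_y).mul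
      ((hc1.div (hQ 2) (hn 2)).comp (γ j).continuousOn_point hmaps)
  have hd2 : ContinuousOn (fun t => ((deriv (γ j).x t : ℝ) : ℂ) *
      (((γ j).point t).2 / Q w ((γ j).point t) ^ 2)) (Icc (γ j).a (γ j).b) :=
    (Complex.continuous_ofReal.comp_continuousOn (γ j).continuousOn_deriv_x).mul
      ((hc2.div (hQ 2) (hn 2)).comp (γ j).continuousOn_point hmaps)
  rw [← mul_sub, ← intervalIntegral.integral_sub
    (hd1.intervalIntegrable_of_Icc (γ j).a_lt_b.le) (hd2.intervalIntegrable_of_Icc (γ j).a_lt_b.le)]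
  congr 1
  refine intervalIntegral.integral_congr fun t _ => ?_
  simp only [RationalArc.point]
  push_cast
  ring

end ArcBoundary

/-! ### Parameter integrals -/

/-- A rational curve `t ↦ (X t / W t, Y t / W t)` over the complex numbers in lowest terms, with an
interval of integration. -/
structure ReducedCurve where
  X : Polynomial ℂ
  Y : Polynomial ℂ
  W : Polynomial ℂ
  a : ℝ
  b : ℝ
  a_lt_b : a < b
  coprime : ∃ A B C : Polynomial ℂ, A * X + B * Y + C * W = 1
  W_a : W.eval (a : ℂ) ≠ 0
  W_b : W.eval (b : ℂ) ≠ 0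

namespace ReducedCurve

/-- The polynomial `W - u X - v Y`. -/
def q (c : ReducedCurve) (w : ℂ × ℂ) : Polynomial ℂ :=
  c.W - Polynomial.C w.1 * c.X - Polynomial.C w.2 * c.Y

/-- The numerator of the Euler form `x dy - y dx`. -/
def N (c : ReducedCurve) : Polynomial ℂ :=
  c.X * c.Y.derivative - c.Y * c.X.derivative

/-- The parameters for which the integrands have no poles. -/
def regularSet (c : ReducedCurve) : Set (ℂ × ℂ) :=
  {w | ∀ t ∈ Icc c.a c.b, (c.q w).eval (t : ℂ) ≠ 0}

/-- `∫ g / (W - u X - v Y)^n dt`. -/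
def period (c : ReducedCurve) (g : Polynomial ℂ) (n : ℕ) (w : ℂ × ℂ) : ℂ :=
  ∫ t in c.a..c.b, g.eval (t : ℂ) / (c.q w).eval (t : ℂ) ^ n

lemma eval_q (c : ReducedCurve) (w : ℂ × ℂ) (z : ℂ) :
    (c.q w).eval z = c.W.eval z - w.1 * c.X.eval z - w.2 * c.Y.eval z := by
  simp [q]

lemma continuous_eval_q (c : ReducedCurve) :
    Continuous fun z : (ℂ × ℂ) × ℂ => (c.q z.1).eval z.2 := by
  simp only [eval_q]; fun_prop

lemma isOpen_regularSet (c : ReducedCurve) : IsOpen c.regularSet := by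
  rw [isOpen_iff_mem_nhds]
  intro w hw
  have hc : Continuous fun z : (ℂ × ℂ) × ℝ => (c.q z.1).eval (z.2 : ℂ) :=
    c.continuous_eval_q.comp (continuous_fst.prodMk (Complex.continuous_ofReal.comp continuous_snd))
  exact isCompact_Icc.eventually_forall_of_forall_eventually (x₀ := w)
    (P := fun w (t : ℝ) => (c.q w).eval (t : ℂ) ≠ 0)
    fun t ht => hc.continuousAt.eventually_ne (hw t ht)

/-- A polynomial as a continuous function on the interval of integration. -/
def toC (c : ReducedCurve) (p : Polynomial ℂ) : C(Icc c.a c.b, ℂ) :=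
  ⟨fun t => p.eval ((t : ℝ) : ℂ), by fun_prop⟩

/-- Integration over the interval as a continuous linear functional. -/
def integralC (c : ReducedCurve) : C(Icc c.a c.b, ℂ) →L[ℂ] ℂ :=
  LinearMap.mkContinuous
    { toFun := fun φ => ∫ t in c.a..c.b, φ (projIcc c.a c.b c.a_lt_b.le t)
      map_add' := fun φ ψ => intervalIntegral.integral_add
        (Continuous.intervalIntegrable (φ.continuous.comp continuous_projIcc) _ _)
        (Continuous.intervalIntegrable (ψ.continuous.comp continuous_projIcc) _ _)
      map_smul' := fun k φ => intervalIntegral.integral_smul k _ } |c.b - c.a| fun φ => by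
    rw [mul_comm]
    exact intervalIntegral.norm_integral_le_of_norm_le_const fun t _ => φ.norm_coe_le_norm _

/-- `W - u X - v Y` as a continuous function on the interval. -/
def qC (c : ReducedCurve) (w : ℂ × ℂ) : C(Icc c.a c.b, ℂ) :=
  c.toC c.W - w.1 • c.toC c.X - w.2 • c.toC c.Y

lemma qC_apply (c : ReducedCurve) (w : ℂ × ℂ) (t : Icc c.a c.b) :
    c.qC w t = (c.q w).eval ((t : ℝ) : ℂ) := by
  rw [eval_q]; simp [qC, toC]

lemma isUnit_qC (c : ReducedCurve) {w : ℂ × ℂ} (hw : w ∈ c.regularSet) : IsUnit (c.qC w) := by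
  rw [ContinuousMap.isUnit_iff_forall_ne_zero]
  intro t
  rw [qC_apply]
  exact hw t t.2

lemma inverse_qC_apply (c : ReducedCurve) {w : ℂ × ℂ} (hw : w ∈ c.regularSet) (t : Icc c.a c.b) :
    Ring.inverse (c.qC w) t = ((c.q w).eval ((t : ℝ) : ℂ))⁻¹ := by
  have h := congrArg (fun φ : C(Icc c.a c.b, ℂ) => φ t) (Ring.mul_inverse_cancel _ (c.isUnit_qC hw))
  simp only [ContinuousMap.mul_apply, qC_apply, ContinuousMap.one_apply] at h
  exact eq_inv_of_mul_eq_one_right h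

lemma period_eq (c : ReducedCurve) (g : Polynomial ℂ) (n : ℕ) {w : ℂ × ℂ} (hw : w ∈ c.regularSet) :
    c.period g n w = c.integralC (c.toC g * Ring.inverse (c.qC w) ^ n) := by
  change _ = ∫ t in c.a..c.b, _
  rw [period]
  refine intervalIntegral.integral_congr fun t ht => ?_
  rw [uIcc_of_le c.a_lt_b.le] at ht
  simp only [projIcc_of_mem c.a_lt_b.le ht, ContinuousMap.mul_apply, ContinuousMap.pow_apply,
    c.inverse_qC_apply hw, toC, ContinuousMap.coe_mk, div_eq_mul_inv, inv_pow]

/-- An affine map into the Banach algebra of continuous functions on the interval, inversion of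
units there and a continuous linear functional are analytic; the period is composed of these, so no
differentiation under the integral sign is needed. -/
lemma analyticAt_period (c : ReducedCurve) (g : Polynomial ℂ) (n : ℕ) {w : ℂ × ℂ}
    (hw : w ∈ c.regularSet) : AnalyticAt ℂ (c.period g n) w := by
  have hq : AnalyticAt ℂ c.qC w := by
    unfold qC
    exact (analyticAt_const.sub (analyticAt_fst.smul analyticAt_const)).sub
      (analyticAt_snd.smul analyticAt_const)
  have hinv : AnalyticAt ℂ (fun z => Ring.inverse (c.qC z)) w := by
    have := analyticAt_inverse (𝕜 := ℂ) (c.isUnit_qC hw).unit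
    exact this.comp_of_eq hq rfl
  have h2 : AnalyticAt ℂ (fun z => c.integralC (c.toC g * Ring.inverse (c.qC z) ^ n)) w :=
    (c.integralC.analyticAt _).comp (analyticAt_const.mul (hinv.pow n))
  refine h2.congr ?_
  filter_upwards [c.isOpen_regularSet.mem_nhds hw] with z hz
  exact (c.period_eq g n hz).symm

/-- Induction on the exponent from the derivative of inversion. Commutativity of the algebra gives
the usual power rule. -/
lemma hasDerivAt_inverse_pow {E : Type*} [NormedCommRing E] [NormedAlgebra ℂ E] [CompleteSpace E]
    {φ : ℂ → E} {φ' : E} {u : ℂ} (h : HasDerivAt φ φ' u) (hu : IsUnit (φ u)) (n : ℕ) :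
    HasDerivAt (fun z => Ring.inverse (φ z) ^ n)
      (-((n : ℂ) • (φ' * Ring.inverse (φ u) ^ (n + 1)))) u := by
  have h1 : HasDerivAt (fun z => Ring.inverse (φ z))
      (-(Ring.inverse (φ u) * φ' * Ring.inverse (φ u))) u := by
    have := (hasFDerivAt_ringInverse (𝕜 := ℂ) hu.unit)
    have h2 := this.comp_hasDerivAt_of_eq u h rfl
    refine h2.congr_deriv ?_
    have e : ((hu.unit⁻¹ : Eˣ) : E) = Ring.inverse (φ u) := by
      rw [← Ring.inverse_unit hu.unit]; rfl
    simp [e]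
  induction n with
  | zero => simpa using hasDerivAt_const u (1 : E)
  | succ n ih =>
    have h3 := ih.mul h1
    refine (h3.congr_deriv ?_).congr_of_eventuallyEq
      (Eventually.of_forall fun z => by simp [pow_succ])
    push_cast
    rw [add_smul, one_smul]
    simp only [Algebra.smul_def]
    ring

/-- The common form of both partial derivatives: `e` is a coordinate line, and `p` is `X` or `Y`,
the polynomial that the chosen parameter multiplies. -/
lemma deriv_period {c : ReducedCurve} (g p : Polynomial ℂ) (n : ℕ) {w : ℂ × ℂ}
    (hw : w ∈ c.regularSet) (e : ℂ → ℂ × ℂ) (he : Continuous e) (u : ℂ) (heu : e u = w)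
    (hd : HasDerivAt (fun z => c.qC (e z)) (-c.toC p) u) :
    deriv (fun z => c.period g n (e z)) u = n * c.period (g * p) (n + 1) w := by
  subst heu
  have h1 := hasDerivAt_inverse_pow hd (c.isUnit_qC hw) n
  have h2 := (c.integralC.hasFDerivAt).comp_hasDerivAt u (h1.const_mul (c.toC g))
  have h3 : deriv (fun z => c.period g n (e z)) u =
      c.integralC (c.toC g * -((n : ℂ) • (-c.toC p * Ring.inverse (c.qC (e u)) ^ (n + 1)))) := by
    refine HasDerivAt.deriv (h2.congr_of_eventuallyEq ?_)
    filter_upwards [he.continuousAt.eventually (c.isOpen_regularSet.mem_nhds hw)] with z hz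
    exact c.period_eq g n hz
  rw [h3, c.period_eq _ _ hw]
  have h4 : c.toC (g * p) = c.toC g * c.toC p := by ext; simp [toC]
  have h5 : c.toC g * -((n : ℂ) • (-c.toC p * Ring.inverse (c.qC (e u)) ^ (n + 1))) =
      (n : ℂ) • (c.toC (g * p) * Ring.inverse (c.qC (e u)) ^ (n + 1)) := by
    rw [h4]
    ext t
    simp
    ring
  rw [h5, map_smul, smul_eq_mul]

lemma partialU_period (c : ReducedCurve) (g : Polynomial ℂ) (n : ℕ) {w : ℂ × ℂ}
    (hw : w ∈ c.regularSet) :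
    partialU (c.period g n) w = n * c.period (g * c.X) (n + 1) w := by
  refine deriv_period g c.X n hw (fun u => (u, w.2)) (by fun_prop) w.1 rfl ?_
  have h := ((hasDerivAt_id w.1).smul_const (c.toC c.X)).const_sub (c.toC c.W)
    |>.sub_const (w.2 • c.toC c.Y)
  simpa [qC] using h

lemma partialV_period (c : ReducedCurve) (g : Polynomial ℂ) (n : ℕ) {w : ℂ × ℂ}
    (hw : w ∈ c.regularSet) :
    partialV (c.period g n) w = n * c.period (g * c.Y) (n + 1) w := by
  refine deriv_period g c.Y n hw (fun u => (w.1, u)) (by fun_prop) w.2 rfl ?_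
  have h := ((hasDerivAt_id w.2).smul_const (c.toC c.Y)).const_sub (c.toC c.W - w.1 • c.toC c.X)
  simpa [qC] using h

end ReducedCurve

/-- Division of `X`, `Y`, `W` by a generator of the ideal they span leaves the points unchanged. The
factor `k` is the reduced denominator at `t`: q is W times Q, and XY' - YX' is W^2 times the Euler
form, so `k ^ 2` cancels in the integrand. -/
lemma RationalArc.exists_reducedCurve (γ : RationalArc) :
    ∃ c : ReducedCurve, c.a = γ.a ∧ c.b = γ.b ∧ ∀ t ∈ Icc γ.a γ.b, ∃ k : ℂ, k ≠ 0 ∧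
      (∀ w, (c.q w).eval (t : ℂ) = k * Q w (γ.point t)) ∧
      c.N.eval (t : ℂ) = k ^ 2 * ((γ.x t * deriv γ.y t - γ.y t * deriv γ.x t : ℝ) : ℂ) := by
  obtain ⟨G, hG⟩ := (IsPrincipalIdealRing.principal (Ideal.span {γ.X, γ.Y, γ.W})).principal
  have hmem : ∀ p ∈ ({γ.X, γ.Y, γ.W} : Set (Polynomial ℝ)), ∃ p₀, p = G * p₀ := by
    intro p hp
    have : p ∈ Ideal.span {γ.X, γ.Y, γ.W} := Ideal.subset_span hp
    rw [hG, Ideal.submodule_span_eq, Ideal.mem_span_singleton'] at this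
    obtain ⟨a, ha⟩ := this
    exact ⟨a, by rw [← ha, mul_comm]⟩
  obtain ⟨X, hX⟩ := hmem γ.X (by simp)
  obtain ⟨Y, hY⟩ := hmem γ.Y (by simp)
  obtain ⟨W, hW⟩ := hmem γ.W (by simp)
  have hGmem : G ∈ Ideal.span {γ.X, γ.Y, γ.W} := by
    rw [hG]; exact Submodule.mem_span_singleton_self G
  obtain ⟨A, B, C, hABC⟩ : ∃ A B C, A * γ.X + B * γ.Y + C * γ.W = G := by
    rw [Ideal.mem_span_insert] at hGmem
    obtain ⟨A, z, hz, h⟩ := hGmem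
    rw [Ideal.mem_span_insert] at hz
    obtain ⟨B, z', hz', h'⟩ := hz
    rw [Ideal.mem_span_singleton'] at hz'
    obtain ⟨C, hC⟩ := hz'
    exact ⟨A, B, C, by rw [h, h', ← hC]; ring⟩
  have hWt : ∀ t ∈ Icc γ.a γ.b, G.eval t ≠ 0 ∧ W.eval t ≠ 0 := by
    intro t ht
    have := γ.W_ne_zero t ht
    rw [hW, Polynomial.eval_mul] at this
    exact mul_ne_zero_iff.1 this
  have hG0 : G ≠ 0 := by
    rintro rfl
    exact (hWt γ.a (left_mem_Icc.2 γ.a_lt_b.le)).1 (by simp)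
  -- The Bézout identity for the generator, divided by the generator.
  have hbez : A * X + B * Y + C * W = 1 := by
    have : G * (A * X + B * Y + C * W) = G * 1 := by
      rw [mul_one, ← hABC]
      conv_rhs => rw [hX, hY, hW]
      rw [hABC]
      ring
    exact mul_left_cancel₀ hG0 this
  have hev : ∀ (p : Polynomial ℝ) (t : ℝ),
      (p.map Complex.ofRealHom).eval (t : ℂ) = ((p.eval t : ℝ) : ℂ) := fun p t => by
    rw [Polynomial.eval_map]
    exact Polynomial.eval₂_at_apply Complex.ofRealHom t
  refine ⟨⟨X.map Complex.ofRealHom, Y.map Complex.ofRealHom, W.map Complex.ofRealHom, γ.a, γ.b,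
    γ.a_lt_b, ⟨A.map Complex.ofRealHom, B.map Complex.ofRealHom, C.map Complex.ofRealHom, ?_⟩,
    ?_, ?_⟩, rfl, rfl, ?_⟩
  · simp only [← Polynomial.map_mul, ← Polynomial.map_add, hbez, Polynomial.map_one]
  · rw [hev]
    exact_mod_cast (hWt _ (left_mem_Icc.2 γ.a_lt_b.le)).2
  · rw [hev]
    exact_mod_cast (hWt _ (right_mem_Icc.2 γ.a_lt_b.le)).2
  · intro t ht
    obtain ⟨h1, h2⟩ := hWt t ht
    refine ⟨((W.eval t : ℝ) : ℂ), by exact_mod_cast h2, fun w => ?_, ?_⟩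
    · have hx : γ.x t = X.eval t / W.eval t := by
        rw [RationalArc.x, hX, hW, Polynomial.eval_mul, Polynomial.eval_mul,
          mul_div_mul_left _ _ h1]
      have hy : γ.y t = Y.eval t / W.eval t := by
        rw [RationalArc.y, hY, hW, Polynomial.eval_mul, Polynomial.eval_mul,
          mul_div_mul_left _ _ h1]
      have h2' : ((W.eval t : ℝ) : ℂ) ≠ 0 := by exact_mod_cast h2
      rw [ReducedCurve.eval_q, Q, RationalArc.point, hx, hy]
      simp only [hev]
      push_cast
      field_simp
    · simp only [ReducedCurve.N, Polynomial.derivative_map, Polynomial.eval_sub,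
        Polynomial.eval_mul, hev]
      rw [γ.deriv_x ht, γ.deriv_y ht, RationalArc.x, RationalArc.y]
      simp only [hX, hY, hW, Polynomial.derivative_mul, Polynomial.eval_mul, Polynomial.eval_add]
      norm_cast
      field_simp
      ring

/-- The transform is a combination of parameter integrals. -/
lemma ArcBoundary.exists_fantappie_eq_sum_period {ι : Type*} [Fintype ι] {P : Set (ℝ × ℝ)}
    {γ : ι → RationalArc} {l r : ι → ℤ} (hP : ArcBoundary P γ)
    (hl : ∀ j, ∀ t ∈ Ioo (γ j).a (γ j).b, SideValue P (γ j) 1 t (l j))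
    (hr : ∀ j, ∀ t ∈ Ioo (γ j).a (γ j).b, SideValue P (γ j) (-1) t (r j)) :
    ∃ c : ι → ReducedCurve, (∀ j, params P ⊆ (c j).regularSet) ∧
      ∀ w ∈ params P, fantappie P w =
        ∑ j, ((l j - r j : ℤ) : ℂ) * (c j).period (c j).N 2 w := by
  choose c ha hb hk using fun j => (γ j).exists_reducedCurve
  refine ⟨c, fun j w hw t ht => ?_, fun w hw => ?_⟩
  · rw [ha, hb] at ht
    obtain ⟨k, hk0, hkq, _⟩ := hk j t ht
    rw [hkq]
    exact mul_ne_zero hk0 (hw _ (hP.point_mem_closure j ht))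
  · rw [hP.fantappie_eq_sum hl hr hw]
    refine Finset.sum_congr rfl fun j _ => ?_
    rw [ReducedCurve.period, ha, hb]
    congr 1
    refine intervalIntegral.integral_congr fun t ht => ?_
    rw [uIcc_of_le (γ j).a_lt_b.le] at ht
    obtain ⟨k, hk0, hkq, hkN⟩ := hk j t ht
    simp only [hkq, hkN, mul_pow]
    rw [mul_div_mul_left _ _ (pow_ne_zero 2 hk0)]

/-! ### Polynomials in the parameters and the variable of integration -/

/-- Specialization of the parameters `u`, `v` in a polynomial in `u`, `v`, `t`. -/
def specialize (w : ℂ × ℂ) : MvPolynomial (Fin 3) ℂ →ₐ[ℂ] Polynomial ℂ :=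
  MvPolynomial.aeval ![Polynomial.C w.1, Polynomial.C w.2, Polynomial.X]

/-- A polynomial in `t` as a polynomial in `u`, `v`, `t`. -/
def liftPoly : Polynomial ℂ →ₐ[ℂ] MvPolynomial (Fin 3) ℂ :=
  Polynomial.aeval (MvPolynomial.X 2)

lemma specialize_liftPoly (w : ℂ × ℂ) (p : Polynomial ℂ) : specialize w (liftPoly p) = p := by
  have : (specialize w).comp liftPoly = AlgHom.id ℂ _ := by
    ext; simp [specialize, liftPoly]
  exact congrArg (fun f : Polynomial ℂ →ₐ[ℂ] Polynomial ℂ => f p) this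

lemma eval_specialize (w : ℂ × ℂ) (t : ℂ) (p : MvPolynomial (Fin 3) ℂ) :
    (specialize w p).eval t = MvPolynomial.eval ![w.1, w.2, t] p := by
  have : (Polynomial.aeval t).comp (specialize w) = MvPolynomial.aeval ![w.1, w.2, t] := by
    ext i; fin_cases i <;> simp [specialize]
  have h := congrArg (fun f : MvPolynomial (Fin 3) ℂ →ₐ[ℂ] ℂ => f p) this
  simpa [Polynomial.coe_aeval_eq_eval, MvPolynomial.coe_aeval_eq_eval] using h

lemma derivative_specialize (w : ℂ × ℂ) (p : MvPolynomial (Fin 3) ℂ) :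
    (specialize w p).derivative = specialize w (MvPolynomial.pderiv 2 p) := by
  induction p using MvPolynomial.induction_on with
  | C a => simp [specialize]
  | add p q hp hq => simp [hp, hq]
  | mul_X p i hp =>
    have hX : (specialize w (MvPolynomial.X i)).derivative =
        specialize w (MvPolynomial.pderiv 2 (MvPolynomial.X i)) := by
      fin_cases i <;> simp [specialize, MvPolynomial.pderiv_X]
    rw [map_mul, Polynomial.derivative_mul, hp, hX, MvPolynomial.pderiv_mul, map_add, map_mul,
      map_mul]

lemma totalDegree_liftPoly_le (p : Polynomial ℂ) : (liftPoly p).totalDegree ≤ p.natDegree := by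
  rw [liftPoly, Polynomial.aeval_eq_sum_range]
  refine (MvPolynomial.totalDegree_finsetSum _ _).trans (Finset.sup_le fun i hi => ?_)
  refine (MvPolynomial.totalDegree_smul_le _ _).trans ?_
  refine (MvPolynomial.totalDegree_pow _ _).trans ?_
  rw [MvPolynomial.totalDegree_X, mul_one]
  exact Finset.mem_range_succ_iff.1 hi

lemma totalDegree_pderiv_le {σ R : Type*} [CommSemiring R] (i : σ) (p : MvPolynomial σ R) :
    (MvPolynomial.pderiv i p).totalDegree ≤ p.totalDegree := by
  classical
  refine Finset.sup_le fun m hm => ?_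
  rw [MvPolynomial.mem_support_iff, MvPolynomial.coeff_pderiv] at hm
  have hm' : m + Finsupp.single i 1 ∈ p.support :=
    MvPolynomial.mem_support_iff.2 (left_ne_zero_of_mul hm)
  have := MvPolynomial.le_totalDegree hm'
  refine le_trans ?_ this
  rw [Finsupp.sum_add_index' (fun _ => rfl) (fun _ _ _ => rfl)]
  exact Nat.le_add_right _ _

/-- The number of monomials in three variables with degree in a window grows quadratically. -/
lemma finrank_restrictTotalDegree_le (N c : ℕ) :
    Module.finrank ℂ (MvPolynomial.restrictTotalDegree (Fin 3) ℂ (N + c)) ≤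
      Module.finrank ℂ (MvPolynomial.restrictTotalDegree (Fin 3) ℂ N) +
        c * (N + c + 1) ^ 2 := by
  classical
  -- A monomial is determined by its total degree, one of `c` values, and its first two exponents,
  -- each at most `N + c`.
  set T : Finset (Fin 3 →₀ ℕ) := ((Finset.Ioc N (N + c)) ×ˢ
    (Finset.range (N + c + 1) ×ˢ Finset.range (N + c + 1))).image
    (fun x => Finsupp.equivFunOnFinite.symm ![x.2.1, x.2.2, x.1 - x.2.1 - x.2.2]) with hT
  have hTcard : T.card ≤ c * (N + c + 1) ^ 2 := by
    refine Finset.card_image_le.trans ?_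
    simp [Finset.card_product]
    ring_nf
    exact le_rfl
  set S : Finset (MvPolynomial (Fin 3) ℂ) := T.image fun s => MvPolynomial.monomial s 1 with hS
  have hsub : MvPolynomial.restrictTotalDegree (Fin 3) ℂ (N + c) ≤
      MvPolynomial.restrictTotalDegree (Fin 3) ℂ N ⊔ Submodule.span ℂ (S : Set _) := by
    intro p hp
    rw [MvPolynomial.mem_restrictTotalDegree] at hp
    rw [p.as_sum]
    refine Submodule.sum_mem _ fun s hs => ?_
    have hdeg : s.sum (fun _ e => e) ≤ N + c := (MvPolynomial.le_totalDegree hs).trans hp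
    by_cases hN : s.sum (fun _ e => e) ≤ N
    · refine Submodule.mem_sup_left ?_
      rw [MvPolynomial.mem_restrictTotalDegree]
      exact (MvPolynomial.totalDegree_monomial_le _ _).trans hN
    · refine Submodule.mem_sup_right ?_
      have hsum : s.sum (fun _ e => e) = s 0 + s 1 + s 2 := by
        rw [Finsupp.sum_fintype _ _ (fun _ => rfl), Fin.sum_univ_three]
      have hsT : s ∈ T := by
        rw [hT, Finset.mem_image]
        refine ⟨(s 0 + s 1 + s 2, s 0, s 1), ?_, ?_⟩
        · simp only [Finset.mem_product, Finset.mem_Ioc, Finset.mem_range]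
          omega
        · ext i
          fin_cases i <;> simp
          omega
      have : MvPolynomial.monomial s (MvPolynomial.coeff s p) =
          MvPolynomial.coeff s p • MvPolynomial.monomial s (1 : ℂ) := by
        rw [MvPolynomial.smul_monomial, smul_eq_mul, mul_one]
      rw [this]
      exact Submodule.smul_mem _ _ (Submodule.subset_span
        (Finset.mem_coe.2 (Finset.mem_image_of_mem _ hsT)))
  refine (Submodule.finrank_mono hsub).trans ?_
  refine (Submodule.finrank_add_le_finrank_add_finrank _ _).trans ?_
  refine Nat.add_le_add_left ?_ _
  exact (finrank_span_finset_le_card S).trans (Finset.card_image_le.trans hTcard)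

/-! ### Integrals with polynomial numerators modulo exact forms -/

namespace ReducedCurve

/-- `W - u X - v Y` as a polynomial in three variables. -/
def qMv (c : ReducedCurve) : MvPolynomial (Fin 3) ℂ :=
  liftPoly c.W - MvPolynomial.X 0 * liftPoly c.X - MvPolynomial.X 1 * liftPoly c.Y

lemma specialize_qMv (c : ReducedCurve) (w : ℂ × ℂ) : specialize w c.qMv = c.q w := by
  simp only [qMv, map_sub, map_mul, specialize_liftPoly, q]
  simp [specialize]

/-- A bound for the degree of `W - u X - v Y`. -/
def degBound (c : ReducedCurve) : ℕ :=
  -- The 1 accounts for the factor u or v in front of `X` or `Y`.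
  c.X.natDegree + c.Y.natDegree + c.W.natDegree + 1

lemma totalDegree_qMv_le (c : ReducedCurve) : c.qMv.totalDegree ≤ c.degBound := by
  have hX := totalDegree_liftPoly_le c.X
  have hY := totalDegree_liftPoly_le c.Y
  have hW := totalDegree_liftPoly_le c.W
  have h1 := MvPolynomial.totalDegree_mul (MvPolynomial.X (R := ℂ) (0 : Fin 3)) (liftPoly c.X)
  have h2 := MvPolynomial.totalDegree_mul (MvPolynomial.X (R := ℂ) (1 : Fin 3)) (liftPoly c.Y)
  rw [MvPolynomial.totalDegree_X] at h1 h2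
  refine (MvPolynomial.totalDegree_sub _ _).trans (max_le ?_ ?_)
  · refine (MvPolynomial.totalDegree_sub _ _).trans (max_le ?_ ?_) <;> unfold degBound <;> omega
  · unfold degBound; omega

lemma intervalIntegrable_div (c : ReducedCurve) (p : Polynomial ℂ) (n : ℕ) {w : ℂ × ℂ}
    (hw : w ∈ c.regularSet) :
    IntervalIntegrable (fun t : ℝ => p.eval (t : ℂ) / (c.q w).eval (t : ℂ) ^ n) volume c.a c.b := by
  refine ContinuousOn.intervalIntegrable_of_Icc c.a_lt_b.le ?_
  exact ContinuousOn.div (by fun_prop) (by fun_prop) fun t ht => pow_ne_zero n (hw t ht)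

/-- The germ at `z` of `∫ p / (W - u X - v Y)^n dt`, for polynomials `p` in `u`, `v`, `t`. -/
def germInt (c : ReducedCurve) {z : ℂ × ℂ} (hz : z ∈ c.regularSet) (n : ℕ) :
    MvPolynomial (Fin 3) ℂ →ₗ[ℂ] Germ (𝓝 z) ℂ where
  toFun p := ((fun w => c.period (specialize w p) n w : ℂ × ℂ → ℂ) : Germ (𝓝 z) ℂ)
  map_add' p r := by
    rw [← Germ.coe_add]
    refine Germ.coe_eq.2 ?_
    filter_upwards [c.isOpen_regularSet.mem_nhds hz] with w hw
    simp only [period, map_add, Polynomial.eval_add, add_div, Pi.add_apply]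
    exact intervalIntegral.integral_add (c.intervalIntegrable_div _ n hw)
      (c.intervalIntegrable_div _ n hw)
  map_smul' k p := by
    rw [RingHom.id_apply, ← Germ.coe_smul]
    refine Germ.coe_eq.2 (Eventually.of_forall fun w => ?_)
    simp only [period, map_smul, Polynomial.eval_smul, smul_eq_mul, mul_div_assoc, Pi.smul_apply]
    exact intervalIntegral.integral_const_mul _ _

/-- The numerator of the derivative of `(t - a) (t - b) p / (W - u X - v Y)^n`. -/
def exactForm (c : ReducedCurve) (n : ℕ) :
    MvPolynomial (Fin 3) ℂ →ₗ[ℂ] MvPolynomial (Fin 3) ℂ :=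
  let B : MvPolynomial (Fin 3) ℂ :=
    (MvPolynomial.X 2 - MvPolynomial.C (c.a : ℂ)) * (MvPolynomial.X 2 - MvPolynomial.C (c.b : ℂ))
  (LinearMap.mulRight ℂ c.qMv ∘ₗ (MvPolynomial.pderiv (R := ℂ) (2 : Fin 3)).toLinearMap -
    (n : ℂ) • LinearMap.mulRight ℂ (MvPolynomial.pderiv 2 c.qMv)) ∘ₗ LinearMap.mulLeft ℂ B

lemma exactForm_apply (c : ReducedCurve) (n : ℕ) (p : MvPolynomial (Fin 3) ℂ) :
    c.exactForm n p =
      MvPolynomial.pderiv 2 ((MvPolynomial.X 2 - MvPolynomial.C (c.a : ℂ)) *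
        (MvPolynomial.X 2 - MvPolynomial.C (c.b : ℂ)) * p) * c.qMv -
      (n : ℂ) • (((MvPolynomial.X 2 - MvPolynomial.C (c.a : ℂ)) *
        (MvPolynomial.X 2 - MvPolynomial.C (c.b : ℂ)) * p) * MvPolynomial.pderiv 2 c.qMv) := rfl

lemma specialize_boundary (c : ReducedCurve) (p : MvPolynomial (Fin 3) ℂ) (w : ℂ × ℂ) (t : ℂ) :
    (specialize w ((MvPolynomial.X 2 - MvPolynomial.C (c.a : ℂ)) *
        (MvPolynomial.X 2 - MvPolynomial.C (c.b : ℂ)) * p)).eval t =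
      (t - c.a) * (t - c.b) * (specialize w p).eval t := by
  simp [specialize]

lemma hasDerivAt_exactForm (c : ReducedCurve) (n : ℕ) (p : MvPolynomial (Fin 3) ℂ) {w : ℂ × ℂ}
    (t : ℝ) (ht : (c.q w).eval (t : ℂ) ≠ 0) :
    HasDerivAt (fun s : ℝ => ((s : ℂ) - c.a) * ((s : ℂ) - c.b) * (specialize w p).eval (s : ℂ) /
        (c.q w).eval (s : ℂ) ^ n)
      ((specialize w (c.exactForm n p)).eval (t : ℂ) / (c.q w).eval (t : ℂ) ^ (n + 1)) t := by
  obtain ⟨B, hB⟩ : ∃ B : MvPolynomial (Fin 3) ℂ, B = (MvPolynomial.X 2 -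
    MvPolynomial.C (c.a : ℂ)) * (MvPolynomial.X 2 - MvPolynomial.C (c.b : ℂ)) * p := ⟨_, rfl⟩
  have h1 := ((specialize w B).hasDerivAt (t : ℂ)).comp_ofReal
  have h2 := ((c.q w).hasDerivAt (t : ℂ)).comp_ofReal
  have h3 := h1.div (h2.pow n) (pow_ne_zero n ht)
  have hfun : (fun s : ℝ => ((s : ℂ) - c.a) * ((s : ℂ) - c.b) * (specialize w p).eval (s : ℂ) /
        (c.q w).eval (s : ℂ) ^ n) = fun s : ℝ => (specialize w B).eval (s : ℂ) /
        (c.q w).eval (s : ℂ) ^ n := by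
    ext s; rw [hB, specialize_boundary]
  rw [hfun]
  refine h3.congr_deriv ?_
  rw [exactForm_apply, ← hB, map_sub, map_mul, map_smul, map_mul, specialize_qMv,
    ← derivative_specialize, ← derivative_specialize, specialize_qMv]
  simp only [Polynomial.eval_sub, Polynomial.eval_mul, Polynomial.eval_smul, smul_eq_mul,
    Pi.pow_apply]
  rcases n with _ | n
  · simp
    field_simp
  · simp only [Nat.add_sub_cancel]
    field_simp
    ring

/-- The factor (t - a)(t - b) makes the primitive vanish at both ends of the interval. -/
lemma germInt_exactForm (c : ReducedCurve) {z : ℂ × ℂ} (hz : z ∈ c.regularSet) (n : ℕ)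
    (p : MvPolynomial (Fin 3) ℂ) : c.germInt hz (n + 1) (c.exactForm n p) = 0 := by
  change ((fun w => c.period (specialize w (c.exactForm n p)) (n + 1) w : ℂ × ℂ → ℂ) :
    Germ (𝓝 z) ℂ) = ((0 : ℂ × ℂ → ℂ) : Germ (𝓝 z) ℂ)
  refine Germ.coe_eq.2 ?_
  filter_upwards [c.isOpen_regularSet.mem_nhds hz] with w hw
  rw [period, intervalIntegral.integral_eq_sub_of_hasDerivAt
    (f := fun s : ℝ => ((s : ℂ) - c.a) * ((s : ℂ) - c.b) * (specialize w p).eval (s : ℂ) /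
        (c.q w).eval (s : ℂ) ^ n) _ (c.intervalIntegrable_div _ _ hw)]
  · simp
  · intro t ht
    rw [uIcc_of_le c.a_lt_b.le] at ht
    exact c.hasDerivAt_exactForm n p t (hw t ht)

/-- If the derivative vanishes, then the primitive is constant along the interval, and it is zero at
`a`. Hence each specialization of `p` at a regular parameter has infinitely many roots, and `p`
vanishes on an open set of parameters. -/
lemma exactForm_injective (c : ReducedCurve) {z : ℂ × ℂ} (hz : z ∈ c.regularSet) (n : ℕ) :
    Function.Injective (c.exactForm n) := by
  rw [← LinearMap.ker_eq_bot, LinearMap.ker_eq_bot']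
  intro p hp
  have hvan : ∀ w ∈ c.regularSet, specialize w p = 0 := by
    intro w hw
    have hconst : ∀ t ∈ Icc c.a c.b, ((t : ℂ) - c.a) * ((t : ℂ) - c.b) *
        (specialize w p).eval (t : ℂ) / (c.q w).eval (t : ℂ) ^ n = 0 := by
      intro t ht
      have hder : ∀ s ∈ uIcc c.a t, HasDerivAt (fun s : ℝ => ((s : ℂ) - c.a) * ((s : ℂ) - c.b) *
          (specialize w p).eval (s : ℂ) / (c.q w).eval (s : ℂ) ^ n) 0 s := by
        intro s hs
        rw [uIcc_of_le ht.1] at hs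
        have := c.hasDerivAt_exactForm n p s (hw s ⟨hs.1, hs.2.trans ht.2⟩)
        simpa [hp] using this
      have h := intervalIntegral.integral_eq_sub_of_hasDerivAt hder (by simp)
      simpa using h.symm
    refine Polynomial.eq_zero_of_infinite_isRoot _ (Set.Infinite.mono (s := Complex.ofReal '' Ioo c.a c.b) ?_
      ((Ioo_infinite c.a_lt_b).image Complex.ofReal_injective.injOn))
    rintro _ ⟨t, ht, rfl⟩
    have h := hconst t (Ioo_subset_Icc_self ht)
    rw [div_eq_zero_iff] at h
    have h' := h.resolve_right (pow_ne_zero n (hw t (Ioo_subset_Icc_self ht)))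
    refine (mul_eq_zero.1 h').resolve_left (mul_ne_zero ?_ ?_)
    · rw [sub_ne_zero]; exact_mod_cast ht.1.ne'
    · rw [sub_ne_zero]; exact_mod_cast ht.2.ne
  obtain ⟨ε, hε, hball⟩ := Metric.isOpen_iff.1 c.isOpen_regularSet z hz
  have hinf : ∀ x : ℂ, (Metric.ball x ε).Infinite := fun x =>
    infinite_of_mem_nhds x (Metric.ball_mem_nhds x hε)
  -- A polynomial that vanishes on a product of infinite sets is zero; two factors are disks of
  -- regular parameters, the third is the whole t-line.
  refine MvPolynomial.funext_set ![Metric.ball z.1 ε, Metric.ball z.2 ε, univ] ?_ ?_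
  · intro i
    fin_cases i
    · exact hinf _
    · exact hinf _
    · exact infinite_univ
  · intro x hx
    have h0 : x 0 ∈ Metric.ball z.1 ε := hx 0 trivial
    have h1 : x 1 ∈ Metric.ball z.2 ε := hx 1 trivial
    have hw : (x 0, x 1) ∈ c.regularSet := by
      refine hball ?_
      rw [← ball_prod_same]
      exact ⟨h0, h1⟩
    have hx3 : x = ![x 0, x 1, x 2] := by ext i; fin_cases i <;> rfl
    have := eval_specialize (x 0, x 1) (x 2) p
    rw [hvan _ hw] at this
    rw [hx3, ← this]
    simp

/-- The factor (t - a)(t - b) contributes 2 to the degree, and q or its derivative contributes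
`degBound`. -/
lemma exactForm_mem (c : ReducedCurve) (n N : ℕ) {p : MvPolynomial (Fin 3) ℂ}
    (hp : p ∈ MvPolynomial.restrictTotalDegree (Fin 3) ℂ N) :
    c.exactForm n p ∈ MvPolynomial.restrictTotalDegree (Fin 3) ℂ (N + (2 + c.degBound)) := by
  rw [MvPolynomial.mem_restrictTotalDegree] at hp ⊢
  have hlin : ∀ k : ℂ, (MvPolynomial.X (2 : Fin 3) - MvPolynomial.C k).totalDegree ≤ 1 := fun k =>
    (MvPolynomial.totalDegree_sub _ _).trans (by simp)
  obtain ⟨B, hB⟩ : ∃ B : MvPolynomial (Fin 3) ℂ, B = (MvPolynomial.X 2 -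
    MvPolynomial.C (c.a : ℂ)) * (MvPolynomial.X 2 - MvPolynomial.C (c.b : ℂ)) * p := ⟨_, rfl⟩
  have hBd : B.totalDegree ≤ N + 2 := by
    have h1 := MvPolynomial.totalDegree_mul (MvPolynomial.X (2 : Fin 3) - MvPolynomial.C (c.a : ℂ))
      (MvPolynomial.X (2 : Fin 3) - MvPolynomial.C (c.b : ℂ))
    have h2 := MvPolynomial.totalDegree_mul ((MvPolynomial.X (2 : Fin 3) - MvPolynomial.C (c.a : ℂ)) *
      (MvPolynomial.X (2 : Fin 3) - MvPolynomial.C (c.b : ℂ))) p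
    have := hlin c.a
    have := hlin c.b
    rw [hB]
    omega
  rw [exactForm_apply, ← hB]
  have hq := c.totalDegree_qMv_le
  refine (MvPolynomial.totalDegree_sub _ _).trans (max_le ?_ ?_)
  · have h1 := MvPolynomial.totalDegree_mul (MvPolynomial.pderiv 2 B) c.qMv
    have h2 := totalDegree_pderiv_le 2 B
    omega
  · have h0 := MvPolynomial.totalDegree_smul_le (n : ℂ) (B * MvPolynomial.pderiv 2 c.qMv)
    have h1 := MvPolynomial.totalDegree_mul B (MvPolynomial.pderiv 2 c.qMv)
    have h2 := totalDegree_pderiv_le 2 c.qMv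
    omega

/-- The integrals with numerators of bounded degree span a space of quadratically growing
dimension. -/
lemma finrank_map_germInt_le (c : ReducedCurve) {z : ℂ × ℂ} (hz : z ∈ c.regularSet) (n N : ℕ) :
    Module.finrank ℂ ((MvPolynomial.restrictTotalDegree (Fin 3) ℂ
      (N + (2 + c.degBound))).map (c.germInt hz (n + 1))) ≤
      (2 + c.degBound) * (N + (2 + c.degBound) + 1) ^ 2 := by
  set V := MvPolynomial.restrictTotalDegree (Fin 3) ℂ (N + (2 + c.degBound)) with hV
  set V' := MvPolynomial.restrictTotalDegree (Fin 3) ℂ N with hV'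
  set J := (c.germInt hz (n + 1)).domRestrict V with hJ
  let D : V' →ₗ[ℂ] V :=
    ((c.exactForm n).domRestrict V').codRestrict V (fun p => by
      rw [LinearMap.domRestrict_apply]
      exact c.exactForm_mem n N p.2)
  have hD : Function.Injective D := by
    intro p p' h
    have : c.exactForm n p = c.exactForm n p' := congrArg Subtype.val h
    exact Subtype.ext (c.exactForm_injective hz n this)
  have hker : LinearMap.range D ≤ LinearMap.ker J := by
    rintro _ ⟨p, rfl⟩
    rw [LinearMap.mem_ker, hJ, LinearMap.domRestrict_apply, LinearMap.codRestrict_apply,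
      LinearMap.domRestrict_apply]
    exact c.germInt_exactForm hz n p
  -- By rank and nullity, the image of `V` has dimension at most dim V - dim V', which is the number
  -- of monomials with degree in a window of fixed width.
  have h1 := Submodule.finrank_mono hker
  rw [LinearMap.finrank_range_of_inj hD] at h1
  have h2 := LinearMap.finrank_range_add_finrank_ker J
  have h3 := finrank_restrictTotalDegree_le N (2 + c.degBound)
  rw [← hV, ← hV'] at h3
  have h4 : LinearMap.range J = V.map (c.germInt hz (n + 1)) := by
    rw [hJ, LinearMap.range_domRestrict]
  rw [← h4]
  omega

end ReducedCurve

/-! ### Holonomicity -/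

lemma partialU_congr {f g : ℂ × ℂ → ℂ} {U : Set (ℂ × ℂ)} (hU : IsOpen U) (h : EqOn f g U) :
    EqOn (partialU f) (partialU g) U := by
  intro w hw
  refine Filter.EventuallyEq.deriv_eq ?_
  have hc : ContinuousAt (fun u : ℂ => (u, w.2)) w.1 := by fun_prop
  filter_upwards [hc.eventually (hU.mem_nhds hw)] with u hu
  exact h hu

lemma partialV_congr {f g : ℂ × ℂ → ℂ} {U : Set (ℂ × ℂ)} (hU : IsOpen U) (h : EqOn f g U) :
    EqOn (partialV f) (partialV g) U := by
  intro w hw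
  refine Filter.EventuallyEq.deriv_eq ?_
  have hc : ContinuousAt (fun u : ℂ => (w.1, u)) w.2 := by fun_prop
  filter_upwards [hc.eventually (hU.mem_nhds hw)] with u hu
  exact h hu

lemma _root_.AnalyticAt.hasDerivAt_fst {f : ℂ × ℂ → ℂ} {w : ℂ × ℂ} (h : AnalyticAt ℂ f w) :
    HasDerivAt (fun u => f (u, w.2)) (fderiv ℂ f w (1, 0)) w.1 :=
  h.differentiableAt.hasFDerivAt.comp_hasDerivAt w.1
    ((hasDerivAt_id w.1).prodMk (hasDerivAt_const w.1 w.2))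

lemma _root_.AnalyticAt.hasDerivAt_snd {f : ℂ × ℂ → ℂ} {w : ℂ × ℂ} (h : AnalyticAt ℂ f w) :
    HasDerivAt (fun u => f (w.1, u)) (fderiv ℂ f w (0, 1)) w.2 :=
  h.differentiableAt.hasFDerivAt.comp_hasDerivAt w.2
    ((hasDerivAt_const w.2 w.1).prodMk (hasDerivAt_id w.2))

section SumOfPeriods

variable {ι : Type*} [Fintype ι] (c : ι → ReducedCurve) (m : ι → ℂ)

lemma partialU_sum_period (n : ℕ) (g : ι → Polynomial ℂ) {w : ℂ × ℂ}
    (hw : ∀ j, w ∈ (c j).regularSet) :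
    partialU (fun w => ∑ j, m j * (c j).period (g j) n w) w =
      n * ∑ j, m j * (c j).period (g j * (c j).X) (n + 1) w := by
  have h : HasDerivAt (fun u => ∑ j, m j * (c j).period (g j) n (u, w.2))
      (∑ j, m j * (n * (c j).period (g j * (c j).X) (n + 1) w)) w.1 := by
    refine HasDerivAt.fun_sum fun j _ => ?_
    refine HasDerivAt.const_mul _ ?_
    rw [← (c j).partialU_period _ _ (hw j)]
    exact ((c j).analyticAt_period _ _ (hw j)).hasDerivAt_fst.differentiableAt.hasDerivAt
  rw [partialU, h.deriv, Finset.mul_sum]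
  exact Finset.sum_congr rfl fun j _ => by ring

lemma partialV_sum_period (n : ℕ) (g : ι → Polynomial ℂ) {w : ℂ × ℂ}
    (hw : ∀ j, w ∈ (c j).regularSet) :
    partialV (fun w => ∑ j, m j * (c j).period (g j) n w) w =
      n * ∑ j, m j * (c j).period (g j * (c j).Y) (n + 1) w := by
  have h : HasDerivAt (fun u => ∑ j, m j * (c j).period (g j) n (w.1, u))
      (∑ j, m j * (n * (c j).period (g j * (c j).Y) (n + 1) w)) w.2 := by
    refine HasDerivAt.fun_sum fun j _ => ?_
    refine HasDerivAt.const_mul _ ?_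
    rw [← (c j).partialV_period _ _ (hw j)]
    exact ((c j).analyticAt_period _ _ (hw j)).hasDerivAt_snd.differentiableAt.hasDerivAt
  rw [partialV, h.deriv, Finset.mul_sum]
  exact Finset.sum_congr rfl fun j _ => by ring

/-- Each derivative raises the pole order by one and multiplies the numerator by `X` or `Y`. The
constant `K` collects the pole orders and is the same for all arcs, so the sum over arcs keeps its
shape. -/
lemma iterate_partial_sum_period {F : ℂ × ℂ → ℂ} {U : Set (ℂ × ℂ)} (hU : IsOpen U)
    (hUc : ∀ j, U ⊆ (c j).regularSet)
    (hF : ∀ w ∈ U, F w = ∑ j, m j * (c j).period (c j).N 2 w) (i k : ℕ) :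
    ∃ K : ℂ, ∀ w ∈ U, (partialU^[i] (partialV^[k] F)) w =
      ∑ j, K * m j * (c j).period ((c j).N * (c j).X ^ i * (c j).Y ^ k) (2 + i + k) w := by
  induction i with
  | zero =>
    induction k with
    | zero => exact ⟨1, fun w hw => by simpa using hF w hw⟩
    | succ k ih =>
      obtain ⟨K, hK⟩ := ih
      refine ⟨K * (2 + k : ℕ), fun w hw => ?_⟩
      simp only [Function.iterate_zero, id_eq] at hK ⊢
      rw [Function.iterate_succ_apply', partialV_congr hU hK hw,
        partialV_sum_period c (fun j => K * m j) _ _ fun j => hUc j hw, Finset.mul_sum]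
      refine Finset.sum_congr rfl fun j _ => ?_
      rw [show 2 + 0 + (k + 1) = 2 + 0 + k + 1 by ring, pow_succ, ← mul_assoc (_ * _) _ (c j).Y]
      push_cast
      ring
  | succ i ih =>
    obtain ⟨K, hK⟩ := ih
    refine ⟨K * (2 + i + k : ℕ), fun w hw => ?_⟩
    rw [Function.iterate_succ_apply', partialU_congr hU hK hw,
      partialU_sum_period c (fun j => K * m j) _ _ fun j => hUc j hw, Finset.mul_sum]
    refine Finset.sum_congr rfl fun j _ => ?_
    rw [show 2 + (i + 1) + k = 2 + i + k + 1 by ring, pow_succ,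
      show (c j).N * ((c j).X ^ i * (c j).X) * (c j).Y ^ k =
        (c j).N * (c j).X ^ i * (c j).Y ^ k * (c j).X by ring]
    push_cast
    ring

lemma finrank_finset_sup_le {V : Type*} [AddCommGroup V] [Module ℂ V] {κ : Type*} (s : Finset κ)
    (S : κ → Submodule ℂ V) (hS : ∀ j, Module.Finite ℂ (S j)) :
    Module.Finite ℂ (s.sup S : Submodule ℂ V) ∧
      Module.finrank ℂ (s.sup S : Submodule ℂ V) ≤ ∑ j ∈ s, Module.finrank ℂ (S j) := by
  classical
  induction s using Finset.induction_on with
  | empty =>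
    have h : (∅ : Finset κ).sup S = ⊥ := Finset.sup_empty
    rw [h, finrank_bot]
    exact ⟨inferInstance, Nat.zero_le _⟩
  | insert j s hj ih =>
    obtain ⟨h1, h2⟩ := ih
    have := hS j
    rw [Finset.sup_insert, Finset.sum_insert hj]
    exact ⟨inferInstance, (Submodule.finrank_add_le_finrank_add_finrank _ _).trans (by omega)⟩

/-- Over the common denominator q^(k+2) every generator of the k-th filtration step is a sum of
integrals whose numerators have degree linear in k; these span a space of quadratically growing
dimension. -/
lemma isHolonomicAt_sum_period {F : ℂ × ℂ → ℂ} {U : Set (ℂ × ℂ)} (hU : IsOpen U)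
    (hUc : ∀ j, U ⊆ (c j).regularSet)
    (hF : ∀ w ∈ U, F w = ∑ j, m j * (c j).period (c j).N 2 w) {z : ℂ × ℂ} (hz : z ∈ U) :
    IsHolonomicAt F z := by
  classical
  constructor
  · have : AnalyticAt ℂ (fun w => ∑ j, m j * (c j).period (c j).N 2 w) z :=
      Finset.analyticAt_fun_sum _ fun j _ =>
        analyticAt_const.mul ((c j).analyticAt_period _ _ (hUc j hz))
    refine this.congr ?_
    filter_upwards [hU.mem_nhds hz] with w hw
    exact (hF w hw).symm
  set d : ι → ℕ := fun j => (c j).degBound with hd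
  -- Each factor u or v costs one degree. Each derivative, and each factor q that fills up the
  -- denominator, costs at most `d j`.
  set Nk : ι → ℕ → ℕ := fun j k => (d j + 1) * k + (c j).N.natDegree with hNk
  set S : ℕ → ι → Submodule ℂ (Germ (𝓝 z) ℂ) := fun k j =>
    (MvPolynomial.restrictTotalDegree (Fin 3) ℂ (Nk j k + (2 + d j))).map
      ((c j).germInt (hUc j hz) (k + 1 + 1)) with hS
  have hle : ∀ k, bernsteinFiltration F z k ≤ (Finset.univ : Finset ι).sup (S k) := by
    intro k
    refine Submodule.span_le.2 ?_
    rintro _ ⟨a, b, i, l, hk, rfl⟩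
    obtain ⟨K, hK⟩ := iterate_partial_sum_period c m hU hUc hF i l
    -- The last factor raises the pole order 2 + i + l to k + 2, independently of i and l.
    set p : ι → MvPolynomial (Fin 3) ℂ := fun j =>
      (K * m j) • (MvPolynomial.X 0 ^ a * MvPolynomial.X 1 ^ b *
        liftPoly ((c j).N * (c j).X ^ i * (c j).Y ^ l) * (c j).qMv ^ (k - i - l)) with hp
    have hpmem : ∀ j, p j ∈ MvPolynomial.restrictTotalDegree (Fin 3) ℂ (Nk j k + (2 + d j)) := by
      intro j
      rw [MvPolynomial.mem_restrictTotalDegree]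
      refine (MvPolynomial.totalDegree_smul_le _ _).trans ?_
      have e1 := MvPolynomial.totalDegree_mul (MvPolynomial.X 0 ^ a * MvPolynomial.X 1 ^ b *
        liftPoly ((c j).N * (c j).X ^ i * (c j).Y ^ l)) ((c j).qMv ^ (k - i - l))
      have e2 := MvPolynomial.totalDegree_mul (MvPolynomial.X 0 ^ a * MvPolynomial.X 1 ^ b)
        (liftPoly ((c j).N * (c j).X ^ i * (c j).Y ^ l))
      have e3 := MvPolynomial.totalDegree_mul (MvPolynomial.X (R := ℂ) (0 : Fin 3) ^ a)
        (MvPolynomial.X 1 ^ b)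
      rw [MvPolynomial.totalDegree_X_pow, MvPolynomial.totalDegree_X_pow] at e3
      have e4 := totalDegree_liftPoly_le ((c j).N * (c j).X ^ i * (c j).Y ^ l)
      have e5 : ((c j).N * (c j).X ^ i * (c j).Y ^ l).natDegree ≤
          (c j).N.natDegree + i * (c j).X.natDegree + l * (c j).Y.natDegree := by
        refine Polynomial.natDegree_mul_le.trans ?_
        refine Nat.add_le_add (Polynomial.natDegree_mul_le.trans ?_) Polynomial.natDegree_pow_le
        exact Nat.add_le_add_left Polynomial.natDegree_pow_le _
      have e6 := MvPolynomial.totalDegree_pow (c j).qMv (k - i - l)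
      have e7 : (k - i - l) * (c j).qMv.totalDegree ≤ (k - i - l) * d j :=
        Nat.mul_le_mul_left _ (c j).totalDegree_qMv_le
      have e8 : i * (c j).X.natDegree ≤ i * d j :=
        Nat.mul_le_mul_left _ (by simp only [hd, ReducedCurve.degBound]; omega)
      have e9 : l * (c j).Y.natDegree ≤ l * d j :=
        Nat.mul_le_mul_left _ (by simp only [hd, ReducedCurve.degBound]; omega)
      have e10 : i * d j + l * d j + (k - i - l) * d j = k * d j := by
        rw [← add_mul, ← add_mul]; congr 1; omega
      have e11 : (d j + 1) * k = k * d j + k := by ring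
      simp only [hNk, e11]
      omega
    have hgerm : ((fun w : ℂ × ℂ => w.1 ^ a * w.2 ^ b * (partialU^[i] (partialV^[l] F)) w :
        ℂ × ℂ → ℂ) : Germ (𝓝 z) ℂ) =
        ∑ j, (c j).germInt (hUc j hz) (k + 1 + 1) (p j) := by
      have : ∑ j, (c j).germInt (hUc j hz) (k + 1 + 1) (p j) =
          ((fun w => ∑ j, (c j).period (specialize w (p j)) (k + 1 + 1) w : ℂ × ℂ → ℂ) :
            Germ (𝓝 z) ℂ) := by
        have h1 := map_sum (Germ.coeRingHom (R := ℂ) (𝓝 z))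
          (fun j => (fun w => (c j).period (specialize w (p j)) (k + 1 + 1) w : ℂ × ℂ → ℂ))
          (Finset.univ : Finset ι)
        rw [show (fun w => ∑ j, (c j).period (specialize w (p j)) (k + 1 + 1) w) =
          ∑ j, (fun w => (c j).period (specialize w (p j)) (k + 1 + 1) w) by ext; simp]
        exact h1.symm
      rw [this]
      refine Germ.coe_eq.2 ?_
      filter_upwards [hU.mem_nhds hz] with w hw
      rw [hK w hw, Finset.mul_sum]
      refine Finset.sum_congr rfl fun j _ => ?_
      rw [ReducedCurve.period, ReducedCurve.period, ← mul_assoc,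
        ← intervalIntegral.integral_const_mul]
      refine intervalIntegral.integral_congr fun t ht => ?_
      rw [uIcc_of_le (c j).a_lt_b.le] at ht
      have hq := hUc j hw t ht
      have hqk : ((c j).q w).eval (t : ℂ) ^ (k + 1 + 1) =
          ((c j).q w).eval (t : ℂ) ^ (k - i - l) * ((c j).q w).eval (t : ℂ) ^ (2 + i + l) := by
        rw [← pow_add]; congr 1; omega
      simp only [hp, map_smul, map_mul, map_pow, specialize_liftPoly, ReducedCurve.specialize_qMv,
        Polynomial.eval_smul, Polynomial.eval_mul, Polynomial.eval_pow, smul_eq_mul, hqk]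
      have hs0 : (specialize w (MvPolynomial.X 0)) = Polynomial.C w.1 := by simp [specialize]
      have hs1 : (specialize w (MvPolynomial.X 1)) = Polynomial.C w.2 := by simp [specialize]
      rw [hs0, hs1]
      simp only [Polynomial.eval_C]
      field_simp
    rw [hgerm]
    refine Submodule.sum_mem _ fun j _ => ?_
    exact (Finset.le_sup (f := S k) (Finset.mem_univ j)) (Submodule.mem_map_of_mem (hpmem j))
  -- The degree bound is affine in k, hence at most a constant times k + 1; the constant is taken
  -- large enough for the sum of all coefficients.
  refine ⟨∑ j, (2 + d j) * (Nk j 1 + d j + 4) ^ 2, fun k => ?_⟩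
  obtain ⟨hfin, hbound⟩ := finrank_finset_sup_le (Finset.univ : Finset ι) (S k)
    (fun j => inferInstance)
  refine (Submodule.finrank_mono (hle k)).trans (hbound.trans ?_)
  rw [Finset.sum_mul]
  refine Finset.sum_le_sum fun j _ => ?_
  refine ((c j).finrank_map_germInt_le (hUc j hz) (k + 1) (Nk j k)).trans ?_
  rw [mul_assoc, ← mul_pow]
  refine Nat.mul_le_mul_left _ (Nat.pow_le_pow_left ?_ 2)
  simp only [hNk]
  change (d j + 1) * k + (c j).N.natDegree + (2 + d j) + 1 ≤ _
  nlinarith [Nat.zero_le ((c j).N.natDegree * k), Nat.zero_le (d j * k)]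

end SumOfPeriods

/-! ### Holonomicity and analytic continuation -/

/-- Passing to the germ as a linear map. -/
def germMap (z : ℂ × ℂ) : (ℂ × ℂ → ℂ) →ₗ[ℂ] Germ (𝓝 z) ℂ where
  toFun f := (f : Germ (𝓝 z) ℂ)
  map_add' _ _ := rfl
  map_smul' _ _ := rfl

/-- The functions that span the Bernstein filtration. -/
def bernsteinSpan (f : ℂ × ℂ → ℂ) (k : ℕ) : Submodule ℂ (ℂ × ℂ → ℂ) :=
  Submodule.span ℂ {g | ∃ a b c d : ℕ, a + b + c + d ≤ k ∧
    g = fun w : ℂ × ℂ => w.1 ^ a * w.2 ^ b * (partialU^[c] (partialV^[d] f)) w}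

lemma map_bernsteinSpan (f : ℂ × ℂ → ℂ) (z : ℂ × ℂ) (k : ℕ) :
    (bernsteinSpan f k).map (germMap z) = bernsteinFiltration f z k := by
  rw [bernsteinSpan, Submodule.map_span, bernsteinFiltration]
  congr 1
  ext g
  constructor
  · rintro ⟨_, ⟨a, b, c, d, h, rfl⟩, rfl⟩
    exact ⟨a, b, c, d, h, rfl⟩
  · rintro ⟨a, b, c, d, h, rfl⟩
    exact ⟨_, ⟨a, b, c, d, h, rfl⟩, rfl⟩

instance finite_bernsteinSpan (f : ℂ × ℂ → ℂ) (k : ℕ) : Module.Finite ℂ (bernsteinSpan f k) := by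
  refine Module.Finite.span_of_finite ℂ ?_
  refine (Set.finite_range fun x : Fin (k + 1) × Fin (k + 1) × Fin (k + 1) × Fin (k + 1) =>
    fun w : ℂ × ℂ => w.1 ^ (x.1 : ℕ) * w.2 ^ (x.2.1 : ℕ) *
      (partialU^[x.2.2.1] (partialV^[x.2.2.2] f)) w).subset ?_
  rintro _ ⟨a, b, c, d, h, rfl⟩
  exact ⟨(⟨a, by omega⟩, ⟨b, by omega⟩, ⟨c, by omega⟩, ⟨d, by omega⟩), rfl⟩

lemma analyticOnNhd_partialU {f : ℂ × ℂ → ℂ} {U : Set (ℂ × ℂ)} (hU : IsOpen U)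
    (h : AnalyticOnNhd ℂ f U) : AnalyticOnNhd ℂ (partialU f) U := by
  intro w hw
  have h1 : AnalyticAt ℂ (fun z => fderiv ℂ f z (1, 0)) w :=
    ((ContinuousLinearMap.apply ℂ ℂ ((1, 0) : ℂ × ℂ)).analyticAt _).comp (h.fderiv w hw)
  refine h1.congr ?_
  filter_upwards [hU.mem_nhds hw] with z hz
  exact (h z hz).hasDerivAt_fst.deriv.symm

lemma analyticOnNhd_partialV {f : ℂ × ℂ → ℂ} {U : Set (ℂ × ℂ)} (hU : IsOpen U)
    (h : AnalyticOnNhd ℂ f U) : AnalyticOnNhd ℂ (partialV f) U := by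
  intro w hw
  have h1 : AnalyticAt ℂ (fun z => fderiv ℂ f z (0, 1)) w :=
    ((ContinuousLinearMap.apply ℂ ℂ ((0, 1) : ℂ × ℂ)).analyticAt _).comp (h.fderiv w hw)
  refine h1.congr ?_
  filter_upwards [hU.mem_nhds hw] with z hz
  exact (h z hz).hasDerivAt_snd.deriv.symm

lemma analyticOnNhd_of_mem_bernsteinSpan {f : ℂ × ℂ → ℂ} {U : Set (ℂ × ℂ)} (hU : IsOpen U)
    (h : AnalyticOnNhd ℂ f U) {k : ℕ} {g : ℂ × ℂ → ℂ} (hg : g ∈ bernsteinSpan f k) :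
    AnalyticOnNhd ℂ g U := by
  induction hg using Submodule.span_induction with
  | mem g hg =>
    obtain ⟨a, b, c, d, _, rfl⟩ := hg
    have h1 : ∀ d, AnalyticOnNhd ℂ (partialV^[d] f) U := fun d => by
      induction d with
      | zero => exact h
      | succ d ih => rw [Function.iterate_succ_apply']; exact analyticOnNhd_partialV hU ih
    have h2 : ∀ c, AnalyticOnNhd ℂ (partialU^[c] (partialV^[d] f)) U := fun c => by
      induction c with
      | zero => exact h1 d
      | succ c ih => rw [Function.iterate_succ_apply']; exact analyticOnNhd_partialU hU ih
    exact fun w hw => ((analyticAt_fst.pow a).mul (analyticAt_snd.pow b)).mul (h2 c w hw)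
  | zero => exact fun w _ => analyticAt_const
  | add g g' _ _ hg hg' => exact hg.add hg'
  | smul k g _ hg => exact fun w hw => analyticAt_const.smul (hg w hw)

/-- Both spaces of germs are images of one finite-dimensional space of functions analytic on `U`. By
the identity theorem a function with zero germ at one point has zero germ at the other, so the two
germ maps have the same kernel. -/
lemma finrank_bernsteinFiltration_eq {f : ℂ × ℂ → ℂ} {U : Set (ℂ × ℂ)} (hU : IsOpen U)
    (hU' : IsPreconnected U) (h : AnalyticOnNhd ℂ f U) {z z' : ℂ × ℂ} (hz : z ∈ U) (hz' : z' ∈ U)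
    (k : ℕ) : Module.finrank ℂ (bernsteinFiltration f z k) =
      Module.finrank ℂ (bernsteinFiltration f z' k) := by
  set S := bernsteinSpan f k with hS
  have hrange : ∀ y, LinearMap.range ((germMap y).domRestrict S) = bernsteinFiltration f y k :=
    fun y => by rw [LinearMap.range_domRestrict, map_bernsteinSpan]
  have key : ∀ y ∈ U, ∀ y' ∈ U, ∀ g ∈ S, germMap y g = 0 → germMap y' g = 0 := by
    intro y hy y' hy' g hg h0
    have h1 : g =ᶠ[𝓝 y] 0 := Germ.coe_eq.1 h0
    have h2 := (analyticOnNhd_of_mem_bernsteinSpan hU h hg).eqOn_zero_of_preconnected_of_eventuallyEq_zero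
      hU' hy h1
    refine Germ.coe_eq.2 ?_
    filter_upwards [hU.mem_nhds hy'] with w hw
    exact h2 hw
  have hker : LinearMap.ker ((germMap z).domRestrict S) =
      LinearMap.ker ((germMap z').domRestrict S) := by
    ext g
    simp only [LinearMap.mem_ker, LinearMap.domRestrict_apply]
    exact ⟨key z hz z' hz' g g.2, key z' hz' z hz g g.2⟩
  have h1 := LinearMap.finrank_range_add_finrank_ker ((germMap z).domRestrict S)
  have h2 := LinearMap.finrank_range_add_finrank_ker ((germMap z').domRestrict S)
  rw [hker] at h1
  rw [← hrange z, ← hrange z']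
  omega

lemma bernsteinFiltration_congr {f g : ℂ × ℂ → ℂ} {z : ℂ × ℂ} (h : f =ᶠ[𝓝 z] g) (k : ℕ) :
    bernsteinFiltration f z k = bernsteinFiltration g z k := by
  obtain ⟨U, hUsub, hU, hz⟩ := mem_nhds_iff.1 h
  have hEq : EqOn f g U := fun w hw => hUsub hw
  have h1 : ∀ d, EqOn (partialV^[d] f) (partialV^[d] g) U := fun d => by
    induction d with
    | zero => exact hEq
    | succ d ih =>
      rw [Function.iterate_succ_apply', Function.iterate_succ_apply']; exact partialV_congr hU ih
  have h2 : ∀ d c, EqOn (partialU^[c] (partialV^[d] f)) (partialU^[c] (partialV^[d] g)) U :=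
    fun d c => by
      induction c with
      | zero => exact h1 d
      | succ c ih =>
        rw [Function.iterate_succ_apply', Function.iterate_succ_apply']; exact partialU_congr hU ih
  have h3 : ∀ a b c d : ℕ,
      ((fun w : ℂ × ℂ => w.1 ^ a * w.2 ^ b * (partialU^[c] (partialV^[d] f)) w : ℂ × ℂ → ℂ) :
        Germ (𝓝 z) ℂ) =
      ((fun w : ℂ × ℂ => w.1 ^ a * w.2 ^ b * (partialU^[c] (partialV^[d] g)) w : ℂ × ℂ → ℂ) :
        Germ (𝓝 z) ℂ) := fun a b c d => by
    refine Germ.coe_eq.2 ?_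
    filter_upwards [hU.mem_nhds hz] with w hw
    rw [h2 d c hw]
  simp only [bernsteinFiltration, h3]

/-- Holonomicity is inherited by analytic continuations. -/
lemma IsContinuationAlong.isHolonomicAt {F : ℂ × ℂ → ℂ} {η : C(unitInterval, ℂ × ℂ)}
    {f : unitInterval → ℂ × ℂ → ℂ} (hf : IsContinuationAlong F η f) (h0 : IsHolonomicAt F (η 0))
    (t : unitInterval) : IsHolonomicAt (f t) (η t) := by
  obtain ⟨hstart, han, hloc⟩ := hf
  refine ⟨han t, ?_⟩
  obtain ⟨C, hC⟩ := h0.2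
  refine ⟨C, fun k => ?_⟩
  have hlc : IsLocallyConstant
      fun s : unitInterval => Module.finrank ℂ (bernsteinFiltration (f s) (η s) k) := by
    rw [IsLocallyConstant.iff_eventually_eq]
    intro s
    -- On a ball around `η s` one function represents all nearby germs of the continuation, so the
    -- dimension does not change there.
    obtain ⟨ε, hε, hball⟩ := Metric.eventually_nhds_iff_ball.1 (han s).eventually_analyticAt
    filter_upwards [hloc s, η.continuous.continuousAt.eventually (Metric.ball_mem_nhds (η s) hε)]
      with r hr hr'
    rw [bernsteinFiltration_congr hr]
    exact finrank_bernsteinFiltration_eq Metric.isOpen_ball (convex_ball _ _).isPreconnected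
      hball hr' (Metric.mem_ball_self hε) k
  have h1 := hlc.apply_eq_of_isPreconnected isPreconnected_univ (mem_univ t) (mem_univ 0)
  rw [h1, bernsteinFiltration_congr hstart]
  exact hC k

/-! ### Algebraic germs -/

/-- Germs of functions of the parameters as an algebra over the polynomials. -/
abbrev germAlgebra (z : ℂ × ℂ) : Algebra (MvPolynomial (Fin 2) ℂ) (Germ (𝓝 z) ℂ) :=
  ((Germ.coeRingHom (R := ℂ) (𝓝 z)).comp
    (RingHom.pi fun w : ℂ × ℂ => MvPolynomial.eval ![w.1, w.2])).toAlgebra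

lemma aeval_germ (z : ℂ × ℂ) (g : ℂ × ℂ → ℂ) (p : Polynomial (MvPolynomial (Fin 2) ℂ)) :
    letI := germAlgebra z
    Polynomial.aeval (g : Germ (𝓝 z) ℂ) p =
      ((fun w => (p.map (MvPolynomial.eval ![w.1, w.2])).eval (g w) : ℂ × ℂ → ℂ) :
        Germ (𝓝 z) ℂ) := by
  let _ := germAlgebra z
  induction p using Polynomial.induction_on' with
  | add p r hp hr =>
    rw [map_add, hp, hr]
    simp only [Polynomial.map_add, Polynomial.eval_add]
    rfl
  | monomial n a =>
    rw [Polynomial.aeval_monomial]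
    simp only [Polynomial.map_monomial, Polynomial.eval_monomial]
    rfl

/-- This identifies the pointwise definition with algebraicity in the algebra of germs, from which
closure under the ring operations is inherited. -/
lemma isAlgebraicAt_iff {g : ℂ × ℂ → ℂ} {z : ℂ × ℂ} :
    letI := germAlgebra z
    IsAlgebraicAt g z ↔ AnalyticAt ℂ g z ∧
      IsAlgebraic (MvPolynomial (Fin 2) ℂ) (g : Germ (𝓝 z) ℂ) := by
  let _ := germAlgebra z
  refine and_congr_right fun _ => exists_congr fun p => and_congr_right fun _ => ?_
  rw [aeval_germ]
  exact (Germ.coe_eq (g := fun _ => (0 : ℂ))).symm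

namespace IsAlgebraicAt

variable {f g : ℂ × ℂ → ℂ} {z : ℂ × ℂ}

lemma add (hf : IsAlgebraicAt f z) (hg : IsAlgebraicAt g z) :
    IsAlgebraicAt (fun w => f w + g w) z := by
  let _ := germAlgebra z
  rw [isAlgebraicAt_iff] at *
  exact ⟨hf.1.add hg.1, hf.2.add hg.2⟩

lemma sub (hf : IsAlgebraicAt f z) (hg : IsAlgebraicAt g z) :
    IsAlgebraicAt (fun w => f w - g w) z := by
  let _ := germAlgebra z
  rw [isAlgebraicAt_iff] at *
  exact ⟨hf.1.sub hg.1, hf.2.sub hg.2⟩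

lemma mul (hf : IsAlgebraicAt f z) (hg : IsAlgebraicAt g z) :
    IsAlgebraicAt (fun w => f w * g w) z := by
  let _ := germAlgebra z
  rw [isAlgebraicAt_iff] at *
  exact ⟨hf.1.mul hg.1, hf.2.mul hg.2⟩

lemma of_mvPolynomial (p : MvPolynomial (Fin 2) ℂ) (z : ℂ × ℂ)
    (hg : ∀ w : ℂ × ℂ, g w = MvPolynomial.eval ![w.1, w.2] p) : IsAlgebraicAt g z := by
  let _ := germAlgebra z
  obtain rfl : g = fun w : ℂ × ℂ => MvPolynomial.eval ![w.1, w.2] p := funext hg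
  rw [isAlgebraicAt_iff]
  refine ⟨?_, ?_⟩
  · have := AnalyticOnNhd.eval_mvPolynomial (𝕜 := ℂ) p ![z.1, z.2] trivial
    refine AnalyticAt.fun_comp_of_eq (f := fun w : ℂ × ℂ => ![w.1, w.2]) this ?_ rfl
    rw [analyticAt_pi_iff]
    intro i
    fin_cases i
    · exact analyticAt_fst
    · exact analyticAt_snd
  · exact isAlgebraic_algebraMap (A := Germ (𝓝 z) ℂ) p

lemma const (k : ℂ) (z : ℂ × ℂ) : IsAlgebraicAt (fun _ => k) z :=
  of_mvPolynomial (MvPolynomial.C k) z fun w => by simp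

lemma inv (hf : IsAlgebraicAt f z) (h0 : f z ≠ 0) : IsAlgebraicAt (fun w => (f w)⁻¹) z := by
  let _ := germAlgebra z
  rw [isAlgebraicAt_iff] at *
  refine ⟨hf.1.inv h0, ?_⟩
  have h1 : (f : Germ (𝓝 z) ℂ) * ((fun w => (f w)⁻¹ : ℂ × ℂ → ℂ) : Germ (𝓝 z) ℂ) = 1 := by
    refine Germ.coe_eq.2 ?_
    filter_upwards [hf.1.continuousAt.eventually_ne h0] with w hw
    exact mul_inv_cancel₀ hw
  let _ : Invertible (f : Germ (𝓝 z) ℂ) := ⟨_, by rw [mul_comm]; exact h1, h1⟩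
  exact hf.2.invOf

lemma div (hf : IsAlgebraicAt f z) (hg : IsAlgebraicAt g z) (h0 : g z ≠ 0) :
    IsAlgebraicAt (fun w => f w / g w) z := by
  simpa only [div_eq_mul_inv] using hf.mul (hg.inv h0)

lemma pow (hf : IsAlgebraicAt f z) (n : ℕ) : IsAlgebraicAt (fun w => f w ^ n) z := by
  induction n with
  | zero => simpa using const 1 z
  | succ n ih => simpa only [pow_succ] using ih.mul hf

lemma finset_sum {κ : Type*} (s : Finset κ) {f : κ → ℂ × ℂ → ℂ}
    (hf : ∀ k ∈ s, IsAlgebraicAt (f k) z) : IsAlgebraicAt (fun w => ∑ k ∈ s, f k w) z := by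
  classical
  induction s using Finset.induction_on with
  | empty => simpa using const 0 z
  | insert k s hk ih =>
    simp only [Finset.sum_insert hk]
    exact (hf k (Finset.mem_insert_self _ _)).add
      (ih fun i hi => hf i (Finset.mem_insert_of_mem hi))

lemma polynomial_eval (hf : IsAlgebraicAt f z) (p : Polynomial ℂ) :
    IsAlgebraicAt (fun w => p.eval (f w)) z := by
  induction p using Polynomial.induction_on' with
  | add p r hp hr => simpa only [Polynomial.eval_add] using hp.add hr
  | monomial n a => simpa only [Polynomial.eval_monomial] using (const a z).mul (hf.pow n)

end IsAlgebraicAt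

/-! ### The discriminant locus of a rational curve -/

lemma isCoprime_of_forall_root {p r : Polynomial ℂ} (h : ∀ α, p.eval α = 0 → r.eval α ≠ 0) :
    IsCoprime p r := by
  by_contra hcop
  by_cases hp : p = 0 ∧ r = 0
  · exact h 0 (by simp [hp.1]) (by simp [hp.2])
  have hg : ¬ IsUnit (EuclideanDomain.gcd p r) := fun hu =>
    hcop (EuclideanDomain.gcd_isUnit_iff.1 hu)
  have hg0 : EuclideanDomain.gcd p r ≠ 0 := fun h0 => hp (EuclideanDomain.gcd_eq_zero_iff.1 h0)
  obtain ⟨α, hα⟩ := IsAlgClosed.exists_root (EuclideanDomain.gcd p r) fun hd =>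
    hg (Polynomial.isUnit_iff_degree_eq_zero.2 hd)
  exact h α (Polynomial.eval_eq_zero_of_dvd_of_eval_eq_zero (EuclideanDomain.gcd_dvd_left p r) hα)
    (Polynomial.eval_eq_zero_of_dvd_of_eval_eq_zero (EuclideanDomain.gcd_dvd_right p r) hα)

namespace ReducedCurve

variable (c : ReducedCurve)

/-- `W - u X - v Y` as a polynomial in `t` over the polynomials in `u`, `v`. -/
def qR : Polynomial (MvPolynomial (Fin 2) ℂ) :=
  c.W.map MvPolynomial.C - Polynomial.C (MvPolynomial.X 0) * c.X.map MvPolynomial.C -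
    Polynomial.C (MvPolynomial.X 1) * c.Y.map MvPolynomial.C

lemma map_qR (w : ℂ × ℂ) : c.qR.map (MvPolynomial.eval ![w.1, w.2]) = c.q w := by
  have h : (MvPolynomial.eval ![w.1, w.2]).comp MvPolynomial.C = RingHom.id ℂ := by ext; simp
  simp [qR, q, Polynomial.map_map, h]

/-- The generic degree. -/
def deg : ℕ := c.qR.natDegree

lemma natDegree_q_le (w : ℂ × ℂ) : (c.q w).natDegree ≤ c.deg := by
  rw [← map_qR]; exact Polynomial.natDegree_map_le

lemma natDegree_W_le : c.W.natDegree ≤ c.deg := by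
  simpa [q] using c.natDegree_q_le (0, 0)

lemma natDegree_X_le : c.X.natDegree ≤ c.deg := by
  have h1 := c.natDegree_q_le (1, 0)
  have h2 : c.X = c.W - c.q (1, 0) := by simp [q]
  rw [h2]
  exact (Polynomial.natDegree_sub_le _ _).trans (max_le c.natDegree_W_le h1)

lemma natDegree_Y_le : c.Y.natDegree ≤ c.deg := by
  have h1 := c.natDegree_q_le (0, 1)
  have h2 : c.Y = c.W - c.q (0, 1) := by simp [q]
  rw [h2]
  exact (Polynomial.natDegree_sub_le _ _).trans (max_le c.natDegree_W_le h1)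

/-- N/q^2 is a proper fraction at full degree, so its partial fractions have no polynomial part. The
derivatives in `N` save one degree; in degree zero `N` vanishes. -/
lemma degree_N_lt : c.N.degree < (2 * c.deg : ℕ) := by
  have hX := c.natDegree_X_le
  have hY := c.natDegree_Y_le
  rcases Nat.eq_zero_or_pos c.deg with h | h
  · rw [h] at hX hY ⊢
    have : c.N = 0 := by
      rw [N, Polynomial.eq_C_of_natDegree_le_zero hX, Polynomial.eq_C_of_natDegree_le_zero hY]
      simp
    rw [this, Polynomial.degree_zero]
    exact WithBot.bot_lt_coe _
  · rw [Polynomial.degree_lt_iff_coeff_zero]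
    intro k hk
    refine Polynomial.coeff_eq_zero_of_natDegree_lt ?_
    have h1 : (c.X * c.Y.derivative).natDegree ≤ c.deg + (c.deg - 1) :=
      Polynomial.natDegree_mul_le.trans (add_le_add hX
        ((Polynomial.natDegree_derivative_le _).trans (Nat.sub_le_sub_right hY 1)))
    have h2 : (c.Y * c.X.derivative).natDegree ≤ c.deg + (c.deg - 1) :=
      Polynomial.natDegree_mul_le.trans (add_le_add hY
        ((Polynomial.natDegree_derivative_le _).trans (Nat.sub_le_sub_right hX 1)))
    have h3 : c.N.natDegree ≤ c.deg + (c.deg - 1) :=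
      (Polynomial.natDegree_sub_le _ _).trans (max_le h1 h2)
    omega

/-- The parameters for which the degree drops, roots collide, or a root is an endpoint. -/
def disc : MvPolynomial (Fin 2) ℂ :=
  c.qR.leadingCoeff * Polynomial.resultant c.qR c.qR.derivative c.deg (c.deg - 1) *
    (c.qR.eval (MvPolynomial.C (c.a : ℂ)) * c.qR.eval (MvPolynomial.C (c.b : ℂ)))

lemma eval_qR_C (w : ℂ × ℂ) (z : ℂ) :
    MvPolynomial.eval ![w.1, w.2] (c.qR.eval (MvPolynomial.C z)) = (c.q w).eval z := by
  rw [← map_qR, Polynomial.eval_map, ← Polynomial.eval₂_at_apply]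
  simp

lemma eval_resultant (w : ℂ × ℂ) : MvPolynomial.eval ![w.1, w.2]
    (Polynomial.resultant c.qR c.qR.derivative c.deg (c.deg - 1)) =
      Polynomial.resultant (c.q w) (c.q w).derivative c.deg (c.deg - 1) := by
  rw [← Polynomial.resultant_map_map, map_qR, ← Polynomial.derivative_map, map_qR]

lemma eval_leadingCoeff (w : ℂ × ℂ) :
    MvPolynomial.eval ![w.1, w.2] c.qR.leadingCoeff = (c.q w).coeff c.deg := by
  rw [← map_qR, Polynomial.coeff_map]; rfl

/-- The factors of `disc` control, in turn, the degree, the collision of roots and the two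
endpoints. The Bézout expression of the resultant excludes a common root of q and its derivative. -/
lemma spec_disc {w : ℂ × ℂ} (hw : MvPolynomial.eval ![w.1, w.2] c.disc ≠ 0) :
    (c.q w).natDegree = c.deg ∧ c.q w ≠ 0 ∧
      (∀ α, (c.q w).eval α = 0 → (c.q w).derivative.eval α ≠ 0) ∧
      (c.q w).eval (c.a : ℂ) ≠ 0 ∧ (c.q w).eval (c.b : ℂ) ≠ 0 := by
  rw [disc, map_mul, map_mul, map_mul, eval_qR_C, eval_qR_C, eval_resultant,
    eval_leadingCoeff] at hw
  obtain ⟨⟨h1, h2⟩, h3, h4⟩ : ((c.q w).coeff c.deg ≠ 0 ∧ _) ∧ _ ∧ _ := by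
    simpa only [mul_ne_zero_iff] using hw
  have hdeg : (c.q w).natDegree = c.deg :=
    le_antisymm (c.natDegree_q_le w) (Polynomial.le_natDegree_of_ne_zero h1)
  have hq0 : c.q w ≠ 0 := by rintro h; rw [h] at h1; simp at h1
  refine ⟨hdeg, hq0, ?_, h3, h4⟩
  intro α hα hα'
  -- The Bézout expression needs positive degree; a nonzero constant has no roots anyway.
  rcases Nat.eq_zero_or_pos c.deg with h | h
  · rw [h] at hdeg
    rw [Polynomial.eq_C_of_natDegree_eq_zero hdeg, Polynomial.eval_C] at hα
    rw [h] at h1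
    exact h1 hα
  · obtain ⟨p, r, _, _, hpr⟩ := Polynomial.exists_mul_add_mul_eq_C_resultant (c.q w)
      (c.q w).derivative hdeg.le ((Polynomial.natDegree_derivative_le _).trans (by rw [hdeg]))
      (Or.inl h.ne')
    have := congrArg (Polynomial.eval α) hpr
    simp only [Polynomial.eval_add, Polynomial.eval_mul, hα, hα', Polynomial.eval_C, zero_mul,
      add_zero] at this
    exact h2 this.symm

lemma W_ne_zero : c.W ≠ 0 := fun h => c.W_a (by simp [h])

/-- A generic member of the linear system has full degree and simple roots. -/
lemma exists_generic : ∃ w : ℂ × ℂ, (c.q w).coeff c.deg ≠ 0 ∧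
    ∀ α, (c.q w).eval α = 0 → (c.q w).derivative.eval α ≠ 0 := by
  classical
  have hlin : ∀ p r : ℂ, ¬ (p = 0 ∧ r = 0) → {v : ℂ | p + v * r = 0}.Finite := by
    intro p r h
    by_cases hr : r = 0
    · have hp : p ≠ 0 := fun hp => h ⟨hp, hr⟩
      refine Set.Finite.subset finite_empty fun v hv => ?_
      simp only [mem_ofPred_eq, hr, mul_zero, add_zero] at hv
      exact (hp hv).elim
    · refine (finite_singleton (-p / r)).subset fun v hv => ?_
      simp only [mem_ofPred_eq] at hv
      rw [mem_singleton_iff, eq_div_iff hr]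
      linear_combination hv
  -- This uses lowest terms: the linear system has no base points, so a generic direction in it
  -- avoids the roots of `W`.
  have hXY : ∀ α ∈ c.W.roots.toFinset, ¬ (c.X.eval α = 0 ∧ c.Y.eval α = 0) := by
    intro α hα ⟨h1, h2⟩
    obtain ⟨A, B, C, h⟩ := c.coprime
    have hW : c.W.eval α = 0 := by
      rw [Multiset.mem_toFinset, Polynomial.mem_roots c.W_ne_zero] at hα
      exact hα
    have := congrArg (Polynomial.eval α) h
    simp [h1, h2, hW] at this
  have hq0 : c.qR ≠ 0 := fun h => c.W_ne_zero (by
    have := c.map_qR (0, 0)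
    rw [h] at this
    simpa [q] using this.symm)
  have hlead : ∃ w : ℂ × ℂ, (c.q w).coeff c.deg ≠ 0 := by
    by_contra! hall
    have h0 : c.qR.leadingCoeff = 0 := by
      refine MvPolynomial.funext fun x => ?_
      have := hall (x 0, x 1)
      rw [← eval_leadingCoeff] at this
      have hx : x = ![x 0, x 1] := by ext i; fin_cases i <;> rfl
      rw [hx]
      simpa using this
    exact hq0 (Polynomial.leadingCoeff_eq_zero.1 h0)
  have hlead' : c.W.coeff c.deg = 0 → ¬ (c.X.coeff c.deg = 0 ∧ c.Y.coeff c.deg = 0) := by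
    rintro h1 ⟨h2, h3⟩
    obtain ⟨w, hw⟩ := hlead
    exact hw (by simp [q, h1, h2, h3])
  -- the direction of the pencil
  obtain ⟨v, hv⟩ : ∃ v : ℂ, (∀ α ∈ c.W.roots.toFinset, c.X.eval α + v * c.Y.eval α ≠ 0) ∧
      (c.W.coeff c.deg = 0 → c.X.coeff c.deg + v * c.Y.coeff c.deg ≠ 0) := by
    have hfin : ((⋃ α ∈ c.W.roots.toFinset, {v : ℂ | c.X.eval α + v * c.Y.eval α = 0}) ∪
        {v : ℂ | c.W.coeff c.deg = 0 ∧ c.X.coeff c.deg + v * c.Y.coeff c.deg = 0}).Finite := by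
      refine Set.Finite.union (Set.Finite.biUnion (Finset.finite_toSet _) fun α hα =>
        hlin _ _ (hXY α hα)) ?_
      by_cases h : c.W.coeff c.deg = 0
      · exact (hlin _ _ (hlead' h)).subset fun v hv => hv.2
      · exact Set.Finite.subset finite_empty fun v hv => (h hv.1).elim
    obtain ⟨v, hv⟩ := hfin.exists_notMem
    rw [mem_union, not_or] at hv
    refine ⟨v, fun α hα h => hv.1 ?_, fun h1 h2 => hv.2 ⟨h1, h2⟩⟩
    simp only [mem_iUnion]
    exact ⟨α, hα, h⟩
  set B : Polynomial ℂ := c.X + Polynomial.C v * c.Y with hB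
  have hBev : ∀ α, B.eval α = c.X.eval α + v * c.Y.eval α := fun α => by simp [hB]
  have hWB : ∀ α, c.W.eval α = 0 → B.eval α ≠ 0 := fun α hα => by
    rw [hBev]
    exact hv.1 α (by rw [Multiset.mem_toFinset, Polynomial.mem_roots c.W_ne_zero]; exact hα)
  -- A multiple root α of W - sB is a zero of this Wronskian, and s = W(α)/B(α). If the Wronskian is
  -- nonzero, only finitely many values of s are bad.
  set T : Polynomial ℂ := c.W.derivative * B - c.W * B.derivative with hT
  -- If the Wronskian vanishes, then `W`, being coprime to `B`, divides its own derivative. So both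
  -- polynomials are constant, and a single value of s has to be avoided.
  have hconst : T = 0 → ∀ α, c.W.eval α / B.eval α = c.W.eval 0 / B.eval 0 := by
    intro hT0 α
    have hcop := isCoprime_of_forall_root hWB
    have hTe : c.W.derivative * B = c.W * B.derivative := sub_eq_zero.1 hT0
    have h1 : c.W ∣ c.W.derivative := hcop.dvd_of_dvd_mul_right ⟨_, hTe⟩
    have h2 : c.W.derivative = 0 := by
      by_contra hne
      have := Polynomial.natDegree_le_of_dvd h1 hne
      have h3 := Polynomial.natDegree_derivative_lt (p := c.W) fun h => hne (by
        rw [Polynomial.eq_C_of_natDegree_eq_zero h]; simp)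
      omega
    have h3 : B.derivative = 0 := by
      rw [h2, zero_mul] at hTe
      exact (mul_eq_zero.1 hTe.symm).resolve_left c.W_ne_zero
    rw [Polynomial.eq_C_of_derivative_eq_zero h2, Polynomial.eq_C_of_derivative_eq_zero h3]
    simp
  -- the member of the pencil
  obtain ⟨s, hs1, hs2, hs3⟩ : ∃ s : ℂ, (∀ α ∈ T.roots.toFinset, s ≠ c.W.eval α / B.eval α) ∧
      s ≠ c.W.eval 0 / B.eval 0 ∧ c.W.coeff c.deg + s * -B.coeff c.deg ≠ 0 := by
    have hfin : (((fun α => c.W.eval α / B.eval α) '' T.roots.toFinset ∪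
        {c.W.eval 0 / B.eval 0}) ∪ {s : ℂ | c.W.coeff c.deg + s * -B.coeff c.deg = 0}).Finite := by
      refine ((Finset.finite_toSet _).image _ |>.union (finite_singleton _)).union (hlin _ _ ?_)
      rintro ⟨h1, h2⟩
      refine hv.2 h1 ?_
      have : B.coeff c.deg = c.X.coeff c.deg + v * c.Y.coeff c.deg := by simp [hB]
      rw [← this]
      exact neg_eq_zero.1 h2
    obtain ⟨s, hs⟩ := hfin.exists_notMem
    rw [mem_union, mem_union, not_or, not_or] at hs
    exact ⟨s, fun α hα h => hs.1.1 ⟨α, hα, h.symm⟩, hs.1.2, hs.2⟩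
  have hq : c.q (s, s * v) = c.W - Polynomial.C s * B := by
    simp only [q, hB, map_mul]; ring
  refine ⟨(s, s * v), ?_, ?_⟩
  · rw [hq]
    simpa [sub_eq_add_neg] using hs3
  · intro α hα hα'
    rw [hq] at hα hα'
    simp only [Polynomial.eval_sub, Polynomial.eval_mul, Polynomial.eval_C,
      Polynomial.derivative_sub, Polynomial.derivative_mul, Polynomial.derivative_C, zero_mul,
      zero_add] at hα hα'
    have hBα : B.eval α ≠ 0 := fun h => hWB α (by rw [h] at hα; linear_combination hα) h
    have hsα : s = c.W.eval α / B.eval α := by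
      rw [eq_div_iff hBα]; linear_combination -hα
    have hTα : T.eval α = 0 := by
      simp only [hT, Polynomial.eval_sub, Polynomial.eval_mul]
      linear_combination B.eval α * hα' - B.derivative.eval α * hα
    by_cases hT0 : T = 0
    · exact hs2 (hsα.trans (hconst hT0 α))
    · exact hs1 α (by rw [Multiset.mem_toFinset, Polynomial.mem_roots hT0]; exact hTα) hsα

/-- The degree and the resultant are tested at the generic member of the system. The endpoint
factors are tested at the origin, where q = W. -/
lemma disc_ne_zero : c.disc ≠ 0 := by
  obtain ⟨w, hw1, hw2⟩ := c.exists_generic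
  have hdeg : (c.q w).natDegree = c.deg :=
    le_antisymm (c.natDegree_q_le w) (Polynomial.le_natDegree_of_ne_zero hw1)
  refine mul_ne_zero (mul_ne_zero ?_ ?_) (mul_ne_zero ?_ ?_)
  · intro h
    rw [← eval_leadingCoeff, h, map_zero] at hw1
    exact hw1 rfl
  · intro h
    have h1 := c.eval_resultant w
    rw [h, map_zero] at h1
    have h2 := Polynomial.resultant_ne_zero (c.q w) (c.q w).derivative
      (isCoprime_of_forall_root hw2)
    rw [hdeg, Polynomial.natDegree_derivative, hdeg] at h2
    exact h2 h1.symm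
  · intro h
    have := c.eval_qR_C (0, 0) c.a
    rw [h, map_zero] at this
    exact c.W_a (by simpa [q] using this.symm)
  · intro h
    have := c.eval_qR_C (0, 0) c.b
    rw [h, map_zero] at this
    exact c.W_b (by simpa [q] using this.symm)

end ReducedCurve

/-! ### Partial fractions -/

/-- The residue of `N / q ^ 2` at a simple root of `q`. -/
def residue (N q : Polynomial ℂ) (τ : ℂ) : ℂ :=
  (N.derivative.eval τ * q.derivative.eval τ - N.eval τ * q.derivative.derivative.eval τ) /
    q.derivative.eval τ ^ 3

lemma sq_dvd_of_eval_eq_zero {Z : Polynomial ℂ} {τ : ℂ} (h : Z.eval τ = 0)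
    (h' : Z.derivative.eval τ = 0) : (Polynomial.X - Polynomial.C τ) ^ 2 ∣ Z := by
  obtain ⟨Z₁, rfl⟩ := Polynomial.dvd_iff_isRoot.2 h
  simp only [Polynomial.derivative_mul, Polynomial.derivative_sub, Polynomial.derivative_X,
    Polynomial.derivative_C, sub_zero, one_mul, Polynomial.eval_add, Polynomial.eval_mul,
    Polynomial.eval_sub, Polynomial.eval_X, Polynomial.eval_C, sub_self, zero_mul, add_zero] at h'
  rw [pow_two]
  exact mul_dvd_mul_left _ (Polynomial.dvd_iff_isRoot.2 h')

/-- Hermite interpolation: `N` minus the combination of the squared cofactors has degree below 2d,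
and it vanishes to order two at each of the d roots, hence is zero. The formula for `residue` is
what makes the first derivative vanish. -/
lemma partial_fractions {d : ℕ} {N q : Polynomial ℂ} (hq : q.natDegree = d) (hq0 : q ≠ 0)
    (hN : N.degree < (2 * d : ℕ)) {τ : Fin d → ℂ} (hinj : Function.Injective τ)
    (hroot : ∀ i, q.eval (τ i) = 0) (hsimple : ∀ i, q.derivative.eval (τ i) ≠ 0) {t : ℂ}
    (ht : q.eval t ≠ 0) :
    N.eval t / q.eval t ^ 2 = ∑ i, (N.eval (τ i) / q.derivative.eval (τ i) ^ 2 / (t - τ i) ^ 2 +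
      residue N q (τ i) / (t - τ i)) := by
  classical
  choose h hh using fun i => Polynomial.dvd_iff_isRoot.2 (hroot i)
  have hq' : ∀ i, q.derivative = h i + (Polynomial.X - Polynomial.C (τ i)) * (h i).derivative := by
    intro i
    conv_lhs => rw [hh i]
    simp [Polynomial.derivative_mul]
  have e1 : ∀ i, q.derivative.eval (τ i) = (h i).eval (τ i) := fun i => by
    rw [hq' i]; simp
  have e2 : ∀ i, q.derivative.derivative.eval (τ i) = 2 * (h i).derivative.eval (τ i) := fun i => by
    rw [hq' i]; simp [Polynomial.derivative_mul]; ring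
  have e3 : ∀ i k, i ≠ k → (h i).eval (τ k) = 0 := by
    intro i k hik
    have := hroot k
    rw [hh i, Polynomial.eval_mul] at this
    refine (mul_eq_zero.1 this).resolve_left ?_
    simpa [sub_eq_zero] using fun h' => hik (hinj h').symm
  have hdegh : ∀ i, (h i).natDegree + 1 = d := by
    intro i
    have hi0 : h i ≠ 0 := by rintro h0; rw [hh i, h0, mul_zero] at hq0; exact hq0 rfl
    rw [← hq, hh i, Polynomial.natDegree_mul (Polynomial.X_sub_C_ne_zero _) hi0,
      Polynomial.natDegree_X_sub_C, add_comm]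
  set κ : Fin d → ℂ := fun i => N.eval (τ i) / q.derivative.eval (τ i) ^ 2 with hκ
  set ρ : Fin d → ℂ := fun i => residue N q (τ i) with hρ
  -- With q = (X - τ i) h i, dividing this by q^2 gives the i-th pair of partial fractions.
  set S : Fin d → Polynomial ℂ := fun i =>
    (Polynomial.C (κ i) + Polynomial.C (ρ i) * (Polynomial.X - Polynomial.C (τ i))) * h i ^ 2 with hS
  set Z : Polynomial ℂ := N - ∑ i, S i with hZ
  have hSdeg : ∀ i, (S i).degree < (2 * d : ℕ) := by
    intro i
    refine lt_of_le_of_lt Polynomial.degree_le_natDegree ?_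
    rw [Nat.cast_lt]
    have h1 : (Polynomial.C (κ i) + Polynomial.C (ρ i) *
        (Polynomial.X - Polynomial.C (τ i))).natDegree ≤ 1 := by
      refine (Polynomial.natDegree_add_le _ _).trans (max_le (by simp) ?_)
      refine (Polynomial.natDegree_C_mul_le _ _).trans ?_
      rw [Polynomial.natDegree_X_sub_C]
    have h2 : (S i).natDegree ≤ 1 + 2 * (h i).natDegree :=
      Polynomial.natDegree_mul_le.trans (add_le_add h1 Polynomial.natDegree_pow_le)
    have := hdegh i
    omega
  have hZdeg : Z.degree < (2 * d : ℕ) := by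
    refine lt_of_le_of_lt (Polynomial.degree_sub_le _ _) (max_lt hN ?_)
    refine lt_of_le_of_lt (Polynomial.degree_sum_le _ _) ?_
    rw [Finset.sup_lt_iff (WithBot.bot_lt_coe _)]
    exact fun i _ => hSdeg i
  have hSk : ∀ i k, i ≠ k → (S i).eval (τ k) = 0 ∧ (S i).derivative.eval (τ k) = 0 := by
    intro i k hik
    simp [hS, Polynomial.derivative_mul, Polynomial.derivative_pow, e3 i k hik]
  have hdvd : ∀ k, (Polynomial.X - Polynomial.C (τ k)) ^ 2 ∣ Z := by
    intro k
    have hk0 := hsimple k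
    rw [e1] at hk0
    refine sq_dvd_of_eval_eq_zero ?_ ?_
    · rw [hZ, Polynomial.eval_sub, Polynomial.eval_finsetSum,
        Finset.sum_eq_single k (fun i _ hik => (hSk i k hik).1) (by simp)]
      simp only [hS, hκ, Polynomial.eval_mul, Polynomial.eval_add, Polynomial.eval_C,
        Polynomial.eval_sub, Polynomial.eval_X, sub_self, mul_zero, add_zero, Polynomial.eval_pow]
      rw [e1, div_mul_cancel₀ _ (pow_ne_zero 2 hk0), sub_self]
    · rw [hZ, Polynomial.derivative_sub, Polynomial.derivative_sum, Polynomial.eval_sub,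
        Polynomial.eval_finsetSum,
        Finset.sum_eq_single k (fun i _ hik => (hSk i k hik).2) (by simp)]
      simp only [hS, hκ, hρ, residue, Polynomial.derivative_mul, Polynomial.derivative_add,
        Polynomial.derivative_C, Polynomial.derivative_sub, Polynomial.derivative_X,
        Polynomial.derivative_pow, Polynomial.eval_mul, Polynomial.eval_add, Polynomial.eval_C,
        Polynomial.eval_sub, Polynomial.eval_X, sub_self, mul_zero, add_zero, zero_add, zero_mul,
        Polynomial.eval_pow, sub_zero, mul_one, e1, e2]
      field_simp
      simp
      ring
  have hprod : ∏ k, (Polynomial.X - Polynomial.C (τ k)) ^ 2 ∣ Z := by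
    refine Finset.prod_dvd_of_coprime ?_ fun k _ => hdvd k
    intro i _ k _ hik
    exact (Polynomial.pairwise_coprime_X_sub_C hinj hik).pow
  have hZ0 : Z = 0 := by
    refine Polynomial.eq_zero_of_dvd_of_degree_lt hprod (hZdeg.trans_eq ?_)
    rw [Polynomial.degree_prod]
    simp [mul_comm]
  have hNt : N.eval t = ∑ i, (S i).eval t := by
    have := congrArg (Polynomial.eval t) (sub_eq_zero.1 hZ0)
    rwa [Polynomial.eval_finsetSum] at this
  rw [hNt, Finset.sum_div]
  refine Finset.sum_congr rfl fun i _ => ?_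
  have hqt : q.eval t = (t - τ i) * (h i).eval t := by
    conv_lhs => rw [hh i]
    simp
  rw [hqt] at ht ⊢
  have h1 := left_ne_zero_of_mul ht
  have h2 := right_ne_zero_of_mul ht
  simp only [hS, Polynomial.eval_mul, Polynomial.eval_add, Polynomial.eval_C,
    Polynomial.eval_sub, Polynomial.eval_X, Polynomial.eval_pow]
  field_simp
  simp only [hκ, hρ]
  ring

/-- If the quotient were -r with r ≥ 0, then τ = (t + ra)/(1 + r) would be a point of the segment.
Thus the principal logarithm is a primitive along the whole interval. -/
lemma div_mem_slitPlane {a t : ℝ} (hat : a ≤ t) {τ : ℂ} (hτ : ∀ s ∈ Icc a t, (s : ℂ) ≠ τ) :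
    ((t : ℂ) - τ) / (a - τ) ∈ Complex.slitPlane := by
  have ha : (a : ℂ) - τ ≠ 0 := sub_ne_zero.2 (hτ a (left_mem_Icc.2 hat))
  by_contra hcon
  rw [Complex.mem_slitPlane_iff_not_le_zero, not_not] at hcon
  obtain ⟨r, hr⟩ : ∃ r : ℝ, ((t : ℂ) - τ) / (a - τ) = -(r : ℂ) :=
    ⟨-(((t : ℂ) - τ) / (a - τ)).re, by
      rw [Complex.le_def] at hcon
      apply Complex.ext <;> simp [hcon.2]⟩
  have hr0 : 0 ≤ r := by
    rw [hr, Complex.le_def] at hcon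
    simpa using hcon.1
  rw [div_eq_iff ha] at hr
  refine hτ ((t + r * a) / (1 + r)) ⟨?_, ?_⟩ ?_
  · rw [le_div_iff₀ (by positivity)]; nlinarith
  · rw [div_le_iff₀ (by positivity)]; nlinarith
  · have : (1 + r : ℂ) ≠ 0 := by
      have : (1 + r : ℝ) ≠ 0 := by positivity
      exact_mod_cast this
    push_cast
    rw [div_eq_iff this]
    linear_combination hr

lemma integral_inv_sub {a b : ℝ} (hab : a ≤ b) {τ : ℂ} (hτ : ∀ s ∈ Icc a b, (s : ℂ) ≠ τ) :
    IntervalIntegrable (fun t : ℝ => 1 / ((t : ℂ) - τ)) volume a b ∧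
    ∫ t in a..b, 1 / ((t : ℂ) - τ) = Complex.log ((b - τ) / (a - τ)) := by
  have hi : IntervalIntegrable (fun t : ℝ => 1 / ((t : ℂ) - τ)) volume a b := by
    refine ContinuousOn.intervalIntegrable_of_Icc hab ?_
    exact ContinuousOn.div (by fun_prop) (by fun_prop) fun t ht => sub_ne_zero.2 (hτ t ht)
  refine ⟨hi, ?_⟩
  have ha : (a : ℂ) - τ ≠ 0 := sub_ne_zero.2 (hτ a (left_mem_Icc.2 hab))
  rw [intervalIntegral.integral_eq_sub_of_hasDerivAt
    (f := fun t : ℝ => Complex.log (((t : ℂ) - τ) / (a - τ))) _ hi]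
  · rw [div_self ha, Complex.log_one, sub_zero]
  · intro t ht
    rw [uIcc_of_le hab] at ht
    have hofr : HasDerivAt (fun x : ℝ => (x : ℂ)) 1 t := Complex.ofRealCLM.hasDerivAt
    have h1 : HasDerivAt (fun x : ℝ => ((x : ℂ) - τ) / (a - τ)) (1 / (a - τ)) t :=
      (hofr.sub_const τ).div_const _
    have h2 := (Complex.hasDerivAt_log (div_mem_slitPlane ht.1
      fun s hs => hτ s ⟨hs.1, hs.2.trans ht.2⟩)).comp t h1
    refine h2.congr_deriv ?_
    have := sub_ne_zero.2 (hτ t ht)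
    field_simp

lemma integral_inv_sub_sq {a b : ℝ} (hab : a ≤ b) {τ : ℂ} (hτ : ∀ s ∈ Icc a b, (s : ℂ) ≠ τ) :
    IntervalIntegrable (fun t : ℝ => 1 / ((t : ℂ) - τ) ^ 2) volume a b ∧
    ∫ t in a..b, 1 / ((t : ℂ) - τ) ^ 2 = 1 / (a - τ) - 1 / (b - τ) := by
  have hi : IntervalIntegrable (fun t : ℝ => 1 / ((t : ℂ) - τ) ^ 2) volume a b := by
    refine ContinuousOn.intervalIntegrable_of_Icc hab ?_
    exact ContinuousOn.div (by fun_prop) (by fun_prop) fun t ht =>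
      pow_ne_zero 2 (sub_ne_zero.2 (hτ t ht))
  refine ⟨hi, ?_⟩
  rw [intervalIntegral.integral_eq_sub_of_hasDerivAt (f := fun t : ℝ => -(1 / ((t : ℂ) - τ))) _ hi]
  · ring
  · intro t ht
    rw [uIcc_of_le hab] at ht
    have hofr : HasDerivAt (fun x : ℝ => (x : ℂ)) 1 t := Complex.ofRealCLM.hasDerivAt
    have hne := sub_ne_zero.2 (hτ t ht)
    refine (((hasDerivAt_const t (1 : ℂ)).div (hofr.sub_const τ) hne).neg).congr_deriv ?_
    field_simp
    simp

/-! ### Branches of the periods -/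

namespace ReducedCurve

variable (c : ReducedCurve)

/-- On `U`, the functions `τ i` are the roots of `W - u X - v Y`, and the `L i` are branches of the
logarithms of `(b - τ i) / (a - τ i)`. -/
structure IsBranchOn (U : Set (ℂ × ℂ)) (τ L : Fin c.deg → ℂ × ℂ → ℂ) : Prop where
  disc : ∀ w ∈ U, MvPolynomial.eval ![w.1, w.2] c.disc ≠ 0
  analytic_root : ∀ i, ∀ w ∈ U, AnalyticAt ℂ (τ i) w
  analytic_log : ∀ i, ∀ w ∈ U, AnalyticAt ℂ (L i) w
  injective : ∀ w ∈ U, Function.Injective fun i => τ i w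
  root : ∀ i, ∀ w ∈ U, (c.q w).eval (τ i w) = 0
  exp_log : ∀ i, ∀ w ∈ U, Complex.exp (L i w) = (c.b - τ i w) / (c.a - τ i w)

/-- The algebraic part of the period, root by root. -/
def algPart (τ : ℂ × ℂ → ℂ) (w : ℂ × ℂ) : ℂ :=
  c.N.eval (τ w) / (c.q w).derivative.eval (τ w) ^ 2 * (1 / (c.a - τ w) - 1 / (c.b - τ w))

/-- The value of the period in terms of roots and logarithms. -/
def branchValue (τ L : Fin c.deg → ℂ × ℂ → ℂ) (w : ℂ × ℂ) : ℂ :=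
  ∑ i, (c.algPart (τ i) w + residue c.N (c.q w) (τ i w) * L i w)

/-- `f` is a branch of the period near `z`. -/
def IsBranchAt (z : ℂ × ℂ) (f : ℂ × ℂ → ℂ) : Prop :=
  ∃ U : Set (ℂ × ℂ), IsOpen U ∧ z ∈ U ∧ ∃ τ L, c.IsBranchOn U τ L ∧
    ∀ w ∈ U, f w = c.branchValue τ L w

variable {c}

lemma IsBranchOn.mono {U V : Set (ℂ × ℂ)} {τ L : Fin c.deg → ℂ × ℂ → ℂ} (h : c.IsBranchOn U τ L)
    (hV : V ⊆ U) : c.IsBranchOn V τ L :=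
  ⟨fun w hw => h.disc w (hV hw), fun i w hw => h.analytic_root i w (hV hw),
    fun i w hw => h.analytic_log i w (hV hw), fun w hw => h.injective w (hV hw),
    fun i w hw => h.root i w (hV hw), fun i w hw => h.exp_log i w (hV hw)⟩

variable (c)

lemma contDiff_eval_q : ContDiff ℂ ⊤ fun z : (ℂ × ℂ) × ℂ => (c.q z.1).eval z.2 := by
  have h : ∀ p : Polynomial ℂ, ContDiff ℂ ⊤ fun z : (ℂ × ℂ) × ℂ => p.eval z.2 := fun p =>
    (Polynomial.contDiff_aeval (𝕜 := ℂ) p ⊤).comp contDiff_snd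
  simp only [eval_q]
  exact ((h _).sub ((contDiff_fst.fst).mul (h _))).sub ((contDiff_fst.snd).mul (h _))

/-- A simple root is an analytic function of the parameters. -/
lemma exists_analytic_root {z : ℂ × ℂ} {τ₀ : ℂ} (h0 : (c.q z).eval τ₀ = 0)
    (h1 : (c.q z).derivative.eval τ₀ ≠ 0) :
    ∃ τ : ℂ × ℂ → ℂ, AnalyticAt ℂ τ z ∧ τ z = τ₀ ∧ ∀ᶠ w in 𝓝 z, (c.q w).eval (τ w) = 0 := by
  have hcd : ContDiffAt ℂ ⊤ (fun p : (ℂ × ℂ) × ℂ => (c.q p.1).eval p.2) (z, τ₀) :=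
    c.contDiff_eval_q.contDiffAt
  -- The partial derivative in the last variable is the value of q' at the root; the implicit
  -- function theorem needs it to be invertible.
  have hinv : (fderiv ℂ (fun p : (ℂ × ℂ) × ℂ => (c.q p.1).eval p.2) (z, τ₀) ∘L
      .inr ℂ (ℂ × ℂ) ℂ).IsInvertible := by
    refine ⟨ContinuousLinearEquiv.unitsEquivAut ℂ (Units.mk0 _ h1), ?_⟩
    ext
    have hd : HasFDerivAt (fun p : (ℂ × ℂ) × ℂ => (c.q p.1).eval p.2)
        (fderiv ℂ (fun p : (ℂ × ℂ) × ℂ => (c.q p.1).eval p.2) (z, τ₀)) (z, τ₀) :=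
      (hcd.differentiableAt (by simp)).hasFDerivAt
    have h2 : HasDerivAt (fun t : ℂ => ((z, t) : (ℂ × ℂ) × ℂ)) (0, 1) τ₀ :=
      (hasDerivAt_const _ _).prodMk (hasDerivAt_id _)
    have h3 := hd.comp_hasDerivAt τ₀ h2
    have h4 := h3.unique ((c.q z).hasDerivAt τ₀)
    simpa using h4.symm
  refine ⟨hcd.implicitFunction (by simp) hinv, ?_, ?_, ?_⟩
  · exact (hcd.contDiffAt_implicitFunction (by simp) hinv).analyticAt
  · exact hcd.implicitFunction_apply_self (by simp) hinv
  · have := hcd.eventually_apply_implicitFunction (by simp) hinv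
    simpa only [h0] using this

lemma exists_roots {w : ℂ × ℂ} (hw : MvPolynomial.eval ![w.1, w.2] c.disc ≠ 0) :
    ∃ τ : Fin c.deg → ℂ, Function.Injective τ ∧ ∀ i, (c.q w).eval (τ i) = 0 := by
  classical
  obtain ⟨hdeg, hq0, hs, -, -⟩ := c.spec_disc hw
  have hsep : (c.q w).Separable := isCoprime_of_forall_root hs
  have hcard : (c.q w).roots.toFinset.card = c.deg := by
    rw [Multiset.toFinset_card_of_nodup (Polynomial.nodup_roots hsep), ← hdeg]
    exact (Polynomial.splits_iff_card_roots.1 (IsAlgClosed.splits _))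
  refine ⟨fun i => ((c.q w).roots.toFinset.equivFinOfCardEq hcard).symm i, ?_, fun i => ?_⟩
  · exact Subtype.val_injective.comp (Equiv.injective _)
  · have := (((c.q w).roots.toFinset.equivFinOfCardEq hcard).symm i).2
    rw [Multiset.mem_toFinset, Polynomial.mem_roots hq0] at this
    exact this

variable {c}

/-- Otherwise there would be one root more than the degree allows. -/
lemma eq_of_root {w : ℂ × ℂ} (hw : MvPolynomial.eval ![w.1, w.2] c.disc ≠ 0)
    {τ : Fin c.deg → ℂ} (hinj : Function.Injective τ) (hτ : ∀ i, (c.q w).eval (τ i) = 0) {α : ℂ}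
    (hα : (c.q w).eval α = 0) : ∃ i, α = τ i := by
  classical
  obtain ⟨hdeg, hq0, -, -, -⟩ := c.spec_disc hw
  by_contra! hne
  have h1 : (insert α (Finset.univ.image τ)).card ≤ (c.q w).natDegree := by
    refine (Finset.card_le_card (t := (c.q w).roots.toFinset) ?_).trans
      ((Multiset.toFinset_card_le _).trans (Polynomial.card_roots' _))
    intro β hβ
    rw [Multiset.mem_toFinset, Polynomial.mem_roots hq0]
    rcases Finset.mem_insert.1 hβ with rfl | hβ
    · exact hα
    · obtain ⟨i, -, rfl⟩ := Finset.mem_image.1 hβ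
      exact hτ i
  rw [Finset.card_insert_of_notMem (by simpa using fun i h => hne i h.symm),
    Finset.card_image_of_injective _ hinj, Finset.card_univ, Fintype.card_fin, hdeg] at h1
  omega

lemma endpoint_sub_ne_zero {w : ℂ × ℂ} (hw : MvPolynomial.eval ![w.1, w.2] c.disc ≠ 0) {α : ℂ}
    (hα : (c.q w).eval α = 0) : (c.a : ℂ) - α ≠ 0 ∧ (c.b : ℂ) - α ≠ 0 := by
  obtain ⟨-, -, -, ha, hb⟩ := c.spec_disc hw
  constructor
  · intro h; rw [sub_eq_zero.1 h] at ha; exact ha hα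
  · intro h; rw [sub_eq_zero.1 h] at hb; exact hb hα

variable (c)

lemma isOpen_disc_ne_zero :
    IsOpen {w : ℂ × ℂ | MvPolynomial.eval ![w.1, w.2] c.disc ≠ 0} := by
  refine isOpen_ne_fun ?_ continuous_const
  refine (MvPolynomial.continuous_eval c.disc).comp ?_
  fun_prop

/-- Local branches exist; any local choice of analytic logarithms can be prescribed. -/
lemma exists_isBranchOn {z : ℂ × ℂ} (hz : MvPolynomial.eval ![z.1, z.2] c.disc ≠ 0) :
    ∃ U : Set (ℂ × ℂ), IsOpen U ∧ z ∈ U ∧ ∃ τ L, c.IsBranchOn U τ L ∧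
      (z ∈ c.regularSet → ∀ i, ∀ w ∈ U, L i w = Complex.log ((c.b - τ i w) / (c.a - τ i w))) := by
  obtain ⟨τ₀, hinj₀, hroot₀⟩ := c.exists_roots hz
  obtain ⟨-, -, hs, -, -⟩ := c.spec_disc hz
  choose τ hτan hτz hτroot using fun i => c.exists_analytic_root (hroot₀ i) (hs _ (hroot₀ i))
  have hβan : ∀ i, AnalyticAt ℂ (fun w => ((c.b : ℂ) - τ i w) / (c.a - τ i w)) z := fun i =>
    (analyticAt_const.sub (hτan i)).div (analyticAt_const.sub (hτan i))
      (by rw [hτz]; exact (endpoint_sub_ne_zero hz (hroot₀ i)).1)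
  have hβ0 : ∀ i, ((c.b : ℂ) - τ i z) / (c.a - τ i z) ≠ 0 := fun i => by
    rw [hτz]
    exact div_ne_zero (endpoint_sub_ne_zero hz (hroot₀ i)).2 (endpoint_sub_ne_zero hz (hroot₀ i)).1
  obtain ⟨L, hLan, hLexp, hLreg⟩ : ∃ L : Fin c.deg → ℂ × ℂ → ℂ, (∀ i, AnalyticAt ℂ (L i) z) ∧
      (∀ i, ∀ w, ((c.b : ℂ) - τ i w) / (c.a - τ i w) ≠ 0 →
        Complex.exp (L i w) = (c.b - τ i w) / (c.a - τ i w)) ∧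
      (z ∈ c.regularSet → ∀ i, ∀ w, L i w = Complex.log ((c.b - τ i w) / (c.a - τ i w))) := by
    -- At a regular parameter no root lies on the interval and the principal logarithm is analytic,
    -- which matches the actual integral. Elsewhere the quotient is normalized by its value at `z`,
    -- so that its logarithm is taken near 1.
    by_cases hreg : z ∈ c.regularSet
    · refine ⟨fun i w => Complex.log ((c.b - τ i w) / (c.a - τ i w)), fun i => ?_,
        fun i w h => Complex.exp_log h, fun _ _ _ => rfl⟩
      refine (hβan i).clog (div_mem_slitPlane c.a_lt_b.le fun s hs h => hreg s hs ?_)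
      rw [h, hτz]
      exact hroot₀ i
    · refine ⟨fun i w => Complex.log (((c.b - τ i w) / (c.a - τ i w)) /
        ((c.b - τ i z) / (c.a - τ i z))) + Complex.log ((c.b - τ i z) / (c.a - τ i z)),
        fun i => ?_, fun i w h => ?_, fun h => (hreg h).elim⟩
      · refine (((hβan i).div analyticAt_const (hβ0 i)).clog ?_).add analyticAt_const
        have h1 := div_self (hβ0 i)
        show _ / _ ∈ Complex.slitPlane
        rw [h1]
        exact Complex.one_mem_slitPlane
      · rw [Complex.exp_add, Complex.exp_log (div_ne_zero h (hβ0 i)), Complex.exp_log (hβ0 i),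
          div_mul_cancel₀ _ (hβ0 i)]
  have hev : ∀ᶠ w in 𝓝 z, MvPolynomial.eval ![w.1, w.2] c.disc ≠ 0 ∧
      (∀ i, AnalyticAt ℂ (τ i) w) ∧ (∀ i, AnalyticAt ℂ (L i) w) ∧
      (∀ i k, i ≠ k → τ i w ≠ τ k w) ∧ (∀ i, (c.q w).eval (τ i w) = 0) := by
    refine Eventually.and (c.isOpen_disc_ne_zero.mem_nhds hz) ?_
    refine (eventually_all.2 fun i => (hτan i).eventually_analyticAt).and ?_
    refine (eventually_all.2 fun i => (hLan i).eventually_analyticAt).and ?_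
    refine (eventually_all.2 fun i => eventually_all.2 fun k => ?_).and (eventually_all.2 hτroot)
    by_cases hik : i = k
    · exact Eventually.of_forall fun _ h => (h hik).elim
    · have : ∀ᶠ w in 𝓝 z, τ i w - τ k w ≠ 0 := ((hτan i).continuousAt.sub
        (hτan k).continuousAt).eventually_ne (sub_ne_zero.2 <| by rw [hτz, hτz]; exact hinj₀.ne hik)
      exact this.mono fun _ h _ => sub_ne_zero.1 h
  obtain ⟨U, hU, hUo, hzU⟩ := eventually_nhds_iff.1 hev
  refine ⟨U, hUo, hzU, τ, L, ⟨fun w hw => (hU w hw).1, fun i w hw => (hU w hw).2.1 i,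
    fun i w hw => (hU w hw).2.2.1 i, fun w hw i k h => ?_, fun i w hw => (hU w hw).2.2.2.2 i,
    fun i w hw => hLexp i w ?_⟩, fun h i w _ => hLreg h i w⟩
  · by_contra hik
    exact (hU w hw).2.2.2.1 i k hik h
  · have := endpoint_sub_ne_zero (hU w hw).1 ((hU w hw).2.2.2.2 i)
    exact div_ne_zero this.2 this.1

variable {c}

/-- Two systems of branches differ near a common point by a permutation of the roots and constants
in the logarithms. -/
lemma IsBranchOn.matching {U V : Set (ℂ × ℂ)} {τ L τ' L' : Fin c.deg → ℂ × ℂ → ℂ}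
    (h : c.IsBranchOn U τ L) (h' : c.IsBranchOn V τ' L') (hU : IsOpen U) (hV : IsOpen V)
    {z : ℂ × ℂ} (hzU : z ∈ U) (hzV : z ∈ V) :
    ∃ (σ : Equiv.Perm (Fin c.deg)) (k : Fin c.deg → ℂ), (∀ i, Complex.exp (k i) = 1) ∧
      ∀ᶠ w in 𝓝 z, ∀ i, τ i w = τ' (σ i) w ∧ L i w = L' (σ i) w + k i := by
  choose σ hσ using fun i => eq_of_root (h.disc z hzU) (h'.injective z hzV)
    (fun i => h'.root i z hzV) (h.root i z hzU)
  have hσinj : Function.Injective σ := fun i k hik => h.injective z hzU (by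
    show τ i z = τ k z
    rw [hσ i, hσ k, hik])
  have hroots : ∀ i, ∀ᶠ w in 𝓝 z, τ i w = τ' (σ i) w := by
    intro i
    have h1 : ∀ᶠ w in 𝓝 z, ∀ k, k ≠ σ i → τ i w ≠ τ' k w := by
      refine eventually_all.2 fun k => ?_
      by_cases hk : k = σ i
      · exact Eventually.of_forall fun _ h => (h hk).elim
      · have : ∀ᶠ w in 𝓝 z, τ i w - τ' k w ≠ 0 :=
          ((h.analytic_root i z hzU).continuousAt.sub
          (h'.analytic_root k z hzV).continuousAt).eventually_ne (sub_ne_zero.2 <|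
          by rw [hσ]; exact fun hh => hk (h'.injective z hzV hh).symm)
        exact this.mono fun _ h _ => sub_ne_zero.1 h
    filter_upwards [h1, hU.mem_nhds hzU, hV.mem_nhds hzV] with w hw hwU hwV
    obtain ⟨k, hk⟩ := eq_of_root (h.disc w hwU) (h'.injective w hwV)
      (fun i => h'.root i w hwV) (h.root i w hwU)
    by_cases hki : k = σ i
    · rw [← hki, hk]
    · exact (hw k hki hk).elim
  have hexp : ∀ i, ∀ᶠ w in 𝓝 z, Complex.exp (L i w - L' (σ i) w) = 1 := by
    intro i
    filter_upwards [hroots i, hU.mem_nhds hzU, hV.mem_nhds hzV] with w hw hwU hwV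
    rw [Complex.exp_sub, h.exp_log i w hwU, h'.exp_log _ w hwV, hw]
    have := endpoint_sub_ne_zero (h'.disc w hwV) (h'.root (σ i) w hwV)
    exact div_self (div_ne_zero this.2 this.1)
  refine ⟨Equiv.ofBijective σ hσinj.bijective_of_finite, fun i => L i z - L' (σ i) z,
    fun i => (hexp i).self_of_nhds, eventually_all.2 fun i => (hroots i).and ?_⟩
  have hcont : ContinuousAt (fun w => L i w - L' (σ i) w - (L i z - L' (σ i) z)) z :=
    ((h.analytic_log i z hzU).continuousAt.sub (h'.analytic_log (σ i) z hzV).continuousAt).sub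
      continuousAt_const
  -- A continuous function with exponential 1 that vanishes at `z` stays in the strip where the
  -- principal logarithm inverts the exponential, so it vanishes near `z`.
  have hsmall : ∀ᶠ w in 𝓝 z, |(L i w - L' (σ i) w - (L i z - L' (σ i) z)).im| < Real.pi := by
    have := (continuous_abs.comp Complex.continuous_im).continuousAt.comp hcont
    refine this.eventually_lt continuousAt_const ?_
    simpa using Real.pi_pos
  filter_upwards [hsmall, hexp i] with w hw hw1
  rw [abs_lt] at hw
  have h2 := Complex.log_exp hw.1 hw.2.le
  rw [Complex.exp_sub, hw1, (hexp i).self_of_nhds, div_one, Complex.log_one] at h2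
  show L i w = L' (σ i) w + (L i z - L' (σ i) z)
  linear_combination -h2

variable (c)

/-- Branches of the period extend to a fixed neighbourhood of every point off the discriminant. -/
lemma exists_extension {z : ℂ × ℂ} (hz : MvPolynomial.eval ![z.1, z.2] c.disc ≠ 0) :
    ∃ B : Set (ℂ × ℂ), IsOpen B ∧ z ∈ B ∧ ∀ z' ∈ B, ∀ f, c.IsBranchAt z' f →
      ∃ g, f =ᶠ[𝓝 z'] g ∧ ∀ z'' ∈ B, c.IsBranchAt z'' g := by
  obtain ⟨B, hBo, hzB, τ', L', hb', -⟩ := c.exists_isBranchOn hz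
  refine ⟨B, hBo, hzB, fun z' hz' f hf => ?_⟩
  obtain ⟨U, hUo, hzU, τ, L, hb, hf⟩ := hf
  obtain ⟨σ, k, hk, hev⟩ := hb.matching hb' hUo hBo hzU hz'
  -- The fixed system on `B`, relabelled and shifted so as to agree with the given branch near `z'`.
  -- Shifts by logarithms of 1 keep the exponentials.
  have hb'' : c.IsBranchOn B (fun i => τ' (σ i)) (fun i w => L' (σ i) w + k i) :=
    ⟨hb'.disc, fun i => hb'.analytic_root _,
      fun i w hw => (hb'.analytic_log _ w hw).add analyticAt_const,
      fun w hw => (hb'.injective w hw).comp σ.injective, fun i => hb'.root _,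
      fun i w hw => by rw [Complex.exp_add, hk, mul_one, hb'.exp_log _ w hw]⟩
  refine ⟨c.branchValue (fun i => τ' (σ i)) (fun i w => L' (σ i) w + k i), ?_,
    fun z'' hz'' => ⟨B, hBo, hz'', _, _, hb'', fun _ _ => rfl⟩⟩
  filter_upwards [hev, hUo.mem_nhds hzU] with w hw hwU
  rw [hf w hwU, branchValue, branchValue]
  refine Finset.sum_congr rfl fun i _ => ?_
  simp only [algPart, (hw i).1, (hw i).2]

/-- The period itself is a branch. -/
lemma isBranchAt_period {z : ℂ × ℂ} (hz : MvPolynomial.eval ![z.1, z.2] c.disc ≠ 0)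
    (hreg : z ∈ c.regularSet) : c.IsBranchAt z (c.period c.N 2) := by
  obtain ⟨U, hUo, hzU, τ, L, hb, hL⟩ := c.exists_isBranchOn hz
  refine ⟨U ∩ c.regularSet, hUo.inter c.isOpen_regularSet, ⟨hzU, hreg⟩, τ, L,
    hb.mono inter_subset_left, fun w hw => ?_⟩
  obtain ⟨hdeg, hq0, hs, -, -⟩ := c.spec_disc (hb.disc w hw.1)
  have hne : ∀ i, ∀ s ∈ Icc c.a c.b, (s : ℂ) ≠ τ i w := fun i s hs' h =>
    hw.2 s hs' (by rw [h]; exact hb.root i w hw.1)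
  have h1 : ∀ t ∈ uIcc c.a c.b, c.N.eval (t : ℂ) / (c.q w).eval (t : ℂ) ^ 2 =
      ∑ i, (c.N.eval (τ i w) / (c.q w).derivative.eval (τ i w) ^ 2 * (1 / ((t : ℂ) - τ i w) ^ 2) +
        residue c.N (c.q w) (τ i w) * (1 / ((t : ℂ) - τ i w))) := by
    intro t ht
    rw [uIcc_of_le c.a_lt_b.le] at ht
    rw [partial_fractions hdeg hq0 c.degree_N_lt (hb.injective w hw.1) (fun i => hb.root i w hw.1)
      (fun i => hs _ (hb.root i w hw.1)) (hw.2 t ht)]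
    simp only [mul_one_div]
  rw [period, intervalIntegral.integral_congr h1, intervalIntegral.integral_finsetSum, branchValue]
  · refine Finset.sum_congr rfl fun i _ => ?_
    obtain ⟨i1, e1⟩ := integral_inv_sub c.a_lt_b.le (hne i)
    obtain ⟨i2, e2⟩ := integral_inv_sub_sq c.a_lt_b.le (hne i)
    rw [intervalIntegral.integral_add (i2.const_mul _) (i1.const_mul _),
      intervalIntegral.integral_const_mul, intervalIntegral.integral_const_mul, e1, e2,
      hL hreg i w hw.1, algPart]
  · intro i _
    exact ((integral_inv_sub_sq c.a_lt_b.le (hne i)).1.const_mul _).add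
      ((integral_inv_sub c.a_lt_b.le (hne i)).1.const_mul _)

variable {c}

lemma IsBranchOn.isAlgebraicAt_root {U : Set (ℂ × ℂ)} {τ L : Fin c.deg → ℂ × ℂ → ℂ}
    (h : c.IsBranchOn U τ L) (hU : IsOpen U) {z : ℂ × ℂ} (hz : z ∈ U) (i : Fin c.deg) :
    IsAlgebraicAt (τ i) z := by
  refine ⟨h.analytic_root i z hz, c.qR, fun h0 => ?_, ?_⟩
  · have := c.map_qR (0, 0)
    rw [h0] at this
    exact c.W_ne_zero (by simpa [q] using this.symm)
  · filter_upwards [hU.mem_nhds hz] with w hw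
    rw [map_qR]
    exact h.root i w hw

lemma isAlgebraicAt_derivative_q {τ : ℂ × ℂ → ℂ} {z : ℂ × ℂ} (hτ : IsAlgebraicAt τ z) :
    IsAlgebraicAt (fun w => (c.q w).derivative.eval (τ w)) z ∧
      IsAlgebraicAt (fun w => (c.q w).derivative.derivative.eval (τ w)) z := by
  have hu : IsAlgebraicAt (fun w => w.1) z :=
    .of_mvPolynomial (MvPolynomial.X 0) z fun w => by simp
  have hv : IsAlgebraicAt (fun w => w.2) z :=
    .of_mvPolynomial (MvPolynomial.X 1) z fun w => by simp
  constructor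
  · simpa [q] using ((hτ.polynomial_eval c.W.derivative).sub
      (hu.mul (hτ.polynomial_eval c.X.derivative))).sub
      (hv.mul (hτ.polynomial_eval c.Y.derivative))
  · simpa [q] using ((hτ.polynomial_eval c.W.derivative.derivative).sub
      (hu.mul (hτ.polynomial_eval c.X.derivative.derivative))).sub
      (hv.mul (hτ.polynomial_eval c.Y.derivative.derivative))

lemma IsBranchOn.isAlgebraicAt {U : Set (ℂ × ℂ)} {τ L : Fin c.deg → ℂ × ℂ → ℂ}
    (h : c.IsBranchOn U τ L) (hU : IsOpen U) {z : ℂ × ℂ} (hz : z ∈ U) (i : Fin c.deg) :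
    IsAlgebraicAt (c.algPart (τ i)) z ∧
      IsAlgebraicAt (fun w => residue c.N (c.q w) (τ i w)) z ∧
      IsAlgebraicAt (fun w => (c.b - τ i w) / (c.a - τ i w)) z := by
  have hτ := h.isAlgebraicAt_root hU hz i
  obtain ⟨hq1, hq2⟩ := isAlgebraicAt_derivative_q (c := c) hτ
  obtain ⟨-, -, hs, -, -⟩ := c.spec_disc (h.disc z hz)
  have hne := hs _ (h.root i z hz)
  obtain ⟨ha0, hb0⟩ := endpoint_sub_ne_zero (h.disc z hz) (h.root i z hz)
  have ha := (IsAlgebraicAt.const (c.a : ℂ) z).sub hτ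
  have hb := (IsAlgebraicAt.const (c.b : ℂ) z).sub hτ
  refine ⟨?_, ?_, hb.div ha ha0⟩
  · exact ((hτ.polynomial_eval c.N).div (hq1.pow 2) (pow_ne_zero 2 hne)).mul
      (((IsAlgebraicAt.const 1 z).div ha ha0).sub ((IsAlgebraicAt.const 1 z).div hb hb0))
  · exact (((hτ.polynomial_eval c.N.derivative).mul hq1).sub
      ((hτ.polynomial_eval c.N).mul hq2)).div (hq1.pow 3) (pow_ne_zero 3 hne)

lemma IsBranchAt.analyticAt {z : ℂ × ℂ} {f : ℂ × ℂ → ℂ} (h : c.IsBranchAt z f) :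
    AnalyticAt ℂ f z := by
  obtain ⟨U, hU, hz, τ, L, hb, hf⟩ := h
  have : AnalyticAt ℂ (c.branchValue τ L) z := by
    refine Finset.analyticAt_fun_sum _ fun i _ => ?_
    exact (hb.isAlgebraicAt hU hz i).1.1.add
      ((hb.isAlgebraicAt hU hz i).2.1.1.mul (hb.analytic_log i z hz))
  refine this.congr ?_
  filter_upwards [hU.mem_nhds hz] with w hw
  exact (hf w hw).symm

end ReducedCurve

/-! ### Continuation along paths -/

lemma isElementaryAt_of_fintype {κ : Type*} [Fintype κ] {f : ℂ × ℂ → ℂ} {z : ℂ × ℂ}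
    {α₀ : ℂ × ℂ → ℂ} {α β L : κ → ℂ × ℂ → ℂ} (h0 : IsAlgebraicAt α₀ z)
    (h : ∀ k, IsAlgebraicAt (α k) z ∧ IsAlgebraicAt (β k) z ∧ AnalyticAt ℂ (L k) z ∧
      ∀ᶠ w in 𝓝 z, Complex.exp (L k w) = β k w)
    (hf : ∀ᶠ w in 𝓝 z, f w = α₀ w + ∑ k, α k w * L k w) : IsElementaryAt f z := by
  let e := (Fintype.equivFin κ).symm
  refine ⟨Fintype.card κ, α₀, fun k => α (e k), fun k => β (e k), fun k => L (e k), h0,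
    fun k => h (e k), ?_⟩
  filter_upwards [hf] with w hw
  rw [hw, Equiv.sum_comp e fun k => α k w * L k w]

lemma isElementaryAt_sum_branch {ι : Type*} [Fintype ι] {c : ι → ReducedCurve} {m : ι → ℂ}
    {f : ι → ℂ × ℂ → ℂ} {z : ℂ × ℂ} (h : ∀ j, (c j).IsBranchAt z (f j)) :
    IsElementaryAt (fun w => ∑ j, m j * f j w) z := by
  choose U hU hz τ L hb hf using h
  refine isElementaryAt_of_fintype (κ := Σ j, Fin (c j).deg)
    (α₀ := fun w => ∑ j, m j * ∑ i, (c j).algPart (τ j i) w)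
    (α := fun k w => m k.1 * residue (c k.1).N ((c k.1).q w) (τ k.1 k.2 w))
    (β := fun k w => ((c k.1).b - τ k.1 k.2 w) / ((c k.1).a - τ k.1 k.2 w))
    (L := fun k => L k.1 k.2) ?_ ?_ ?_
  · exact IsAlgebraicAt.finset_sum _ fun j _ => (IsAlgebraicAt.const _ z).mul
      (IsAlgebraicAt.finset_sum _ fun i _ => ((hb j).isAlgebraicAt (hU j) (hz j) i).1)
  · rintro ⟨j, i⟩
    refine ⟨(IsAlgebraicAt.const _ z).mul ((hb j).isAlgebraicAt (hU j) (hz j) i).2.1,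
      ((hb j).isAlgebraicAt (hU j) (hz j) i).2.2, (hb j).analytic_log i z (hz j), ?_⟩
    filter_upwards [(hU j).mem_nhds (hz j)] with w hw
    exact (hb j).exp_log i w hw
  · have : ∀ᶠ w in 𝓝 z, ∀ j, w ∈ U j := eventually_all.2 fun j => (hU j).mem_nhds (hz j)
    filter_upwards [this] with w hw
    rw [Fintype.sum_sigma, ← Finset.sum_add_distrib]
    refine Finset.sum_congr rfl fun j _ => ?_
    rw [hf j w (hw j), ReducedCurve.branchValue, Finset.sum_add_distrib, mul_add, Finset.mul_sum,
      Finset.mul_sum]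
    congr 1
    exact Finset.sum_congr rfl fun i _ => (mul_assoc _ _ _).symm

/-- A class of germs that extend to a fixed neighbourhood of every point can be continued along
paths. -/
lemma exists_continuation {Good : ℂ × ℂ → (ℂ × ℂ → ℂ) → Prop} {η : C(unitInterval, ℂ × ℂ)}
    (hext : ∀ t, ∃ B : Set (ℂ × ℂ), IsOpen B ∧ η t ∈ B ∧ ∀ z' ∈ B, ∀ f, Good z' f →
      ∃ g, f =ᶠ[𝓝 z'] g ∧ ∀ z'' ∈ B, Good z'' g)
    {F : ℂ × ℂ → ℂ} (h0 : Good (η 0) F) :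
    ∃ f : unitInterval → ℂ × ℂ → ℂ, f 0 =ᶠ[𝓝 (η 0)] F ∧ (∀ t, Good (η t) (f t)) ∧
      ∀ t, ∀ᶠ s in 𝓝 t, f s =ᶠ[𝓝 (η s)] f t := by
  choose B hBo hηB hB using hext
  -- A subdivision of the path into finitely many pieces, each inside one of the uniform
  -- neighbourhoods.
  obtain ⟨t, ht0, htm, ⟨n, hn⟩, hcov⟩ := exists_monotone_Icc_subset_open_cover_unitInterval
    (c := fun s => η ⁻¹' B s) (fun s => (hBo s).preimage η.continuous)
    (fun s _ => mem_iUnion.2 ⟨s, hηB s⟩)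
  -- The continuation is built up to `t n`; at the last parameter compatibility is only asked from
  -- the left.
  have key : ∀ n, ∃ f : unitInterval → ℂ × ℂ → ℂ, f 0 =ᶠ[𝓝 (η 0)] F ∧
      (∀ s ≤ t n, Good (η s) (f s)) ∧
      ∀ s ≤ t n, ∀ᶠ r in 𝓝 s, r ≤ t n → f r =ᶠ[𝓝 (η r)] f s := by
    intro n
    induction n with
    | zero =>
      refine ⟨fun _ => F, EventuallyEq.rfl, fun s hs => ?_, fun s _ => ?_⟩
      · rw [ht0] at hs
        rw [le_antisymm hs bot_le]
        exact h0
      · exact Eventually.of_forall fun _ _ => EventuallyEq.rfl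
    | succ n ih =>
      obtain ⟨f, hf0, hfg, hfc⟩ := ih
      obtain ⟨i, hi⟩ := hcov n
      have hmem : ∀ s, t n ≤ s → s ≤ t (n + 1) → η s ∈ B i := fun s h1 h2 => hi ⟨h1, h2⟩
      obtain ⟨g, hg, hgB⟩ := hB i _ (hmem _ le_rfl (htm n.le_succ)) _ (hfg _ le_rfl)
      refine ⟨fun s => if s ≤ t n then f s else g, ?_, fun s hs => ?_, fun s hs => ?_⟩
      · simp only [if_pos (show (0 : unitInterval) ≤ t n from bot_le)]
        exact hf0
      · by_cases h : s ≤ t n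
        · simp only [if_pos h]; exact hfg s h
        · simp only [if_neg h]; exact hgB _ (hmem s (not_le.1 h).le hs)
      · rcases lt_trichotomy s (t n) with h | h | h
        · filter_upwards [hfc s h.le, Iic_mem_nhds h] with r hr hrn _
          simp only [if_pos h.le, if_pos (show r ≤ t n from hrn)]
          exact hr hrn
        -- At the junction the old germ and its extension agree on a neighbourhood in the plane,
        -- which also contains the nearby points of the path.
        · have hg' : ∀ᶠ r in 𝓝 s, f s =ᶠ[𝓝 (η r)] g := by
            rw [← h] at hg
            exact η.continuous.continuousAt.eventually hg.eventually_nhds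
          filter_upwards [hfc s h.le, hg'] with r hr hrg _
          simp only [if_pos h.le]
          by_cases hrn : r ≤ t n
          · simp only [if_pos hrn]; exact hr hrn
          · simp only [if_neg hrn]; exact hrg.symm
        · filter_upwards [Ioi_mem_nhds h] with r hr _
          simp only [if_neg (not_le.2 h), if_neg (not_le.2 (show t n < r from hr))]
          exact EventuallyEq.rfl
  obtain ⟨f, hf0, hfg, hfc⟩ := key n
  rw [hn n le_rfl] at hfg hfc
  exact ⟨f, hf0, fun s => hfg s le_top, fun s => (hfc s le_top).mono fun r hr => hr le_top⟩

/-- A linear combination of periods continues along all paths off the discriminants, as an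
elementary function. -/
lemma exists_elementary_continuation {ι : Type*} [Fintype ι] {c : ι → ReducedCurve} {m : ι → ℂ}
    {F : ℂ × ℂ → ℂ} {U : Set (ℂ × ℂ)} (hU : IsOpen U) (hUc : ∀ j, U ⊆ (c j).regularSet)
    (hF : ∀ w ∈ U, F w = ∑ j, m j * (c j).period (c j).N 2 w) {η : C(unitInterval, ℂ × ℂ)}
    (h0 : η 0 ∈ U) (hη : ∀ t j, MvPolynomial.eval ![(η t).1, (η t).2] (c j).disc ≠ 0) :
    ∃ f : unitInterval → ℂ × ℂ → ℂ, IsContinuationAlong F η f ∧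
      ∀ t, IsElementaryAt (f t) (η t) := by
  choose f hf0 hfg hfc using fun j => exists_continuation (Good := (c j).IsBranchAt) (η := η)
    (fun t => (c j).exists_extension (hη t j))
    ((c j).isBranchAt_period (hη 0 j) (hUc j h0))
  refine ⟨fun t w => ∑ j, m j * f j t w, ⟨?_, fun t => ?_, fun t => ?_⟩, fun t =>
    isElementaryAt_sum_branch fun j => hfg j t⟩
  · have : ∀ᶠ w in 𝓝 (η 0), ∀ j, f j 0 w = (c j).period (c j).N 2 w :=
      eventually_all.2 hf0
    filter_upwards [this, hU.mem_nhds h0] with w hw hwU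
    simp only [hF w hwU, hw]
  · exact Finset.analyticAt_fun_sum _ fun j _ => analyticAt_const.mul (hfg j t).analyticAt
  · have : ∀ᶠ s in 𝓝 t, ∀ j, f j s =ᶠ[𝓝 (η s)] f j t := eventually_all.2 fun j => hfc j t
    filter_upwards [this] with s hs
    have : ∀ᶠ w in 𝓝 (η s), ∀ j, f j s w = f j t w := eventually_all.2 hs
    filter_upwards [this] with w hw
    simp only [hw]

/-! ### Values of rational functions -/

namespace HasValueAt

variable {R S : RationalFunctions} {w : ℂ × ℂ} {c d : ℂ}

lemma algebraMap_ne_zero {D : MvPolynomial (Fin 2) ℝ}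
    (h : MvPolynomial.aeval ![w.1, w.2] D ≠ 0) :
    algebraMap (MvPolynomial (Fin 2) ℝ) RationalFunctions D ≠ 0 := by
  intro h0
  rw [(FaithfulSMul.algebraMap_injective _ RationalFunctions).eq_iff' (map_zero _)] at h0
  rw [h0, map_zero] at h
  exact h rfl

lemma of_polynomial (p : MvPolynomial (Fin 2) ℝ) (w : ℂ × ℂ) :
    HasValueAt (algebraMap _ RationalFunctions p) w (MvPolynomial.aeval ![w.1, w.2] p) :=
  ⟨p, 1, by simp, by simp, by simp⟩

lemma add (h : HasValueAt R w c) (h' : HasValueAt S w d) : HasValueAt (R + S) w (c + d) := by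
  obtain ⟨N, D, hD, rfl, rfl⟩ := h
  obtain ⟨N', D', hD', rfl, rfl⟩ := h'
  refine ⟨N * D' + D * N', D * D', ?_, ?_, ?_⟩
  · rw [map_mul]; exact mul_ne_zero hD hD'
  · rw [div_add_div _ _ (algebraMap_ne_zero hD) (algebraMap_ne_zero hD')]
    simp only [map_add, map_mul]
  · rw [div_add_div _ _ hD hD']
    simp only [map_add, map_mul]

lemma mul (h : HasValueAt R w c) (h' : HasValueAt S w d) : HasValueAt (R * S) w (c * d) := by
  obtain ⟨N, D, hD, rfl, rfl⟩ := h
  obtain ⟨N', D', hD', rfl, rfl⟩ := h'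
  refine ⟨N * N', D * D', ?_, ?_, ?_⟩
  · rw [map_mul]; exact mul_ne_zero hD hD'
  · rw [div_mul_div_comm]; simp only [map_mul]
  · rw [div_mul_div_comm]; simp only [map_mul]

lemma finset_sum {κ : Type*} (s : Finset κ) {R : κ → RationalFunctions} {c : κ → ℂ}
    (h : ∀ k ∈ s, HasValueAt (R k) w (c k)) : HasValueAt (∑ k ∈ s, R k) w (∑ k ∈ s, c k) := by
  classical
  induction s using Finset.induction_on with
  | empty => simpa using of_polynomial 0 w
  | insert k s hk ih =>
    rw [Finset.sum_insert hk, Finset.sum_insert hk]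
    exact (h k (Finset.mem_insert_self _ _)).add (ih fun i hi => h i (Finset.mem_insert_of_mem hi))

lemma of_real (k : ℝ) (w : ℂ × ℂ) :
    HasValueAt (algebraMap (MvPolynomial (Fin 2) ℝ) RationalFunctions (MvPolynomial.C k)) w
      (k : ℂ) := by
  have := of_polynomial (MvPolynomial.C k) w
  rwa [MvPolynomial.aeval_C] at this

end HasValueAt

/-- `1 - ⟨p, X⟩`. -/
def linForm (p : ℝ × ℝ) : MvPolynomial (Fin 2) ℝ :=
  1 - MvPolynomial.C p.1 * MvPolynomial.X 0 - MvPolynomial.C p.2 * MvPolynomial.X 1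

lemma aeval_linForm (p : ℝ × ℝ) (w : ℂ × ℂ) :
    MvPolynomial.aeval ![w.1, w.2] (linForm p) = Q w p := by
  simp [linForm, Q, mul_comm]

lemma eval_linForm (p w : ℝ × ℝ) :
    MvPolynomial.eval ![w.1, w.2] (linForm p) = 1 - (p.1 * w.1 + p.2 * w.2) := by
  simp [linForm]; ring

/-! ### Arcs on lines -/

namespace RationalArc

variable {γ : RationalArc}

lemma point_mem_image (γ : RationalArc) {t : ℝ} (ht : t ∈ Icc γ.a γ.b) : γ.point t ∈ γ.image :=
  ⟨t, ht, rfl⟩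

lemma exists_direction (h : Collinear ℝ γ.image) :
    ∃ v : ℝ × ℝ, v ≠ 0 ∧ (∀ s ∈ Icc γ.a γ.b, ∀ t ∈ Icc γ.a γ.b,
      cross v (γ.point s - γ.point t) = 0) ∧ ∀ t ∈ Ioo γ.a γ.b, cross v (γ.vel t) = 0 := by
  have ha : γ.a ∈ Icc γ.a γ.b := left_mem_Icc.2 γ.a_lt_b.le
  obtain ⟨v, hv⟩ := (collinear_iff_of_mem (γ.point_mem_image ha)).1 h
  have h1 : ∀ s ∈ Icc γ.a γ.b, ∃ r : ℝ, γ.point s = r • v + γ.point γ.a := fun s hs =>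
    hv _ (γ.point_mem_image hs)
  have h2 : ∀ s ∈ Icc γ.a γ.b, ∀ t ∈ Icc γ.a γ.b, cross v (γ.point s - γ.point t) = 0 := by
    intro s hs t ht
    obtain ⟨r, hr⟩ := h1 s hs
    obtain ⟨r', hr'⟩ := h1 t ht
    have : γ.point s - γ.point t = (r - r') • v := by rw [hr, hr', sub_smul]; abel
    rw [this, cross_smul_right, cross_self, mul_zero]
  refine ⟨v, ?_, h2, ?_⟩
  · rintro rfl
    have hm : (γ.a + γ.b) / 2 ∈ Ioo γ.a γ.b := by
      have := γ.a_lt_b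
      constructor <;> linarith
    obtain ⟨r, hr⟩ := h1 _ (Ioo_subset_Icc_self hm)
    rw [smul_zero, zero_add] at hr
    exact hm.1.ne (γ.point_injective hm ha hr.symm)
  · intro t ht
    have hd := hasDerivAt_cross v
      ((γ.hasDerivAt_point (Ioo_subset_Icc_self ht)).sub_const (γ.point γ.a))
    have hz : (fun s => cross v (γ.point s - γ.point γ.a)) =ᶠ[𝓝 t] fun _ => 0 := by
      filter_upwards [Icc_mem_nhds ht.1 ht.2] with s hs
      exact h2 s hs _ ha
    exact hd.unique ((hasDerivAt_const t (0 : ℝ)).congr_of_eventuallyEq hz)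

lemma cross_eq_zero_of_parallel {v d e : ℝ × ℝ} (hv : v ≠ 0) (hd : cross v d = 0)
    (he : cross v e = 0) : cross d e = 0 := by
  simp only [cross] at *
  by_cases h1 : v.1 = 0
  · have h2 : v.2 ≠ 0 := fun h2 => hv (Prod.ext h1 h2)
    have h3 : d.1 = 0 := by simpa [h1, h2] using hd
    have h4 : e.1 = 0 := by simpa [h1, h2] using he
    simp [h3, h4]
  · refine mul_left_cancel₀ h1 ?_
    linear_combination d.1 * he - e.1 * hd

lemma cross_vel_eq_zero (h : Collinear ℝ γ.image) {s t : ℝ} (hs : s ∈ Icc γ.a γ.b)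
    (ht : t ∈ Ioo γ.a γ.b) : cross (γ.point t - γ.point s) (γ.vel t) = 0 := by
  obtain ⟨v, hv, h1, h2⟩ := exists_direction h
  exact cross_eq_zero_of_parallel hv (h1 t (Ioo_subset_Icc_self ht) s hs) (h2 t ht)

lemma hasDerivAt_Q_point (γ : RationalArc) (w : ℂ × ℂ) {t : ℝ} (ht : t ∈ Icc γ.a γ.b) :
    HasDerivAt (fun s => Q w (γ.point s))
      (-(w.1 * ((deriv γ.x t : ℝ) : ℂ) + w.2 * ((deriv γ.y t : ℝ) : ℂ))) t := by
  have h1 := (γ.hasDerivAt_x ht).ofReal_comp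
  have h2 := (γ.hasDerivAt_y ht).ofReal_comp
  refine (((h1.const_mul w.1).const_sub 1).sub (h2.const_mul w.2)).congr_deriv ?_
  ring

/-- The integral of a linear one-form with constant coefficients over an arc on a line. -/
lemma integral_of_collinear (h : Collinear ℝ γ.image) (α β : ℝ) {w : ℂ × ℂ}
    (hw : ∀ p ∈ γ.image, Q w p ≠ 0) :
    ∫ t in γ.a..γ.b, ((α * deriv γ.x t + β * deriv γ.y t : ℝ) : ℂ) / Q w (γ.point t) ^ 2 =
      ((α * (γ.x γ.b - γ.x γ.a) + β * (γ.y γ.b - γ.y γ.a) : ℝ) : ℂ) /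
        (Q w (γ.point γ.a) * Q w (γ.point γ.b)) := by
  have ha : γ.a ∈ Icc γ.a γ.b := left_mem_Icc.2 γ.a_lt_b.le
  have hQ : ∀ t ∈ Icc γ.a γ.b, Q w (γ.point t) ≠ 0 := fun t ht => hw _ (γ.point_mem_image ht)
  have hQc : ContinuousOn (fun t => Q w (γ.point t)) (Icc γ.a γ.b) :=
    (continuous_Q w).comp_continuousOn γ.continuousOn_point
  -- A primitive on a line: the displacement from the initial point over the product of the values
  -- of Q at the initial and the moving point.
  set f : ℝ → ℂ := fun t => ((α * (γ.x t - γ.x γ.a) + β * (γ.y t - γ.y γ.a) : ℝ) : ℂ) /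
    (Q w (γ.point γ.a) * Q w (γ.point t)) with hf
  have hfc : ContinuousOn f (Icc γ.a γ.b) := by
    refine ContinuousOn.div ?_ (continuousOn_const.mul hQc)
      fun t ht => mul_ne_zero (hQ _ ha) (hQ t ht)
    refine Complex.continuous_ofReal.comp_continuousOn ?_
    exact (continuousOn_const.mul (γ.continuousOn_x.sub continuousOn_const)).add
      (continuousOn_const.mul (γ.continuousOn_y.sub continuousOn_const))
  have hInt : IntervalIntegrable (fun t => ((α * deriv γ.x t + β * deriv γ.y t : ℝ) : ℂ) /
      Q w (γ.point t) ^ 2) volume γ.a γ.b := by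
    refine ContinuousOn.intervalIntegrable_of_Icc γ.a_lt_b.le ?_
    refine ContinuousOn.div ?_ (hQc.pow 2) fun t ht => pow_ne_zero 2 (hQ t ht)
    refine Complex.continuous_ofReal.comp_continuousOn ?_
    exact (continuousOn_const.mul γ.continuousOn_deriv_x).add
      (continuousOn_const.mul γ.continuousOn_deriv_y)
  rw [intervalIntegral.integral_eq_sub_of_hasDerivAt_of_le γ.a_lt_b.le hfc (fun t ht => ?_) hInt]
  · simp [hf]
  · have ht' := Ioo_subset_Icc_self ht
    have h1 := (γ.hasDerivAt_x ht').sub_const (γ.x γ.a)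
    have h2 := (γ.hasDerivAt_y ht').sub_const (γ.y γ.a)
    have h3 := ((h1.const_mul α).add (h2.const_mul β)).ofReal_comp
    have hd := h3.div ((γ.hasDerivAt_Q_point w ht').const_mul (Q w (γ.point γ.a)))
      (mul_ne_zero (hQ _ ha) (hQ t ht'))
    refine hd.congr_deriv ?_
    have hcr := cross_vel_eq_zero h ha ht
    have hcr' : ((γ.x t : ℂ) - γ.x γ.a) * ((deriv γ.y t : ℝ) : ℂ) -
        ((γ.y t : ℂ) - γ.y γ.a) * ((deriv γ.x t : ℝ) : ℂ) = 0 := by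
      simp only [cross, RationalArc.point, RationalArc.vel, Prod.fst_sub, Prod.snd_sub] at hcr
      exact_mod_cast hcr
    have hQa := hQ _ ha
    have hQt := hQ t ht'
    have e1 : Q w (γ.point γ.a) = 1 - w.1 * (γ.x γ.a : ℂ) - w.2 * (γ.y γ.a : ℂ) := rfl
    have e2 : Q w (γ.point t) = 1 - w.1 * (γ.x t : ℂ) - w.2 * (γ.y t : ℂ) := rfl
    rw [div_eq_div_iff (pow_ne_zero 2 (mul_ne_zero hQa hQt)) (pow_ne_zero 2 hQt)]
    -- The two sides differ by αv - βu times the determinant of displacement and velocity, which is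
    -- zero on a line.
    have key : (α * ((deriv γ.x t : ℝ) : ℂ) + β * ((deriv γ.y t : ℝ) : ℂ)) * Q w (γ.point t) +
        (α * ((γ.x t : ℂ) - γ.x γ.a) + β * ((γ.y t : ℂ) - γ.y γ.a)) *
        (w.1 * ((deriv γ.x t : ℝ) : ℂ) + w.2 * ((deriv γ.y t : ℝ) : ℂ)) =
        (α * ((deriv γ.x t : ℝ) : ℂ) + β * ((deriv γ.y t : ℝ) : ℂ)) * Q w (γ.point γ.a) := by
      rw [e1, e2]
      linear_combination (α * w.2 - β * w.1) * hcr'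
    simp only [Pi.add_apply]
    push_cast
    linear_combination Q w (γ.point γ.a) * Q w (γ.point t) ^ 2 * key

lemma arcIntegralDx_of_collinear (h : Collinear ℝ γ.image) {w : ℂ × ℂ}
    (hw : ∀ p ∈ γ.image, Q w p ≠ 0) : arcIntegralDx γ w =
      ((γ.x γ.b - γ.x γ.a : ℝ) : ℂ) / (Q w (γ.point γ.a) * Q w (γ.point γ.b)) := by
  simpa [arcIntegralDx] using integral_of_collinear h 1 0 hw

lemma arcIntegralDy_of_collinear (h : Collinear ℝ γ.image) {w : ℂ × ℂ}
    (hw : ∀ p ∈ γ.image, Q w p ≠ 0) : arcIntegralDy γ w =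
      ((γ.y γ.b - γ.y γ.a : ℝ) : ℂ) / (Q w (γ.point γ.a) * Q w (γ.point γ.b)) := by
  simpa [arcIntegralDy] using integral_of_collinear h 0 1 hw

/-- On a line the Euler form agrees with the form whose coefficients are frozen at the initial
point, because displacement and velocity are parallel. -/
lemma integral_euler_of_collinear (h : Collinear ℝ γ.image) {w : ℂ × ℂ}
    (hw : ∀ p ∈ γ.image, Q w p ≠ 0) :
    ∫ t in γ.a..γ.b, ((γ.x t * deriv γ.y t - γ.y t * deriv γ.x t : ℝ) : ℂ) /
        Q w (γ.point t) ^ 2 =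
      ((cross (γ.point γ.a) (γ.point γ.b) : ℝ) : ℂ) /
        (Q w (γ.point γ.a) * Q w (γ.point γ.b)) := by
  have ha : γ.a ∈ Icc γ.a γ.b := left_mem_Icc.2 γ.a_lt_b.le
  have h1 := integral_of_collinear h (-γ.y γ.a) (γ.x γ.a) hw
  have h2 : cross (γ.point γ.a) (γ.point γ.b) =
      -γ.y γ.a * (γ.x γ.b - γ.x γ.a) + γ.x γ.a * (γ.y γ.b - γ.y γ.a) := by
    simp only [cross, RationalArc.point]; ring
  rw [h2, ← h1]
  rw [intervalIntegral.integral_of_le γ.a_lt_b.le, intervalIntegral.integral_of_le γ.a_lt_b.le,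
    integral_Ioc_eq_integral_Ioo, integral_Ioc_eq_integral_Ioo]
  refine setIntegral_congr_fun measurableSet_Ioo fun t ht => ?_
  have hcr := cross_vel_eq_zero h ha ht
  simp only [cross, RationalArc.point, RationalArc.vel, Prod.fst_sub, Prod.snd_sub] at hcr
  have : γ.x t * deriv γ.y t - γ.y t * deriv γ.x t =
      -γ.y γ.a * deriv γ.x t + γ.x γ.a * deriv γ.y t := by linear_combination hcr
  simp only [this]

/-- The interior points of an arc on a line are not extreme points. -/
lemma not_mem_extremePoints (h : Collinear ℝ γ.image) {K : Set (ℝ × ℝ)} (hK : γ.image ⊆ K) {t : ℝ}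
    (ht : t ∈ Ioo γ.a γ.b) : γ.point t ∉ K.extremePoints ℝ := by
  intro hext
  obtain ⟨v, hv, h1, h2⟩ := exists_direction h
  have ht' := Ioo_subset_Icc_self ht
  set e := γ.vel t with he
  have he0 : e ≠ 0 := γ.vel_ne_zero ht
  have hpos : 0 < cross e (-e.2, e.1) := by
    have : e.1 ≠ 0 ∨ e.2 ≠ 0 := by
      by_contra! hh
      exact he0 (Prod.ext hh.1 hh.2)
    simp only [cross]
    rcases this with h | h <;> nlinarith [mul_self_pos.2 h, mul_self_nonneg e.1, mul_self_nonneg e.2]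
  -- the coordinate along the line
  set f : ℝ → ℝ := fun s => cross (e.2, -e.1) (γ.point s - γ.point t) with hf
  have hd : HasDerivAt f (cross (e.2, -e.1) e) t :=
    hasDerivAt_cross _ ((γ.hasDerivAt_point ht').sub_const (γ.point t))
  have hd0 : 0 < cross (e.2, -e.1) e := by simp only [cross] at *; linarith
  have hpar : ∀ s ∈ Icc γ.a γ.b, γ.point s = γ.point t + (f s / cross (e.2, -e.1) e) • e := by
    intro s hs
    have hc := cross_eq_zero_of_parallel hv (h1 s hs t ht') (h2 t ht)
    rw [← he] at hc
    simp only [cross, Prod.fst_sub, Prod.snd_sub] at hc hd0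
    refine Prod.ext ?_ ?_
    · simp only [Prod.fst_add, Prod.smul_fst, smul_eq_mul, hf, cross, Prod.fst_sub, Prod.snd_sub]
      rw [div_mul_eq_mul_div, ← sub_eq_iff_eq_add', eq_div_iff hd0.ne']
      linear_combination e.2 * hc
    · simp only [Prod.snd_add, Prod.smul_snd, smul_eq_mul, hf, cross, Prod.fst_sub, Prod.snd_sub]
      rw [div_mul_eq_mul_div, ← sub_eq_iff_eq_add', eq_div_iff hd0.ne']
      linear_combination -e.1 * hc
  have hft : f t = 0 := by simp [hf, cross]
  -- The coordinate along the line has positive derivative, so it takes both signs near `t`, and the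
  -- point lies strictly between two other points of the arc.
  have hslope := hasDerivAt_iff_tendsto_slope.1 hd
  have hev := hslope.eventually_const_lt hd0
  have hIcc : ∀ᶠ s in 𝓝 t, s ∈ Icc γ.a γ.b := Icc_mem_nhds ht.1 ht.2
  obtain ⟨s₁, ⟨hs₁, hs₁I⟩, hs₁t⟩ := ((hev.filter_mono (nhdsGT_le_nhdsNE t)).and
    (hIcc.filter_mono nhdsWithin_le_nhds) |>.and self_mem_nhdsWithin).exists
  obtain ⟨s₂, ⟨hs₂, hs₂I⟩, hs₂t⟩ := ((hev.filter_mono (nhdsLT_le_nhdsNE t)).and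
    (hIcc.filter_mono nhdsWithin_le_nhds) |>.and self_mem_nhdsWithin).exists
  have hs₁t' : t < s₁ := hs₁t
  have hs₂t' : s₂ < t := hs₂t
  rw [slope_def_field, hft, sub_zero] at hs₁ hs₂
  have hf1 : 0 < f s₁ := by
    rcases div_pos_iff.1 hs₁ with h | h
    · exact h.1
    · linarith [h.2]
  have hf2 : f s₂ < 0 := by
    rcases div_pos_iff.1 hs₂ with h | h
    · linarith [h.2]
    · exact h.1
  have hseg : γ.point t ∈ openSegment ℝ (γ.point s₂) (γ.point s₁) := by
    have hne : f s₁ - f s₂ ≠ 0 := by linarith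
    refine ⟨f s₁ / (f s₁ - f s₂), -f s₂ / (f s₁ - f s₂), div_pos hf1 (by linarith),
      div_pos (by linarith) (by linarith), by field_simp; ring, ?_⟩
    rw [hpar s₁ hs₁I, hpar s₂ hs₂I]
    ext
    · simp; field_simp; ring
    · simp; field_simp; ring
  have := (mem_extremePoints.1 hext).2 _ (hK (γ.point_mem_image hs₂I)) _
    (hK (γ.point_mem_image hs₁I)) hseg
  exact hs₁t'.ne' (γ.point_injective ht hs₁I this.2)

end RationalArc

/-! ### Line segments as arcs -/

lemma segment_injective {p q : ℝ × ℝ} (h : p ≠ q) : Function.Injective fun t : ℝ =>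
    ((Polynomial.C p.1 + Polynomial.C (q.1 - p.1) * Polynomial.X).eval t /
      (1 : Polynomial ℝ).eval t,
      (Polynomial.C p.2 + Polynomial.C (q.2 - p.2) * Polynomial.X).eval t /
      (1 : Polynomial ℝ).eval t) := by
  intro s t hst
  by_contra hne
  simp only [Polynomial.eval_add, Polynomial.eval_C, Polynomial.eval_mul, Polynomial.eval_X,
    Polynomial.eval_one, div_one, Prod.mk.injEq, add_right_inj] at hst
  have hst' := sub_ne_zero.2 hne
  have key : ∀ c d : ℝ, (d - c) * s = (d - c) * t → c = d := fun c d hcd => by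
    have h0 : (d - c) * (s - t) = 0 := by linear_combination hcd
    linarith [(mul_eq_zero.1 h0).resolve_right hst']
  exact h (Prod.ext (key _ _ hst.1) (key _ _ hst.2))

/-- The line segment from `p` to `q` as an arc. -/
def segmentArc (p q : ℝ × ℝ) (h : p ≠ q) : RationalArc where
  X := Polynomial.C p.1 + Polynomial.C (q.1 - p.1) * Polynomial.X
  Y := Polynomial.C p.2 + Polynomial.C (q.2 - p.2) * Polynomial.X
  W := 1
  a := 0
  b := 1
  a_lt_b := one_pos
  W_ne_zero := by simp
  injOn_Ico := (segment_injective h).injOn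
  injOn_Ioc := (segment_injective h).injOn
  regular := by
    rintro t - ⟨h1, h2⟩
    have hd : ∀ c e : ℝ, deriv (fun s : ℝ => (Polynomial.C c + Polynomial.C e *
        Polynomial.X).eval s / (1 : Polynomial ℝ).eval s) t = e := by
      intro c e
      have : (fun s : ℝ => (Polynomial.C c + Polynomial.C e * Polynomial.X).eval s /
          (1 : Polynomial ℝ).eval s) = fun s => c + e * s := by ext s; simp
      rw [this]
      simp
    rw [hd] at h1 h2
    exact h (Prod.ext (by linarith) (by linarith))

lemma segmentArc_point (p q : ℝ × ℝ) (h : p ≠ q) (t : ℝ) :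
    (segmentArc p q h).point t = p + t • (q - p) := by
  ext <;> simp [segmentArc, RationalArc.point, RationalArc.x, RationalArc.y, mul_comm]

lemma segmentArc_vel (p q : ℝ × ℝ) (h : p ≠ q) (t : ℝ) : (segmentArc p q h).vel t = q - p := by
  have hx : (segmentArc p q h).x = fun s => p.1 + (q.1 - p.1) * s := by
    ext s; simp [segmentArc, RationalArc.x]
  have hy : (segmentArc p q h).y = fun s => p.2 + (q.2 - p.2) * s := by
    ext s; simp [segmentArc, RationalArc.y]
  ext
  · simp only [RationalArc.vel, hx]
    simp
  · simp only [RationalArc.vel, hy]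
    simp

lemma segmentArc_image (p q : ℝ × ℝ) (h : p ≠ q) : (segmentArc p q h).image = segment ℝ p q := by
  rw [segment_eq_image']
  exact image_congr fun t _ => segmentArc_point p q h t

lemma segmentArc_openImage (p q : ℝ × ℝ) (h : p ≠ q) :
    (segmentArc p q h).openImage = openSegment ℝ p q := by
  rw [openSegment_eq_image']
  exact image_congr fun t _ => segmentArc_point p q h t

lemma collinear_segmentArc (p q : ℝ × ℝ) (h : p ≠ q) : Collinear ℝ (segmentArc p q h).image := by
  rw [segmentArc_image, collinear_iff_exists_forall_eq_smul_vadd]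
  refine ⟨p, q - p, fun x hx => ?_⟩
  rw [segment_eq_image'] at hx
  obtain ⟨t, -, rfl⟩ := hx
  exact ⟨t, by rw [vadd_eq_add, add_comm]⟩

/-! ### Polygons -/

lemma RationalArc.exists_hasValueAt_div (γ : RationalArc) (k : ℝ) (S : Set (ℂ × ℂ))
    (hS : ∀ w ∈ S, ∀ p ∈ γ.image, Q w p ≠ 0) : ∃ R : RationalFunctions, ∀ w ∈ S,
      HasValueAt R w ((k : ℂ) / (Q w (γ.point γ.a) * Q w (γ.point γ.b))) := by
  refine ⟨algebraMap _ _ (MvPolynomial.C k) /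
    algebraMap _ _ (linForm (γ.point γ.a) * linForm (γ.point γ.b)), fun w hw =>
    ⟨_, _, ?_, rfl, ?_⟩⟩
  · rw [map_mul, aeval_linForm, aeval_linForm]
    exact mul_ne_zero (hS w hw _ (γ.point_mem_image (left_mem_Icc.2 γ.a_lt_b.le)))
      (hS w hw _ (γ.point_mem_image (right_mem_Icc.2 γ.a_lt_b.le)))
  · rw [map_mul, aeval_linForm, aeval_linForm, MvPolynomial.aeval_C]
    rfl

/-- The Euler form is used because the formulas with dx or dy would leave a factor 1/v or 1/u, and
thus an apparent pole on an axis. -/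
lemma ArcBoundary.exists_hasValueAt_fantappie {ι : Type*} [Fintype ι] {P : Set (ℝ × ℝ)}
    {γ : ι → RationalArc} {l r : ι → ℤ} (hP : ArcBoundary P γ)
    (hl : ∀ j, ∀ t ∈ Ioo (γ j).a (γ j).b, SideValue P (γ j) 1 t (l j))
    (hr : ∀ j, ∀ t ∈ Ioo (γ j).a (γ j).b, SideValue P (γ j) (-1) t (r j))
    (hγ : ∀ j, Collinear ℝ (γ j).image) :
    ∃ R : RationalFunctions, ∀ w ∈ params P, HasValueAt R w (fantappie P w) := by
  have hQ : ∀ j, ∀ w ∈ params P, ∀ p ∈ (γ j).image, Q w p ≠ 0 := by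
    rintro j w hw p ⟨t, ht, rfl⟩
    exact hw _ (hP.point_mem_closure j ht)
  choose R hR using fun j => (γ j).exists_hasValueAt_div
    (cross ((γ j).point (γ j).a) ((γ j).point (γ j).b)) (params P) (hQ j)
  refine ⟨∑ j, algebraMap (MvPolynomial (Fin 2) ℝ) _ (MvPolynomial.C ((l j - r j : ℤ) : ℝ)) * R j, fun w hw => ?_⟩
  rw [hP.fantappie_eq_sum hl hr hw]
  refine HasValueAt.finset_sum _ fun j _ => ?_
  rw [RationalArc.integral_euler_of_collinear (hγ j) (hQ j w hw)]
  have := (HasValueAt.of_real ((l j - r j : ℤ) : ℝ) w).mul (hR j w hw)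
  rwa [Complex.ofReal_intCast] at this

/-! ### Convex polygons and their polars -/

/-- The pairing of a point with a covector. -/
def dot (p w : ℝ × ℝ) : ℝ := p.1 * w.1 + p.2 * w.2

/-- Rotation by a right angle. -/
def rot (v : ℝ × ℝ) : ℝ × ℝ := (-v.2, v.1)

lemma dot_rot (u v : ℝ × ℝ) : dot u (rot v) = cross v u := by simp [dot, rot, cross]; ring

lemma dot_add_right (u v w : ℝ × ℝ) : dot u (v + w) = dot u v + dot u w := by simp [dot]; ring

lemma dot_smul_right (c : ℝ) (u v : ℝ × ℝ) : dot u (c • v) = c * dot u v := by simp [dot]; ring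

lemma dot_add_left (u v w : ℝ × ℝ) : dot (u + v) w = dot u w + dot v w := by simp [dot]; ring

lemma dot_smul_left (c : ℝ) (u v : ℝ × ℝ) : dot (c • u) v = c * dot u v := by simp [dot]; ring

lemma dot_self_pos {w : ℝ × ℝ} (hw : w ≠ 0) : 0 < dot w w := by
  have : w.1 ≠ 0 ∨ w.2 ≠ 0 := by
    by_contra! hh
    exact hw (Prod.ext hh.1 hh.2)
  simp only [dot]
  rcases this with h | h <;>
    nlinarith [mul_self_pos.2 h, mul_self_nonneg w.1, mul_self_nonneg w.2]

lemma cross_swap (u v : ℝ × ℝ) : cross u v = -cross v u := by simp [cross]; ring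

/-- Two points on a line `⟨·, v⟩ = c` differ by a multiple of the rotated vector. -/
lemma eq_add_smul_rot {v x y : ℝ × ℝ} (hv : v ≠ 0) (h : dot v x = dot v y) :
    ∃ t : ℝ, x = y + t • rot v := by
  have hpos := (dot_self_pos hv).ne'
  refine ⟨cross v (x - y) / dot v v, ?_⟩
  simp only [dot] at h hpos
  ext
  · simp only [Prod.fst_add, Prod.smul_fst, smul_eq_mul, rot, cross, dot, Prod.fst_sub,
      Prod.snd_sub]
    rw [div_mul_eq_mul_div, ← sub_eq_iff_eq_add', eq_div_iff hpos]
    linear_combination v.1 * h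
  · simp only [Prod.snd_add, Prod.smul_snd, smul_eq_mul, rot, cross, dot, Prod.fst_sub,
      Prod.snd_sub]
    rw [div_mul_eq_mul_div, ← sub_eq_iff_eq_add', eq_div_iff hpos]
    linear_combination v.2 * h

lemma eq_of_dot_eq {p q x y : ℝ × ℝ} (h : cross p q ≠ 0) (hp : dot p x = dot p y)
    (hq : dot q x = dot q y) : x = y := by
  simp only [dot, cross] at *
  ext
  · refine mul_left_cancel₀ h ?_
    linear_combination q.2 * hp - p.2 * hq
  · refine mul_left_cancel₀ h ?_
    linear_combination p.1 * hq - q.1 * hp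

lemma exists_dot_eq (f : ℝ × ℝ →L[ℝ] ℝ) : ∃ n : ℝ × ℝ, ∀ x, f x = dot x n := by
  refine ⟨(f (1, 0), f (0, 1)), fun x => ?_⟩
  have : x = x.1 • ((1, 0) : ℝ × ℝ) + x.2 • ((0, 1) : ℝ × ℝ) := by ext <;> simp
  conv_lhs => rw [this]
  rw [map_add, map_smul, map_smul]
  simp [dot]

/-- `K` is a convex polygon with vertex set `V` and with the origin in its interior. -/
structure IsConvexPolygon (K : Set (ℝ × ℝ)) (V : Finset (ℝ × ℝ)) : Prop where
  extremePoints_eq : K.extremePoints ℝ = V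
  eq_convexHull : K = convexHull ℝ (V : Set (ℝ × ℝ))
  zero_mem : (0 : ℝ × ℝ) ∈ interior K

/-- `p` and `q` are consecutive vertices, and the edge between them lies on the line
`⟨·, w⟩ = 1`. -/
structure IsEdge (V : Finset (ℝ × ℝ)) (p q w : ℝ × ℝ) : Prop where
  left_mem : p ∈ V
  right_mem : q ∈ V
  cross_pos : 0 < cross p q
  left_eq : dot p w = 1
  right_eq : dot q w = 1
  le : ∀ u ∈ V, dot u w ≤ 1

namespace IsConvexPolygon

variable {K : Set (ℝ × ℝ)} {V : Finset (ℝ × ℝ)}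

lemma mem (h : IsConvexPolygon K V) {v : ℝ × ℝ} (hv : v ∈ V) : v ∈ K := by
  rw [h.eq_convexHull]; exact subset_convexHull ℝ _ hv

lemma isCompact (h : IsConvexPolygon K V) : IsCompact K := by
  rw [h.eq_convexHull]; exact V.finite_toSet.isCompact_convexHull ℝ

lemma convex (h : IsConvexPolygon K V) : Convex ℝ K := by
  rw [h.eq_convexHull]; exact convex_convexHull ℝ _

lemma dot_le (h : IsConvexPolygon K V) {w : ℝ × ℝ} {c : ℝ} (hw : ∀ u ∈ V, dot u w ≤ c)
    {x : ℝ × ℝ} (hx : x ∈ K) : dot x w ≤ c := by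
  rw [h.eq_convexHull] at hx
  have hconv : Convex ℝ {x : ℝ × ℝ | dot x w ≤ c} := by
    intro x hx y hy a b ha hb hab
    simp only [mem_ofPred_eq] at *
    rw [dot_add_left, dot_smul_left, dot_smul_left]
    calc a * dot x w + b * dot y w ≤ a * c + b * c := by gcongr
      _ = c := by rw [← add_mul, hab, one_mul]
  exact convexHull_min (fun u hu => hw u hu) hconv hx

lemma eventually_smul_mem (h : IsConvexPolygon K V) (d : ℝ × ℝ) :
    ∀ᶠ ε : ℝ in 𝓝 0, ε • d ∈ K := by
  have hc : Continuous fun ε : ℝ => ε • d := by fun_prop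
  refine hc.continuousAt.eventually_mem ?_
  rw [zero_smul]
  exact mem_interior_iff_mem_nhds.1 h.zero_mem

lemma exists_smul_mem (h : IsConvexPolygon K V) (d : ℝ × ℝ) : ∃ ε : ℝ, 0 < ε ∧ ε • d ∈ K := by
  obtain ⟨ε, h1, h2⟩ := (((h.eventually_smul_mem d).filter_mono nhdsWithin_le_nhds).and
    (self_mem_nhdsWithin (s := Ioi (0 : ℝ)))).exists
  exact ⟨ε, h2, h1⟩

/-- Otherwise the polygon would lie in the half-plane where the covector is nonpositive, although it
contains a small positive multiple of that covector. -/
lemma exists_dot_pos (h : IsConvexPolygon K V) {w : ℝ × ℝ} (hw : w ≠ 0) : ∃ u ∈ V, 0 < dot u w := by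
  by_contra! hcon
  obtain ⟨ε, hε, hmem⟩ := h.exists_smul_mem w
  have := h.dot_le hcon hmem
  rw [dot_smul_left] at this
  nlinarith [dot_self_pos hw]

lemma not_openSegment (h : IsConvexPolygon K V) {u p q : ℝ × ℝ} (hu : u ∈ V) (hp : p ∈ K)
    (hq : q ∈ K) (hseg : u ∈ openSegment ℝ p q) : p = u ∧ q = u := by
  have : u ∈ K.extremePoints ℝ := by rw [h.extremePoints_eq]; exact hu
  exact (mem_extremePoints.1 this).2 p hp q hq hseg

/-- Of three distinct points on a line one lies strictly between the other two, and then it is not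
extreme. The three positions of the affine coordinate μ are treated in turn. -/
lemma eq_or_eq (h : IsConvexPolygon K V) {p q u w : ℝ × ℝ} (hp : p ∈ V) (hq : q ∈ V) (hu : u ∈ V)
    (hpq : p ≠ q) (hp1 : dot p w = 1) (hq1 : dot q w = 1) (hu1 : dot u w = 1) :
    u = p ∨ u = q := by
  have hw : w ≠ 0 := by
    rintro rfl
    simp [dot] at hp1
  have comm : ∀ a b : ℝ × ℝ, dot a b = dot b a := fun a b => by simp [dot]; ring
  obtain ⟨s, hs⟩ := eq_add_smul_rot (v := w) (x := q) (y := p) hw (by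
    rw [comm, hq1, comm, hp1])
  obtain ⟨t, ht⟩ := eq_add_smul_rot (v := w) (x := u) (y := p) hw (by
    rw [comm, hu1, comm, hp1])
  have hs0 : s ≠ 0 := by
    rintro rfl
    exact hpq (by rw [hs, zero_smul, add_zero])
  obtain ⟨μ, hμ⟩ : ∃ μ : ℝ, u = p + μ • (q - p) := ⟨t / s, by
    have : q - p = s • rot w := by rw [hs]; abel
    rw [this, smul_smul, div_mul_cancel₀ _ hs0, ht]⟩
  have hpq' : q - p ≠ 0 := sub_ne_zero.2 hpq.symm
  rcases lt_trichotomy μ 0 with hneg | h0 | hpos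
  · have : p ∈ openSegment ℝ u q := by
      refine ⟨1 / (1 - μ), -μ / (1 - μ), by apply div_pos <;> linarith,
        by apply div_pos <;> linarith, by rw [← add_div, ← sub_eq_add_neg, div_self (by linarith)],
        ?_⟩
      have hne : 1 - μ ≠ 0 := by linarith
      rw [hμ]
      ext <;> simp <;> field_simp <;> ring
    exact Or.inl (h.not_openSegment hp (h.mem hu) (h.mem hq) this).1
  · left; rw [hμ, h0, zero_smul, add_zero]
  · rcases lt_trichotomy μ 1 with hlt | h1 | hgt
    · have : u ∈ openSegment ℝ p q := by
        rw [openSegment_eq_image']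
        exact ⟨μ, ⟨hpos, hlt⟩, hμ.symm⟩
      exact Or.inl (h.not_openSegment hu (h.mem hp) (h.mem hq) this).1.symm
    · right; rw [hμ, h1, one_smul]; abel
    · have : q ∈ openSegment ℝ p u := by
        refine ⟨1 - 1 / μ, 1 / μ, ?_, by positivity, by ring, ?_⟩
        · rw [sub_pos, div_lt_one hpos]; exact hgt
        · rw [hμ]
          ext <;> simp <;> field_simp <;> ring
      exact Or.inr (h.not_openSegment hq (h.mem hp) (h.mem hu) this).2

/-- Every vertex is exposed. -/
lemma exists_exposing (h : IsConvexPolygon K V) {v : ℝ × ℝ} (hv : v ∈ V) :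
    ∃ w, dot v w = 1 ∧ ∀ u ∈ V, u ≠ v → dot u w < 1 := by
  classical
  have hne : ∃ u ∈ V, u ≠ v := by
    obtain ⟨u₁, hu₁, h1⟩ := h.exists_dot_pos (w := (1, 0)) (by simp)
    obtain ⟨u₂, hu₂, h2⟩ := h.exists_dot_pos (w := (-1, 0)) (by simp)
    simp only [dot] at h1 h2
    by_cases hu : u₁ = v
    · refine ⟨u₂, hu₂, ?_⟩
      rintro rfl
      rw [hu] at h1
      linarith
    · exact ⟨u₁, hu₁, hu⟩
  -- An extreme point is not in the hull of the other vertices, so it can be strictly separated from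
  -- it. The origin in the interior lets the separating functional be scaled to the value 1 at `v`.
  have hnot : v ∉ convexHull ℝ ((V.erase v : Finset (ℝ × ℝ)) : Set (ℝ × ℝ)) := by
    have hext : v ∈ K.extremePoints ℝ := by rw [h.extremePoints_eq]; exact hv
    rw [h.convex.mem_extremePoints_iff_mem_sdiff_convexHull_sdiff] at hext
    refine fun hmem => hext.2 (convexHull_mono ?_ hmem)
    intro u hu
    rw [Finset.mem_coe, Finset.mem_erase] at hu
    exact ⟨h.mem hu.2, hu.1⟩
  obtain ⟨f, c, hf1, hf2⟩ := geometric_hahn_banach_closed_point (convex_convexHull ℝ _)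
    ((V.erase v).finite_toSet.isCompact_convexHull ℝ).isClosed hnot
  obtain ⟨n, hn⟩ := exists_dot_eq f
  have hlt : ∀ u ∈ V, u ≠ v → dot u n < dot v n := fun u hu huv => by
    rw [← hn, ← hn]
    exact (hf1 u (subset_convexHull ℝ _ (by simp [hu, huv]))).trans hf2
  have hn0 : n ≠ 0 := by
    rintro rfl
    obtain ⟨u, hu, huv⟩ := hne
    have := hlt u hu huv
    simp [dot] at this
  have hpos : 0 < dot v n := by
    obtain ⟨u, hu, hu0⟩ := h.exists_dot_pos hn0
    by_cases huv : u = v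
    · rwa [huv] at hu0
    · exact hu0.trans (hlt u hu huv)
  refine ⟨(dot v n)⁻¹ • n, ?_, fun u hu huv => ?_⟩
  · rw [dot_smul_right, inv_mul_cancel₀ hpos.ne']
  · rw [dot_smul_right, inv_mul_lt_iff₀ hpos, mul_one]
    exact hlt u hu huv

/-- The neighbour of a vertex on a given side. -/
lemma exists_neighbour (h : IsConvexPolygon K V) {v : ℝ × ℝ} (hv : v ∈ V) {ε : ℝ} (hε : ε ≠ 0) :
    ∃ q ∈ V, 0 < ε * cross v q ∧ ∃ w, dot v w = 1 ∧ dot q w = 1 ∧ ∀ u ∈ V, dot u w ≤ 1 := by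
  classical
  obtain ⟨w, hw1, hw⟩ := h.exists_exposing hv
  have hv0 : v ≠ 0 := by rintro rfl; simp [dot] at hw1
  have hrot : ε • rot v ≠ 0 := by
    refine smul_ne_zero hε fun h0 => hv0 ?_
    simp only [rot, Prod.mk_eq_zero, neg_eq_zero] at h0
    exact Prod.ext h0.2 h0.1
  have hS : (V.filter fun u => 0 < ε * cross v u).Nonempty := by
    obtain ⟨u, hu, hpos⟩ := h.exists_dot_pos hrot
    rw [dot_smul_right, dot_rot] at hpos
    exact ⟨u, Finset.mem_filter.2 ⟨hu, hpos⟩⟩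
  -- The supporting line at `v` is rotated about `v` until it first meets another vertex on the
  -- chosen side. The ratio is the amount of rotation at which `u` is hit.
  obtain ⟨q, hq, hmin⟩ := Finset.exists_min_image _
    (fun u => (1 - dot u w) / (ε * cross v u)) hS
  rw [Finset.mem_filter] at hq
  have hqv : q ≠ v := by
    rintro rfl
    rw [cross_self, mul_zero] at hq
    exact lt_irrefl _ hq.2
  obtain ⟨s, hs⟩ : ∃ s, s = (1 - dot q w) / (ε * cross v q) := ⟨_, rfl⟩
  have hs0 : 0 < s := by
    rw [hs]
    exact div_pos (by linarith [hw q hq.1 hqv]) hq.2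
  have hdot : ∀ u, dot u (w + (s * ε) • rot v) = dot u w + s * (ε * cross v u) := fun u => by
    rw [dot_add_right, dot_smul_right, dot_rot]; ring
  refine ⟨q, hq.1, hq.2, w + (s * ε) • rot v, ?_, ?_, fun u hu => ?_⟩
  · rw [hdot, cross_self, hw1]; ring
  · rw [hdot, hs, div_mul_cancel₀ _ hq.2.ne']; ring
  · rw [hdot]
    by_cases hpos : 0 < ε * cross v u
    · have := hmin u (Finset.mem_filter.2 ⟨hu, hpos⟩)
      rw [← hs, le_div_iff₀ hpos] at this
      linarith
    · have h1 : dot u w ≤ 1 := by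
        by_cases huv : u = v
        · rw [huv, hw1]
        · exact (hw u hu huv).le
      nlinarith

end IsConvexPolygon

namespace IsEdge

variable {V : Finset (ℝ × ℝ)} {p q w p' q' w' : ℝ × ℝ}

lemma ne (h : IsEdge V p q w) : p ≠ q := by
  rintro rfl
  have := h.cross_pos
  rw [cross_self] at this
  exact lt_irrefl _ this

lemma left_ne_zero (h : IsEdge V p q w) : p ≠ 0 := by
  rintro rfl
  have := h.left_eq
  simp [dot] at this

lemma right_ne_zero (h : IsEdge V p q w) : q ≠ 0 := by
  rintro rfl
  have := h.right_eq
  simp [dot] at this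

/-- Covectors with value 1 at `p` differ by a multiple of the rotated `p`. Each covector is at most
1 at the right end of the other edge, which bounds the multiple from both sides by zero. -/
lemma covector_eq_of_left (h : IsEdge V p q w) (h' : IsEdge V p q' w') : w = w' := by
  obtain ⟨t, ht⟩ := eq_add_smul_rot h.left_ne_zero (h.left_eq.trans h'.left_eq.symm)
  have h1 := h.le q' h'.right_mem
  have h2 := h'.le q h.right_mem
  have h3 := h.right_eq
  rw [ht, dot_add_right, dot_smul_right, dot_rot] at h1 h3
  rw [h'.right_eq] at h1
  have t1 : t ≤ 0 := by
    by_contra! hh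
    nlinarith [mul_pos hh h'.cross_pos]
  have t2 : 0 ≤ t := by
    by_contra! hh
    nlinarith [mul_neg_of_neg_of_pos hh h.cross_pos]
  rw [ht, le_antisymm t1 t2, zero_smul, add_zero]

lemma covector_eq_of_right (h : IsEdge V p q w) (h' : IsEdge V p' q w') : w = w' := by
  obtain ⟨t, ht⟩ := eq_add_smul_rot h.right_ne_zero (h.right_eq.trans h'.right_eq.symm)
  have h1 := h.le p' h'.left_mem
  have h2 := h'.le p h.left_mem
  have h3 := h.left_eq
  rw [ht, dot_add_right, dot_smul_right, dot_rot, cross_swap] at h1 h3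
  rw [h'.left_eq] at h1
  have t1 : 0 ≤ t := by
    by_contra! hh
    nlinarith [mul_neg_of_neg_of_pos hh h'.cross_pos]
  have t2 : t ≤ 0 := by
    by_contra! hh
    nlinarith [mul_pos hh h.cross_pos]
  rw [ht, le_antisymm t2 t1, zero_smul, add_zero]

variable {K : Set (ℝ × ℝ)}

lemma right_unique (hK : IsConvexPolygon K V) (h : IsEdge V p q w) (h' : IsEdge V p q' w') :
    q = q' := by
  have hw := h.covector_eq_of_left h'
  subst hw
  rcases hK.eq_or_eq h'.left_mem h'.right_mem h.right_mem h'.ne h'.left_eq h'.right_eq h.right_eq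
    with hh | hh
  · exact (h.ne hh.symm).elim
  · exact hh

lemma left_unique (hK : IsConvexPolygon K V) (h : IsEdge V p q w) (h' : IsEdge V p' q w') :
    p = p' := by
  have hw := h.covector_eq_of_right h'
  subst hw
  rcases hK.eq_or_eq h'.left_mem h'.right_mem h.left_mem h'.ne h'.left_eq h'.right_eq h.left_eq
    with hh | hh
  · exact hh
  · exact (h.ne hh).elim

end IsEdge

/-- The vertices of a convex polygon in their cyclic order, with the lines of the edges. -/
structure CyclicVertices (V : Finset (ℝ × ℝ)) where
  next : Equiv.Perm V
  covector : V → ℝ × ℝ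
  isEdge : ∀ v : V, IsEdge V (v : ℝ × ℝ) (next v : ℝ × ℝ) (covector v)

namespace IsConvexPolygon

variable {K : Set (ℝ × ℝ)} {V : Finset (ℝ × ℝ)}

/-- The successor is the neighbour with positive orientation and the predecessor the one with
negative orientation; uniqueness of the edges at a vertex makes these maps inverse to each other. -/
lemma nonempty_cyclicVertices (h : IsConvexPolygon K V) : Nonempty (CyclicVertices V) := by
  have h1 : ∀ v : V, ∃ q : V, ∃ w, IsEdge V v q w := by
    intro v
    obtain ⟨q, hq, hc, w, hw1, hw2, hw⟩ := h.exists_neighbour v.2 one_ne_zero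
    exact ⟨⟨q, hq⟩, w, v.2, hq, by simpa using hc, hw1, hw2, hw⟩
  have h2 : ∀ v : V, ∃ p : V, ∃ w, IsEdge V p v w := by
    intro v
    obtain ⟨q, hq, hc, w, hw1, hw2, hw⟩ := h.exists_neighbour v.2 (neg_ne_zero.2 one_ne_zero)
    exact ⟨⟨q, hq⟩, w, hq, v.2, by rw [cross_swap]; linarith, hw2, hw1, hw⟩
  choose σ w hσ using h1
  choose π w' hπ using h2
  exact ⟨⟨⟨σ, π, fun v => Subtype.ext ((hπ (σ v)).left_unique h (hσ v)),
    fun v => Subtype.ext ((hσ (π v)).right_unique h (hπ v))⟩, w, hσ⟩⟩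

end IsConvexPolygon

/-! ### The edges of the polar polygon -/

namespace CyclicVertices

variable {K : Set (ℝ × ℝ)} {V : Finset (ℝ × ℝ)} (c : CyclicVertices V)

/-- The preceding vertex. -/
def prev (v : V) : V := c.next.symm v

/-- The covector of the preceding edge. -/
def prevCovector (v : V) : ℝ × ℝ := c.covector (c.prev v)

/-- The ratio of the edge of the polar dual to `v` and the rotated vector `v`. -/
def ratio (v : V) : ℝ := cross (c.prevCovector v) (c.covector v)

lemma next_prev (v : V) : c.next (c.prev v) = v := c.next.apply_symm_apply v

lemma isEdge_prev (v : V) : IsEdge V (c.prev v) v (c.prevCovector v) := by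
  have := c.isEdge (c.prev v)
  rwa [next_prev] at this

lemma prev_ne_next (v : V) : c.prev v ≠ c.next v := by
  intro h
  have h1 := (c.isEdge v).cross_pos
  have h2 := (c.isEdge_prev v).cross_pos
  rw [h, cross_swap] at h2
  linarith

lemma next_ne (v : V) : c.next v ≠ v := fun h => (c.isEdge v).ne (congrArg Subtype.val h.symm)

lemma prev_ne (v : V) : c.prev v ≠ v := fun h => (c.isEdge_prev v).ne (congrArg Subtype.val h)

/-- The covectors of both edges at `v` have value 1 there, so they differ by a multiple of the
rotated `v`; the determinant with the first one identifies the multiple. -/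
lemma covector_eq (v : V) :
    c.covector v = c.prevCovector v + c.ratio v • rot v := by
  obtain ⟨t, ht⟩ := eq_add_smul_rot (c.isEdge v).left_ne_zero
    ((c.isEdge v).left_eq.trans (c.isEdge_prev v).right_eq.symm)
  have : c.ratio v = t := by
    have h1 := (c.isEdge_prev v).right_eq
    rw [ratio, ht, cross_add_right, cross_self, cross_smul_right, zero_add]
    have : cross (c.prevCovector v) (rot v) = 1 := by
      rw [← h1]; simp [cross, rot, dot]; ring
    rw [this, mul_one]
  rw [this, ht]

lemma dot_covector (u : ℝ × ℝ) (v : V) :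
    dot u (c.covector v) = dot u (c.prevCovector v) + c.ratio v * cross v u := by
  rw [covector_eq, dot_add_right, dot_smul_right, dot_rot]

/-- A negative ratio would put the next vertex outside the supporting half-plane of the preceding
edge, and ratio zero would put three vertices on one line. -/
lemma ratio_pos (hK : IsConvexPolygon K V) (v : V) : 0 < c.ratio v := by
  have h1 := c.dot_covector (c.next v) v
  rw [(c.isEdge v).right_eq] at h1
  have h2 := (c.isEdge_prev v).le _ (c.next v).2
  have h3 := (c.isEdge v).cross_pos
  have h4 : 0 ≤ c.ratio v := by
    by_contra! hh
    nlinarith [mul_neg_of_neg_of_pos hh h3]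
  refine lt_of_le_of_ne h4 fun h0 => ?_
  rw [← h0, zero_mul, add_zero] at h1
  rcases hK.eq_or_eq (c.isEdge_prev v).left_mem v.2 (c.next v).2 (c.isEdge_prev v).ne
    (c.isEdge_prev v).left_eq (c.isEdge_prev v).right_eq h1.symm with hh | hh
  · exact c.prev_ne_next v (Subtype.ext hh.symm)
  · exact c.next_ne v (Subtype.ext hh)

/-- With the next lemma, this gives the linear forms of the two neighbours at the ends of the dual
edge where they do not vanish; these values fix the residue. -/
lemma next_dot_prevCovector (v : V) :
    1 - dot (c.next v) (c.prevCovector v) = c.ratio v * cross v (c.next v) := by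
  have h1 := c.dot_covector (c.next v) v
  rw [(c.isEdge v).right_eq] at h1
  linarith

lemma prev_dot_covector (v : V) :
    1 - dot (c.prev v) (c.covector v) = c.ratio v * cross (c.prev v) v := by
  rw [c.dot_covector (c.prev v) v, (c.isEdge_prev v).left_eq, cross_swap]
  ring

/-- A constraint active inside a dual edge is active at both of its ends, and the only vertex common
to the two consecutive edges is `v`. -/
lemma dot_lt_one (hK : IsConvexPolygon K V) {u v : V} (huv : u ≠ v) {s : ℝ} (hs : s ∈ Ioo (0 : ℝ) 1) :
    dot u (c.prevCovector v + s • (c.covector v - c.prevCovector v)) < 1 := by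
  have h1 := (c.isEdge v).le u u.2
  have h2 := (c.isEdge_prev v).le u u.2
  have e : dot u (c.prevCovector v + s • (c.covector v - c.prevCovector v)) =
      (1 - s) * dot u (c.prevCovector v) + s * dot u (c.covector v) := by
    simp [dot]; ring
  rw [e]
  by_contra! hge
  have e1 : dot u (c.covector v) = 1 := by nlinarith [hs.1, hs.2]
  have e2 : dot u (c.prevCovector v) = 1 := by nlinarith [hs.1, hs.2]
  rcases hK.eq_or_eq v.2 (c.next v).2 u.2 (c.isEdge v).ne (c.isEdge v).left_eq
    (c.isEdge v).right_eq e1 with hh | hh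
  · exact huv (Subtype.ext hh)
  rcases hK.eq_or_eq (c.prev v).2 v.2 u.2 (c.isEdge_prev v).ne (c.isEdge_prev v).left_eq
    (c.isEdge_prev v).right_eq e2 with hh' | hh'
  · exact c.prev_ne_next v (Subtype.ext (hh'.symm.trans hh))
  · exact huv (Subtype.ext hh')

/-- The edge of the polar polygon that is dual to a vertex. -/
def dualEdge (v : V) : (ℝ × ℝ) × (ℝ × ℝ) := (c.prevCovector v, c.covector v)

lemma dualEdge_injective (hK : IsConvexPolygon K V) : Function.Injective c.dualEdge := by
  intro u v huv
  simp only [dualEdge, Prod.mk.injEq] at huv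
  have comm : ∀ a b : ℝ × ℝ, dot a b = dot b a := fun a b => by simp [dot]; ring
  refine Subtype.ext (eq_of_dot_eq (c.ratio_pos hK v).ne' ?_ ?_)
  · rw [comm, comm _ (v : ℝ × ℝ), (c.isEdge_prev v).right_eq, ← huv.1, (c.isEdge_prev u).right_eq]
  · rw [comm, comm _ (v : ℝ × ℝ), (c.isEdge v).left_eq, ← huv.2, (c.isEdge u).left_eq]

/-- The polar of the vertex set. -/
def _root_.Polypol.polarSet (V : Finset (ℝ × ℝ)) : Set (ℝ × ℝ) := {w | ∀ v ∈ V, dot v w ≤ 1}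

/-- The constraints of the two ends of an edge are active there and linearly independent, so neither
summand of a convex combination can differ from the point. -/
lemma covector_mem_extremePoints (v : V) : c.covector v ∈ (polarSet V).extremePoints ℝ := by
  have hE := c.isEdge v
  refine mem_extremePoints.2 ⟨hE.le, fun x hx y hy hseg => ?_⟩
  obtain ⟨a, b, ha, hb, hab, hxy⟩ := hseg
  have key : ∀ u ∈ V, dot u (c.covector v) = 1 → dot u x = 1 ∧ dot u y = 1 := by
    intro u hu h1
    rw [← hxy, dot_add_right, dot_smul_right, dot_smul_right] at h1
    have h2 := hx u hu
    have h3 := hy u hu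
    have hb' : b = 1 - a := by linarith
    subst hb'
    constructor <;> nlinarith
  have h1 := key v v.2 hE.left_eq
  have h2 := key _ (c.next v).2 hE.right_eq
  exact ⟨eq_of_dot_eq hE.cross_pos.ne' (h1.1.trans hE.left_eq.symm) (h2.1.trans hE.right_eq.symm),
    eq_of_dot_eq hE.cross_pos.ne' (h1.2.trans hE.left_eq.symm) (h2.2.trans hE.right_eq.symm)⟩

lemma cross_dualEdge (v : V) (x : ℝ × ℝ) :
    cross (c.covector v - c.prevCovector v) (x - c.prevCovector v) =
      c.ratio v * (1 - dot v x) := by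
  have h1 := (c.isEdge_prev v).right_eq
  rw [c.covector_eq v, add_sub_cancel_left]
  simp only [cross, rot, dot, Prod.smul_fst, Prod.smul_snd, Prod.fst_sub, Prod.snd_sub,
    smul_eq_mul] at *
  linear_combination c.ratio v * h1

/-- A point of the polar on the line of an edge lies on the edge. -/
lemma mem_dualEdge (hK : IsConvexPolygon K V) (v : V) {x : ℝ × ℝ} (hx : x ∈ polarSet V)
    (hvx : dot v x = 1) :
    ∃ t ∈ Icc (0 : ℝ) 1, x = c.prevCovector v + t • (c.covector v - c.prevCovector v) := by
  have hr := c.ratio_pos hK v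
  obtain ⟨s, hs⟩ := eq_add_smul_rot (c.isEdge v).left_ne_zero
    (hvx.trans (c.isEdge_prev v).right_eq.symm)
  have h1 := hx _ (c.next v).2
  have h2 := hx _ (c.prev v).2
  have h3 := c.next_dot_prevCovector v
  rw [hs, dot_add_right, dot_smul_right, dot_rot] at h1 h2
  rw [(c.isEdge_prev v).left_eq, cross_swap] at h2
  have s0 : 0 ≤ s := by
    by_contra! hh
    nlinarith [mul_neg_of_neg_of_pos hh (c.isEdge_prev v).cross_pos]
  have s1 : s ≤ c.ratio v := by
    by_contra! hh
    nlinarith [mul_lt_mul_of_pos_right hh (c.isEdge v).cross_pos]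
  refine ⟨s / c.ratio v, ⟨by positivity, (div_le_one hr).2 s1⟩, ?_⟩
  rw [c.covector_eq v, add_sub_cancel_left, smul_smul, div_mul_cancel₀ _ hr.ne', hs]

/-- Some constraint must be active at the midpoint of an edge, since otherwise the midpoint could be
moved to the right of the edge inside the polar. Its ends then lie on one dual edge and, being
extreme, are the ends of that dual edge. -/
lemma edges_polarSet (hK : IsConvexPolygon K V) : edges (polarSet V) = range c.dualEdge := by
  ext e
  constructor
  · rintro ⟨he1, he2, hne, hleft⟩
    have hm1 := he1.1
    have hm2 := he2.1
    -- a constraint that is active at the midpoint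
    obtain ⟨v, hv, hmid⟩ : ∃ v ∈ V, 1 ≤ dot v (e.1 + (1 / 2 : ℝ) • (e.2 - e.1)) := by
      by_contra! hcon
      have hev : ∀ᶠ ε : ℝ in 𝓝 0, ∀ v ∈ V,
          dot v (e.1 + (1 / 2 : ℝ) • (e.2 - e.1) - ε • rot (e.2 - e.1)) < 1 := by
        rw [Filter.eventually_all_finset]
        intro v hv
        have hc : Continuous fun ε : ℝ =>
            dot v (e.1 + (1 / 2 : ℝ) • (e.2 - e.1) - ε • rot (e.2 - e.1)) := by
          simp only [dot]; fun_prop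
        refine hc.continuousAt.eventually_lt continuousAt_const ?_
        simpa using hcon v hv
      obtain ⟨ε, h1, h2⟩ := ((hev.filter_mono nhdsWithin_le_nhds).and
        (self_mem_nhdsWithin (s := Ioi (0 : ℝ)))).exists
      have h2' : 0 < ε := h2
      have := hleft _ fun v hv => (h1 v hv).le
      have hpos := dot_self_pos (sub_ne_zero.2 hne.symm)
      have e1 : cross (e.2 - e.1) (e.1 + (1 / 2 : ℝ) • (e.2 - e.1) - ε • rot (e.2 - e.1) - e.1) =
          -ε * dot (e.2 - e.1) (e.2 - e.1) := by
        simp [cross, rot, dot]; ring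
      rw [e1] at this
      nlinarith
    have h1 := hm1 v hv
    have h2 := hm2 v hv
    have e1 : dot v (e.1 + (1 / 2 : ℝ) • (e.2 - e.1)) = (dot v e.1 + dot v e.2) / 2 := by
      simp [dot]; ring
    rw [e1] at hmid
    set v' : V := ⟨v, hv⟩
    obtain ⟨t₁, ht₁, hx₁⟩ := c.mem_dualEdge hK v' hm1 (by show dot v e.1 = 1; linarith)
    obtain ⟨t₂, ht₂, hx₂⟩ := c.mem_dualEdge hK v' hm2 (by show dot v e.2 = 1; linarith)
    have hne' : c.prevCovector v' ≠ c.covector v' := by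
      intro hh
      have := c.ratio_pos hK v'
      rw [ratio, hh, cross_self] at this
      exact lt_irrefl _ this
    have hend : ∀ x ∈ (polarSet V).extremePoints ℝ, ∀ t ∈ Icc (0 : ℝ) 1,
        x = c.prevCovector v' + t • (c.covector v' - c.prevCovector v') → t = 0 ∨ t = 1 := by
      intro x hx t ht hxt
      by_contra! hcon
      have hseg : x ∈ openSegment ℝ (c.prevCovector v') (c.covector v') := by
        rw [openSegment_eq_image']
        exact ⟨t, ⟨lt_of_le_of_ne ht.1 hcon.1.symm, lt_of_le_of_ne ht.2 hcon.2⟩, hxt.symm⟩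
      have := (mem_extremePoints.1 hx).2 _ (c.covector_mem_extremePoints _).1 _
        (c.covector_mem_extremePoints _).1 hseg
      exact hne' (this.1.trans this.2.symm)
    refine ⟨v', ?_⟩
    rcases hend _ he1 t₁ ht₁ hx₁ with rfl | rfl <;> rcases hend _ he2 t₂ ht₂ hx₂ with rfl | rfl
    · exact (hne (hx₁.trans hx₂.symm)).elim
    · refine Prod.ext ?_ ?_
      · rw [hx₁]; simp [dualEdge]
      · rw [hx₂]; simp [dualEdge]
    -- The reversed orientation is excluded by the origin, which belongs to the polar but would lie
    -- to the right.
    · exfalso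
      rw [zero_smul, add_zero] at hx₂
      rw [one_smul, add_sub_cancel] at hx₁
      have h0 := hleft 0 fun v _ => by simp [dot]
      have h3 := c.cross_dualEdge v' 0
      have hr := c.ratio_pos hK v'
      rw [hx₁, hx₂] at h0
      simp [dot, cross] at h0 h3
      nlinarith
    · exact (hne (hx₁.trans hx₂.symm)).elim
  · rintro ⟨v, rfl⟩
    refine ⟨c.covector_mem_extremePoints _, c.covector_mem_extremePoints _, fun hh => ?_,
      fun x hx => ?_⟩
    · have := c.ratio_pos hK v
      simp only [dualEdge] at hh
      rw [ratio, hh, cross_self] at this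
      exact lt_irrefl _ this
    · show 0 ≤ cross (c.covector v - c.prevCovector v) (x - c.prevCovector v)
      rw [cross_dualEdge]
      exact mul_nonneg (c.ratio_pos hK v).le (by linarith [hx v v.2])

/-! ### The boundary of a convex polygon -/

/-- A point on a supporting line is a convex combination of the vertices on that line. -/
lemma _root_.Polypol.IsConvexPolygon.exists_weights (hK : IsConvexPolygon K V) {w x : ℝ × ℝ}
    (hw : ∀ u ∈ V, dot u w ≤ 1) (hx : x ∈ K) (hxw : dot x w = 1) :
    ∃ μ : ℝ × ℝ → ℝ, (∀ u ∈ V, 0 ≤ μ u) ∧ ∑ u ∈ V, μ u = 1 ∧ ∑ u ∈ V, μ u • u = x ∧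
      ∀ u ∈ V, dot u w ≠ 1 → μ u = 0 := by
  rw [hK.eq_convexHull, Finset.mem_convexHull'] at hx
  obtain ⟨μ, hμ0, hμ1, hμx⟩ := hx
  have hdot : ∑ u ∈ V, μ u * (1 - dot u w) = 0 := by
    have h1 : dot x w = ∑ u ∈ V, μ u * dot u w := by
      rw [← hμx]
      simp only [dot, Prod.fst_sum, Prod.snd_sum, Finset.sum_mul, ← Finset.sum_add_distrib,
        Prod.smul_fst, Prod.smul_snd, smul_eq_mul]
      exact Finset.sum_congr rfl fun u _ => by ring
    simp only [mul_sub, mul_one, Finset.sum_sub_distrib]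
    rw [hμ1, ← h1, hxw, sub_self]
  have hzero := (Finset.sum_eq_zero_iff_of_nonneg fun u hu =>
    mul_nonneg (hμ0 u hu) (by linarith [hw u hu])).1 hdot
  exact ⟨μ, hμ0, hμ1, hμx, fun u hu hne => (mul_eq_zero.1 (hzero u hu)).resolve_right
    fun h => hne (by linarith)⟩

lemma _root_.Polypol.IsEdge.mem_segment (hK : IsConvexPolygon K V) {p q w x : ℝ × ℝ}
    (h : IsEdge V p q w) (hx : x ∈ K) (hxw : dot x w = 1) : x ∈ segment ℝ p q := by
  classical
  obtain ⟨μ, hμ0, hμ1, hμx, hμ⟩ := hK.exists_weights h.le hx hxw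
  have hsupp : ∀ u ∈ V, u ∉ ({p, q} : Finset (ℝ × ℝ)) → μ u = 0 := by
    intro u hu hne
    refine hμ u hu fun h1 => hne ?_
    simpa using hK.eq_or_eq h.left_mem h.right_mem hu h.ne h.left_eq h.right_eq h1
  have hsub : ({p, q} : Finset (ℝ × ℝ)) ⊆ V := by
    intro u hu
    rcases Finset.mem_insert.1 hu with rfl | hu
    · exact h.left_mem
    · rw [Finset.mem_singleton.1 hu]; exact h.right_mem
  rw [← Finset.sum_subset hsub (fun u hu hn => hsupp u hu hn), Finset.sum_pair h.ne] at hμ1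
  rw [← Finset.sum_subset hsub (fun u hu hn => by rw [hsupp u hu hn, zero_smul]),
    Finset.sum_pair h.ne] at hμx
  exact ⟨μ p, μ q, hμ0 p h.left_mem, hμ0 q h.right_mem, hμ1, hμx⟩

lemma dot_segment {p q w x : ℝ × ℝ} (hp : dot p w = 1) (hq : dot q w = 1)
    (hx : x ∈ segment ℝ p q) : dot x w = 1 := by
  obtain ⟨a, b, -, -, hab, rfl⟩ := hx
  rw [dot_add_left, dot_smul_left, dot_smul_left, hp, hq, mul_one, mul_one, hab]

/-- A supporting functional at a boundary point can be scaled to the value 1 there, because the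
origin is interior. If its line carries two vertices it carries an edge, which contains the point;
otherwise the point is a vertex. -/
lemma frontier_eq (hK : IsConvexPolygon K V) :
    frontier K = ⋃ v : V, segment ℝ (v : ℝ × ℝ) (c.next v) := by
  ext x
  rw [mem_iUnion, hK.isCompact.isClosed.frontier_eq]
  constructor
  · rintro ⟨hxK, hxi⟩
    obtain ⟨f, hf⟩ := geometric_hahn_banach_open_point hK.convex.interior isOpen_interior hxi
    obtain ⟨n, hn⟩ := exists_dot_eq f
    have hpos : 0 < dot x n := by
      have := hf 0 hK.zero_mem
      rwa [map_zero, hn] at this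
    have hle : ∀ y ∈ K, dot y n ≤ dot x n := by
      intro y hy
      have hcl : y ∈ closure (interior K) := by
        rw [hK.convex.closure_interior_eq_closure_of_nonempty_interior ⟨0, hK.zero_mem⟩]
        exact subset_closure hy
      have hcd : IsClosed {y : ℝ × ℝ | f y ≤ f x} := isClosed_le f.continuous continuous_const
      have := closure_minimal (fun y hy => (hf y hy).le) hcd hcl
      rw [← hn, ← hn]
      exact this
    obtain ⟨w, hw⟩ : ∃ w, w = (dot x n)⁻¹ • n := ⟨_, rfl⟩
    have hxw : dot x w = 1 := by rw [hw, dot_smul_right, inv_mul_cancel₀ hpos.ne']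
    have hlew : ∀ y ∈ K, dot y w ≤ 1 := fun y hy => by
      rw [hw, dot_smul_right, inv_mul_le_iff₀ hpos, mul_one]
      exact hle y hy
    -- the edges through the supporting line
    have hedge : ∀ p ∈ V, ∀ q ∈ V, p ≠ q → dot p w = 1 → dot q w = 1 →
        ∃ v : V, x ∈ segment ℝ (v : ℝ × ℝ) (c.next v) := by
      intro p hp q hq hpq hp1 hq1
      have hfin : ∀ p q, IsEdge V p q w → ∃ v : V, x ∈ segment ℝ (v : ℝ × ℝ) (c.next v) := by
        intro p q hE
        refine ⟨⟨p, hE.left_mem⟩, ?_⟩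
        rw [(c.isEdge ⟨p, hE.left_mem⟩).right_unique hK hE]
        exact hE.mem_segment hK hxK hxw
      rcases lt_trichotomy (cross p q) 0 with hc | hc | hc
      · exact hfin q p ⟨hq, hp, by rw [cross_swap]; linarith, hq1, hp1,
          fun u hu => hlew u (hK.mem hu)⟩
      · refine (hpq ?_).elim
        simp only [cross, dot] at hc hp1 hq1
        ext
        · linear_combination q.1 * hp1 - p.1 * hq1 + w.2 * hc
        · linear_combination q.2 * hp1 - p.2 * hq1 - w.1 * hc
      · exact hfin p q ⟨hp, hq, hc, hp1, hq1, fun u hu => hlew u (hK.mem hu)⟩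
    by_contra! hcon
    have hlt : ∃ v ∈ V, ∀ u ∈ V, u ≠ v → dot u w < 1 := by
      by_cases hex : ∃ v ∈ V, dot v w = 1
      · obtain ⟨v, hv, hv1⟩ := hex
        refine ⟨v, hv, fun u hu huv => lt_of_le_of_ne (hlew u (hK.mem hu)) fun hu1 => ?_⟩
        obtain ⟨v', hv'⟩ := hedge u hu v hv huv hu1 hv1
        exact hcon v' hv'
      · push Not at hex
        obtain ⟨v, hv, -⟩ := hK.exists_dot_pos (w := (1, 0)) (by simp)
        exact ⟨v, hv, fun u hu _ => lt_of_le_of_ne (hlew u (hK.mem hu)) (hex u hu)⟩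
    obtain ⟨v, hv, hlt⟩ := hlt
    have hxv : x = v := by
      obtain ⟨μ, hμ0, hμ1, hμx, hμ⟩ := hK.exists_weights (fun u hu => hlew u (hK.mem hu)) hxK hxw
      have hsupp : ∀ u ∈ V, u ≠ v → μ u = 0 := fun u hu hne =>
        hμ u hu (hlt u hu hne).ne
      rw [Finset.sum_eq_single_of_mem v hv hsupp] at hμ1
      rw [Finset.sum_eq_single_of_mem v hv fun u hu hne => by rw [hsupp u hu hne, zero_smul],
        hμ1, one_smul] at hμx
      exact hμx.symm
    refine hcon ⟨v, hv⟩ ?_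
    rw [hxv]
    exact left_mem_segment ℝ _ _
  · rintro ⟨v, hx⟩
    have hE := c.isEdge v
    refine ⟨hK.convex.segment_subset (hK.mem v.2) (hK.mem (c.next v).2) hx, fun hInt => ?_⟩
    have hx1 := dot_segment hE.left_eq hE.right_eq hx
    -- Conversely, a point of an edge leaves the polygon when pushed radially outwards, since its
    -- covector then exceeds 1.
    have hcont : Continuous fun ε : ℝ => x + ε • x := by fun_prop
    have hev : ∀ᶠ ε : ℝ in 𝓝 0, x + ε • x ∈ K := by
      refine hcont.continuousAt.eventually_mem ?_
      rw [zero_smul, add_zero]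
      exact mem_interior_iff_mem_nhds.1 hInt
    obtain ⟨ε, h1, h2⟩ := ((hev.filter_mono nhdsWithin_le_nhds).and
      (self_mem_nhdsWithin (s := Ioi (0 : ℝ)))).exists
    have h2' : 0 < ε := h2
    have := hK.dot_le hE.le h1
    rw [dot_add_left, dot_smul_left, hx1] at this
    linarith

/-- The edges of the polygon as arcs. -/
def edgeArc (v : V) : RationalArc := segmentArc v (c.next v) (c.isEdge v).ne

lemma arcBoundary (hK : IsConvexPolygon K V) : ArcBoundary K c.edgeArc where
  bounded := hK.isCompact.isBounded
  measurable := hK.isCompact.isClosed.measurableSet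
  frontier_eq := by
    simp only [edgeArc, segmentArc_image]
    exact c.frontier_eq hK
  meet_at_vertices := by
    intro v u hvu
    rw [edgeArc, edgeArc, segmentArc_openImage, segmentArc_image, Set.disjoint_left]
    intro x hxv hxu
    have hE := c.isEdge v
    have hx1 := dot_segment hE.left_eq hE.right_eq (openSegment_subset_segment ℝ _ _ hxv)
    have hvertex : ∀ y ∈ V, x ≠ y := by
      rintro y hy rfl
      have := hK.not_openSegment hy (hK.mem v.2) (hK.mem (c.next v).2) hxv
      exact hE.ne (this.1.trans this.2.symm)
    rw [← insert_endpoints_openSegment] at hxu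
    rcases hxu with hxu | hxu | hxu
    · exact hvertex _ u.2 hxu
    · exact hvertex _ (c.next u).2 hxu
    · obtain ⟨a, b, ha, hb, hab, rfl⟩ := hxu
      have h1 := hE.le u u.2
      have h2 := hE.le _ (c.next u).2
      rw [dot_add_left, dot_smul_left, dot_smul_left] at hx1
      have hb' : b = 1 - a := by linarith
      subst hb'
      -- Both values are at most 1 and a proper average of them is 1. So both ends of the other edge
      -- lie on this line, and the two edges coincide.
      have e1 : dot u (c.covector v) = 1 := by nlinarith
      have e2 : dot (c.next u) (c.covector v) = 1 := by nlinarith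
      rcases hK.eq_or_eq v.2 (c.next v).2 u.2 hE.ne hE.left_eq hE.right_eq e1 with hh | hh
      · exact hvu (Subtype.ext hh.symm)
      rcases hK.eq_or_eq v.2 (c.next v).2 (c.next u).2 hE.ne hE.left_eq hE.right_eq e2
        with hh' | hh'
      · have h3 := (c.isEdge u).cross_pos
        have h4 := hE.cross_pos
        rw [hh, hh', cross_swap] at h3
        linarith
      · exact (c.isEdge u).ne (hh.trans hh'.symm)

/-- The side value is known to be constant, so one ray suffices: the one towards the origin, which
stays in the polygon by convexity. -/
lemma sideValue_left (hK : IsConvexPolygon K V) (v : V) {t : ℝ}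
    (ht : t ∈ Ioo (c.edgeArc v).a (c.edgeArc v).b) : SideValue K (c.edgeArc v) 1 t 1 := by
  obtain ⟨l, hl⟩ := (c.arcBoundary hK).exists_sideValue_const v 1 (by simp)
  have hl' := hl t ht
  have hE := c.isEdge v
  have hpt : (c.edgeArc v).point t ∈ segment ℝ (v : ℝ × ℝ) (c.next v) := by
    rw [← segmentArc_image _ _ hE.ne]
    exact (c.edgeArc v).point_mem_image (Ioo_subset_Icc_self ht)
  have hptK := hK.convex.segment_subset (hK.mem v.2) (hK.mem (c.next v).2) hpt
  have hdir : 0 < 1 * cross ((c.edgeArc v).vel t) (-(c.edgeArc v).point t) := by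
    rw [edgeArc, segmentArc_vel, segmentArc_point]
    have : cross ((c.next v : ℝ × ℝ) - v) (-((v : ℝ × ℝ) + t • ((c.next v : ℝ × ℝ) - v))) =
        cross v (c.next v) := by
      simp [cross]; ring
    rw [this, one_mul]
    exact hE.cross_pos
  obtain ⟨s, ⟨hs, hs1⟩, hs0⟩ := (((hl' _ hdir).and
    (Ioo_mem_nhdsGT (show (0 : ℝ) < 1 from one_pos))).and self_mem_nhdsWithin).exists
  have hmem : (c.edgeArc v).point t + s • -(c.edgeArc v).point t ∈ K := by
    have := hK.convex hptK (interior_subset hK.zero_mem) (show 0 ≤ 1 - s by linarith [hs1.2])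
      hs1.1.le (by ring)
    rw [smul_zero, add_zero, sub_smul, one_smul] at this
    rwa [smul_neg, ← sub_eq_add_neg]
  rw [indicator_of_mem hmem] at hs
  rw [hs]
  exact hl'

/-- Directions to the right increase the covector of the edge beyond 1 immediately. -/
lemma sideValue_right (hK : IsConvexPolygon K V) (v : V) (t : ℝ) :
    SideValue K (c.edgeArc v) (-1) t 0 := by
  intro d hd
  filter_upwards [self_mem_nhdsWithin] with s hs
  have hs' : 0 < s := hs
  refine indicator_of_notMem (fun hmem => ?_) _
  have hE := c.isEdge v
  have h1 := hK.dot_le hE.le hmem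
  rw [edgeArc, segmentArc_vel] at hd
  rw [edgeArc, segmentArc_point] at h1
  -- the outer normal is a multiple of the covector
  have h2 : cross ((c.next v : ℝ × ℝ) - v) d = -cross v (c.next v) * dot d (c.covector v) := by
    have e1 := hE.left_eq
    have e2 := hE.right_eq
    simp only [cross, dot, Prod.fst_sub, Prod.snd_sub] at *
    linear_combination ((c.next v : ℝ × ℝ).2 * d.1 - (c.next v : ℝ × ℝ).1 * d.2) * e1 +
      ((v : ℝ × ℝ).1 * d.2 - (v : ℝ × ℝ).2 * d.1) * e2
  rw [h2] at hd
  have hpos : 0 < dot d (c.covector v) := by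
    by_contra! hh
    nlinarith [hE.cross_pos]
  have h3 : dot ((v : ℝ × ℝ) + t • ((c.next v : ℝ × ℝ) - v) + s • d) (c.covector v) =
      1 + s * dot d (c.covector v) := by
    have e1 := hE.left_eq
    have e2 := hE.right_eq
    simp only [dot, Prod.fst_add, Prod.snd_add, Prod.smul_fst, Prod.smul_snd, Prod.fst_sub,
      Prod.snd_sub, smul_eq_mul] at *
    linear_combination (1 - t) * e1 + t * e2
  rw [h3] at h1
  nlinarith

lemma fantappie_eq (hK : IsConvexPolygon K V) {w : ℂ × ℂ} (hw : w ∈ params K) :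
    fantappie K w = ∑ v : V, ((cross v (c.next v) : ℝ) : ℂ) / (Q w v * Q w (c.next v)) := by
  rw [(c.arcBoundary hK).fantappie_eq_sum (l := fun _ => 1) (r := fun _ => 0)
    (fun v t ht => c.sideValue_left hK v ht) (fun v t _ => c.sideValue_right hK v t) hw]
  refine Finset.sum_congr rfl fun v _ => ?_
  rw [RationalArc.integral_euler_of_collinear (γ := c.edgeArc v) (collinear_segmentArc _ _ (c.isEdge v).ne)]
  · have e0 : (c.edgeArc v).point (c.edgeArc v).a = v := by
      rw [edgeArc, segmentArc_point]; simp [segmentArc]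
    have e1 : (c.edgeArc v).point (c.edgeArc v).b = c.next v := by
      rw [edgeArc, segmentArc_point]; simp [segmentArc]
    rw [e0, e1]
    simp
  · rintro p ⟨t, ht, rfl⟩
    exact hw _ ((c.arcBoundary hK).point_mem_closure v ht)

end CyclicVertices

/-! ### The canonical form of the polar polygon -/

lemma totalDegree_linForm_le (p : ℝ × ℝ) : (linForm p).totalDegree ≤ 1 := by
  have h : ∀ (k : ℝ) (i : Fin 2),
      (MvPolynomial.C k * MvPolynomial.X i : MvPolynomial (Fin 2) ℝ).totalDegree ≤ 1 := by
    intro k i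
    refine (MvPolynomial.totalDegree_mul _ _).trans ?_
    rw [MvPolynomial.totalDegree_C, MvPolynomial.totalDegree_X]
  rw [linForm]
  refine (MvPolynomial.totalDegree_sub _ _).trans (max_le ?_ (h _ _))
  refine (MvPolynomial.totalDegree_sub _ _).trans (max_le ?_ (h _ _))
  simp

lemma eval_edgeForm (e : (ℝ × ℝ) × (ℝ × ℝ)) (x : Fin 2 → ℝ) :
    MvPolynomial.eval x (edgeForm e) = cross (e.2 - e.1) ((x 0, x 1) - e.1) := by
  simp [edgeForm, cross]

namespace CyclicVertices

variable {K : Set (ℝ × ℝ)} {V : Finset (ℝ × ℝ)} (c : CyclicVertices V)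

/-- The vertices that are not on the edge from `v`. -/
def others (v : V) : Finset V := (Finset.univ.erase v).erase (c.next v)

lemma mul_prod_others {M : Type*} [CommMonoid M] (f : V → M) (v : V) :
    f (c.next v) * ∏ u ∈ c.others v, f u = ∏ u ∈ Finset.univ.erase v, f u :=
  Finset.mul_prod_erase _ f (Finset.mem_erase.2 ⟨c.next_ne v, Finset.mem_univ _⟩)

lemma mul_prod_others' {M : Type*} [CommMonoid M] (f : V → M) (v : V) :
    f v * ∏ u ∈ c.others v, f u = ∏ u ∈ Finset.univ.erase (c.next v), f u := by
  rw [others, Finset.erase_right_comm]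
  exact Finset.mul_prod_erase _ f (Finset.mem_erase.2 ⟨(c.next_ne v).symm, Finset.mem_univ _⟩)

lemma mul_mul_prod_others {M : Type*} [CommMonoid M] (f : V → M) (v : V) :
    f v * (f (c.next v) * ∏ u ∈ c.others v, f u) = ∏ u, f u := by
  rw [mul_prod_others]
  exact Finset.mul_prod_erase _ f (Finset.mem_univ _)

/-- The adjoint polynomial, up to a constant. -/
def adjoint : MvPolynomial (Fin 2) ℝ :=
  ∑ v : V, MvPolynomial.C (cross v (c.next v)) * ∏ u ∈ c.others v, linForm u

/-- The numerator of the canonical form. -/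
def numerator : MvPolynomial (Fin 2) ℝ := MvPolynomial.C (∏ v, c.ratio v) * c.adjoint

/-- The edge dual to `v` lies on the line Q_v = 0. The positive factor `ratio` per edge explains the
product of ratios in `numerator`. -/
lemma edgeForm_dualEdge (v : V) :
    edgeForm (c.dualEdge v) = MvPolynomial.C (c.ratio v) * linForm v := by
  refine MvPolynomial.funext fun x => ?_
  have hx : x = ![x 0, x 1] := by ext i; fin_cases i <;> rfl
  rw [eval_edgeForm, map_mul, MvPolynomial.eval_C]
  conv_rhs => rw [hx]
  have h1 := c.cross_dualEdge v (x 0, x 1)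
  have h2 := eval_linForm v (x 0, x 1)
  rw [h2]
  exact h1

/-- The product of u and det(p, q) equals q₂ - p₂ up to multiples of the linear forms of p and q.
These corrections cancel around the cycle. The right-hand side has degree at most n - 2, so the
adjoint has degree at most n - 3, one less than its definition suggests. -/
lemma X_mul_adjoint : MvPolynomial.X 0 * c.adjoint =
    ∑ v : V, MvPolynomial.C ((c.next v : ℝ × ℝ).2 - (v : ℝ × ℝ).2) *
      ∏ u ∈ c.others v, linForm u := by
  have hterm : ∀ v : V, MvPolynomial.X 0 *
      (MvPolynomial.C (cross v (c.next v)) * ∏ u ∈ c.others v, linForm u) =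
      MvPolynomial.C ((c.next v : ℝ × ℝ).2 - (v : ℝ × ℝ).2) * ∏ u ∈ c.others v, linForm u -
      MvPolynomial.C (c.next v : ℝ × ℝ).2 * ∏ u ∈ Finset.univ.erase (c.next v), linForm u +
      MvPolynomial.C (v : ℝ × ℝ).2 * ∏ u ∈ Finset.univ.erase v, linForm u := by
    intro v
    rw [← c.mul_prod_others (fun u => linForm u) v, ← c.mul_prod_others' (fun u => linForm u) v]
    have e1 : linForm (v : ℝ × ℝ) = 1 - MvPolynomial.C (v : ℝ × ℝ).1 * MvPolynomial.X 0 -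
      MvPolynomial.C (v : ℝ × ℝ).2 * MvPolynomial.X 1 := rfl
    have e2 : linForm (c.next v : ℝ × ℝ) = 1 -
      MvPolynomial.C (c.next v : ℝ × ℝ).1 * MvPolynomial.X 0 -
      MvPolynomial.C (c.next v : ℝ × ℝ).2 * MvPolynomial.X 1 := rfl
    rw [e1, e2]
    simp only [cross, map_sub, map_mul]
    ring
  rw [adjoint, Finset.mul_sum, Finset.sum_congr rfl fun v _ => hterm v, Finset.sum_add_distrib,
    Finset.sum_sub_distrib, Equiv.sum_comp c.next fun v : V => MvPolynomial.C (v : ℝ × ℝ).2 *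
      ∏ u ∈ Finset.univ.erase v, linForm u]
  ring

lemma card_others (v : V) : (c.others v).card + 2 = V.card := by
  have h1 := Finset.card_erase_of_mem
    (Finset.mem_erase.2 ⟨c.next_ne v, Finset.mem_univ _⟩ : c.next v ∈ Finset.univ.erase v)
  have h2 := Finset.card_erase_of_mem (Finset.mem_univ v)
  rw [Finset.card_univ, Fintype.card_coe] at h2
  have h3 : 0 < (Finset.univ.erase v).card :=
    Finset.card_pos.2 ⟨_, Finset.mem_erase.2 ⟨c.next_ne v, Finset.mem_univ _⟩⟩
  rw [others, h1]
  omega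

lemma three_le_card (c : CyclicVertices V) (hK : IsConvexPolygon K V) : 3 ≤ V.card := by
  obtain ⟨v, hv, -⟩ := hK.exists_dot_pos (w := (1, 0)) (by simp)
  have h1 := c.card_others ⟨v, hv⟩
  have h2 : 0 < (c.others ⟨v, hv⟩).card := by
    refine Finset.card_pos.2 ⟨c.prev ⟨v, hv⟩, ?_⟩
    rw [others, Finset.mem_erase, Finset.mem_erase]
    exact ⟨c.prev_ne_next _, c.prev_ne _, Finset.mem_univ _⟩
  omega

lemma totalDegree_numerator (hK : IsConvexPolygon K V) : c.numerator.totalDegree + 3 ≤ V.card := by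
  have h3 := c.three_le_card hK
  have hnum : c.numerator.totalDegree ≤ c.adjoint.totalDegree := by
    refine (MvPolynomial.totalDegree_mul _ _).trans ?_
    rw [MvPolynomial.totalDegree_C, zero_add]
  -- The degree of a product with u is additive only for a nonzero adjoint; degree zero is harmless,
  -- since there are at least three vertices.
  by_cases h0 : c.adjoint = 0
  · rw [h0, MvPolynomial.totalDegree_zero] at hnum
    omega
  have h1 : (MvPolynomial.X 0 * c.adjoint).totalDegree = 1 + c.adjoint.totalDegree := by
    rw [MvPolynomial.totalDegree_mul_of_isDomain (MvPolynomial.X_ne_zero _) h0,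
      MvPolynomial.totalDegree_X]
  have h2 : (MvPolynomial.X 0 * c.adjoint).totalDegree ≤ V.card - 2 := by
    rw [X_mul_adjoint]
    refine MvPolynomial.totalDegree_finsetSum_le fun v _ => ?_
    refine (MvPolynomial.totalDegree_mul _ _).trans ?_
    rw [MvPolynomial.totalDegree_C, zero_add]
    refine (MvPolynomial.totalDegree_finsetProd _ _).trans ?_
    refine (Finset.sum_le_card_nsmul (c.others v) (fun u => (linForm u).totalDegree) 1
      fun u _ => totalDegree_linForm_le u).trans ?_
    have := c.card_others v
    rw [smul_eq_mul, mul_one]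
    omega
  omega

/-- The numerator over the product of the edge forms is the sum over the edges. -/
lemma sum_prod_others {F : Type*} [Field F] {f : V → F} (hf : ∀ v, f v ≠ 0) (k : V → F) :
    ∑ v, k v * ∏ u ∈ c.others v, f u = (∏ v, f v) * ∑ v, k v / (f v * f (c.next v)) := by
  rw [Finset.mul_sum]
  refine Finset.sum_congr rfl fun v _ => ?_
  rw [← c.mul_mul_prod_others f v]
  have h1 := hf v
  have h2 := hf (c.next v)
  field_simp

/-- On the edge dual to `v` the form of `v` vanishes, so only the summands that omit it survive,
namely those of the two edges at `v`. The forms of the next and the preceding vertex are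
proportional to 1 - s and s there. -/
lemma residue_eq (hK : IsConvexPolygon K V) (v : V) {s : ℝ} (hs : s ∈ Ioo (0 : ℝ) 1) {f : V → ℝ}
    (hf : ∀ u : V, f u = 1 - dot u (c.prevCovector v + s • (c.covector v - c.prevCovector v))) :
    ((∏ u, c.ratio u) * ∑ u : V, cross u (c.next u) * ∏ x ∈ c.others u, f x) /
      ∏ u ∈ Finset.univ.erase v, (c.ratio u * f u) = 1 / s + 1 / (1 - s) ∧
    ∏ u ∈ Finset.univ.erase v, (c.ratio u * f u) ≠ 0 := by
  have hr : ∀ u, c.ratio u ≠ 0 := fun u => (c.ratio_pos hK u).ne'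
  have hlin : ∀ u : V, f u = (1 - s) * (1 - dot u (c.prevCovector v)) +
      s * (1 - dot u (c.covector v)) := fun u => by
    rw [hf]; simp [dot]; ring
  have hfv : f v = 0 := by
    rw [hlin, (c.isEdge_prev v).right_eq, (c.isEdge v).left_eq]; ring
  have hfu : ∀ u, u ≠ v → f u ≠ 0 := fun u hu => by
    rw [hf]
    have := c.dot_lt_one hK hu hs
    linarith
  have hfq : f (c.next v) = (1 - s) * (c.ratio v * cross v (c.next v)) := by
    rw [hlin, (c.isEdge v).right_eq, next_dot_prevCovector]; ring
  have hfp : f (c.prev v) = s * (c.ratio v * cross (c.prev v) v) := by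
    rw [hlin, (c.isEdge_prev v).left_eq, prev_dot_covector]; ring
  have hprod : ∏ u ∈ Finset.univ.erase v, f u ≠ 0 :=
    Finset.prod_ne_zero_iff.2 fun u hu => hfu u (Finset.ne_of_mem_erase hu)
  have hD : ∏ u ∈ Finset.univ.erase v, (c.ratio u * f u) ≠ 0 :=
    Finset.prod_ne_zero_iff.2 fun u hu => mul_ne_zero (hr u) (hfu u (Finset.ne_of_mem_erase hu))
  refine ⟨?_, hD⟩
  have hsum : ∑ u : V, cross u (c.next u) * ∏ x ∈ c.others u, f x =
      cross v (c.next v) * ∏ x ∈ c.others v, f x +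
        cross (c.prev v) v * ∏ x ∈ c.others (c.prev v), f x := by
    rw [← Finset.sum_subset (Finset.subset_univ {v, c.prev v}) fun u _ hu => ?_,
      Finset.sum_pair (c.prev_ne v).symm, next_prev]
    have hu' : u ≠ v ∧ u ≠ c.prev v := by simpa using hu
    rw [Finset.prod_eq_zero (i := v) ?_ hfv, mul_zero]
    rw [others, Finset.mem_erase, Finset.mem_erase]
    refine ⟨fun hh => hu'.2 ?_, hu'.1.symm, Finset.mem_univ _⟩
    rw [prev, hh, Equiv.symm_apply_apply]
  have hq := c.mul_prod_others f v
  have hp := c.mul_prod_others' f (c.prev v)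
  rw [next_prev] at hp
  have hq0 := hfu _ (c.next_ne v)
  have hp0 := hfu _ (c.prev_ne v)
  rw [div_eq_iff hD, Finset.prod_mul_distrib, ← Finset.mul_prod_erase Finset.univ c.ratio
    (Finset.mem_univ v), hsum, eq_div_of_mul_eq hq0 ((mul_comm _ _).trans hq),
    eq_div_of_mul_eq hp0 ((mul_comm _ _).trans hp), hfq, hfp]
  have h1 := (c.isEdge v).cross_pos.ne'
  have h2 := (c.isEdge_prev v).cross_pos.ne'
  have h3 := hr v
  have h4 : s ≠ 0 := hs.1.ne'
  have h5 : 1 - s ≠ 0 := by linarith [hs.2]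
  field_simp
  ring

/-- A polynomial of small degree that vanishes on the edges of the polar is zero. -/
lemma eq_zero_of_vanish (hK : IsConvexPolygon K V) {B : MvPolynomial (Fin 2) ℝ}
    (hdeg : B.totalDegree < V.card)
    (hB : ∀ v : V, ∀ s ∈ Ioo (0 : ℝ) 1, MvPolynomial.eval
      ![(c.prevCovector v + s • (c.covector v - c.prevCovector v)).1,
        (c.prevCovector v + s • (c.covector v - c.prevCovector v)).2] B = 0) : B = 0 := by
  classical
  -- `B` vanishes on the lines of the edges
  have hline : ∀ (v : V) (y : ℝ × ℝ), dot v y = 1 → MvPolynomial.eval ![y.1, y.2] B = 0 := by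
    intro v y hy
    obtain ⟨t, ht⟩ := eq_add_smul_rot (c.isEdge v).left_ne_zero
      (hy.trans (c.isEdge_prev v).right_eq.symm)
    obtain ⟨b, hb⟩ : ∃ b : Polynomial ℝ, b = MvPolynomial.aeval
      ![Polynomial.C (c.prevCovector v).1 +
          Polynomial.C (c.covector v - c.prevCovector v).1 * Polynomial.X,
        Polynomial.C (c.prevCovector v).2 +
          Polynomial.C (c.covector v - c.prevCovector v).2 * Polynomial.X] B := ⟨_, rfl⟩
    have hbe : ∀ s : ℝ, b.eval s = MvPolynomial.eval
        ![(c.prevCovector v + s • (c.covector v - c.prevCovector v)).1,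
          (c.prevCovector v + s • (c.covector v - c.prevCovector v)).2] B := by
      intro s
      rw [hb, ← Polynomial.coe_aeval_eq_eval, ← MvPolynomial.aeval_eq_eval,
        MvPolynomial.comp_aeval_apply]
      congr 2
      ext i
      fin_cases i <;> simp [mul_comm]
    have hb0 : b = 0 := by
      refine Polynomial.eq_zero_of_infinite_isRoot b ((Ioo_infinite one_pos).mono fun s hs => ?_)
      show b.eval s = 0
      rw [hbe]
      exact hB v s hs
    have := hbe (t / c.ratio v)
    rw [hb0, Polynomial.eval_zero] at this
    rw [this]
    have hr := (c.ratio_pos hK v).ne'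
    rw [c.covector_eq v, add_sub_cancel_left, smul_smul, div_mul_cancel₀ _ hr, ← ht]
  by_contra hB0
  -- a generic direction
  have hne : B * ((∏ v : V, (1 - linForm v)) *
      ∏ e ∈ (Finset.univ : Finset V).offDiag, (linForm e.1 - linForm e.2)) ≠ 0 := by
    refine mul_ne_zero hB0 (mul_ne_zero (Finset.prod_ne_zero_iff.2 fun v _ h0 => ?_)
      (Finset.prod_ne_zero_iff.2 fun e he h0 => ?_))
    · have h1 := congrArg (MvPolynomial.eval ![(v : ℝ × ℝ).1, (v : ℝ × ℝ).2]) h0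
      rw [map_sub, eval_linForm, map_one, map_zero] at h1
      have := dot_self_pos (c.isEdge v).left_ne_zero
      simp only [dot] at this
      linarith
    · have hne : (e.1 : ℝ × ℝ) - e.2 ≠ 0 := sub_ne_zero.2 fun h =>
        (Finset.mem_offDiag.1 he).2.2 (Subtype.ext h)
      have h1 := congrArg (MvPolynomial.eval ![((e.1 : ℝ × ℝ) - e.2).1, ((e.1 : ℝ × ℝ) - e.2).2]) h0
      rw [map_sub, eval_linForm, eval_linForm, map_zero] at h1
      have := dot_self_pos hne
      simp only [dot, Prod.fst_sub, Prod.snd_sub] at this h1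
      linarith
  obtain ⟨d, hd⟩ : ∃ d : Fin 2 → ℝ, MvPolynomial.eval d (B * ((∏ v : V, (1 - linForm v)) *
      ∏ e ∈ (Finset.univ : Finset V).offDiag, (linForm e.1 - linForm e.2))) ≠ 0 := by
    by_contra! hcon
    exact hne (MvPolynomial.funext fun d => by rw [hcon d, map_zero])
  have hd2 : d = ![d 0, d 1] := by ext i; fin_cases i <;> rfl
  have hlf : ∀ p : ℝ × ℝ, MvPolynomial.eval d (linForm p) = 1 - dot p (d 0, d 1) := fun p => by
    rw [hd2]; exact eval_linForm p (d 0, d 1)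
  rw [map_mul, map_mul, map_prod, map_prod, mul_ne_zero_iff, mul_ne_zero_iff,
    Finset.prod_ne_zero_iff, Finset.prod_ne_zero_iff] at hd
  obtain ⟨hd0, hd1, hd3⟩ := hd
  have hdot0 : ∀ v : V, dot v (d 0, d 1) ≠ 0 := fun v h => hd1 v (Finset.mem_univ _) (by
    rw [map_sub, hlf, h, map_one]; ring)
  have hdinj : ∀ u v : V, dot u (d 0, d 1) = dot v (d 0, d 1) → u = v := fun u v h => by
    by_contra huv
    exact hd3 (u, v) (Finset.mem_offDiag.2 ⟨Finset.mem_univ _, Finset.mem_univ _, huv⟩) (by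
      rw [map_sub, hlf, hlf, h]; ring)
  -- The restriction of `B` to the line through the origin in the direction `d`.
  obtain ⟨b, hb⟩ : ∃ b : Polynomial ℝ, b = MvPolynomial.aeval
      (fun i => Polynomial.C (d i) * Polynomial.X) B := ⟨_, rfl⟩
  have hbe : ∀ t : ℝ, b.eval t = MvPolynomial.eval ![t * d 0, t * d 1] B := by
    intro t
    rw [hb, ← Polynomial.coe_aeval_eq_eval, ← MvPolynomial.aeval_eq_eval,
      MvPolynomial.comp_aeval_apply]
    congr 2
    ext i
    fin_cases i
    · exact (by simp : Polynomial.aeval t (Polynomial.C (d 0) * Polynomial.X) = d 0 * t).trans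
        (mul_comm _ _)
    · exact (by simp : Polynomial.aeval t (Polynomial.C (d 1) * Polynomial.X) = d 1 * t).trans
        (mul_comm _ _)
  have hbdeg : b.natDegree < V.card := by
    refine lt_of_le_of_lt ?_ hdeg
    have := MvPolynomial.aeval_natDegree_le B le_rfl
      (fun i => Polynomial.C (d i) * Polynomial.X) (n := 1) fun i =>
        (Polynomial.natDegree_C_mul_le _ _).trans Polynomial.natDegree_X_le
    rwa [mul_one, ← hb] at this
  -- The line meets the edge line of `v` at the parameter 1/⟨v, d⟩. For generic `d` these are as
  -- many distinct roots as there are edges, more than the degree.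
  have hb0 : b = 0 := by
    refine Polynomial.eq_zero_of_natDegree_lt_card_of_eval_eq_zero b
      (f := fun v : V => (dot v (d 0, d 1))⁻¹) (fun u v h => hdinj u v (inv_injective h))
      (fun v => ?_) (by rwa [Fintype.card_coe])
    rw [hbe]
    refine hline v (_ * d 0, _ * d 1) ?_
    have := hdot0 v
    simp only [dot] at this ⊢
    field_simp
  refine hd0 ?_
  have := hbe 1
  rw [hb0, Polynomial.eval_zero, one_mul, one_mul, ← hd2] at this
  exact this.symm

open Classical in
/-- The edges of the polar. -/
def dualEdges : Finset ((ℝ × ℝ) × (ℝ × ℝ)) := Finset.univ.image c.dualEdge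

lemma coe_dualEdges (hK : IsConvexPolygon K V) : (c.dualEdges : Set _) = edges (polarSet V) := by
  rw [c.edges_polarSet hK, dualEdges, Finset.coe_image, Finset.coe_univ, image_univ]

lemma prod_dualEdges (hK : IsConvexPolygon K V) {M : Type*} [CommMonoid M]
    (f : (ℝ × ℝ) × (ℝ × ℝ) → M) : ∏ e ∈ c.dualEdges, f e = ∏ v, f (c.dualEdge v) :=
  Finset.prod_image fun _ _ _ _ h => c.dualEdge_injective hK h

open Classical in
lemma prod_erase_dualEdges (hK : IsConvexPolygon K V) {M : Type*} [CommMonoid M]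
    (f : (ℝ × ℝ) × (ℝ × ℝ) → M) (v : V) :
    ∏ e ∈ c.dualEdges.erase (c.dualEdge v), f e = ∏ u ∈ Finset.univ.erase v, f (c.dualEdge u) := by
  rw [dualEdges, ← Finset.image_erase (c.dualEdge_injective hK)]
  exact Finset.prod_image fun _ _ _ _ h => c.dualEdge_injective hK h

lemma card_dualEdges (hK : IsConvexPolygon K V) : c.dualEdges.card = V.card := by
  rw [dualEdges, Finset.card_image_of_injective _ (c.dualEdge_injective hK), Finset.card_univ,
    Fintype.card_coe]

open Classical in
lemma numerator_residue (hK : IsConvexPolygon K V) (v : V) {s : ℝ} (hs : s ∈ Ioo (0 : ℝ) 1) :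
    let x := (c.dualEdge v).1 + s • ((c.dualEdge v).2 - (c.dualEdge v).1)
    MvPolynomial.eval ![x.1, x.2] c.numerator / MvPolynomial.eval ![x.1, x.2]
        (∏ e' ∈ c.dualEdges.erase (c.dualEdge v), edgeForm e') = 1 / s + 1 / (1 - s) ∧
      MvPolynomial.eval ![x.1, x.2]
        (∏ e' ∈ c.dualEdges.erase (c.dualEdge v), edgeForm e') ≠ 0 := by
  intro x
  have h := c.residue_eq hK v hs (f := fun u => 1 - dot u x) fun u => rfl
  have hlf : ∀ p : ℝ × ℝ, MvPolynomial.eval ![x.1, x.2] (linForm p) = 1 - dot p x :=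
    fun p => eval_linForm p x
  rw [c.prod_erase_dualEdges hK, map_prod, numerator, adjoint, map_mul, map_sum,
    MvPolynomial.eval_C]
  simp only [edgeForm_dualEdge, map_mul, map_prod, MvPolynomial.eval_C, hlf]
  exact h

/-- The canonical form of the polar. -/
def canonicalForm : RationalFunctions :=
  algebraMap (MvPolynomial (Fin 2) ℝ) RationalFunctions c.numerator /
    algebraMap (MvPolynomial (Fin 2) ℝ) RationalFunctions (∏ e ∈ c.dualEdges, edgeForm e)

lemma isCanonicalForm (hK : IsConvexPolygon K V) :
    IsCanonicalForm (polarSet V) c.canonicalForm := by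
  refine ⟨c.dualEdges, c.numerator, c.coe_dualEdges hK, rfl, ?_, fun e he s hs => ?_⟩
  · rw [c.card_dualEdges hK]; exact c.totalDegree_numerator hK
  · obtain ⟨v, -, rfl⟩ := Finset.mem_image.1 he
    exact (c.numerator_residue hK v hs).1

lemma canonicalForm_unique (hK : IsConvexPolygon K V) {Ω : RationalFunctions}
    (hΩ : IsCanonicalForm (polarSet V) Ω) : Ω = c.canonicalForm := by
  obtain ⟨E, A, hE, rfl, hdeg, hres⟩ := hΩ
  obtain rfl : E = c.dualEdges := Finset.coe_injective (by rw [hE, c.coe_dualEdges hK])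
  rw [c.card_dualEdges hK] at hdeg
  have hAB : A - c.numerator = 0 := by
    refine c.eq_zero_of_vanish hK ?_ fun v s hs => ?_
    · have h1 := c.totalDegree_numerator hK
      have h2 := MvPolynomial.totalDegree_sub A c.numerator
      omega
    · have h1 := hres (c.dualEdge v) (Finset.mem_image_of_mem _ (Finset.mem_univ v)) s hs
      obtain ⟨h2, h3⟩ := c.numerator_residue hK v hs
      have h4 := h1.trans h2.symm
      rw [div_left_inj' h3] at h4
      rw [map_sub, sub_eq_zero]
      exact h4
  rw [sub_eq_zero.1 hAB, canonicalForm]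

/-- Clearing denominators in the edge sum for F gives the adjoint over the product of the Q_v; the
factors `ratio` in numerator and denominator cancel. -/
lemma hasValueAt_canonicalForm (hK : IsConvexPolygon K V) {w : ℂ × ℂ} (hw : w ∈ params K) :
    HasValueAt c.canonicalForm w (fantappie K w) := by
  have hQ : ∀ v : V, Q w v ≠ 0 := fun v => hw v (subset_closure (hK.mem v.2))
  have hr : ∏ v, ((c.ratio v : ℝ) : ℂ) ≠ 0 := Finset.prod_ne_zero_iff.2 fun v _ =>
    Complex.ofReal_ne_zero.2 (c.ratio_pos hK v).ne'
  have hD : MvPolynomial.aeval ![w.1, w.2] (∏ e ∈ c.dualEdges, edgeForm e) =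
      (∏ v, ((c.ratio v : ℝ) : ℂ)) * ∏ v : V, Q w v := by
    rw [c.prod_dualEdges hK, map_prod, ← Finset.prod_mul_distrib]
    refine Finset.prod_congr rfl fun v _ => ?_
    rw [edgeForm_dualEdge, map_mul, aeval_linForm, MvPolynomial.aeval_C]
    rfl
  have hN : MvPolynomial.aeval ![w.1, w.2] c.numerator =
      (∏ v, ((c.ratio v : ℝ) : ℂ)) * ((∏ v : V, Q w v) * fantappie K w) := by
    rw [numerator, map_mul, MvPolynomial.aeval_C, adjoint, map_sum, c.fantappie_eq hK hw,
      ← c.sum_prod_others hQ fun v => ((cross v (c.next v) : ℝ) : ℂ)]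
    simp only [map_mul, map_prod, aeval_linForm, MvPolynomial.aeval_C]
    simp
  have hQp : ∏ v : V, Q w v ≠ 0 := Finset.prod_ne_zero_iff.2 fun v _ => hQ v
  refine ⟨_, _, ?_, rfl, ?_⟩
  · rw [hD]; exact mul_ne_zero hr hQp
  · rw [hD, hN]
    field_simp

end CyclicVertices

/-! ### Convex polypols with straight arcs -/

/-- The frontier of a convex set is a null set, so nothing is lost by passing to the closed polygon.
-/
lemma fantappie_closure {P : Set (ℝ × ℝ)} (hP : Convex ℝ P) (w : ℂ × ℂ) :
    fantappie (closure P) w = fantappie P w := by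
  have hae : (closure P : Set (ℝ × ℝ)) =ᵐ[volume] P := by
    have h1 : (P : Set (ℝ × ℝ)) ≤ᵐ[volume] closure P := subset_closure.eventuallyLE
    have h2 : (closure P : Set (ℝ × ℝ)) ≤ᵐ[volume] P := by
      rw [ae_le_set]
      exact measure_mono_null (sdiff_subset_sdiff_right interior_subset)
        (hP.addHaar_frontier volume)
    exact h2.antisymm h1
  rw [fantappie, fantappie, setIntegral_congr_set hae]

/-- Extreme points lie on the frontier and are not interior points of straight arcs, so they are
among the finitely many endpoints of the arcs. The Krein–Milman theorem then recovers the closure as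
their hull. -/
lemma ArcBoundary.exists_isConvexPolygon {ι : Type*} [Finite ι] {P : Set (ℝ × ℝ)}
    {γ : ι → RationalArc} (hP : ArcBoundary P γ) (hγ : ∀ j, Collinear ℝ (γ j).image)
    (hconv : Convex ℝ P) (h0 : (0, 0) ∈ interior P) :
    ∃ V, IsConvexPolygon (closure P) V := by
  have hcomp := hP.isCompact_closure
  have hfin : ((closure P).extremePoints ℝ).Finite := by
    refine Set.Finite.subset (finite_iUnion fun j : ι =>
      (finite_singleton ((γ j).point (γ j).b)).insert ((γ j).point (γ j).a)) fun x hx => ?_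
    have hfr : x ∈ frontier P := by
      refine ⟨hx.1, fun hInt => ?_⟩
      exact Set.disjoint_left.1 (disjoint_interior_extremePoints (closure P))
        (interior_mono subset_closure hInt) hx
    rw [hP.frontier_eq, mem_iUnion] at hfr
    obtain ⟨j, t, ht, rfl⟩ := hfr
    refine mem_iUnion.2 ⟨j, ?_⟩
    rcases eq_endpoints_or_mem_Ioo_of_mem_Icc ht with rfl | rfl | ht'
    · exact mem_insert _ _
    · exact mem_insert_of_mem _ (mem_singleton _)
    · refine ((γ j).not_mem_extremePoints (hγ j) ?_ ht' hx).elim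
      rintro _ ⟨s, hs, rfl⟩
      exact hP.point_mem_closure j hs
  refine ⟨hfin.toFinset, hfin.coe_toFinset.symm, ?_, ?_⟩
  · rw [hfin.coe_toFinset]
    have h1 := closure_convexHull_extremePoints hcomp hconv.closure
    rw [(hfin.isCompact_convexHull ℝ).isClosed.closure_eq] at h1
    exact h1.symm
  · exact interior_mono subset_closure h0

lemma ArcBoundary.exists_canonicalForm {ι : Type*} [Finite ι] {P : Set (ℝ × ℝ)}
    {γ : ι → RationalArc} (hP : ArcBoundary P γ) (hγ : ∀ j, Collinear ℝ (γ j).image)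
    (hconv : Convex ℝ P) (h0 : (0, 0) ∈ interior P) :
    ∃ Ω : RationalFunctions, IsCanonicalForm (polar P) Ω ∧
      (∀ Ω' : RationalFunctions, IsCanonicalForm (polar P) Ω' → Ω' = Ω) ∧
      ∀ w ∈ params P, HasValueAt Ω w (fantappie P w) := by
  obtain ⟨V, hV⟩ := hP.exists_isConvexPolygon hγ hconv h0
  obtain ⟨c⟩ := hV.nonempty_cyclicVertices
  have hpolar : polar P = polarSet V := by
    ext w
    simp only [polar, polarSet, hV.extremePoints_eq, mem_ofPred_eq, Finset.mem_coe, dot,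
      sub_nonneg]
  rw [hpolar]
  refine ⟨c.canonicalForm, c.isCanonicalForm hV, fun Ω' h => c.canonicalForm_unique hV h,
    fun w hw => ?_⟩
  rw [← fantappie_closure hconv]
  refine c.hasValueAt_canonicalForm hV ?_
  intro p hp
  rw [closure_closure] at hp
  exact hw p hp

/-! ### The disk and the half-disk -/

lemma mem_disk {p : ℝ × ℝ} : p ∈ disk ↔ p.1 ^ 2 + p.2 ^ 2 ≤ 1 := Iff.rfl

lemma mem_halfDisk {p : ℝ × ℝ} : p ∈ halfDisk ↔ p.1 ^ 2 + p.2 ^ 2 ≤ 1 ∧ 0 ≤ p.2 := Iff.rfl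

lemma convex_disk : Convex ℝ disk := by
  intro p hp q hq a b ha hb hab
  rw [mem_disk] at *
  simp only [Prod.fst_add, Prod.smul_fst, smul_eq_mul, Prod.snd_add, Prod.smul_snd]
  obtain rfl : b = 1 - a := by linarith
  nlinarith [mul_nonneg (mul_nonneg ha hb) (sq_nonneg (p.1 - q.1)),
    mul_nonneg (mul_nonneg ha hb) (sq_nonneg (p.2 - q.2)), mul_le_mul_of_nonneg_left hp ha,
    mul_le_mul_of_nonneg_left hq hb]

lemma convex_halfDisk : Convex ℝ halfDisk := by
  intro p hp q hq a b ha hb hab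
  refine ⟨convex_disk hp.1 hq.1 ha hb hab, ?_⟩
  simp only [Prod.snd_add, Prod.smul_snd, smul_eq_mul]
  exact add_nonneg (mul_nonneg ha hp.2) (mul_nonneg hb hq.2)

lemma isBounded_disk : Bornology.IsBounded disk := by
  refine (Metric.isBounded_closedBall (x := (0 : ℝ × ℝ)) (r := 1)).subset fun p hp => ?_
  rw [mem_disk] at hp
  rw [mem_closedBall_zero_iff, Prod.norm_def, max_le_iff, Real.norm_eq_abs, Real.norm_eq_abs,
    abs_le, abs_le]
  constructor <;> constructor <;> nlinarith [sq_nonneg p.1, sq_nonneg p.2]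

lemma isClosed_disk : IsClosed disk := isClosed_le (by fun_prop) continuous_const

lemma isClosed_halfDisk : IsClosed halfDisk :=
  isClosed_disk.inter (isClosed_le continuous_const continuous_snd)

lemma not_mem_interior_of_ray {S : Set (ℝ × ℝ)} {p : ℝ × ℝ} (d : ℝ × ℝ)
    (h : ∀ s : ℝ, 0 < s → p + s • d ∉ S) : p ∉ interior S := by
  intro hp
  have hc : Continuous fun s : ℝ => p + s • d := by fun_prop
  have hev : ∀ᶠ s : ℝ in 𝓝 0, p + s • d ∈ S := by
    refine hc.continuousAt.eventually_mem ?_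
    rw [zero_smul, add_zero]
    exact mem_interior_iff_mem_nhds.1 hp
  obtain ⟨s, h1, h2⟩ := ((hev.filter_mono nhdsWithin_le_nhds).and
    (self_mem_nhdsWithin (s := Ioi (0 : ℝ)))).exists
  exact h s h2 h1

lemma not_mem_disk_of_ray {p d : ℝ × ℝ} (hp : p.1 ^ 2 + p.2 ^ 2 = 1)
    (hd : 0 < p.1 * d.1 + p.2 * d.2) {s : ℝ} (hs : 0 < s) : p + s • d ∉ disk := by
  intro h
  rw [mem_disk] at h
  simp only [Prod.fst_add, Prod.smul_fst, smul_eq_mul, Prod.snd_add, Prod.smul_snd] at h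
  nlinarith [mul_pos hs hd, sq_nonneg (s * d.1), sq_nonneg (s * d.2)]

lemma isOpen_openDisk : IsOpen {p : ℝ × ℝ | p.1 ^ 2 + p.2 ^ 2 < 1} :=
  isOpen_lt (by fun_prop) continuous_const

lemma frontier_disk : frontier disk = {p | p.1 ^ 2 + p.2 ^ 2 = 1} := by
  ext p
  rw [isClosed_disk.frontier_eq]
  constructor
  · rintro ⟨h1, h2⟩
    by_contra hne
    refine h2 (mem_interior.2 ⟨{q | q.1 ^ 2 + q.2 ^ 2 < 1}, fun q (hq : _ < _) => mem_disk.2 hq.le,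
      isOpen_openDisk, ?_⟩)
    exact lt_of_le_of_ne h1 hne
  · intro h
    have h' : p.1 ^ 2 + p.2 ^ 2 = 1 := h
    exact ⟨h'.le, not_mem_interior_of_ray p fun s hs => not_mem_disk_of_ray h' (by nlinarith) hs⟩

lemma frontier_halfDisk :
    frontier halfDisk = {p | (p.1 ^ 2 + p.2 ^ 2 = 1 ∧ 0 ≤ p.2) ∨ (p.1 ^ 2 ≤ 1 ∧ p.2 = 0)} := by
  ext p
  rw [isClosed_halfDisk.frontier_eq]
  constructor
  · rintro ⟨⟨h1, h2⟩, h3⟩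
    by_contra hne
    simp only [mem_ofPred_eq] at hne
    push Not at hne
    have h4 : p.1 ^ 2 + p.2 ^ 2 ≠ 1 := fun h => absurd h2 (not_le.2 (hne.1 h))
    have h5 : p.2 ≠ 0 := hne.2 (by nlinarith [sq_nonneg p.2])
    refine h3 (mem_interior.2 ⟨{q | q.1 ^ 2 + q.2 ^ 2 < 1} ∩ {q | 0 < q.2},
      fun q hq => ⟨le_of_lt hq.1, le_of_lt hq.2⟩,
      isOpen_openDisk.inter (isOpen_lt continuous_const continuous_snd),
      lt_of_le_of_ne h1 h4, lt_of_le_of_ne h2 h5.symm⟩)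
  · rintro (⟨h1, h2⟩ | ⟨h1, h2⟩)
    · exact ⟨⟨h1.le, h2⟩, not_mem_interior_of_ray p fun s hs h =>
        not_mem_disk_of_ray h1 (by nlinarith) hs h.1⟩
    · refine ⟨⟨by rw [h2]; nlinarith, h2.ge⟩, not_mem_interior_of_ray (0, -1) fun s hs h => ?_⟩
      have := h.2
      simp only [Prod.snd_add, h2, Prod.smul_snd, smul_eq_mul] at this
      linarith

/-- The half-circle `ε y ≥ 0`. -/
def circleArc (ε : ℝ) (hε : ε ≠ 0) : RationalArc where
  -- The sign makes the upper half-circle, `ε = 1`, run counterclockwise from (1, 0) to (-1, 0).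
  X := Polynomial.C (-2) * Polynomial.X
  Y := Polynomial.C ε * (1 - Polynomial.X ^ 2)
  W := 1 + Polynomial.X ^ 2
  a := -1
  b := 1
  a_lt_b := by norm_num
  W_ne_zero := fun t _ => by
    simp only [Polynomial.eval_add, Polynomial.eval_one, Polynomial.eval_pow, Polynomial.eval_X]
    positivity
  -- The parameter is recovered by stereographic projection from (0, -ε).
  injOn_Ico := Function.LeftInverse.injective (g := fun p : ℝ × ℝ => -p.1 / (1 + p.2 / ε))
    (fun t => by
      have : 1 + t ^ 2 ≠ 0 := by positivity
      simp
      field_simp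
      ring) |>.injOn
  injOn_Ioc := Function.LeftInverse.injective (g := fun p : ℝ × ℝ => -p.1 / (1 + p.2 / ε))
    (fun t => by
      have : 1 + t ^ 2 ≠ 0 := by positivity
      simp
      field_simp
      ring) |>.injOn
  regular := by
    rintro t - ⟨h1, h2⟩
    have hne : 1 + t ^ 2 ≠ 0 := by positivity
    have hW : HasDerivAt (fun s : ℝ => 1 + s ^ 2) (2 * t) t := by
      simpa using (hasDerivAt_pow 2 t).const_add 1
    have hX := ((hasDerivAt_id t).const_mul (-2)).div hW hne
    have hY := (((hasDerivAt_pow 2 t).const_sub 1).const_mul ε).div hW hne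
    have e1 : (fun s : ℝ => (Polynomial.C (-2) * Polynomial.X : Polynomial ℝ).eval s /
        (1 + Polynomial.X ^ 2 : Polynomial ℝ).eval s) = fun s => -2 * s / (1 + s ^ 2) := by
      ext s; simp
    have e2 : (fun s : ℝ => (Polynomial.C ε * (1 - Polynomial.X ^ 2) : Polynomial ℝ).eval s /
        (1 + Polynomial.X ^ 2 : Polynomial ℝ).eval s) =
        fun s => ε * (1 - s ^ 2) / (1 + s ^ 2) := by
      ext s; simp
    rw [e1] at h1
    rw [e2] at h2
    have h1' := hX.deriv.symm.trans h1
    have h2' := hY.deriv.symm.trans h2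
    rw [div_eq_zero_iff] at h1' h2'
    have hne2 : (1 + t ^ 2) ^ 2 ≠ 0 := by positivity
    have h3 := h1'.resolve_right hne2
    have h4 := h2'.resolve_right hne2
    simp at h3 h4
    have ht : t = 0 := by
      have : ε * (-4 * t) = 0 := by linear_combination h4
      have := (mul_eq_zero.1 this).resolve_left hε
      linarith
    rw [ht] at h3
    norm_num at h3

lemma circleArc_x (ε : ℝ) (hε : ε ≠ 0) :
    (circleArc ε hε).x = fun t => -2 * t / (1 + t ^ 2) := by
  ext t; simp [circleArc, RationalArc.x]

lemma circleArc_y (ε : ℝ) (hε : ε ≠ 0) :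
    (circleArc ε hε).y = fun t => ε * (1 - t ^ 2) / (1 + t ^ 2) := by
  ext t; simp [circleArc, RationalArc.y]

lemma circleArc_point (ε : ℝ) (hε : ε ≠ 0) (t : ℝ) :
    (circleArc ε hε).point t = (-2 * t / (1 + t ^ 2), ε * (1 - t ^ 2) / (1 + t ^ 2)) := by
  rw [RationalArc.point, circleArc_x, circleArc_y]

lemma circleArc_deriv_x (ε : ℝ) (hε : ε ≠ 0) (t : ℝ) :
    deriv (circleArc ε hε).x t = -(2 / (1 + t ^ 2)) * ((1 - t ^ 2) / (1 + t ^ 2)) := by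
  have hne : 1 + t ^ 2 ≠ 0 := by positivity
  have hW : HasDerivAt (fun s : ℝ => 1 + s ^ 2) (2 * t) t := by
    simpa using (hasDerivAt_pow 2 t).const_add 1
  rw [circleArc_x]
  refine (((hasDerivAt_id t).const_mul (-2)).div hW hne).deriv.trans ?_
  simp only [id]
  field_simp
  ring

lemma circleArc_deriv_y (ε : ℝ) (hε : ε ≠ 0) (t : ℝ) :
    deriv (circleArc ε hε).y t = ε * (2 / (1 + t ^ 2)) * (-2 * t / (1 + t ^ 2)) := by
  have hne : 1 + t ^ 2 ≠ 0 := by positivity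
  have hW : HasDerivAt (fun s : ℝ => 1 + s ^ 2) (2 * t) t := by
    simpa using (hasDerivAt_pow 2 t).const_add 1
  rw [circleArc_y]
  refine ((((hasDerivAt_pow 2 t).const_sub 1).const_mul ε).div hW hne).deriv.trans ?_
  push_cast
  field_simp
  ring

lemma circleArc_image {ε : ℝ} (hε : ε ≠ 0) (hε2 : ε ^ 2 = 1) :
    (circleArc ε hε).image = {p | p.1 ^ 2 + p.2 ^ 2 = 1 ∧ 0 ≤ ε * p.2} := by
  ext p
  constructor
  · rintro ⟨t, ht, rfl⟩
    have ht' : -1 ≤ t ∧ t ≤ 1 := ht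
    rw [circleArc_point]
    have hne : 1 + t ^ 2 ≠ 0 := by positivity
    constructor
    · simp only [div_pow, mul_pow, hε2]
      field_simp
      ring
    · show 0 ≤ ε * (ε * (1 - t ^ 2) / (1 + t ^ 2))
      rw [show ε * (ε * (1 - t ^ 2) / (1 + t ^ 2)) = ε ^ 2 * ((1 - t ^ 2) / (1 + t ^ 2)) by ring,
        hε2, one_mul]
      exact div_nonneg (by nlinarith) (by positivity)
  · rintro ⟨h1, h2⟩
    have hpos : 0 < 1 + ε * p.2 := by linarith
    have hsq : (ε * p.2) ^ 2 = p.2 ^ 2 := by rw [mul_pow, hε2, one_mul]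
    have hp1 : p.1 ^ 2 = (1 - ε * p.2) * (1 + ε * p.2) := by nlinarith
    refine ⟨-p.1 / (1 + ε * p.2), ?_, ?_⟩
    · have : (-p.1 / (1 + ε * p.2)) ^ 2 ≤ 1 := by
        rw [div_pow, neg_sq, hp1, div_le_one (by positivity)]
        nlinarith
      exact abs_le.1 (by rwa [← sq_le_one_iff_abs_le_one])
    · rw [circleArc_point]
      have hsum : 1 + (-p.1 / (1 + ε * p.2)) ^ 2 = 2 / (1 + ε * p.2) := by
        rw [div_pow, neg_sq, hp1]; field_simp; ring
      have hdiff : 1 - (-p.1 / (1 + ε * p.2)) ^ 2 = 2 * (ε * p.2) / (1 + ε * p.2) := by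
        rw [div_pow, neg_sq, hp1]; field_simp; ring
      rw [hsum, hdiff]
      ext
      · simp only; field_simp
      · simp only; field_simp; linear_combination p.2 * hε2

lemma circleArc_openImage_subset {ε : ℝ} (hε : ε ≠ 0) (hε2 : ε ^ 2 = 1) :
    (circleArc ε hε).openImage ⊆ {p | 0 < ε * p.2} := by
  rintro _ ⟨t, ht, rfl⟩
  have ht' : -1 < t ∧ t < 1 := ht
  rw [circleArc_point]
  show 0 < ε * (ε * (1 - t ^ 2) / (1 + t ^ 2))
  rw [show ε * (ε * (1 - t ^ 2) / (1 + t ^ 2)) = ε ^ 2 * ((1 - t ^ 2) / (1 + t ^ 2)) by ring,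
    hε2, one_mul]
  exact div_pos (by nlinarith) (by positivity)

/-- The diameter of the half-disk. -/
def diameter : RationalArc := segmentArc (-1, 0) (1, 0) (by norm_num)

lemma diameter_point (t : ℝ) : diameter.point t = (-1 + 2 * t, 0) := by
  rw [diameter, segmentArc_point]
  ext
  · simp; ring
  · simp

lemma diameter_image : diameter.image = {p | p.1 ^ 2 ≤ 1 ∧ p.2 = 0} := by
  ext p
  constructor
  · rintro ⟨t, ht, rfl⟩
    have ht' : 0 ≤ t ∧ t ≤ 1 := ht
    rw [diameter_point]
    exact ⟨by simp only; nlinarith, rfl⟩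
  · rintro ⟨h1, h2⟩
    rw [sq_le_one_iff_abs_le_one, abs_le] at h1
    refine ⟨(p.1 + 1) / 2, ⟨?_, ?_⟩, ?_⟩
    · show 0 ≤ (p.1 + 1) / 2; linarith
    · show (p.1 + 1) / 2 ≤ 1; linarith
    · rw [diameter_point]
      ext
      · simp only; ring
      · exact h2.symm

lemma diameter_openImage_subset : diameter.openImage ⊆ {p | p.1 ^ 2 < 1 ∧ p.2 = 0} := by
  rintro _ ⟨t, ht, rfl⟩
  have ht' : 0 < t ∧ t < 1 := ht
  rw [diameter_point]
  exact ⟨by simp only; nlinarith, rfl⟩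

/-- The boundary of the half-disk. -/
def halfDiskArcs : Fin 2 → RationalArc := ![circleArc 1 one_ne_zero, diameter]

lemma isSemialgebraic_disk : IsSemialgebraic disk := by
  refine ⟨2, ![{1 - MvPolynomial.X 0 ^ 2 - MvPolynomial.X 1 ^ 2}, ∅],
    ![∅, {1 - MvPolynomial.X 0 ^ 2 - MvPolynomial.X 1 ^ 2}], ?_⟩
  ext p
  simp only [mem_iUnion, Fin.exists_fin_two, mem_disk]
  simp
  rw [le_iff_lt_or_eq]
  constructor
  · rintro (h | h)
    · right; linarith
    · left; linarith
  · rintro (h | h)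
    · right; linarith
    · left; linarith

lemma isSemialgebraic_halfDisk : IsSemialgebraic halfDisk := by
  -- Two weak inequalities split into four combinations of an equation and a strict inequality.
  refine ⟨4, ![{1 - MvPolynomial.X 0 ^ 2 - MvPolynomial.X 1 ^ 2, MvPolynomial.X 1},
      {1 - MvPolynomial.X 0 ^ 2 - MvPolynomial.X 1 ^ 2}, {MvPolynomial.X 1}, ∅],
    ![∅, {MvPolynomial.X 1}, {1 - MvPolynomial.X 0 ^ 2 - MvPolynomial.X 1 ^ 2},
      {1 - MvPolynomial.X 0 ^ 2 - MvPolynomial.X 1 ^ 2, MvPolynomial.X 1}], ?_⟩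
  ext p
  simp only [mem_iUnion, mem_halfDisk, Fin.exists_fin_succ]
  simp
  rw [le_iff_lt_or_eq, le_iff_lt_or_eq]
  constructor
  · rintro ⟨h1 | h1, h2 | h2⟩
    · right; right; right; exact ⟨by linarith, h2⟩
    · right; right; left; exact ⟨h2.symm, by linarith⟩
    · right; left; exact ⟨by linarith, h2⟩
    · left; exact ⟨by linarith, h2.symm⟩
  · rintro (⟨h1, h2⟩ | ⟨h1, h2⟩ | ⟨h1, h2⟩ | ⟨h1, h2⟩)
    · exact ⟨Or.inr (by linarith), Or.inr h2.symm⟩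
    · exact ⟨Or.inr (by linarith), Or.inl h2⟩
    · exact ⟨Or.inl (by linarith), Or.inr h1.symm⟩
    · exact ⟨Or.inl (by linarith), Or.inl h2⟩

lemma interior_halfDisk_nonempty : (interior halfDisk).Nonempty :=
  ⟨(0, 1 / 2), mem_interior.2 ⟨{q | q.1 ^ 2 + q.2 ^ 2 < 1} ∩ {q | 0 < q.2},
    fun q hq => ⟨le_of_lt hq.1, le_of_lt hq.2⟩,
    isOpen_openDisk.inter (isOpen_lt continuous_const continuous_snd),
    show (0 : ℝ) ^ 2 + (1 / 2) ^ 2 < 1 by norm_num, show (0 : ℝ) < 1 / 2 by norm_num⟩⟩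

lemma subset_closure_interior_of_convex {S : Set (ℝ × ℝ)} (hS : Convex ℝ S)
    (h : (interior S).Nonempty) : S ⊆ closure (interior S) := by
  rw [hS.closure_interior_eq_closure_of_nonempty_interior h]
  exact subset_closure

lemma isRegularPolypol_halfDisk : IsRegularPolypol halfDisk halfDiskArcs where
  bounded := isBounded_disk.subset fun _ hp => hp.1
  pathConnected := convex_halfDisk.isPathConnected
    (interior_halfDisk_nonempty.mono interior_subset)
  semialgebraic := isSemialgebraic_halfDisk
  domain := subset_closure_interior_of_convex convex_halfDisk interior_halfDisk_nonempty
  frontier_eq := by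
    rw [frontier_halfDisk]
    ext p
    simp only [mem_iUnion, Fin.exists_fin_two, halfDiskArcs, Matrix.cons_val_zero,
      Matrix.cons_val_one, circleArc_image one_ne_zero (one_pow 2), diameter_image, one_mul]
    rfl
  meet_at_vertices := by
    intro i j hij
    fin_cases i <;> fin_cases j
    · exact (hij rfl).elim
    · refine Set.disjoint_left.2 fun p hp hq => ?_
      have h1 := circleArc_openImage_subset one_ne_zero (one_pow 2) hp
      have h2 : p ∈ diameter.image := hq
      rw [diameter_image] at h2
      have h1' : 0 < 1 * p.2 := h1
      have := h2.2
      linarith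
    · refine Set.disjoint_left.2 fun p hp hq => ?_
      have h1 := diameter_openImage_subset hp
      have h2 : p ∈ (circleArc 1 one_ne_zero).image := hq
      rw [circleArc_image one_ne_zero (one_pow 2)] at h2
      have h3 := h2.1
      rw [h1.2] at h3
      nlinarith [h1.1]
    · exact (hij rfl).elim

lemma isRegularPolypol_disk : IsRegularPolypol disk
    ![circleArc 1 one_ne_zero, circleArc (-1) (neg_ne_zero.2 one_ne_zero)] where
  bounded := isBounded_disk
  pathConnected := convex_disk.isPathConnected ⟨0, by simp [mem_disk]⟩
  semialgebraic := isSemialgebraic_disk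
  domain := subset_closure_interior_of_convex convex_disk
    (interior_halfDisk_nonempty.mono (interior_mono fun _ hp => hp.1))
  frontier_eq := by
    rw [frontier_disk]
    ext p
    simp only [mem_iUnion, Fin.exists_fin_two, Matrix.cons_val_zero, Matrix.cons_val_one,
      circleArc_image one_ne_zero (one_pow 2),
      circleArc_image (neg_ne_zero.2 one_ne_zero) (show (-1 : ℝ) ^ 2 = 1 by norm_num)]
    constructor
    · intro h
      rcases le_total 0 p.2 with h0 | h0
      · left; exact ⟨h, by linarith⟩
      · right; exact ⟨h, by linarith⟩
    · rintro (h | h) <;> exact h.1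
  meet_at_vertices := by
    have key : ∀ (ε : ℝ) (hε : ε ≠ 0) (hε' : -ε ≠ 0), ε ^ 2 = 1 →
        Disjoint (circleArc ε hε).openImage (circleArc (-ε) hε').image := by
      intro ε hε hε' h2
      refine Set.disjoint_left.2 fun p hp hq => ?_
      have h3 : 0 < ε * p.2 := circleArc_openImage_subset hε h2 hp
      rw [circleArc_image hε' (by rw [neg_sq, h2])] at hq
      have := hq.2
      linarith
    intro i j hij
    fin_cases i <;> fin_cases j
    · exact (hij rfl).elim
    · exact key 1 one_ne_zero (neg_ne_zero.2 one_ne_zero) (one_pow 2)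
    · have h := key (-1) (neg_ne_zero.2 one_ne_zero) (by norm_num) (by norm_num)
      simpa using h
    · exact (hij rfl).elim

/-! ### The transform of the half-disk -/

lemma Q_ofReal (u v : ℝ) (p : ℝ × ℝ) :
    Q ((u : ℂ), (v : ℂ)) p = ((1 - u * p.1 - v * p.2 : ℝ) : ℂ) := by
  simp [Q]

lemma mem_params_of_disk {P : Set (ℝ × ℝ)} (hP : closure P ⊆ disk) {u v : ℝ}
    (huv : u ^ 2 + v ^ 2 < 1) : ((u : ℂ), (v : ℂ)) ∈ params P := by
  intro p hp
  have h := mem_disk.1 (hP hp)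
  rw [Q_ofReal, Complex.ofReal_ne_zero]
  nlinarith [sq_nonneg (u - p.1), sq_nonneg (v - p.2)]

/-- By constancy one ray suffices: the one to the point (0, 1/2), which lies to the left of both
arcs and stays in the half-disk by convexity. -/
lemma sideValue_halfDisk_left (j : Fin 2) {t : ℝ}
    (ht : t ∈ Ioo (halfDiskArcs j).a (halfDiskArcs j).b) :
    SideValue halfDisk (halfDiskArcs j) 1 t 1 := by
  have hP := isRegularPolypol_halfDisk.arcBoundary
  obtain ⟨l, hl⟩ := hP.exists_sideValue_const j 1 (by simp)
  have hl' := hl t ht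
  have hmem : (halfDiskArcs j).point t ∈ halfDisk := by
    have := hP.point_mem_closure j (Ioo_subset_Icc_self ht)
    rwa [isClosed_halfDisk.closure_eq] at this
  have hc : ((0, 1 / 2) : ℝ × ℝ) ∈ halfDisk :=
    ⟨show (0 : ℝ) ^ 2 + (1 / 2) ^ 2 ≤ 1 by norm_num, show (0 : ℝ) ≤ 1 / 2 by norm_num⟩
  have hdir : 0 < 1 * cross ((halfDiskArcs j).vel t) ((0, 1 / 2) - (halfDiskArcs j).point t) := by
    rw [one_mul]
    fin_cases j
    · have ht' : -1 < t ∧ t < 1 := ht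
      have hne : 0 < 1 + t ^ 2 := by positivity
      show 0 < cross ((circleArc 1 one_ne_zero).vel t)
        ((0, 1 / 2) - (circleArc 1 one_ne_zero).point t)
      rw [RationalArc.vel, circleArc_deriv_x, circleArc_deriv_y, circleArc_point]
      simp only [cross, Prod.fst_sub, Prod.snd_sub]
      have : -(2 / (1 + t ^ 2)) * ((1 - t ^ 2) / (1 + t ^ 2)) *
          (1 / 2 - 1 * (1 - t ^ 2) / (1 + t ^ 2)) -
          1 * (2 / (1 + t ^ 2)) * (-2 * t / (1 + t ^ 2)) * (0 - -2 * t / (1 + t ^ 2)) =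
          (1 + 3 * t ^ 2) / (1 + t ^ 2) ^ 2 := by
        field_simp; ring
      rw [this]
      positivity
    · show 0 < cross (diameter.vel t) ((0, 1 / 2) - diameter.point t)
      rw [diameter, segmentArc_vel, ← diameter, diameter_point]
      simp only [cross, Prod.fst_sub, Prod.snd_sub]
      norm_num
  obtain ⟨s, ⟨hs, hs1⟩, hs0⟩ := (((hl' _ hdir).and
    (Ioo_mem_nhdsGT (show (0 : ℝ) < 1 from one_pos))).and self_mem_nhdsWithin).exists
  have hmem' : (halfDiskArcs j).point t + s • ((0, 1 / 2) - (halfDiskArcs j).point t) ∈ halfDisk :=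
    convex_halfDisk.add_smul_sub_mem hmem hc ⟨hs1.1.le, hs1.2.le⟩
  rw [indicator_of_mem hmem'] at hs
  rw [hs]
  exact hl'

lemma sideValue_halfDisk_right (j : Fin 2) {t : ℝ} :
    SideValue halfDisk (halfDiskArcs j) (-1) t 0 := by
  intro d hd
  filter_upwards [self_mem_nhdsWithin] with s hs
  have hs' : 0 < s := hs
  refine indicator_of_notMem (fun hmem => ?_) _
  fin_cases j
  · have hd' : 0 < -1 * cross ((circleArc 1 one_ne_zero).vel t) d := hd
    have hmem' : (circleArc 1 one_ne_zero).point t + s • d ∈ halfDisk := hmem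
    have hne : 0 < 1 + t ^ 2 := by positivity
    refine not_mem_disk_of_ray ?_ ?_ hs' hmem'.1
    · rw [circleArc_point]
      simp only
      field_simp
      ring
    · rw [RationalArc.vel, circleArc_deriv_x, circleArc_deriv_y] at hd'
      rw [circleArc_point]
      simp only [cross] at hd' ⊢
      have : -1 * (-(2 / (1 + t ^ 2)) * ((1 - t ^ 2) / (1 + t ^ 2)) * d.2 -
          1 * (2 / (1 + t ^ 2)) * (-2 * t / (1 + t ^ 2)) * d.1) =
          (2 / (1 + t ^ 2)) * (-2 * t / (1 + t ^ 2) * d.1 +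
            1 * (1 - t ^ 2) / (1 + t ^ 2) * d.2) := by ring
      rw [this] at hd'
      exact (mul_pos_iff_of_pos_left (by positivity)).1 hd'
  · have hd' : 0 < -1 * cross (diameter.vel t) d := hd
    have hmem' : diameter.point t + s • d ∈ halfDisk := hmem
    rw [diameter, segmentArc_vel] at hd'
    rw [diameter_point] at hmem'
    have h2 := hmem'.2
    simp only [cross, Prod.fst_sub, Prod.snd_sub, Prod.snd_add, Prod.smul_snd, smul_eq_mul]
      at hd' h2
    nlinarith

/-- The addition formula applies to the first term and -v/r, with r the square root, and produces
the arctangent of the inverse of the second argument; positivity of that argument turns it into π/2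
minus the second term. -/
lemma arctan_add_arctan_of_pos {u v : ℝ} (huv : u ^ 2 + v ^ 2 < 1) (h : 0 < 1 + v - u) :
    Real.arctan ((1 + v + u) / √(1 - u ^ 2 - v ^ 2)) +
      Real.arctan ((1 + v - u) / √(1 - u ^ 2 - v ^ 2)) =
      Real.pi / 2 + Real.arctan (v / √(1 - u ^ 2 - v ^ 2)) := by
  obtain ⟨r, hr⟩ : ∃ r, r = √(1 - u ^ 2 - v ^ 2) := ⟨_, rfl⟩
  have hΔ : 0 < 1 - u ^ 2 - v ^ 2 := by linarith
  have hr0 : 0 < r := by rw [hr]; exact Real.sqrt_pos.2 hΔ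
  have hr2 : r ^ 2 = 1 - u ^ 2 - v ^ 2 := by rw [hr]; exact Real.sq_sqrt hΔ.le
  rw [← hr]
  have hu : 0 < 1 + u := by nlinarith [sq_nonneg v]
  have h1 : 1 - (1 + v + u) / r * -(v / r) = (1 + u) * (1 + v - u) / r ^ 2 := by
    field_simp
    rw [hr2]; ring
  have hpos : 0 < (1 + u) * (1 + v - u) / r ^ 2 := by positivity
  have h2 := Real.arctan_add (x := (1 + v + u) / r) (y := -(v / r)) (by linarith)
  rw [h1, Real.arctan_neg] at h2
  have h3 : ((1 + v + u) / r + -(v / r)) / ((1 + u) * (1 + v - u) / r ^ 2) =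
      ((1 + v - u) / r)⁻¹ := by
    field_simp
    ring
  rw [h3, Real.arctan_inv_of_pos (by positivity)] at h2
  linarith

/-- The two terms are exchanged by changing the sign of u, and at least one of 1 + v - u and 1 + v +
u is positive. -/
lemma arctan_add_arctan {u v : ℝ} (huv : u ^ 2 + v ^ 2 < 1) :
    Real.arctan ((1 + v + u) / √(1 - u ^ 2 - v ^ 2)) +
      Real.arctan ((1 + v - u) / √(1 - u ^ 2 - v ^ 2)) =
      Real.pi / 2 + Real.arctan (v / √(1 - u ^ 2 - v ^ 2)) := by
  by_cases h : 0 < 1 + v - u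
  · exact arctan_add_arctan_of_pos huv h
  · have hv : -1 < v := by nlinarith [sq_nonneg u]
    have h' := arctan_add_arctan_of_pos (u := -u) (v := v) (by rwa [neg_sq]) (by linarith)
    rw [neg_sq, sub_neg_eq_add, ← sub_eq_add_neg, add_comm] at h'
    exact h'

lemma integral_halfCircle {u v : ℝ} (huv : u ^ 2 + v ^ 2 < 1) :
    ∫ t in (-1 : ℝ)..1, 2 * (1 + t ^ 2) / ((1 - v) + 2 * u * t + (1 + v) * t ^ 2) ^ 2 =
      (Real.pi + 2 * Real.arctan (v / √(1 - u ^ 2 - v ^ 2))) /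
        ((1 - u ^ 2 - v ^ 2) * √(1 - u ^ 2 - v ^ 2)) +
        2 * v / ((1 - u ^ 2) * (1 - u ^ 2 - v ^ 2)) := by
  have harc := arctan_add_arctan huv
  obtain ⟨r, hr⟩ : ∃ r, r = √(1 - u ^ 2 - v ^ 2) := ⟨_, rfl⟩
  obtain ⟨Δ, hΔdef⟩ : ∃ Δ, Δ = 1 - u ^ 2 - v ^ 2 := ⟨_, rfl⟩
  have hΔ : 0 < Δ := by linarith
  have hr0 : 0 < r := by rw [hr, ← hΔdef]; exact Real.sqrt_pos.2 hΔ
  have hr2 : r ^ 2 = Δ := by rw [hr, ← hΔdef]; exact Real.sq_sqrt hΔ.le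
  have ha : 0 < 1 + v := by nlinarith [sq_nonneg u]
  have hg : ∀ t : ℝ, (1 + v) * ((1 - v) + 2 * u * t + (1 + v) * t ^ 2) =
      ((1 + v) * t + u) ^ 2 + Δ := fun t => by rw [hΔdef]; ring
  have hgpos : ∀ t : ℝ, 0 < (1 - v) + 2 * u * t + (1 + v) * t ^ 2 := fun t => by
    have : 0 < (1 + v) * ((1 - v) + 2 * u * t + (1 + v) * t ^ 2) := by rw [hg]; positivity
    exact (mul_pos_iff_of_pos_left ha).1 this
  rw [← hr] at harc ⊢
  rw [← hΔdef]
  -- The primitive comes from completing the square in the denominator as in `hg`: an arctangent,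
  -- plus a rational term for the double pole.
  have hderiv : ∀ t : ℝ, HasDerivAt (fun t => 2 * Real.arctan (((1 + v) * t + u) / r) / (Δ * r) +
      ((2 / Δ - 2 / (1 + v)) * t + 2 * u / ((1 + v) * Δ)) /
        ((1 - v) + 2 * u * t + (1 + v) * t ^ 2))
      (2 * (1 + t ^ 2) / ((1 - v) + 2 * u * t + (1 + v) * t ^ 2) ^ 2) t := by
    intro t
    have hid := hasDerivAt_id t
    have h1 : HasDerivAt (fun t : ℝ => ((1 + v) * t + u) / r) ((1 + v) / r) t := by
      simpa using ((hid.const_mul (1 + v)).add_const u).div_const r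
    have h2 := (h1.arctan.const_mul 2).div_const (Δ * r)
    have h3 : HasDerivAt (fun t : ℝ => (2 / Δ - 2 / (1 + v)) * t + 2 * u / ((1 + v) * Δ))
        (2 / Δ - 2 / (1 + v)) t := by
      simpa using (hid.const_mul (2 / Δ - 2 / (1 + v))).add_const (2 * u / ((1 + v) * Δ))
    have h4 : HasDerivAt (fun t : ℝ => (1 - v) + 2 * u * t + (1 + v) * t ^ 2)
        (2 * u + (1 + v) * (2 * t)) t := by
      exact (((hid.const_mul (2 * u)).const_add (1 - v)).add
        ((hasDerivAt_pow 2 t).const_mul (1 + v))).congr_deriv (by simp)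
    refine (h2.add (h3.div h4 (hgpos t).ne')).congr_deriv ?_
    have hgt := (hgpos t).ne'
    have e1 : 1 + (((1 + v) * t + u) / r) ^ 2 =
        (1 + v) * ((1 - v) + 2 * u * t + (1 + v) * t ^ 2) / Δ := by
      rw [hg, div_pow, hr2]; field_simp; ring
    rw [e1]
    obtain ⟨g, hgdef⟩ : ∃ g, g = (1 - v) + 2 * u * t + (1 + v) * t ^ 2 := ⟨_, rfl⟩
    rw [← hgdef] at hgt ⊢
    field_simp
    rw [hr2, hgdef, hΔdef]
    ring
  rw [intervalIntegral.integral_eq_sub_of_hasDerivAt (fun t _ => hderiv t)]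
  · have e2 : ((1 + v) * -1 + u) / r = -((1 + v - u) / r) := by ring
    have e3 : (1 + v) * 1 + u = 1 + v + u := by ring
    rw [e2, e3, Real.arctan_neg]
    have hu1 : 0 < 1 + u := by nlinarith [sq_nonneg v]
    have hu2 : 0 < 1 - u := by nlinarith [sq_nonneg v]
    have e4 : (1 - v) + 2 * u * 1 + (1 + v) * 1 ^ 2 = 2 * (1 + u) := by ring
    have e5 : (1 - v) + 2 * u * -1 + (1 + v) * (-1) ^ 2 = 2 * (1 - u) := by ring
    rw [e4, e5]
    have e6 : 1 - u ^ 2 = (1 + u) * (1 - u) := by ring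
    rw [e6]
    have e7 : Real.pi + 2 * Real.arctan (v / r) = 2 * (Real.arctan ((1 + v + u) / r) +
        Real.arctan ((1 + v - u) / r)) := by linarith
    rw [e7]
    field_simp
    rw [hΔdef]
    ring
  · refine Continuous.intervalIntegrable ?_ _ _
    refine Continuous.div (by fun_prop) (by fun_prop) fun t => pow_ne_zero 2 (hgpos t).ne'

lemma rpow_three_halves {Δ : ℝ} (hΔ : 0 < Δ) : Δ ^ (3 / 2 : ℝ) = Δ * √Δ := by
  rw [show (3 / 2 : ℝ) = 1 + 1 / 2 by norm_num, Real.rpow_add hΔ, Real.rpow_one,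
    ← Real.sqrt_eq_rpow]

lemma fantappie_halfDisk {u v : ℝ} (huv : u ^ 2 + v ^ 2 < 1) :
    fantappie halfDisk (u, v) =
      (((Real.pi + 2 * Real.arctan (v / √(1 - u ^ 2 - v ^ 2))) /
          (1 - u ^ 2 - v ^ 2) ^ (3 / 2 : ℝ) +
        2 * v / ((1 - u ^ 2) * (1 - u ^ 2 - v ^ 2)) : ℝ) : ℂ) := by
  have hsub : closure halfDisk ⊆ disk := by
    rw [isClosed_halfDisk.closure_eq]; exact fun _ hp => hp.1
  have hw := mem_params_of_disk hsub huv
  have hP := isRegularPolypol_halfDisk.arcBoundary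
  rw [hP.fantappie_eq_sum (l := fun _ => 1) (r := fun _ => 0)
    (fun j t ht => sideValue_halfDisk_left j ht) (fun j t _ => sideValue_halfDisk_right j) hw,
    Fin.sum_univ_two]
  -- The diameter lies on a line through the origin, where the Euler form vanishes.
  have hd : ∫ t in (halfDiskArcs 1).a..(halfDiskArcs 1).b, (((halfDiskArcs 1).x t *
      deriv (halfDiskArcs 1).y t - (halfDiskArcs 1).y t * deriv (halfDiskArcs 1).x t : ℝ) : ℂ) /
      Q ((u : ℂ), (v : ℂ)) ((halfDiskArcs 1).point t) ^ 2 = 0 := by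
    rw [RationalArc.integral_euler_of_collinear (γ := halfDiskArcs 1)
      (collinear_segmentArc (-1, 0) (1, 0) (by norm_num))]
    · have h1 : cross ((halfDiskArcs 1).point (halfDiskArcs 1).a)
          ((halfDiskArcs 1).point (halfDiskArcs 1).b) = 0 := by
        show cross (diameter.point diameter.a) (diameter.point diameter.b) = 0
        rw [diameter_point, diameter_point]
        simp [cross]
      rw [h1]
      simp
    · rintro p ⟨t, ht, rfl⟩
      exact hw _ (hP.point_mem_closure 1 ht)
  rw [hd, mul_zero, add_zero, rpow_three_halves (by linarith), ← integral_halfCircle huv,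
    ← intervalIntegral.integral_ofReal]
  have h10 : (((1 : ℤ) - 0 : ℤ) : ℂ) = 1 := by norm_num
  rw [h10, one_mul]
  show ∫ t in (-1 : ℝ)..1, _ = _
  refine intervalIntegral.integral_congr fun t _ => ?_
  show ((((circleArc 1 one_ne_zero).x t * deriv (circleArc 1 one_ne_zero).y t -
    (circleArc 1 one_ne_zero).y t * deriv (circleArc 1 one_ne_zero).x t : ℝ) : ℂ) /
      Q ((u : ℂ), (v : ℂ)) ((circleArc 1 one_ne_zero).point t) ^ 2) = _
  rw [Q_ofReal, ← Complex.ofReal_pow, ← Complex.ofReal_div, circleArc_deriv_x, circleArc_deriv_y,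
    circleArc_x, circleArc_y, circleArc_point]
  congr 1
  have hne : 1 + t ^ 2 ≠ 0 := by positivity
  have e1 : 1 - u * (-2 * t / (1 + t ^ 2)) - v * (1 * (1 - t ^ 2) / (1 + t ^ 2)) =
      ((1 - v) + 2 * u * t + (1 + v) * t ^ 2) / (1 + t ^ 2) := by
    field_simp; ring
  simp only
  rw [e1, div_pow, div_div_eq_mul_div]
  congr 1
  field_simp
  ring

/-! ### The transform of the disk -/

/-- Up to a null set the lower half is the mirror image of the upper one, whose transform is that of
the half-disk at (u, -v). In the sum the arctangent and the rational term, both odd in v, cancel. -/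
lemma fantappie_disk {u v : ℝ} (huv : u ^ 2 + v ^ 2 < 1) :
    fantappie disk (u, v) = ((2 * Real.pi / (1 - u ^ 2 - v ^ 2) ^ (3 / 2 : ℝ) : ℝ) : ℂ) := by
  have hw : ((u : ℂ), (v : ℂ)) ∈ params disk :=
    mem_params_of_disk (by rw [isClosed_disk.closure_eq]) huv
  have hInt := integrableOn_inv_Q isBounded_disk hw
  have hmeasH : MeasurableSet halfDisk := isClosed_halfDisk.measurableSet
  have hsub : halfDisk ⊆ disk := fun _ hp => hp.1
  -- the reflected half-disk
  have hrefl : MeasurePreserving (fun p : ℝ × ℝ => (p.1, -p.2)) volume volume :=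
    (MeasurePreserving.id volume).prod (Measure.measurePreserving_neg volume)
  have hemb : MeasurableEmbedding (fun p : ℝ × ℝ => (p.1, -p.2)) :=
    ((Homeomorph.refl ℝ).prodCongr (Homeomorph.neg ℝ)).measurableEmbedding
  have hpre : (fun p : ℝ × ℝ => (p.1, -p.2)) ⁻¹' (disk \ halfDisk) =ᵐ[volume] halfDisk := by
    have hnull : volume ((univ : Set ℝ) ×ˢ ({0} : Set ℝ)) = 0 := by
      rw [Measure.volume_eq_prod, Measure.prod_prod, Real.volume_singleton, mul_zero]
    have h1 : ∀ᵐ p : ℝ × ℝ, p ∉ (univ : Set ℝ) ×ˢ ({0} : Set ℝ) :=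
      measure_eq_zero_iff_ae_notMem.1 hnull
    filter_upwards [h1] with p hp
    have hp2 : p.2 ≠ 0 := fun h => hp ⟨mem_univ _, h⟩
    apply propext
    show (((p.1, -p.2) : ℝ × ℝ) ∈ disk ∧ ((p.1, -p.2) : ℝ × ℝ) ∉ halfDisk) ↔ p ∈ halfDisk
    simp only [mem_halfDisk, mem_disk, neg_sq, not_and, not_le]
    constructor
    · rintro ⟨h2, h3⟩
      exact ⟨h2, by linarith [h3 h2]⟩
    · rintro ⟨h2, h3⟩
      exact ⟨h2, fun _ => by linarith [lt_of_le_of_ne h3 hp2.symm]⟩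
  have hlower : ∫ p in disk \ halfDisk, 1 / Q ((u : ℂ), (v : ℂ)) p ^ 3 =
      ∫ p in halfDisk, 1 / Q ((u : ℂ), ((-v : ℝ) : ℂ)) p ^ 3 := by
    rw [← hrefl.setIntegral_preimage_emb hemb, setIntegral_congr_set hpre]
    simp only [Q_ofReal]
    refine setIntegral_congr_fun hmeasH fun p _ => ?_
    simp only [mul_neg, neg_mul]
  have hsplit : fantappie disk (u, v) = fantappie halfDisk (u, v) +
      fantappie halfDisk ((u : ℂ), ((-v : ℝ) : ℂ)) := by
    rw [fantappie, fantappie, fantappie, ← hlower, ← mul_add]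
    congr 1
    rw [← setIntegral_union disjoint_sdiff_right (isClosed_disk.measurableSet.diff hmeasH)
      (hInt.mono_set hsub) (hInt.mono_set sdiff_subset), union_sdiff_cancel hsub]
  rw [hsplit, fantappie_halfDisk huv, fantappie_halfDisk (by rwa [neg_sq]), ← Complex.ofReal_add]
  congr 1
  rw [neg_sq, neg_div, Real.arctan_neg]
  ring

/-! ### Irrationality -/

/-- The order of vanishing at 1 is odd on the left and even on the right. -/
lemma odd_rootMultiplicity_aux (n d : Polynomial ℝ) (k : ℝ) (hk : k ≠ 0) (hd : d ≠ 0) :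
    n ^ 2 * (1 - Polynomial.X ^ 2) ^ 3 ≠ Polynomial.C k * d ^ 2 := by
  intro h
  have hfac : (1 - Polynomial.X ^ 2 : Polynomial ℝ) =
      (Polynomial.X - Polynomial.C 1) * -(Polynomial.X + Polynomial.C 1) := by
    rw [map_one]; ring
  have hR : Polynomial.C k * d ^ 2 ≠ 0 :=
    mul_ne_zero (Polynomial.C_ne_zero.2 hk) (pow_ne_zero 2 hd)
  have hL : n ^ 2 * (1 - Polynomial.X ^ 2) ^ 3 ≠ 0 := h ▸ hR
  have hn : n ^ 2 ≠ 0 := left_ne_zero_of_mul hL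
  have hq : (1 - Polynomial.X ^ 2 : Polynomial ℝ) ≠ 0 := fun h0 => hL (by rw [h0]; ring)
  have hm1 : (1 - Polynomial.X ^ 2 : Polynomial ℝ).rootMultiplicity 1 = 1 := by
    rw [hfac] at hq ⊢
    rw [Polynomial.rootMultiplicity_mul hq, Polynomial.rootMultiplicity_X_sub_C_self,
      Polynomial.rootMultiplicity_eq_zero]
    simp [Polynomial.IsRoot]
  have hpow : ∀ p : Polynomial ℝ, p ≠ 0 → (p ^ 2).rootMultiplicity 1 =
      2 * p.rootMultiplicity 1 := fun p hp => by
    rw [pow_two, Polynomial.rootMultiplicity_mul (mul_ne_zero hp hp), two_mul]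
  have h2 := congrArg (Polynomial.rootMultiplicity 1) h
  rw [Polynomial.rootMultiplicity_mul hL, Polynomial.rootMultiplicity_mul hR, pow_succ _ 2,
    Polynomial.rootMultiplicity_mul (mul_ne_zero (pow_ne_zero 2 hq) hq), hpow _ hq,
    hpow _ (pow_ne_zero_iff two_ne_zero |>.1 hn), hpow _ hd, hm1,
    Polynomial.rootMultiplicity_C] at h2
  omega

lemma not_rational_of_eq {F : ℂ × ℂ → ℂ} {k : ℝ} (hk : k ≠ 0)
    (hF : ∀ u : ℝ, u ^ 2 < 1 → F ((u : ℂ), 0) = ((k / (1 - u ^ 2) ^ (3 / 2 : ℝ) : ℝ) : ℂ)) :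
    ¬ ∃ R : RationalFunctions, ∀ᶠ w in 𝓝 ((0, 0) : ℂ × ℂ), HasValueAt R w (F w) := by
  rintro ⟨R, hR⟩
  -- The representation of `R` may vary from point to point. The one at the origin is kept, since
  -- its denominator does not vanish there and so restricts to a nonzero polynomial on the axis.
  obtain ⟨N, D, hD, hRND, -⟩ := hR.self_of_nhds
  have hD0 := HasValueAt.algebraMap_ne_zero hD
  -- the restriction to the first axis
  obtain ⟨n, hn⟩ : ∃ n : Polynomial ℝ, n = MvPolynomial.aeval ![Polynomial.X, 0] N := ⟨_, rfl⟩
  obtain ⟨d, hd⟩ : ∃ d : Polynomial ℝ, d = MvPolynomial.aeval ![Polynomial.X, 0] D := ⟨_, rfl⟩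
  have heval : ∀ (p : MvPolynomial (Fin 2) ℝ) (u : ℝ), MvPolynomial.aeval ![(u : ℂ), (0 : ℂ)] p =
      (((MvPolynomial.aeval ![Polynomial.X, 0] p : Polynomial ℝ).eval u : ℝ) : ℂ) := by
    intro p u
    rw [← Polynomial.coe_aeval_eq_eval, MvPolynomial.comp_aeval_apply]
    have h1 : ![(u : ℂ), (0 : ℂ)] = algebraMap ℝ ℂ ∘ fun i =>
        Polynomial.aeval u ((![Polynomial.X, 0] : Fin 2 → Polynomial ℝ) i) := by
      ext i
      fin_cases i <;> simp
    rw [h1, MvPolynomial.aeval_algebraMap_apply]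
    rfl
  have hd0 : d ≠ 0 := by
    rintro rfl
    have := heval D 0
    rw [← hd, Polynomial.eval_zero] at this
    exact hD (by simpa using this)
  -- Squaring the relation removes the square root and leaves an identity of polynomials, valid at
  -- infinitely many points.
  have hreal : ∀ᶠ u : ℝ in 𝓝 0, n.eval u ^ 2 * (1 - u ^ 2) ^ 3 = k ^ 2 * d.eval u ^ 2 := by
    have hcont : Tendsto (fun u : ℝ => ((u : ℂ), (0 : ℂ))) (𝓝 0) (𝓝 ((0, 0) : ℂ × ℂ)) := by
      have : Continuous fun u : ℝ => ((u : ℂ), (0 : ℂ)) := by fun_prop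
      simpa using this.tendsto 0
    have hsmall : ∀ᶠ u : ℝ in 𝓝 0, u ^ 2 < 1 := by
      have : Continuous fun u : ℝ => u ^ 2 := by fun_prop
      exact this.continuousAt.eventually_lt continuousAt_const (by norm_num)
    filter_upwards [hcont.eventually hR, hsmall] with u hu hu1
    obtain ⟨N', D', hD', hR', hval⟩ := hu
    rw [hRND, div_eq_div_iff hD0 (HasValueAt.algebraMap_ne_zero hD'), ← map_mul, ← map_mul,
      (FaithfulSMul.algebraMap_injective _ RationalFunctions).eq_iff] at hR'
    have h1 := congrArg (MvPolynomial.aeval ![(u : ℂ), (0 : ℂ)]) hR'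
    rw [map_mul, map_mul] at h1
    have h2 : F ((u : ℂ), 0) * MvPolynomial.aeval ![(u : ℂ), (0 : ℂ)] D =
        MvPolynomial.aeval ![(u : ℂ), (0 : ℂ)] N := by
      rw [hval, div_mul_eq_mul_div, div_eq_iff hD']
      exact h1.symm
    rw [hF u hu1, heval, heval, ← hn, ← hd, ← Complex.ofReal_mul, Complex.ofReal_inj] at h2
    have hΔ : 0 < 1 - u ^ 2 := by linarith
    rw [rpow_three_halves hΔ] at h2
    have hs := Real.sq_sqrt hΔ.le
    have hs0 := Real.sqrt_pos.2 hΔ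
    rw [← h2]
    obtain ⟨r, hr⟩ : ∃ r, r = √(1 - u ^ 2) := ⟨_, rfl⟩
    rw [← hr] at hs hs0 ⊢
    rw [← hs]
    field_simp
  refine odd_rootMultiplicity_aux n d (k ^ 2) (pow_ne_zero 2 hk) hd0 ?_
  refine Polynomial.eq_of_infinite_eval_eq _ _ ?_
  obtain ⟨ε, hε, hball⟩ := Metric.eventually_nhds_iff_ball.1 hreal
  refine (Ioo_infinite (show -ε < ε by linarith)).mono fun u hu => ?_
  have := hball u (by rw [Real.ball_eq_Ioo]; simpa using hu)
  simpa using this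

lemma not_rational_disk : ¬ ∃ R : RationalFunctions,
    ∀ᶠ w in 𝓝 ((0, 0) : ℂ × ℂ), HasValueAt R w (fantappie disk w) := by
  refine not_rational_of_eq (k := 2 * Real.pi) (by positivity) fun u hu => ?_
  have := fantappie_disk (u := u) (v := 0) (by simpa using hu)
  simpa using this

lemma not_rational_halfDisk : ¬ ∃ R : RationalFunctions,
    ∀ᶠ w in 𝓝 ((0, 0) : ℂ × ℂ), HasValueAt R w (fantappie halfDisk w) := by
  refine not_rational_of_eq (k := Real.pi) Real.pi_ne_zero fun u hu => ?_
  have := fantappie_halfDisk (u := u) (v := 0) (by simpa using hu)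
  simpa using this

end Polypol

end

open Polypol in
theorem mainTheorem1 :
    (∀ (n : ℕ) (P : Set (ℝ × ℝ)) (γ : Fin n → RationalArc), IsRegularPolypol P γ →
      -- the transform is a convergent integral, holomorphic in the parameters
      (∀ w ∈ params P, IntegrableOn (fun p => 1 / Q w p ^ 3) P) ∧
      (0, 0) ∈ params P ∧ IsOpen (params P) ∧
      AnalyticOnNhd ℂ (fantappie P) (params P) ∧
      -- it is a sum of integrals of rational functions over the oriented boundary arcs
      (∃ m : Fin n → ℤ, (∀ j, IsBoundaryMultiplicity P (γ j) (m j)) ∧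
        ∀ w ∈ params P,
          (w.1 ≠ 0 → fantappie P w = 1 / w.1 * ∑ j, (m j : ℂ) * arcIntegralDy (γ j) w) ∧
          (w.2 ≠ 0 → fantappie P w = -(1 / w.2) * ∑ j, (m j : ℂ) * arcIntegralDx (γ j) w)) ∧
      -- it is holonomic, and a multivalued elementary function off an algebraic curve
      (∀ w ∈ params P, IsHolonomicAt (fantappie P) w) ∧
      (∃ D : MvPolynomial (Fin 2) ℂ, D ≠ 0 ∧
        ∀ η : C(unitInterval, ℂ × ℂ), η 0 ∈ params P →
          (∀ t, MvPolynomial.eval ![(η t).1, (η t).2] D ≠ 0) →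
          ∃ f : unitInterval → ℂ × ℂ → ℂ, IsContinuationAlong (fantappie P) η f ∧
            ∀ t, IsElementaryAt (f t) (η t) ∧ IsHolonomicAt (f t) (η t)) ∧
      -- polygons
      ((∀ j, Collinear ℝ (γ j).image) →
        (∀ j, ∃ R : RationalFunctions, ∀ w ∈ params P, HasValueAt R w (arcIntegralDx (γ j) w)) ∧
        (∀ j, ∃ R : RationalFunctions, ∀ w ∈ params P, HasValueAt R w (arcIntegralDy (γ j) w)) ∧
        (∃ R : RationalFunctions, ∀ w ∈ params P, HasValueAt R w (fantappie P w)) ∧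
        (Convex ℝ P → (0, 0) ∈ interior P →
          ∃ Ω : RationalFunctions, IsCanonicalForm (polar P) Ω ∧
            (∀ Ω' : RationalFunctions, IsCanonicalForm (polar P) Ω' → Ω' = Ω) ∧
            ∀ w ∈ params P, HasValueAt Ω w (fantappie P w)))) ∧
    -- rationality fails for the disk and the half-disk, which are polypols with curved arcs
    (∃ (n : ℕ) (γ : Fin n → RationalArc), IsRegularPolypol disk γ) ∧
    (∃ (n : ℕ) (γ : Fin n → RationalArc), IsRegularPolypol halfDisk γ) ∧
    (∀ u v : ℝ, u ^ 2 + v ^ 2 < 1 →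
      fantappie disk (u, v) = ((2 * Real.pi / (1 - u ^ 2 - v ^ 2) ^ (3 / 2 : ℝ) : ℝ) : ℂ)) ∧
    (∀ u v : ℝ, u ^ 2 + v ^ 2 < 1 →
      fantappie halfDisk (u, v) =
        (((Real.pi + 2 * Real.arctan (v / Real.sqrt (1 - u ^ 2 - v ^ 2))) /
            (1 - u ^ 2 - v ^ 2) ^ (3 / 2 : ℝ) +
          2 * v / ((1 - u ^ 2) * (1 - u ^ 2 - v ^ 2)) : ℝ) : ℂ)) ∧
    (¬ ∃ R : RationalFunctions, ∀ᶠ w in 𝓝 ((0, 0) : ℂ × ℂ), HasValueAt R w (fantappie disk w)) ∧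
    (¬ ∃ R : RationalFunctions,
      ∀ᶠ w in 𝓝 ((0, 0) : ℂ × ℂ), HasValueAt R w (fantappie halfDisk w)) := by
  refine ⟨fun n P γ hP => ?_, ⟨2, _, isRegularPolypol_disk⟩, ⟨2, _, isRegularPolypol_halfDisk⟩,
    fun u v h => fantappie_disk h, fun u v h => fantappie_halfDisk h, not_rational_disk,
    not_rational_halfDisk⟩
  have hB := hP.arcBoundary
  choose l hl using fun j => hB.exists_sideValue_const j 1 abs_one
  choose r hr using fun j => hB.exists_sideValue_const j (-1) (by simp)
  obtain ⟨c, hUc, hF⟩ := hB.exists_fantappie_eq_sum_period hl hr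
  have hU := isOpen_params hP.bounded
  have hhol : ∀ w ∈ params P, IsHolonomicAt (fantappie P) w := fun w hw =>
    isHolonomicAt_sum_period _ _ hU hUc hF hw
  refine ⟨fun w hw => integrableOn_inv_Q hP.bounded hw, zero_mem_params P, hU,
    fun w hw => (hhol w hw).1,
    ⟨fun j => l j - r j, fun j => isBoundaryMultiplicity_of_sideValue (hl j) (hr j),
      fun w hw => ⟨fun h => ?_, fun h => ?_⟩⟩, hhol,
    -- A path off this product avoids the discriminant of every arc, so all periods continue along
    -- it simultaneously.
    ⟨∏ j, (c j).disc, Finset.prod_ne_zero_iff.2 fun j _ => (c j).disc_ne_zero, fun η h0 hη => ?_⟩,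
    fun hγ => ?_⟩
  · rw [← hB.fst_mul_fantappie hl hr hw]
    field_simp
  · rw [neg_mul, ← mul_neg, ← hB.snd_mul_fantappie hl hr hw]
    field_simp
  · obtain ⟨f, hf, hel⟩ := exists_elementary_continuation hU hUc hF h0 fun t j h => hη t (by
      rw [map_prod]
      exact Finset.prod_eq_zero (Finset.mem_univ j) h)
    exact ⟨f, hf, fun t => ⟨hel t, hf.isHolonomicAt (hhol _ h0) t⟩⟩
  · have hQ : ∀ j, ∀ w ∈ params P, ∀ p ∈ (γ j).image, Q w p ≠ 0 := by
      rintro j w hw p ⟨t, ht, rfl⟩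
      exact hw _ (hB.point_mem_closure j ht)
    refine ⟨fun j => ?_, fun j => ?_, hB.exists_hasValueAt_fantappie hl hr hγ,
      hB.exists_canonicalForm hγ⟩
    · obtain ⟨R, hR⟩ := (γ j).exists_hasValueAt_div ((γ j).x (γ j).b - (γ j).x (γ j).a) _ (hQ j)
      refine ⟨R, fun w hw => ?_⟩
      rw [RationalArc.arcIntegralDx_of_collinear (hγ j) (hQ j w hw)]
      exact hR w hw
    · obtain ⟨R, hR⟩ := (γ j).exists_hasValueAt_div ((γ j).y (γ j).b - (γ j).y (γ j).a) _ (hQ j)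
      refine ⟨R, fun w hw => ?_⟩
      rw [RationalArc.arcIntegralDy_of_collinear (hγ j) (hQ j w hw)]
      exact hR w hw
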